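/- **Setting.** Let $G$ be a second countable (Hausdorff) real Lie group with Lie algebra $\mathfrak g$, let $\mathbb G$ be a linear algebraic group defined over $\mathbb R$, and let $G\to\mathbb G(\mathbb R)$ be a morphism of Lie groups with finite central kernel and with image open for the usual topology. Assume that $\mathfrak g$ is reductive with centre made of semisimple elements. Through this morphism, $x\in G$ is called elliptic if its image is diagonalizable over $\mathbb C$ with eigenvalues of modulus $1$, and $X\in\mathfrak g$ is called semisimple, infinitesimally elliptic, or hyperbolic if its image is diagonalizable over $\mathbb C$ with, respectively, arbitrary, purely imaginary, or real eigenvalues. For a Cartan subalgebra $\mathfrak h$, let $\mathfrak t$ and $\mathfrak a$ be the sets of its infinitesimally elliptic and of its hyperbolic elements, so $\mathfrak h=\mathfrak t\oplus\mathfrak a$, and put $\mathfrak h_{(\mathbb R)}=i\mathfrak t\oplus\mathfrak a$. Fix a $G$-invariant nondegenerate symmetric bilinear form $\langle\ ,\ \rangle$ on $\mathfrak g$ whose complexification restricts to a scalar product on every $\mathfrak h_{(\mathbb R)}$. A form $\lambda\in\mathfrak g^*$ is semisimple if $\lambda=\langle X,\cdot\rangle$ with $X$ semisimple. Let $\mathfrak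 g(\lambda)$ be the stabilizer of $\lambda$ in $\mathfrak g$. Extending by $0$ on the $\langle\ ,\ \rangle$-orthogonal, we regard $\mathfrak h^*\subset\mathfrak g^*$. If $\mathfrak h$ is a Cartan subalgebra of $\mathfrak g(\lambda)$, let $C(\mathfrak g(\lambda),\mathfrak h)$ be the set of open chambers in $\mathfrak h_{(\mathbb R)}^*$ for the imaginary roots $\alpha$ (those with $\overline\alpha=-\alpha$) of $(\mathfrak g(\lambda)_{\mathbb C},\mathfrak h_{\mathbb C})$. For $F\in C(\mathfrak g(\lambda),\mathfrak h)$, let $\rho_F$ be half the sum of the imaginary roots that are positive on $F$. A *parameter* for $\mathfrak g$ is a pair $\tilde\lambda=(\lambda,F)$ with $\lambda\in\mathfrak g^*$ semisimple and $F\in C(\mathfrak g(\lambda),\mathfrak h)$ for some Cartan subalgebra $\mathfrak h$ of $\mathfrak g(\lambda)$ (which $F$ determines). Let $\tilde{\mathfrak g}^*_I$ be the set of parameters such that $\mathfrak g(\lambda)$ has a Cartan subalgebra all of whose roots are imaginary, $\mathfrak h$ is a fundamental Cartan subalgebra of $\mathfrak g(\lambda)$ (i.e. $\dim\mathfrak t$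 is maximal), and the imaginary roots of $(\mathfrak g(\lambda)_{\mathbb C},\mathfrak h_{\mathbb C})$ that are simple relative to $F$ are all noncompact. Let $e\in G$ be elliptic. Denote by $\mathfrak g(e),\mathfrak h(e),\mathfrak t(e)$ the sets of fixed points of $\mathrm{Ad}\,e$ in $\mathfrak g,\mathfrak h,\mathfrak t$; the same notions apply to $\mathfrak g(e)$, and $\mathfrak g(e)^*$ (resp. $\mathfrak h(e)^*$) is identified by restriction with the $\mathrm{Ad}^*e$-fixed elements of $\mathfrak g^*$ (resp. $\mathfrak h^*$). Let $\tilde\lambda=(\lambda,F)$ be a parameter for $\mathfrak g$, with Cartan subalgebra $\mathfrak h=\mathfrak t\oplus\mathfrak a$, that is fixed by $e$, and assume that $e$ stabilizes some chamber in $\mathfrak a^*$ for the roots of $(\mathfrak g(\lambda)(i\rho_F),\mathfrak a)$, where $\mathfrak g(\lambda)(i\rho_F)$ is the stabilizer of $i\rho_F$ in $\mathfrak g(\lambda)$. **(a)** The form $\lambda$ is semisimple in $\mathfrak g(e)^*$, $\mathfrak h(e)$ is a Cartan subalgebra of $\mathfrak g(e)(\lambda)$, and $\rho_F$, restricted to $\mathfrak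 h(e)$, belongs to $\mathfrak h(e)_{(\mathbb R)}^*$ and is regular for the imaginary roots of $(\mathfrak g(e)(\lambda)_{\mathbb C},\mathfrak h(e)_{\mathbb C})$. Hence there is a unique $F[e]\in C(\mathfrak g(e)(\lambda),\mathfrak h(e))$ containing $\rho_F$; put $\tilde\lambda[e]=(\lambda,F[e])$. (One says that $\tilde\lambda[e]$ exists when, as assumed here, $e$ fixes $\tilde\lambda$ and stabilizes a chamber as above.) **(b)** There is $e_0\in e\exp\mathfrak t(e)$, elliptic, such that $\tilde\lambda[e_0]$ exists and such that, for every $F'\in C(\mathfrak g(\lambda),\mathfrak h)$, if $\rho_{F'}\in F[e_0]$ (i.e. $\rho_{F'}$ is fixed by $\mathrm{Ad}^*e_0$ and its restriction to $\mathfrak h(e_0)$ lies in $F[e_0]$), then $F'=F$. When $\tilde\lambda\in\tilde{\mathfrak g}^*_I$, one can moreover choose this same $e_0$ so that $\tilde\lambda[e_0]\in\widetilde{\mathfrak g(e_0)}{}^*_I$. **(c)** Assume $\tilde\lambda\in\tilde{\mathfrak g}^*_I$. The set of all parameters $\tilde\lambda'=(\lambda',F')$ for $\mathfrak g$ that are fixed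 by $e$, for which $\tilde\lambda'[e]$ exists, and which satisfy $\tilde\lambda'[e]=\tilde\lambda[e]$, is finite of cardinality $$\frac{|W(\mathfrak g(\lambda)_{\mathbb C},\mathfrak h_{\mathbb C})(\mathrm{Ad}^*e)|}{|W(\mathfrak g(e)(\lambda)_{\mathbb C},\mathfrak h(e)_{\mathbb C})|},$$ where $W(\cdot,\cdot)$ denotes the (finite) Weyl group of the root system, and $W(\mathfrak g(\lambda)_{\mathbb C},\mathfrak h_{\mathbb C})(\mathrm{Ad}^*e)$ is the commutant in $W(\mathfrak g(\lambda)_{\mathbb C},\mathfrak h_{\mathbb C})$ of the action of $\mathrm{Ad}^*e$ on $\mathfrak h_{\mathbb C}^*$. -/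

import Mathlib

open scoped Manifold ContDiff TensorProduct

namespace EllipticDescent

noncomputable section

/-! ## Linear forms on a real Lie algebra `L` of matrices

`L` is a real Lie algebra, `r` is the (faithful) linear map from `L` to real matrices through which
elements of `L` are called elliptic, hyperbolic or semisimple, and `B` is an invariant form. -/

section Algebra

variable {L : Type*} [LieRing L] [LieAlgebra ℝ L] {n : ℕ}

/-- A real matrix that is diagonalizable over `ℂ`. -/
def IsSemisimpleMatrix (M : Matrix (Fin n) (Fin n) ℝ) : Prop :=
  Module.End.IsSemisimple (Matrix.toLin' M)

/-- `z` is a complex eigenvalue of the real matrix `M`. -/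
def IsComplexEigenvalue (M : Matrix (Fin n) (Fin n) ℝ) (z : ℂ) : Prop :=
  (M.map Complex.ofRealHom).charpoly.IsRoot z

/-- `X` is semisimple. -/
def IsSemisimpleElt (r : L →ₗ[ℝ] Matrix (Fin n) (Fin n) ℝ) (X : L) : Prop :=
  IsSemisimpleMatrix (r X)

/-- `X` is infinitesimally elliptic: semisimple with imaginary eigenvalues. -/
def IsInfElliptic (r : L →ₗ[ℝ] Matrix (Fin n) (Fin n) ℝ) (X : L) : Prop :=
  IsSemisimpleMatrix (r X) ∧ ∀ z, IsComplexEigenvalue (r X) z → z.re = 0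

/-- `X` is hyperbolic: semisimple with real eigenvalues. -/
def IsInfHyperbolic (r : L →ₗ[ℝ] Matrix (Fin n) (Fin n) ℝ) (X : L) : Prop :=
  IsSemisimpleMatrix (r X) ∧ ∀ z, IsComplexEigenvalue (r X) z → z.im = 0

/-- The stabilizer `L(f)` of a linear form `f` for the coadjoint representation. -/
def stab (f : Module.Dual ℝ L) : LieSubalgebra ℝ L where
  carrier := {X | ∀ Y, f ⁅X, Y⁆ = 0}
  add_mem' := by
    intro X Y hX hY Z
    simp [hX Z, hY Z]
  zero_mem' := by
    intro Z
    simp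
  smul_mem' := by
    intro c X hX Z
    simp [hX Z]
  lie_mem' := by
    intro X Y hX hY Z
    rw [lie_lie, map_sub, hX, hY, sub_zero]

/-- The commutant `L(a)` of an automorphism `a`. -/
def fixedSub (a : L →ₗ⁅ℝ⁆ L) : LieSubalgebra ℝ L where
  carrier := {X | a X = X}
  add_mem' := by
    intro X Y hX hY
    change a X = X at hX
    change a Y = Y at hY
    change a (X + Y) = X + Y
    rw [map_add, hX, hY]
  zero_mem' := by simp
  smul_mem' := by
    intro c X hX
    change a X = X at hX
    change a (c • X) = c • X
    rw [map_smul, hX]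
  lie_mem' := by
    intro X Y hX hY
    change a X = X at hX
    change a Y = Y at hY
    change a ⁅X, Y⁆ = ⁅X, Y⁆
    rw [LieHom.map_lie, hX, hY]

/-- The linear form `f` is semisimple, i.e. it corresponds under `B` to a semisimple element. -/
def IsSemisimpleForm (r : L →ₗ[ℝ] Matrix (Fin n) (Fin n) ℝ) (B : LinearMap.BilinForm ℝ L)
    (f : Module.Dual ℝ L) : Prop :=
  ∃ X : L, IsSemisimpleElt r X ∧ ∀ Y, f Y = B X Y

/-- `h` is a Cartan subalgebra of the subalgebra `m`. -/
def IsCartanOf (m h : LieSubalgebra ℝ L) : Prop :=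
  h ≤ m ∧ (h.comap m.incl).IsCartanSubalgebra

/-- `ℂ`-linear forms on the complexification of `h`, given by their restrictions to `h`. -/
abbrev CForm (h : LieSubalgebra ℝ L) := h →ₗ[ℝ] ℂ

/-- The common eigenspace of `h` in the complexification of `m` with eigenvalue `α`. -/
def rootSpace (m h : LieSubalgebra ℝ L) (α : CForm h) : Submodule ℂ (ℂ ⊗[ℝ] L) :=
  m.toSubmodule.baseChange ℂ ⊓
    ⨅ H : h, Module.End.eigenspace
      (LieAlgebra.ad ℂ (ℂ ⊗[ℝ] L) ((1 : ℂ) ⊗ₜ[ℝ] (H : L))) (α H)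

/-- `α` is a root of the complexification of `h` in that of `m`. -/
def IsRoot (m h : LieSubalgebra ℝ L) (α : CForm h) : Prop :=
  α ≠ 0 ∧ rootSpace m h α ≠ ⊥

/-- The conjugate of `α` is `-α`. -/
def IsImaginary (h : LieSubalgebra ℝ L) (α : CForm h) : Prop :=
  ∀ X : h, star (α X) = -α X

/-- The imaginary roots of `(m, h)`. -/
def imagRoots (m h : LieSubalgebra ℝ L) : Set (CForm h) :=
  {α | IsRoot m h α ∧ IsImaginary h α}

/-- The `ℂ`-linear extension of a form to the complexification of `h`. -/
def cext (h : LieSubalgebra ℝ L) (β : CForm h) : ℂ ⊗[ℝ] h →ₗ[ℂ] ℂ :=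
  LinearMap.liftBaseChange ℂ β

/-- `H` is the coroot of `α`: the element of `[m^α, m^(-α)]`, in the complexification of `h`, on
which `α` takes the value `2`. -/
def IsCoroot (m h : LieSubalgebra ℝ L) (α : CForm h) (H : ℂ ⊗[ℝ] h) : Prop :=
  h.toSubmodule.subtype.baseChange ℂ H ∈
      Submodule.span ℂ {z : ℂ ⊗[ℝ] L | ∃ x ∈ rootSpace m h α, ∃ y ∈ rootSpace m h (-α),
        LieAlgebra.ad ℂ (ℂ ⊗[ℝ] L) x y = z} ∧
    cext h α H = 2

/-- The coroot `H_α`. -/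
def coroot (m h : LieSubalgebra ℝ L) (α : CForm h) : ℂ ⊗[ℝ] h :=
  Classical.epsilon fun H => IsCoroot m h α H

/-- The number `β(H_α)`. -/
def pair (m h : LieSubalgebra ℝ L) (β α : CForm h) : ℂ :=
  cext h β (coroot m h α)

/-- The space `su(2)` of traceless skew-Hermitian matrices. -/
def su2 : Submodule ℝ (Matrix (Fin 2) (Fin 2) ℂ) where
  carrier := {A | A.conjTranspose = -A ∧ A.trace = 0}
  add_mem' := by
    rintro A A' ⟨h1, h2⟩ ⟨h3, h4⟩
    refine ⟨?_, ?_⟩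
    · rw [Matrix.conjTranspose_add, h1, h3, neg_add, add_comm]
    · rw [Matrix.trace_add, h2, h4, add_zero]
  zero_mem' := by simp
  smul_mem' := by
    rintro c A ⟨h1, h2⟩
    refine ⟨?_, ?_⟩
    · rw [Matrix.conjTranspose_smul, h1]; simp
    · rw [Matrix.trace_smul, h2, smul_zero]

/-- The root `α` is compact: the real points of `ℂ H_α ⊕ m^α ⊕ m^(-α)` form a Lie algebra
isomorphic to `su(2)`. -/
def IsCompactRoot (m h : LieSubalgebra ℝ L) (α : CForm h) : Prop :=
  ∃ s : LieSubalgebra ℝ L,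
    (∀ X : L, X ∈ s ↔ (1 : ℂ) ⊗ₜ[ℝ] X ∈
      Submodule.span ℂ {h.toSubmodule.subtype.baseChange ℂ (coroot m h α)} ⊔
        rootSpace m h α ⊔ rootSpace m h (-α)) ∧
    ∃ ψ : s ≃ₗ[ℝ] su2, ∀ X Y : s,
      (ψ ⁅X, Y⁆ : Matrix (Fin 2) (Fin 2) ℂ) = ψ X * ψ Y - ψ Y * ψ X

/-- The space `h_(ℝ)^*` of real linear forms on `i t ⊕ a`, where `t` and `a` are the elliptic and
hyperbolic components of `h`: complex forms that are imaginary on `t` and real on `a`. -/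
def realDual (r : L →ₗ[ℝ] Matrix (Fin n) (Fin n) ℝ) (h : LieSubalgebra ℝ L) : Set (CForm h) :=
  {β | (∀ X : h, IsInfElliptic r (X : L) → (β X).re = 0) ∧
    ∀ X : h, IsInfHyperbolic r (X : L) → (β X).im = 0}

/-- The subspace `a^*` of `h_(ℝ)^*`: the forms that vanish on `t` and are real on `a`. -/
def splitDual (r : L →ₗ[ℝ] Matrix (Fin n) (Fin n) ℝ) (h : LieSubalgebra ℝ L) : Set (CForm h) :=
  {β | (∀ X : h, IsInfElliptic r (X : L) → β X = 0) ∧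
    ∀ X : h, IsInfHyperbolic r (X : L) → (β X).im = 0}

/-- `β` lies on none of the hyperplanes defined by the roots in `R`. -/
def IsRegularFor (m h : LieSubalgebra ℝ L) (R : Set (CForm h)) (β : CForm h) : Prop :=
  ∀ α ∈ R, (pair m h β α).re ≠ 0

/-- The elements of `S` on the same side as `β` of each hyperplane defined by a root in `R`. The
numbers `β(H_α)` are real for `β` in `h_(ℝ)^*`. -/
def chamberOf (m h : LieSubalgebra ℝ L) (S R : Set (CForm h)) (β : CForm h) : Set (CForm h) :=
  {γ | γ ∈ S ∧ ∀ α ∈ R, 0 < (pair m h β α).re * (pair m h γ α).re}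

/-- `C` is an open chamber in the space `S` for the roots in `R`. -/
def IsChamber (m h : LieSubalgebra ℝ L) (S R C : Set (CForm h)) : Prop :=
  ∃ β ∈ S, IsRegularFor m h R β ∧ C = chamberOf m h S R β

/-- `F ∈ C(m, h)`: a chamber in `h_(ℝ)^*` for the imaginary roots of `(m, h)`. -/
def IsImagChamber (r : L →ₗ[ℝ] Matrix (Fin n) (Fin n) ℝ) (m h : LieSubalgebra ℝ L)
    (F : Set (CForm h)) : Prop :=
  IsChamber m h (realDual r h) (imagRoots m h) F

/-- The imaginary roots that are positive on the chamber `F`. -/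
def posRoots (m h : LieSubalgebra ℝ L) (F : Set (CForm h)) : Set (CForm h) :=
  {α | α ∈ imagRoots m h ∧ ∀ β ∈ F, 0 < (pair m h β α).re}

/-- The imaginary roots that are simple relative to `F`. -/
def simpleRoots (m h : LieSubalgebra ℝ L) (F : Set (CForm h)) : Set (CForm h) :=
  {α | α ∈ posRoots m h F ∧
    ¬ ∃ β ∈ posRoots m h F, ∃ γ ∈ posRoots m h F, α = β + γ}

/-- `ρ_F`: half the sum of the imaginary roots that are positive on `F`. -/
def rho (m h : LieSubalgebra ℝ L) (F : Set (CForm h)) : CForm h :=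
  (1 / 2 : ℂ) • ∑ᶠ α ∈ posRoots m h F, α

/-- `h` is a fundamental Cartan subalgebra of `m`: the dimension of its elliptic component is the
largest possible. -/
def IsFundamental (r : L →ₗ[ℝ] Matrix (Fin n) (Fin n) ℝ) (m h : LieSubalgebra ℝ L) : Prop :=
  IsCartanOf m h ∧ ∀ h' : LieSubalgebra ℝ L, IsCartanOf m h' →
    Module.finrank ℝ (Submodule.span ℝ {X : L | X ∈ h' ∧ IsInfElliptic r X}) ≤
      Module.finrank ℝ (Submodule.span ℝ {X : L | X ∈ h ∧ IsInfElliptic r X})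

/-- The Weyl group of the roots of `(m, h)`, acting on the dual of the complexification of `h`. -/
def weylGroup (m h : LieSubalgebra ℝ L) : Subgroup (CForm h ≃ₗ[ℂ] CForm h) :=
  Subgroup.closure {s | ∃ α, IsRoot m h α ∧ ∀ β, s β = β - pair m h β α • α}

variable (L) in
/-- A pair `(λ, F)`, where `F` is a set of forms on the complexification of `h`; as such a set
remembers `h`, the latter is recorded too. -/
@[ext]
structure Param where
  /-- the linear form `λ` -/
  lam : Module.Dual ℝ L
  /-- the subalgebra `h` to which `F` is attached -/
  h : LieSubalgebra ℝ L
  /-- the chamber `F` -/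
  F : Set (CForm h)

/-- `λ` is semisimple, `h` is a Cartan subalgebra of `L(λ)` and `F ∈ C(L(λ), h)`. -/
structure IsParam (r : L →ₗ[ℝ] Matrix (Fin n) (Fin n) ℝ) (B : LinearMap.BilinForm ℝ L)
    (P : Param L) : Prop where
  semisimple : IsSemisimpleForm r B P.lam
  cartan : IsCartanOf (stab P.lam) P.h
  chamber : IsImagChamber r (stab P.lam) P.h P.F

/-- The form `ρ_F` of a pair `(λ, F)`. -/
def Param.rho (P : Param L) : CForm P.h :=
  EllipticDescent.rho (stab P.lam) P.h P.F

/-- The set `L~*_I`: `L(λ)` has some Cartan subalgebra all of whose roots are imaginary, `h` is a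
fundamental Cartan subalgebra of `L(λ)`, and the imaginary roots of `(L(λ), h)` that are simple
relative to `F` are noncompact. -/
structure IsTypeI (r : L →ₗ[ℝ] Matrix (Fin n) (Fin n) ℝ) (B : LinearMap.BilinForm ℝ L)
    (P : Param L) : Prop where
  param : IsParam r B P
  imaginary : ∃ h' : LieSubalgebra ℝ L, IsCartanOf (stab P.lam) h' ∧
    ∀ α, IsRoot (stab P.lam) h' α → IsImaginary h' α
  fundamental : IsFundamental r (stab P.lam) P.h
  noncompact : ∀ α ∈ simpleRoots (stab P.lam) P.h P.F, ¬ IsCompactRoot (stab P.lam) P.h α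

/-- The linear form on `L` that extends `f` and vanishes on the `B`-orthogonal of `h`. -/
def extendForm (B : LinearMap.BilinForm ℝ L) (h : LieSubalgebra ℝ L) (f : h →ₗ[ℝ] ℝ) :
    Module.Dual ℝ L :=
  Classical.epsilon fun ψ : Module.Dual ℝ L =>
    (∀ X : h, ψ X = f X) ∧ ∀ Y : L, (∀ X : h, B (X : L) Y = 0) → ψ Y = 0

/-- The subalgebra `L(λ)(i ρ_F)`. -/
def stabRho (B : LinearMap.BilinForm ℝ L) (P : Param L) : LieSubalgebra ℝ L :=
  stab P.lam ⊓ stab (extendForm B P.h (Complex.reLm ∘ₗ (Complex.I • P.rho)))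

/-- The automorphism `a` restricted to a stable subalgebra `h`. -/
def resAut (a : L →ₗ⁅ℝ⁆ L) (h : LieSubalgebra ℝ L) (hs : ∀ X ∈ h, a X ∈ h) : h →ₗ[ℝ] h :=
  (a : L →ₗ[ℝ] L).restrict (p := h.toSubmodule) (q := h.toSubmodule) hs

/-- The automorphism `a` fixes `(λ, F)`. -/
structure Fixes (a : L →ₗ⁅ℝ⁆ L) (P : Param L) : Prop where
  lam_eq : ∀ X, P.lam (a X) = P.lam X
  stable : ∀ X ∈ P.h, a X ∈ P.h
  mem_iff : ∀ β : CForm P.h, β ∘ₗ resAut a P.h stable ∈ P.F ↔ β ∈ P.F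

/-- There is a chamber in `a^*` for the roots of `(L(λ)(i ρ_F), a)` that is stable under the
automorphism `a`. -/
def HasStableChamber (r : L →ₗ[ℝ] Matrix (Fin n) (Fin n) ℝ) (B : LinearMap.BilinForm ℝ L)
    (a : L →ₗ⁅ℝ⁆ L) (P : Param L) (hs : ∀ X ∈ P.h, a X ∈ P.h) : Prop :=
  ∃ C : Set (CForm P.h),
    IsChamber (stabRho B P) P.h (splitDual r P.h) {α | IsRoot (stabRho B P) P.h α} C ∧
    ∀ β : CForm P.h, β ∘ₗ resAut a P.h hs ∈ C ↔ β ∈ C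

/-- Restriction of `r` to `L(a)`. -/
def resRep (r : L →ₗ[ℝ] Matrix (Fin n) (Fin n) ℝ) (a : L →ₗ⁅ℝ⁆ L) :
    fixedSub a →ₗ[ℝ] Matrix (Fin n) (Fin n) ℝ :=
  r ∘ₗ ((fixedSub a).incl : fixedSub a →ₗ[ℝ] L)

/-- Restriction of `B` to `L(a)`. -/
def resBilin (B : LinearMap.BilinForm ℝ L) (a : L →ₗ⁅ℝ⁆ L) :
    LinearMap.BilinForm ℝ (fixedSub a) :=
  B.comp ((fixedSub a).incl : fixedSub a →ₗ[ℝ] L) ((fixedSub a).incl : fixedSub a →ₗ[ℝ] L)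

/-- Restriction of `λ` to `L(a)`. -/
def resLam (f : Module.Dual ℝ L) (a : L →ₗ⁅ℝ⁆ L) : Module.Dual ℝ (fixedSub a) :=
  f ∘ₗ ((fixedSub a).incl : fixedSub a →ₗ[ℝ] L)

/-- `h(a)`, as a subalgebra of `L(a)`. -/
def resSub (h : LieSubalgebra ℝ L) (a : L →ₗ⁅ℝ⁆ L) : LieSubalgebra ℝ (fixedSub a) :=
  h.comap (fixedSub a).incl

/-- Restriction of a form from `h` to `h(a)`. -/
def resForm {h : LieSubalgebra ℝ L} (β : CForm h) (a : L →ₗ⁅ℝ⁆ L) : CForm (resSub h a) where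
  toFun X := β ⟨((X : fixedSub a) : L), X.2⟩
  map_add' X Y := by
    rw [← map_add]; rfl
  map_smul' c X := by
    rw [RingHom.id_apply, ← map_smul]; rfl

/-- The pair `(λ, F)[a] = (λ, F[a])` for `L(a)`, where `F[a]` is the chamber in `h(a)_(ℝ)^*`, for the
imaginary roots of `(L(a)(λ), h(a))`, that contains `ρ_F`. -/
def descent (r : L →ₗ[ℝ] Matrix (Fin n) (Fin n) ℝ) (P : Param L) (a : L →ₗ⁅ℝ⁆ L) :
    Param (fixedSub a) where
  lam := resLam P.lam a
  h := resSub P.h a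
  F := chamberOf (stab (resLam P.lam a)) (resSub P.h a) (realDual (resRep r a) (resSub P.h a))
    (imagRoots (stab (resLam P.lam a)) (resSub P.h a)) (resForm P.rho a)

/-- The commutant in the Weyl group of `(m, h)` of the coadjoint action of `a` on the dual of the
complexification of `h`. -/
def weylCommutant (m h : LieSubalgebra ℝ L) (a : L →ₗ⁅ℝ⁆ L) (hs : ∀ X ∈ h, a X ∈ h) :
    Set (CForm h ≃ₗ[ℂ] CForm h) :=
  {w | w ∈ weylGroup m h ∧
    ∀ β : CForm h, w (β ∘ₗ resAut a h hs) = (w β) ∘ₗ resAut a h hs}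

end Algebra

/-! ## The group -/

lemma comp_mfderiv_eq_id {d : ℕ} {M : Type*} [TopologicalSpace M]
    [ChartedSpace (EuclideanSpace ℝ (Fin d)) M] (c c' : M → M)
    (hc : ContMDiff (𝓡 d) (𝓡 d) ∞ c) (hc' : ContMDiff (𝓡 d) (𝓡 d) ∞ c')
    (h : ∀ x, c' (c x) = x) (x : M) :
    (mfderiv (𝓡 d) (𝓡 d) c' (c x)).comp (mfderiv (𝓡 d) (𝓡 d) c x) =
      ContinuousLinearMap.id ℝ (TangentSpace (𝓡 d) x) := by
  have h1 : c' ∘ c = id := funext h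
  have h2 := mfderiv_comp (I := 𝓡 d) (I' := 𝓡 d) (I'' := 𝓡 d) x
    (hc'.mdifferentiableAt (by simp) : MDifferentiableAt (𝓡 d) (𝓡 d) c' (c x))
    (hc.mdifferentiableAt (by simp) : MDifferentiableAt (𝓡 d) (𝓡 d) c x)
  rw [h1, mfderiv_id] at h2
  exact h2.symm

section Group

variable {d n : ℕ} {G : Type*} [TopologicalSpace G]
  [ChartedSpace (EuclideanSpace ℝ (Fin d)) G] [Group G]

instance instLieGroupMinSmoothness [LieGroup (𝓡 d) ∞ G] :
    LieGroup (𝓡 d) (minSmoothness ℝ 3) G :=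
  LieGroup.of_le (n := ∞) (by
    rw [minSmoothness_of_isRCLikeNormedField]
    exact WithTop.coe_le_coe.mpr (le_top : (3 : ℕ∞) ≤ ⊤))

/-- The linear algebraic group `𝔾` is defined over `ℝ`: it is the set of common zeros in
`GL_n(ℂ)` of polynomials with real coefficients in the entries. -/
def IsDefinedOverReal (𝔾 : Subgroup (GL (Fin n) ℂ)) : Prop :=
  ∃ S : Set (MvPolynomial (Fin n × Fin n) ℝ), ∀ g : GL (Fin n) ℂ,
    g ∈ 𝔾 ↔ ∀ p ∈ S,
      MvPolynomial.aeval (fun ij : Fin n × Fin n => (g : Matrix (Fin n) (Fin n) ℂ) ij.1 ij.2) p = 0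

/-- The group `𝔾(ℝ)` of real points. -/
def realPoints (𝔾 : Subgroup (GL (Fin n) ℂ)) : Subgroup (GL (Fin n) ℝ) :=
  𝔾.comap (Matrix.GeneralLinearGroup.map Complex.ofRealHom)

/-- The morphism `φ` is smooth. -/
def IsSmoothMorphism (d : ℕ) [ChartedSpace (EuclideanSpace ℝ (Fin d)) G]
    (φ : G →* GL (Fin n) ℝ) : Prop :=
  ∀ i j, ContMDiff (𝓡 d) 𝓘(ℝ, ℝ) ∞ fun g : G => (φ g : Matrix (Fin n) (Fin n) ℝ) i j

/-- The differential of `φ` at the identity. -/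
def differential (d : ℕ) [ChartedSpace (EuclideanSpace ℝ (Fin d)) G] (φ : G →* GL (Fin n) ℝ) :
    GroupLieAlgebra (𝓡 d) G →ₗ[ℝ] Matrix (Fin n) (Fin n) ℝ where
  toFun X := Matrix.of fun i j =>
    (mfderiv (𝓡 d) 𝓘(ℝ, ℝ) (fun g : G => (φ g : Matrix (Fin n) (Fin n) ℝ) i j) 1 X : ℝ)
  map_add' X Y := by
    ext i j
    exact map_add (mfderiv (𝓡 d) 𝓘(ℝ, ℝ)
      (fun g : G => (φ g : Matrix (Fin n) (Fin n) ℝ) i j) 1) X Y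
  map_smul' c X := by
    ext i j
    exact map_smul (mfderiv (𝓡 d) 𝓘(ℝ, ℝ)
      (fun g : G => (φ g : Matrix (Fin n) (Fin n) ℝ) i j) 1) c X

variable [LieGroup (𝓡 d) ∞ G]

lemma contMDiff_conj (d : ℕ) [ChartedSpace (EuclideanSpace ℝ (Fin d)) G] [LieGroup (𝓡 d) ∞ G]
    (e : G) : ContMDiff (𝓡 d) (𝓡 d) ∞ fun x : G => e * x * e⁻¹ :=
  contMDiff_mul_right.comp contMDiff_mul_left

/-- The differential at the identity of the conjugation by `e`. -/
def conjDeriv (d : ℕ) [ChartedSpace (EuclideanSpace ℝ (Fin d)) G] (e : G)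
    (X : GroupLieAlgebra (𝓡 d) G) : GroupLieAlgebra (𝓡 d) G :=
  (mfderiv (𝓡 d) (𝓡 d) (fun x : G => e * x * e⁻¹) 1 X : EuclideanSpace ℝ (Fin d))

lemma isInvertible_mfderiv_conj (e h : G) :
    (mfderiv (𝓡 d) (𝓡 d) (fun x : G => e * x * e⁻¹) h).IsInvertible := by
  have hinv : (mfderiv (𝓡 d) (𝓡 d) (fun x : G => e⁻¹ * x * e⁻¹⁻¹) (e * h * e⁻¹)).comp
      (mfderiv (𝓡 d) (𝓡 d) (fun x : G => e * x * e⁻¹) h) =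
      ContinuousLinearMap.id ℝ (TangentSpace (𝓡 d) h) :=
    comp_mfderiv_eq_id _ _ (contMDiff_conj d e) (contMDiff_conj d e⁻¹) (fun x => by group) h
  have hinv' : (mfderiv (𝓡 d) (𝓡 d) (fun x : G => e * x * e⁻¹) h).comp
      (mfderiv (𝓡 d) (𝓡 d) (fun x : G => e⁻¹ * x * e⁻¹⁻¹) (e * h * e⁻¹)) =
      ContinuousLinearMap.id ℝ (TangentSpace (𝓡 d) (e * h * e⁻¹)) := by
    have h0 := comp_mfderiv_eq_id (d := d) _ _ (contMDiff_conj d e⁻¹) (contMDiff_conj d e)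
      (fun x => by group) (e * h * e⁻¹)
    have h4 : ∀ y : G, y = h →
        (mfderiv (𝓡 d) (𝓡 d) (fun x : G => e * x * e⁻¹) y :
          EuclideanSpace ℝ (Fin d) →L[ℝ] EuclideanSpace ℝ (Fin d)) =
        mfderiv (𝓡 d) (𝓡 d) (fun x : G => e * x * e⁻¹) h := by
      rintro y rfl; rfl
    have h6 := h4 (e⁻¹ * (e * h * e⁻¹) * e⁻¹⁻¹) (by group)
    exact (congrArg (fun f : EuclideanSpace ℝ (Fin d) →L[ℝ] EuclideanSpace ℝ (Fin d) =>
      f.comp (mfderiv (𝓡 d) (𝓡 d) (fun x : G => e⁻¹ * x * e⁻¹⁻¹) (e * h * e⁻¹) :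
        EuclideanSpace ℝ (Fin d) →L[ℝ] EuclideanSpace ℝ (Fin d))) h6).symm.trans h0
  exact ContinuousLinearMap.IsInvertible.of_inverse hinv' hinv

lemma mpullback_conj (e : G) (X : GroupLieAlgebra (𝓡 d) G) :
    VectorField.mpullback (𝓡 d) (𝓡 d) (fun x : G => e * x * e⁻¹)
      (mulInvariantVectorField (conjDeriv d e X)) = mulInvariantVectorField X := by
  have hd : ∀ (e x : G), MDifferentiableAt (𝓡 d) (𝓡 d) (fun x : G => e * x * e⁻¹) x :=
    fun e x => (contMDiff_conj d e).mdifferentiableAt (by simp)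
  have hl : ∀ (g x : G), MDifferentiableAt (𝓡 d) (𝓡 d) (fun x : G => g * x) x :=
    fun g x => (contMDiff_mul_left (I := 𝓡 d) (n := ∞) (a := g)).mdifferentiableAt (by simp)
  ext1 h
  have key : (mulInvariantVectorField (conjDeriv d e X) (e * h * e⁻¹) : EuclideanSpace ℝ (Fin d)) =
      mfderiv (𝓡 d) (𝓡 d) (fun x : G => e * x * e⁻¹) h (mulInvariantVectorField X h) := by
    have hcomp : (fun x : G => e * h * e⁻¹ * x) ∘ (fun x : G => e * x * e⁻¹) =
        (fun x : G => e * x * e⁻¹) ∘ (fun x : G => h * x) := by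
      ext x
      simp only [Function.comp_apply]
      group
    have h1 := mfderiv_comp (I := 𝓡 d) (I' := 𝓡 d) (I'' := 𝓡 d) (1 : G)
      (hl (e * h * e⁻¹) (e * 1 * e⁻¹)) (hd e 1)
    have h2 := mfderiv_comp (I := 𝓡 d) (I' := 𝓡 d) (I'' := 𝓡 d) (1 : G)
      (hd e (h * 1)) (hl h 1)
    have h3 : ∀ y : G, y = 1 → ∀ v : EuclideanSpace ℝ (Fin d),
        (mfderiv (𝓡 d) (𝓡 d) (fun x : G => e * h * e⁻¹ * x) y v : EuclideanSpace ℝ (Fin d)) =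
        mfderiv (𝓡 d) (𝓡 d) (fun x : G => e * h * e⁻¹ * x) 1 v := by
      rintro y rfl v; rfl
    have h4 : ∀ y : G, y = h → ∀ v : EuclideanSpace ℝ (Fin d),
        (mfderiv (𝓡 d) (𝓡 d) (fun x : G => e * x * e⁻¹) y v : EuclideanSpace ℝ (Fin d)) =
        mfderiv (𝓡 d) (𝓡 d) (fun x : G => e * x * e⁻¹) h v := by
      rintro y rfl v; rfl
    have h0 : (mfderiv (𝓡 d) (𝓡 d) ((fun x : G => e * h * e⁻¹ * x) ∘ (fun x : G => e * x * e⁻¹)) 1 :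
        EuclideanSpace ℝ (Fin d) →L[ℝ] EuclideanSpace ℝ (Fin d)) =
        mfderiv (𝓡 d) (𝓡 d) ((fun x : G => e * x * e⁻¹) ∘ (fun x : G => h * x)) 1 := by
      rw [hcomp]
    have h5 := DFunLike.congr_fun (Eq.trans (Eq.symm h1) (Eq.trans h0 h2)) X
    exact ((h3 (e * 1 * e⁻¹) (by group) _).symm.trans h5).trans (h4 _ (mul_one h) _)
  rw [VectorField.mpullback_apply, (isInvertible_mfderiv_conj e h).inverse_apply_eq]
  exact key

lemma conjDeriv_lie (e : G) (X Y : GroupLieAlgebra (𝓡 d) G) :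
    conjDeriv d e ⁅X, Y⁆ = ⁅conjDeriv d e X, conjDeriv d e Y⁆ := by
  have hM : IsManifold (𝓡 d) (minSmoothness ℝ 2) G :=
    IsManifold.of_le (n := minSmoothness ℝ 3) (minSmoothness_monotone (by norm_cast))
  have h := VectorField.mpullback_mlieBracket (I := 𝓡 d) (I' := 𝓡 d) (n := ∞)
    (f := fun x : G => e * x * e⁻¹) (x₀ := (1 : G))
    (mdifferentiableAt_mulInvariantVectorField (conjDeriv d e X))
    (mdifferentiableAt_mulInvariantVectorField (conjDeriv d e Y))
    (contMDiff_conj d e).contMDiffAt (by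
      rw [minSmoothness_of_isRCLikeNormedField]
      exact WithTop.coe_le_coe.mpr (le_top : (2 : ℕ∞) ≤ ⊤))
  rw [mpullback_conj, mpullback_conj, VectorField.mpullback_apply] at h
  have h4 : ∀ y : G, y = 1 → ∀ V W : (x : G) → TangentSpace (𝓡 d) x,
      (VectorField.mlieBracket (𝓡 d) V W y : EuclideanSpace ℝ (Fin d)) =
        VectorField.mlieBracket (𝓡 d) V W 1 := by
    rintro y rfl V W; rfl
  have h6 : (mfderiv (𝓡 d) (𝓡 d) (fun x : G => e * x * e⁻¹) 1).IsInvertible :=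
    isInvertible_mfderiv_conj e 1
  have h7 := congrArg (fun v => mfderiv (𝓡 d) (𝓡 d) (fun x : G => e * x * e⁻¹) 1 v) h
  have h8 := (h6.self_apply_inverse _).symm.trans h7
  exact (h8.symm.trans (h4 _ (by group) _ _))

/-- The adjoint action of `e` on the Lie algebra: the differential at the identity of the
conjugation by `e`. -/
def Ad (d : ℕ) [ChartedSpace (EuclideanSpace ℝ (Fin d)) G] [LieGroup (𝓡 d) ∞ G] (e : G) :
    GroupLieAlgebra (𝓡 d) G →ₗ⁅ℝ⁆ GroupLieAlgebra (𝓡 d) G where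
  toFun X := conjDeriv d e X
  map_add' X Y := map_add (mfderiv (𝓡 d) (𝓡 d) (fun x : G => e * x * e⁻¹) 1) X Y
  map_smul' c X := map_smul (mfderiv (𝓡 d) (𝓡 d) (fun x : G => e * x * e⁻¹) 1) c X
  map_lie' := by
    intro X Y
    exact conjDeriv_lie e X Y

/-- `e` is elliptic: its image is diagonalizable over `ℂ` with eigenvalues of modulus one. -/
def IsElliptic (φ : G →* GL (Fin n) ℝ) (e : G) : Prop :=
  IsSemisimpleMatrix (φ e : Matrix (Fin n) (Fin n) ℝ) ∧
    ∀ z, IsComplexEigenvalue (φ e : Matrix (Fin n) (Fin n) ℝ) z → ‖z‖ = 1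

/-- `g = exp X`: `g` is the value at `1` of the one-parameter subgroup with velocity `X` at `0`. -/
def IsExp {d : ℕ} [ChartedSpace (EuclideanSpace ℝ (Fin d)) G] (X : GroupLieAlgebra (𝓡 d) G)
    (g : G) : Prop :=
  ∃ γ : ℝ → G, ContMDiff 𝓘(ℝ, ℝ) (𝓡 d) ∞ γ ∧ (∀ s t, γ (s + t) = γ s * γ t) ∧
    (mfderiv 𝓘(ℝ, ℝ) (𝓡 d) γ 0 (1 : ℝ) : EuclideanSpace ℝ (Fin d)) = X ∧ γ 1 = g

/-- The standing hypothesis on `G`: `𝔾` is a linear algebraic group defined over `ℝ`, `φ` is a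
morphism of Lie groups from `G` to `𝔾(ℝ)` with finite central kernel and open image, and the Lie
algebra of `G` is reductive with centre made of semisimple elements. -/
structure IsReductiveRealGroup (d : ℕ) [ChartedSpace (EuclideanSpace ℝ (Fin d)) G]
    [LieGroup (𝓡 d) ∞ G] (𝔾 : Subgroup (GL (Fin n) ℂ)) (φ : G →* GL (Fin n) ℝ) : Prop where
  definedOverReal : IsDefinedOverReal 𝔾
  smooth : IsSmoothMorphism d φ
  mem_realPoints : ∀ g, φ g ∈ realPoints 𝔾
  open_range : ∃ U : Set (GL (Fin n) ℝ), IsOpen U ∧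
    Set.range φ = U ∩ (realPoints 𝔾 : Set (GL (Fin n) ℝ))
  finite_ker : Finite φ.ker
  ker_le_center : φ.ker ≤ Subgroup.center G
  reductive : LieAlgebra.radical ℝ (GroupLieAlgebra (𝓡 d) G) =
    LieAlgebra.center ℝ (GroupLieAlgebra (𝓡 d) G)
  semisimple_center : ∀ X ∈ LieAlgebra.center ℝ (GroupLieAlgebra (𝓡 d) G),
    IsSemisimpleElt (differential d φ) X

/-- `B` is a nondegenerate `G`-invariant symmetric bilinear form whose complexification restricts
to a scalar product on `h_(ℝ) = i t ⊕ a` for every Cartan subalgebra `h`, where `t` and `a` are its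
elliptic and hyperbolic components: `B` is negative definite on `t`, positive definite on `a`, and
`t` and `a` are orthogonal. -/
structure IsAdmissibleForm (d : ℕ) [ChartedSpace (EuclideanSpace ℝ (Fin d)) G]
    [LieGroup (𝓡 d) ∞ G] (φ : G →* GL (Fin n) ℝ)
    (B : LinearMap.BilinForm ℝ (GroupLieAlgebra (𝓡 d) G)) : Prop where
  symm : B.IsSymm
  nondegenerate : B.Nondegenerate
  invariant : ∀ (g : G) (X Y : GroupLieAlgebra (𝓡 d) G), B (Ad d g X) (Ad d g Y) = B X Y
  neg_elliptic : ∀ h : LieSubalgebra ℝ (GroupLieAlgebra (𝓡 d) G), h.IsCartanSubalgebra →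
    ∀ X ∈ h, IsInfElliptic (differential d φ) X → X ≠ 0 → B X X < 0
  pos_hyperbolic : ∀ h : LieSubalgebra ℝ (GroupLieAlgebra (𝓡 d) G), h.IsCartanSubalgebra →
    ∀ X ∈ h, IsInfHyperbolic (differential d φ) X → X ≠ 0 → 0 < B X X
  orthogonal : ∀ h : LieSubalgebra ℝ (GroupLieAlgebra (𝓡 d) G), h.IsCartanSubalgebra →
    ∀ X ∈ h, IsInfElliptic (differential d φ) X →
      ∀ Y ∈ h, IsInfHyperbolic (differential d φ) Y → B X Y = 0

end Group

end

end EllipticDescent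

namespace EllipticDescent

noncomputable section
set_option linter.unusedSectionVars false

section LieGroupFacts

variable {d n : ℕ} {G : Type*} [TopologicalSpace G]
  [ChartedSpace (EuclideanSpace ℝ (Fin d)) G] [Group G] [LieGroup (𝓡 d) ∞ G]

/-- The derivative of a real function in the direction of a tangent vector. -/
def dirDeriv (d : ℕ) [ChartedSpace (EuclideanSpace ℝ (Fin d)) G] (f : G → ℝ) (g : G)
    (v : TangentSpace (𝓡 d) g) : ℝ :=
  mfderiv (𝓡 d) 𝓘(ℝ, ℝ) f g v

lemma differential_apply (φ : G →* GL (Fin n) ℝ) (X : GroupLieAlgebra (𝓡 d) G) (i j : Fin n) :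
    differential d φ X i j =
      dirDeriv d (fun g : G => (φ g : Matrix (Fin n) (Fin n) ℝ) i j) 1 X := rfl

lemma dirDeriv_sum_mul {ι : Type} (s : Finset ι) (c : ι → ℝ) (f : ι → G → ℝ) (g : G)
    (hf : ∀ i ∈ s, MDifferentiableAt (𝓡 d) 𝓘(ℝ, ℝ) (f i) g) (v : TangentSpace (𝓡 d) g) :
    dirDeriv d (fun x => ∑ i ∈ s, c i * f i x) g v = ∑ i ∈ s, c i * dirDeriv d (f i) g v := by
  have h1 : HasMFDerivAt (𝓡 d) 𝓘(ℝ, ℝ) (∑ i ∈ s, c i • f i) g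
      (∑ i ∈ s, c i • mfderiv (𝓡 d) 𝓘(ℝ, ℝ) (f i) g) :=
    HasMFDerivAt.sum fun i hi => ((hf i hi).hasMFDerivAt).const_smul (c i)
  have h2 : (fun x => ∑ i ∈ s, c i * f i x) = ∑ i ∈ s, c i • f i := by
    ext x; simp
  unfold dirDeriv
  rw [h2, h1.mfderiv]
  have h3 : ∀ (T : ι → TangentSpace (𝓡 d) g →L[ℝ] ℝ),
      (∑ i ∈ s, c i • T i) v = ∑ i ∈ s, c i * T i v := by
    intro T
    simp
  exact h3 fun i => mfderiv (𝓡 d) 𝓘(ℝ, ℝ) (f i) g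

lemma dirDeriv_comp {f : G → ℝ} {c : G → G} {g : G}
    (hf : MDifferentiableAt (𝓡 d) 𝓘(ℝ, ℝ) f (c g)) (hc : MDifferentiableAt (𝓡 d) (𝓡 d) c g)
    (v : TangentSpace (𝓡 d) g) :
    dirDeriv d (f ∘ c) g v = dirDeriv d f (c g) (mfderiv (𝓡 d) (𝓡 d) c g v) := by
  unfold dirDeriv
  rw [mfderiv_comp (I' := 𝓡 d) g hf hc]
  rfl

lemma IsSmoothMorphism.mdifferentiableAt {φ : G →* GL (Fin n) ℝ} (hφ : IsSmoothMorphism d φ)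
    (i j : Fin n) (g : G) :
    MDifferentiableAt (𝓡 d) 𝓘(ℝ, ℝ) (fun g : G => (φ g : Matrix (Fin n) (Fin n) ℝ) i j) g :=
  (hφ i j).mdifferentiableAt (by simp)

lemma dirDeriv_mulInvariantVectorField {φ : G →* GL (Fin n) ℝ} (hφ : IsSmoothMorphism d φ)
    (X : GroupLieAlgebra (𝓡 d) G) (g : G) (i j : Fin n) :
    dirDeriv d (fun g : G => (φ g : Matrix (Fin n) (Fin n) ℝ) i j) g
        (mulInvariantVectorField X g) =
      ((φ g : Matrix (Fin n) (Fin n) ℝ) * differential d φ X) i j := by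
  have hl : MDifferentiableAt (𝓡 d) (𝓡 d) (fun x : G => g * x) 1 :=
    (contMDiff_mul_left (n := ∞) (I := 𝓡 d) (a := g)).mdifferentiableAt (by simp)
  have h1 := dirDeriv_comp (f := fun g : G => (φ g : Matrix (Fin n) (Fin n) ℝ) i j)
    (hφ.mdifferentiableAt i j (g * 1)) hl X
  have h2 : (fun g : G => (φ g : Matrix (Fin n) (Fin n) ℝ) i j) ∘ (fun x : G => g * x) =
      fun x => ∑ k, (φ g : Matrix (Fin n) (Fin n) ℝ) i k * (φ x : Matrix (Fin n) (Fin n) ℝ) k j := by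
    ext x
    simp [Matrix.mul_apply]
  rw [h2, dirDeriv_sum_mul _ _ (fun k x => (φ x : Matrix (Fin n) (Fin n) ℝ) k j) _
    (fun k _ => hφ.mdifferentiableAt k j 1)] at h1
  have h3 : ∀ y : G, y = g → ∀ v : EuclideanSpace ℝ (Fin d),
      dirDeriv d (fun g : G => (φ g : Matrix (Fin n) (Fin n) ℝ) i j) y v =
        dirDeriv d (fun g : G => (φ g : Matrix (Fin n) (Fin n) ℝ) i j) g v := by
    rintro y rfl v; rfl
  exact ((h3 (g * 1) (mul_one g) _).symm.trans h1.symm)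

lemma differential_Ad {φ : G →* GL (Fin n) ℝ} (hφ : IsSmoothMorphism d φ) (g : G)
    (X : GroupLieAlgebra (𝓡 d) G) :
    differential d φ (Ad d g X) = (φ g : Matrix (Fin n) (Fin n) ℝ) * differential d φ X *
      ((φ g)⁻¹ : GL (Fin n) ℝ) := by
  ext i j
  have hc : MDifferentiableAt (𝓡 d) (𝓡 d) (fun x : G => g * x * g⁻¹) 1 :=
    (contMDiff_conj d g).mdifferentiableAt (by simp)
  have h1 := dirDeriv_comp (f := fun g : G => (φ g : Matrix (Fin n) (Fin n) ℝ) i j)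
    (c := fun x : G => g * x * g⁻¹) (g := 1) (hφ.mdifferentiableAt i j (g * 1 * g⁻¹)) hc X
  have h2 : (fun g : G => (φ g : Matrix (Fin n) (Fin n) ℝ) i j) ∘ (fun x : G => g * x * g⁻¹) =
      fun x => ∑ kl : Fin n × Fin n, ((φ g : Matrix (Fin n) (Fin n) ℝ) i kl.1 *
        ((φ g)⁻¹ : GL (Fin n) ℝ).1 kl.2 j) * (φ x : Matrix (Fin n) (Fin n) ℝ) kl.1 kl.2 := by
    ext x
    simp only [Function.comp_apply, map_mul, map_inv, Units.val_mul, Matrix.mul_apply,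
      Finset.sum_mul, Fintype.sum_prod_type]
    rw [Finset.sum_comm]
    refine Finset.sum_congr rfl fun k _ => Finset.sum_congr rfl fun l _ => ?_
    ring
  rw [h2, dirDeriv_sum_mul _ _ (fun (kl : Fin n × Fin n) x =>
    (φ x : Matrix (Fin n) (Fin n) ℝ) kl.1 kl.2) _
    (fun kl _ => hφ.mdifferentiableAt kl.1 kl.2 1)] at h1
  have h3 : ∀ y : G, y = 1 → ∀ v : EuclideanSpace ℝ (Fin d),
      dirDeriv d (fun g : G => (φ g : Matrix (Fin n) (Fin n) ℝ) i j) y v =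
        dirDeriv d (fun g : G => (φ g : Matrix (Fin n) (Fin n) ℝ) i j) 1 v := by
    rintro y rfl v; rfl
  have h4 : differential d φ (Ad d g X) i j = _ := (h3 (g * 1 * g⁻¹) (by group) _).symm.trans h1.symm
  rw [h4]
  simp only [Matrix.mul_apply, Finset.sum_mul, Fintype.sum_prod_type]
  rw [Finset.sum_comm]
  refine Finset.sum_congr rfl fun k _ => Finset.sum_congr rfl fun l _ => ?_
  rw [differential_apply]
  ring

lemma contMDiff_mulInvariantVectorField_one (X : GroupLieAlgebra (𝓡 d) G) :
    ContMDiff (𝓡 d) (𝓡 d).tangent 1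
      (fun g : G => (⟨g, mulInvariantVectorField X g⟩ : TangentBundle (𝓡 d) G)) :=
  (contMDiff_mulInvariantVectorField X).of_le (by
    rw [minSmoothness_of_isRCLikeNormedField]; norm_cast)

lemma mfderiv_mul_left_mulInvariantVectorField (X : GroupLieAlgebra (𝓡 d) G) (g h : G) :
    mfderiv (𝓡 d) (𝓡 d) (fun x : G => g * x) h (mulInvariantVectorField X h) =
      mulInvariantVectorField X (g * h) := by
  have hl : ∀ g y : G, MDifferentiableAt (𝓡 d) (𝓡 d) (fun x : G => g * x) y := fun g y =>
    (contMDiff_mul_left (n := ∞) (I := 𝓡 d) (a := g)).mdifferentiableAt (by simp)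
  have h1 := mfderiv_comp (I := 𝓡 d) (I' := 𝓡 d) (I'' := 𝓡 d) (1 : G) (hl g (h * 1)) (hl h 1)
  have h2 : (fun x : G => g * x) ∘ (fun x : G => h * x) = fun x : G => (g * h) * x := by
    ext x; simp [mul_assoc]
  have h3 : ∀ y : G, y = h → ∀ v : EuclideanSpace ℝ (Fin d),
      (mfderiv (𝓡 d) (𝓡 d) (fun x : G => g * x) y v : EuclideanSpace ℝ (Fin d)) =
        mfderiv (𝓡 d) (𝓡 d) (fun x : G => g * x) h v := by
    rintro y rfl v; rfl
  have h0 : (mfderiv (𝓡 d) (𝓡 d) ((fun x : G => g * x) ∘ (fun x : G => h * x)) 1 :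
      EuclideanSpace ℝ (Fin d) →L[ℝ] EuclideanSpace ℝ (Fin d)) =
      mfderiv (𝓡 d) (𝓡 d) (fun x : G => (g * h) * x) 1 := by rw [h2]
  have h5 := DFunLike.congr_fun (Eq.trans (Eq.symm h0) h1) X
  exact ((h3 (h * 1) (mul_one h) _).symm.trans h5.symm)

/-- The left translate of an integral curve of a left invariant vector field. -/
lemma IsMIntegralCurveOn.mul_left_of_invariant {X : GroupLieAlgebra (𝓡 d) G} {γ : ℝ → G}
    {s : Set ℝ} (hγ : IsMIntegralCurveOn γ (mulInvariantVectorField (I := 𝓡 d) X) s) (g : G) :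
    IsMIntegralCurveOn (fun t => g * γ t) (mulInvariantVectorField (I := 𝓡 d) X) s := by
  intro t ht
  have hl : MDifferentiableAt (𝓡 d) (𝓡 d) (fun x : G => g * x) (γ t) :=
    (contMDiff_mul_left (n := ∞) (I := 𝓡 d) (a := g)).mdifferentiableAt (by simp)
  have h1 := hl.hasMFDerivAt.comp_hasMFDerivWithinAt t (hγ t ht)
  have h2 : (mfderiv (𝓡 d) (𝓡 d) (fun x : G => g * x) (γ t)).comp
      ((1 : ℝ →L[ℝ] ℝ).smulRight (mulInvariantVectorField (I := 𝓡 d) X (γ t))) =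
      (1 : ℝ →L[ℝ] ℝ).smulRight (mulInvariantVectorField (I := 𝓡 d) X (g * γ t)) := by
    rw [← mfderiv_mul_left_mulInvariantVectorField X g (γ t)]
    refine ContinuousLinearMap.ext fun c => ?_
    exact map_smul (mfderiv (𝓡 d) (𝓡 d) (fun x : G => g * x) (γ t)) c _
  exact h2 ▸ h1

variable [T2Space G]

lemma exists_isMIntegralCurve_invariant (X : GroupLieAlgebra (𝓡 d) G) :
    ∃ γ : ℝ → G, γ 0 = 1 ∧ IsMIntegralCurve γ (mulInvariantVectorField (I := 𝓡 d) X) := by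
  have : IsManifold (𝓡 d) 1 G := IsManifold.of_le (n := ∞) (by norm_cast)
  obtain ⟨γ, h0, hγ⟩ := exists_isMIntegralCurveAt_of_contMDiffAt_boundaryless (I := 𝓡 d) (t₀ := 0)
    (contMDiff_mulInvariantVectorField_one X (1 : G))
  obtain ⟨ε, hε, hγ⟩ := isMIntegralCurveAt_iff'.mp hγ
  refine exists_isMIntegralCurve_of_isMIntegralCurveOn
    (contMDiff_mulInvariantVectorField_one X) hε (fun x => ⟨fun t => x * γ t, by simp [h0], ?_⟩) 1
  rw [Real.ball_eq_Ioo] at hγ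
  simpa using IsMIntegralCurveOn.mul_left_of_invariant hγ x

lemma IsMIntegralCurve.map_add_of_invariant {X : GroupLieAlgebra (𝓡 d) G} {γ : ℝ → G}
    (h0 : γ 0 = 1) (hγ : IsMIntegralCurve γ (mulInvariantVectorField (I := 𝓡 d) X)) (s t : ℝ) :
    γ (s + t) = γ s * γ t := by
  have : IsManifold (𝓡 d) 1 G := IsManifold.of_le (n := ∞) (by norm_cast)
  have h1 : IsMIntegralCurve (fun t => γ s * γ t) (mulInvariantVectorField (I := 𝓡 d) X) := by
    rw [isMIntegralCurve_iff_isMIntegralCurveOn] at hγ ⊢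
    exact IsMIntegralCurveOn.mul_left_of_invariant hγ _
  have h2 := isMIntegralCurve_Ioo_eq_of_contMDiff_boundaryless (t₀ := 0)
    (contMDiff_mulInvariantVectorField_one X) (hγ.comp_add s) h1 (by simp [h0])
  have := congrFun h2 t
  simpa [add_comm] using this

lemma hasDerivAt_comp_integralCurve {φ : G →* GL (Fin n) ℝ} (hφ : IsSmoothMorphism d φ)
    {X : GroupLieAlgebra (𝓡 d) G} {γ : ℝ → G}
    (hγ : IsMIntegralCurve γ (mulInvariantVectorField (I := 𝓡 d) X)) (t : ℝ) (i j : Fin n) :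
    HasDerivAt (fun t => (φ (γ t) : Matrix (Fin n) (Fin n) ℝ) i j)
      (((φ (γ t) : Matrix (Fin n) (Fin n) ℝ) * differential d φ X) i j) t := by
  have h1 := (hφ.mdifferentiableAt i j (γ t)).hasMFDerivAt.comp t (hγ t)
  rw [hasMFDerivAt_iff_hasFDerivAt] at h1
  rw [← dirDeriv_mulInvariantVectorField hφ, hasDerivAt_iff_hasFDerivAt]
  have h3 : ∀ c : ℝ, (mfderiv (𝓡 d) 𝓘(ℝ, ℝ) (fun g : G => (φ g : Matrix (Fin n) (Fin n) ℝ) i j)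
      (γ t)) (c • mulInvariantVectorField (I := 𝓡 d) X (γ t)) =
      c • dirDeriv d (fun g : G => (φ g : Matrix (Fin n) (Fin n) ℝ) i j) (γ t)
        (mulInvariantVectorField (I := 𝓡 d) X (γ t)) := fun c => map_smul (mfderiv (𝓡 d) 𝓘(ℝ, ℝ)
      (fun g : G => (φ g : Matrix (Fin n) (Fin n) ℝ) i j) (γ t)) c _
  have h4 : (ContinuousLinearMap.toSpanSingleton ℝ
      (dirDeriv d (fun g : G => (φ g : Matrix (Fin n) (Fin n) ℝ) i j) (γ t)
        (mulInvariantVectorField (I := 𝓡 d) X (γ t))) : ℝ →L[ℝ] ℝ) =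
      (mfderiv (𝓡 d) 𝓘(ℝ, ℝ) (fun g : G => (φ g : Matrix (Fin n) (Fin n) ℝ) i j) (γ t)).comp
      ((1 : ℝ →L[ℝ] ℝ).smulRight (mulInvariantVectorField (I := 𝓡 d) X (γ t))) := by
    refine ContinuousLinearMap.ext fun c => ?_
    exact (h3 c).symm
  rw [h4]
  exact h1

end LieGroupFacts

section MatrixExponential

attribute [local instance] Matrix.linftyOpNormedRing Matrix.linftyOpNormedAlgebra

variable {n : ℕ}

lemma hasDerivAt_matrix {F : ℝ → Matrix (Fin n) (Fin n) ℝ} {F' : Matrix (Fin n) (Fin n) ℝ} {t : ℝ}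
    (h : ∀ i j, HasDerivAt (fun t => F t i j) (F' i j) t) : HasDerivAt F F' t := by
  have h1 : ∀ M : Matrix (Fin n) (Fin n) ℝ, M = ∑ i, ∑ j, M i j • Matrix.single i j (1 : ℝ) := by
    intro M
    conv_lhs => rw [Matrix.matrix_eq_sum_single M]
    simp
  have h2 : F = fun t => ∑ i, ∑ j, F t i j • Matrix.single i j (1 : ℝ) := funext fun t => h1 _
  rw [h2, h1 F']
  exact HasDerivAt.fun_sum fun i _ => HasDerivAt.fun_sum fun j _ => (h i j).smul_const _

lemma hasDerivAt_entry {F : ℝ → Matrix (Fin n) (Fin n) ℝ} {F' : Matrix (Fin n) (Fin n) ℝ} {t : ℝ}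
    (h : HasDerivAt F F' t) (T : Matrix (Fin n) (Fin n) ℝ →ₗ[ℝ] ℝ) :
    HasDerivAt (fun t => T (F t)) (T F') t :=
  (LinearMap.toContinuousLinearMap T).hasFDerivAt.comp_hasDerivAt t h

/-- A solution of `F' = F X` with `F 0 = 1` is the exponential. -/
lemma eq_exp_of_hasDerivAt {F : ℝ → Matrix (Fin n) (Fin n) ℝ} {X : Matrix (Fin n) (Fin n) ℝ}
    (h0 : F 0 = 1) (h : ∀ t i j, HasDerivAt (fun t => F t i j) ((F t * X) i j) t) (t : ℝ) :
    F t = NormedSpace.exp (t • X) := by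
  have h1 : ∀ t, HasDerivAt (fun t => F t * NormedSpace.exp (t • (-X))) 0 t := by
    intro t
    have h2 := (hasDerivAt_matrix (h t)).mul (hasDerivAt_exp_smul_const' (𝕂 := ℝ) (-X) t)
    convert! h2 using 1
    simp [mul_assoc]
  have h3 : F t * NormedSpace.exp (t • (-X)) = F 0 * NormedSpace.exp ((0 : ℝ) • (-X)) :=
    is_const_of_deriv_eq_zero (fun t => (h1 t).differentiableAt) (fun t => (h1 t).deriv) t 0
  rw [h0, zero_smul, NormedSpace.exp_zero, mul_one] at h3
  have h4 : NormedSpace.exp (t • (-X)) * NormedSpace.exp (t • X) = 1 := by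
    rw [← Matrix.exp_add_of_commute, smul_neg, neg_add_cancel, NormedSpace.exp_zero]
    exact ((Commute.refl X).neg_left).smul_left t |>.smul_right t
  calc F t = F t * (NormedSpace.exp (t • (-X)) * NormedSpace.exp (t • X)) := by rw [h4, mul_one]
    _ = _ := by rw [← mul_assoc, h3, one_mul]

lemma hasDerivAt_conj_exp (Z M : Matrix (Fin n) (Fin n) ℝ) :
    HasDerivAt (fun t : ℝ => NormedSpace.exp (t • Z) * M * NormedSpace.exp (-(t • Z)))
      (Z * M - M * Z) 0 := by
  have h1 := (hasDerivAt_exp_smul_const' (𝕂 := ℝ) Z 0).mul_const M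
  have h2 := h1.mul (hasDerivAt_exp_smul_const' (𝕂 := ℝ) (-Z) 0)
  simp only [smul_neg] at h2
  convert! h2 using 1
  simp [sub_eq_add_neg]

lemma contDiff_exp_smul (Z : Matrix (Fin n) (Fin n) ℝ) :
    ContDiff ℝ ∞ (fun t : ℝ => NormedSpace.exp (t • Z)) := by
  have h1 : ContDiff ℝ ∞ (NormedSpace.exp : Matrix (Fin n) (Fin n) ℝ → _) :=
    contDiff_iff_contDiffAt.2 fun x => (NormedSpace.exp_analytic (𝕂 := ℝ) x).contDiffAt
  exact h1.comp (contDiff_id.smul contDiff_const)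

lemma continuous_exp_smul (Z : Matrix (Fin n) (Fin n) ℝ) :
    Continuous (fun t : ℝ => NormedSpace.exp (t • Z)) :=
  (contDiff_exp_smul Z).continuous

end MatrixExponential

section LieGroupFacts

variable {d n : ℕ} {G : Type*} [TopologicalSpace G]
  [ChartedSpace (EuclideanSpace ℝ (Fin d)) G] [Group G] [LieGroup (𝓡 d) ∞ G] [T2Space G]

instance : FiniteDimensional ℝ (GroupLieAlgebra (𝓡 d) G) :=
  inferInstanceAs (FiniteDimensional ℝ (EuclideanSpace ℝ (Fin d)))

/-- One-parameter subgroups, and their images under `φ`. -/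
lemma exists_oneParameter {φ : G →* GL (Fin n) ℝ} (hφ : IsSmoothMorphism d φ)
    (X : GroupLieAlgebra (𝓡 d) G) :
    ∃ γ : ℝ → G, Continuous γ ∧ (∀ s t, γ (s + t) = γ s * γ t) ∧
      IsMIntegralCurve γ (mulInvariantVectorField (I := 𝓡 d) X) ∧ γ 0 = 1 ∧
      ∀ t, (φ (γ t) : Matrix (Fin n) (Fin n) ℝ) = NormedSpace.exp (t • differential d φ X) := by
  obtain ⟨γ, h0, hγ⟩ := exists_isMIntegralCurve_invariant X
  refine ⟨γ, hγ.continuous, fun s t => IsMIntegralCurve.map_add_of_invariant h0 hγ s t, hγ, h0,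
    fun t => ?_⟩
  exact eq_exp_of_hasDerivAt (F := fun t => (φ (γ t) : Matrix (Fin n) (Fin n) ℝ)) (by simp [h0])
    (fun t i j => hasDerivAt_comp_integralCurve hφ hγ t i j) t

lemma differential_injective {φ : G →* GL (Fin n) ℝ} (hφ : IsSmoothMorphism d φ)
    (hker : Finite φ.ker) : Function.Injective (differential d φ) := by
  rw [injective_iff_map_eq_zero]
  intro X hX
  obtain ⟨γ, hc, -, hγ, h0, h1⟩ := exists_oneParameter hφ X
  have h2 : ∀ t, γ t ∈ φ.ker := by
    intro t
    rw [MonoidHom.mem_ker]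
    ext1
    rw [h1, hX, smul_zero, NormedSpace.exp_zero, Units.val_one]
  have h3 : ∀ t, γ t = 1 := by
    intro t
    have hfin : (Set.range γ).Finite := (Set.toFinite (φ.ker : Set G)).subset (by
      rintro _ ⟨t, rfl⟩; exact h2 t)
    have hpre : IsPreconnected (Set.range γ) := isPreconnected_range hc
    have hs : (Set.range γ).Subsingleton :=
      hpre.isDiscrete_iff_subsingleton.mp hfin.isDiscrete
    rw [← h0]
    exact hs ⟨t, rfl⟩ ⟨0, rfl⟩
  have h4 : γ = fun _ => 1 := funext h3
  have h5 := hγ 0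
  rw [h4] at h5
  have h6 := h5.mfderiv
  rw [mfderiv_const] at h6
  have h7 := DFunLike.congr_fun h6 (1 : ℝ)
  have h8 : (0 : EuclideanSpace ℝ (Fin d)) =
    (1 : ℝ) • (mulInvariantVectorField (I := 𝓡 d) X (1 : G) : EuclideanSpace ℝ (Fin d)) := h7
  rw [one_smul] at h8
  have h9 : (mulInvariantVectorField (I := 𝓡 d) X (1 : G) : EuclideanSpace ℝ (Fin d)) = X := by
    have : (fun x : G => 1 * x) = id := by ext; simp
    change mfderiv (𝓡 d) (𝓡 d) (fun x : G => 1 * x) 1 X = X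
    rw [this, mfderiv_id]
    rfl
  exact h9.symm.trans h8.symm

end LieGroupFacts

section BracketOfDifferential

open VectorField

variable {d n : ℕ} {G : Type*} [TopologicalSpace G]
  [ChartedSpace (EuclideanSpace ℝ (Fin d)) G] [Group G] [LieGroup (𝓡 d) ∞ G]

lemma dirDeriv_entry_mul {φ : G →* GL (Fin n) ℝ} (hφ : IsSmoothMorphism d φ)
    (X : GroupLieAlgebra (𝓡 d) G) (M : Matrix (Fin n) (Fin n) ℝ) (g : G) (i j : Fin n) :
    dirDeriv d (fun g : G => ((φ g : Matrix (Fin n) (Fin n) ℝ) * M) i j) g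
        (mulInvariantVectorField X g) =
      ((φ g : Matrix (Fin n) (Fin n) ℝ) * (differential d φ X * M)) i j := by
  have h1 : (fun g : G => ((φ g : Matrix (Fin n) (Fin n) ℝ) * M) i j) =
      fun g => ∑ k, M k j * (φ g : Matrix (Fin n) (Fin n) ℝ) i k := by
    ext g
    simp [Matrix.mul_apply, mul_comm]
  rw [h1, dirDeriv_sum_mul _ _ (fun k x => (φ x : Matrix (Fin n) (Fin n) ℝ) i k) _
    (fun k _ => hφ.mdifferentiableAt i k g), ← mul_assoc, Matrix.mul_apply]
  refine Finset.sum_congr rfl fun k _ => ?_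
  rw [dirDeriv_mulInvariantVectorField hφ, mul_comm]

lemma contMDiff_entry_mul {φ : G →* GL (Fin n) ℝ} (hφ : IsSmoothMorphism d φ)
    (M : Matrix (Fin n) (Fin n) ℝ) (i j : Fin n) :
    ContMDiff (𝓡 d) 𝓘(ℝ, ℝ) ∞ (fun g : G => ((φ g : Matrix (Fin n) (Fin n) ℝ) * M) i j) := by
  have h1 : (fun g : G => ((φ g : Matrix (Fin n) (Fin n) ℝ) * M) i j) =
      fun g => ∑ k, (φ g : Matrix (Fin n) (Fin n) ℝ) i k * M k j := by
    ext g
    simp [Matrix.mul_apply]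
  rw [h1]
  exact contMDiff_finsetSum fun k _ => (hφ i k).mul contMDiff_const

lemma mlieBracket_smul_invariant (X Z : GroupLieAlgebra (𝓡 d) G) {f : G → ℝ}
    (hf : ContMDiff (𝓡 d) 𝓘(ℝ, ℝ) ∞ f) :
    mlieBracket (𝓡 d) (mulInvariantVectorField (I := 𝓡 d) X)
        (f • mulInvariantVectorField (I := 𝓡 d) (G := G) Z) =
      (fun g => dirDeriv d f g (mulInvariantVectorField X g)) • mulInvariantVectorField Z +
        f • mulInvariantVectorField (I := 𝓡 d) ⁅X, Z⁆ := by
  funext g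
  rw [mlieBracket_smul_right (hf.mdifferentiableAt (by simp))
    (mdifferentiableAt_mulInvariantVectorField Z), GroupLieAlgebra.bracket_def,
    mulInvariantVector_mlieBracket]
  rfl

lemma differential_lie {φ : G →* GL (Fin n) ℝ} (hφ : IsSmoothMorphism d φ)
    (X Y : GroupLieAlgebra (𝓡 d) G) :
    differential d φ ⁅X, Y⁆ =
      differential d φ X * differential d φ Y - differential d φ Y * differential d φ X := by
  rcases eq_or_ne X 0 with rfl | hX
  · simp
  have : IsManifold (𝓡 d) (minSmoothness ℝ 3) G :=
    IsManifold.of_le (n := ∞) (by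
      rw [minSmoothness_of_isRCLikeNormedField]
      exact WithTop.coe_le_coe.mpr (le_top : (3 : ℕ∞) ≤ ⊤))
  ext i j
  set f : Matrix (Fin n) (Fin n) ℝ → G → ℝ :=
    fun M g => ((φ g : Matrix (Fin n) (Fin n) ℝ) * M) i j with hfdef
  have hf : ∀ M, ContMDiff (𝓡 d) 𝓘(ℝ, ℝ) ∞ (f M) := fun M => contMDiff_entry_mul hφ M i j
  have hb : ∀ (X Z : GroupLieAlgebra (𝓡 d) G) M, mlieBracket (𝓡 d)
      (mulInvariantVectorField (I := 𝓡 d) X)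
        (f M • mulInvariantVectorField (I := 𝓡 d) (G := G) Z) =
      f (differential d φ X * M) • mulInvariantVectorField Z +
        f M • mulInvariantVectorField (I := 𝓡 d) ⁅X, Z⁆ := by
    intro X Z M
    rw [mlieBracket_smul_invariant X Z (hf M)]
    congr 2
    funext g
    exact dirDeriv_entry_mul hφ X M g i j
  have hs : ∀ (Z : GroupLieAlgebra (𝓡 d) G), ContMDiff (𝓡 d) (𝓡 d).tangent (minSmoothness ℝ 2)
      (fun g : G => (⟨g, mulInvariantVectorField Z g⟩ : TangentBundle (𝓡 d) G)) :=
    fun Z => contMDiff_mulInvariantVectorField Z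
  have hle : minSmoothness ℝ 2 ≤ (∞ : WithTop ℕ∞) := by
    rw [minSmoothness_of_isRCLikeNormedField]
    exact WithTop.coe_le_coe.mpr (le_top : (2 : ℕ∞) ≤ ⊤)
  have hfs : ∀ (Z : GroupLieAlgebra (𝓡 d) G) M,
      ContMDiff (𝓡 d) (𝓡 d).tangent (minSmoothness ℝ 2)
      (fun g : G => (⟨g, (f M • mulInvariantVectorField (I := 𝓡 d) (G := G) Z) g⟩ :
        TangentBundle (𝓡 d) G)) := by
    intro Z M
    exact ((hf M).of_le hle).smul_section (hs Z)
  have hd : ∀ (Z : GroupLieAlgebra (𝓡 d) G) M, MDifferentiableAt (𝓡 d) (𝓡 d).tangent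
      (fun g : G => (⟨g, (f M • mulInvariantVectorField (I := 𝓡 d) (G := G) Z) g⟩ :
        TangentBundle (𝓡 d) G)) 1 := fun Z M => (hfs Z M).mdifferentiableAt (by
    rw [minSmoothness_of_isRCLikeNormedField]; simp)
  have hb2 : ∀ (W Z : GroupLieAlgebra (𝓡 d) G) M Z' M', mlieBracket (𝓡 d)
      (mulInvariantVectorField (I := 𝓡 d) W)
        (f M • mulInvariantVectorField (I := 𝓡 d) (G := G) Z + f M' • mulInvariantVectorField Z') 1 =
      (f (differential d φ W * M) • mulInvariantVectorField (I := 𝓡 d) Z +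
        f M • mulInvariantVectorField (I := 𝓡 d) ⁅W, Z⁆) 1 +
      (f (differential d φ W * M') • mulInvariantVectorField (I := 𝓡 d) Z' +
        f M' • mulInvariantVectorField (I := 𝓡 d) ⁅W, Z'⁆) 1 := by
    intro W Z M Z' M'
    rw [mlieBracket_add_right (hd Z M) (hd Z' M'), hb, hb]
  have key := leibniz_identity_mlieBracket_apply (x := 1) (hs X 1) (hs Y 1) (hfs X 1 1)
  rw [← mulInvariantVector_mlieBracket X Y, ← GroupLieAlgebra.bracket_def, hb, hb, hb, hb2, hb2]
    at key
  have hone : ∀ Z : GroupLieAlgebra (𝓡 d) G,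
      (mulInvariantVectorField (I := 𝓡 d) Z (1 : G) : EuclideanSpace ℝ (Fin d)) = Z := by
    intro Z
    have : (fun x : G => 1 * x) = id := by ext; simp
    change mfderiv (𝓡 d) (𝓡 d) (fun x : G => 1 * x) 1 Z = Z
    rw [this, mfderiv_id]
    rfl
  have hev : ∀ M (Z : GroupLieAlgebra (𝓡 d) G),
      ((f M • mulInvariantVectorField (I := 𝓡 d) (G := G) Z) 1 : EuclideanSpace ℝ (Fin d)) =
        M i j • (Z : EuclideanSpace ℝ (Fin d)) := by
    intro M Z
    have h1 : f M 1 = M i j := by simp [hfdef]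
    change f M 1 • (mulInvariantVectorField (I := 𝓡 d) Z (1 : G) : EuclideanSpace ℝ (Fin d)) = _
    rw [h1, hone]
  set c : Matrix (Fin n) (Fin n) ℝ → ℝ := fun M => M i j with hc
  have key2 : (c (differential d φ X * (differential d φ Y * 1)) • X +
      c (differential d φ Y * 1) • ⁅X, X⁆) + (c (differential d φ X * 1) • ⁅Y, X⁆ +
      c 1 • ⁅X, ⁅Y, X⁆⁆) =
      (c (differential d φ ⁅X, Y⁆ * 1) • X + c 1 • ⁅⁅X, Y⁆, X⁆) +
      ((c (differential d φ Y * (differential d φ X * 1)) • X +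
      c (differential d φ X * 1) • ⁅Y, X⁆) + (c (differential d φ Y * 1) • ⁅X, X⁆ +
      c 1 • ⁅Y, ⁅X, X⁆⁆)) := by
    simp only [Pi.add_apply] at key
    rw [hev, hev, hev, hev, hev, hev, hev, hev] at key
    exact key
  rw [leibniz_lie X Y X] at key2
  simp only [mul_one, lie_self, smul_zero, lie_zero, add_zero] at key2
  have key3 : ((c (differential d φ X * differential d φ Y) -
      c (differential d φ Y * differential d φ X)) - c (differential d φ ⁅X, Y⁆)) • X = 0 := by
    rw [sub_smul, sub_smul]
    have h3 := sub_eq_zero.mpr key2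
    rw [← h3]
    abel
  have := (smul_eq_zero.mp key3).resolve_right hX
  rw [Matrix.sub_apply]
  simp only [hc] at this
  linarith

end BracketOfDifferential

section ChartAtOne

attribute [local instance] Matrix.linftyOpNormedRing Matrix.linftyOpNormedAlgebra

variable {d n : ℕ} {G : Type*} [TopologicalSpace G]
  [ChartedSpace (EuclideanSpace ℝ (Fin d)) G] [Group G] [LieGroup (𝓡 d) ∞ G]

/-- The morphism `φ` read in the chart at the identity. -/
def chartMap (φ : G →* GL (Fin n) ℝ) (u : EuclideanSpace ℝ (Fin d)) : Matrix (Fin n) (Fin n) ℝ :=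
  φ ((extChartAt (𝓡 d) (1 : G)).symm u)

/-- The differential of `φ` as a continuous linear map. -/
def differentialCLM (d : ℕ) [ChartedSpace (EuclideanSpace ℝ (Fin d)) G] (φ : G →* GL (Fin n) ℝ) :
    EuclideanSpace ℝ (Fin d) →L[ℝ] Matrix (Fin n) (Fin n) ℝ :=
  LinearMap.toContinuousLinearMap (E := EuclideanSpace ℝ (Fin d)) (differential d φ)

lemma contDiffAt_chartMap_entry {φ : G →* GL (Fin n) ℝ} (hφ : IsSmoothMorphism d φ) (i j : Fin n) :
    ContDiffAt ℝ ∞ (fun u => chartMap (d := d) φ u i j) (extChartAt (𝓡 d) (1 : G) 1) := by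
  have h1 := (contMDiffAt_iff.mp ((hφ i j) 1)).2
  simp only [modelWithCornersSelf_coe, Set.range_id, contDiffWithinAt_univ] at h1
  exact h1

lemma fderiv_chartMap_entry {φ : G →* GL (Fin n) ℝ} (hφ : IsSmoothMorphism d φ) (i j : Fin n)
    (X : GroupLieAlgebra (𝓡 d) G) :
    fderiv ℝ (fun u => chartMap (d := d) φ u i j) (extChartAt (𝓡 d) (1 : G) 1)
      (X : EuclideanSpace ℝ (Fin d)) = differential d φ X i j := by
  have h1 := (hφ.mdifferentiableAt i j 1).mfderiv
  simp only [modelWithCornersSelf_coe, Set.range_id, fderivWithin_univ] at h1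
  rw [differential_apply]
  unfold dirDeriv
  rw [h1]
  rfl

lemma matrix_eq_sum_smul_single (M : Matrix (Fin n) (Fin n) ℝ) :
    M = ∑ i, ∑ j, M i j • Matrix.single i j (1 : ℝ) := by
  conv_lhs => rw [Matrix.matrix_eq_sum_single M]
  simp

lemma contDiffAt_chartMap {φ : G →* GL (Fin n) ℝ} (hφ : IsSmoothMorphism d φ) :
    ContDiffAt ℝ ∞ (chartMap (d := d) φ) (extChartAt (𝓡 d) (1 : G) 1) := by
  have h2 : chartMap (d := d) φ = fun u => ∑ i, ∑ j, chartMap (d := d) φ u i j •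
    Matrix.single i j (1 : ℝ) := funext fun u => matrix_eq_sum_smul_single _
  rw [h2]
  exact ContDiffAt.sum fun i _ => ContDiffAt.sum fun j _ =>
    (contDiffAt_chartMap_entry hφ i j).smul contDiffAt_const

lemma hasStrictFDerivAt_chartMap {φ : G →* GL (Fin n) ℝ} (hφ : IsSmoothMorphism d φ) :
    HasStrictFDerivAt (chartMap (d := d) φ) (differentialCLM d φ)
      (extChartAt (𝓡 d) (1 : G) 1) := by
  have h1 := (contDiffAt_chartMap hφ).hasStrictFDerivAt (by simp)
  convert! h1 using 1
  ext1 X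
  have h3 : ∀ i j, HasFDerivAt (fun u => chartMap (d := d) φ u i j)
      ((LinearMap.toContinuousLinearMap (Matrix.entryLinearMap ℝ ℝ i j)).comp
        (fderiv ℝ (chartMap (d := d) φ) (extChartAt (𝓡 d) (1 : G) 1)))
      (extChartAt (𝓡 d) (1 : G) 1) := fun i j =>
    (LinearMap.toContinuousLinearMap (Matrix.entryLinearMap ℝ ℝ i j)).hasFDerivAt.comp _
      h1.hasFDerivAt
  ext i j
  have h4 := fderiv_chartMap_entry hφ i j X
  rw [(h3 i j).fderiv] at h4
  exact h4.symm

lemma chartMap_one (φ : G →* GL (Fin n) ℝ) :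
    chartMap (d := d) φ (extChartAt (𝓡 d) (1 : G) 1) = 1 := by
  simp [chartMap]

/-- A map with injective strict derivative, between finite dimensional spaces, has a local
left inverse that is a restriction of a local inverse of a linear projection of the map. -/
lemma exists_injOn_of_injective_strictFDeriv {E F : Type*} [NormedAddCommGroup E] [NormedSpace ℝ E]
    [FiniteDimensional ℝ E] [NormedAddCommGroup F] [NormedSpace ℝ F] [FiniteDimensional ℝ F]
    {f : E → F} {f' : E →L[ℝ] F} {x : E} (hf : HasStrictFDerivAt f f' x)
    (hinj : Function.Injective f') : ∃ U ∈ nhds x, Set.InjOn f U := by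
  obtain ⟨g, hg⟩ := LinearMap.exists_leftInverse_of_injective (f' : E →ₗ[ℝ] F)
    (LinearMap.ker_eq_bot.mpr hinj)
  have h1 : HasStrictFDerivAt (fun y => LinearMap.toContinuousLinearMap g (f y))
      ((ContinuousLinearEquiv.refl ℝ E : E ≃L[ℝ] E) : E →L[ℝ] E) x := by
    have h2 := (LinearMap.toContinuousLinearMap g).hasStrictFDerivAt.comp x hf
    convert! h2 using 1
    ext1 v
    exact (LinearMap.congr_fun hg v).symm
  have hE : CompleteSpace E := FiniteDimensional.complete ℝ E
  refine ⟨(h1.toOpenPartialHomeomorph _).source,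
    (h1.toOpenPartialHomeomorph _).open_source.mem_nhds h1.mem_toOpenPartialHomeomorph_source, ?_⟩
  intro a ha b hb hab
  refine (h1.toOpenPartialHomeomorph _).injOn ha hb ?_
  rw [h1.toOpenPartialHomeomorph_coe]
  simp only [hab]

lemma locally_injective_exp_mul {φ : G →* GL (Fin n) ℝ} (hφ : IsSmoothMorphism d φ)
    (hinj : Function.Injective (differential d φ)) {Y : Matrix (Fin n) (Fin n) ℝ}
    (hY : Y ∉ LinearMap.range (differential d φ)) :
    ∃ δ > 0, ∃ V ∈ nhds (1 : G), ∀ s s' : ℝ, |s| < δ → |s'| < δ → ∀ x ∈ V, ∀ x' ∈ V,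
      NormedSpace.exp (s • Y) * (φ x : Matrix (Fin n) (Fin n) ℝ) =
        NormedSpace.exp (s' • Y) * (φ x' : Matrix (Fin n) (Fin n) ℝ) → s = s' := by
  set u0 := extChartAt (𝓡 d) (1 : G) 1 with hu0
  have h2 := (hasStrictDerivAt_exp_smul_const' (𝕂 := ℝ) Y 0).hasStrictFDerivAt
  have h3 := h2.comp ((0 : ℝ), u0) (hasStrictFDerivAt_fst (𝕜 := ℝ))
  have h4 := (hasStrictFDerivAt_chartMap hφ).comp ((0 : ℝ), u0) (hasStrictFDerivAt_snd (𝕜 := ℝ))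
  have h5 : HasStrictFDerivAt (fun p : ℝ × EuclideanSpace ℝ (Fin d) =>
      NormedSpace.exp (p.1 • Y) * chartMap (d := d) φ p.2) _ ((0 : ℝ), u0) := h3.mul' h4
  obtain ⟨U, hU, hUinj⟩ := exists_injOn_of_injective_strictFDeriv h5 (by
    refine (injective_iff_map_eq_zero _).2 ?_
    rintro ⟨s, v⟩ hsv
    have h6 : s • Y + differential d φ v = 0 := by
      have h7 : NormedSpace.exp ((0 : ℝ) • Y) * differential d φ v +
        (s • (Y * NormedSpace.exp ((0 : ℝ) • Y))) * chartMap (d := d) φ u0 = 0 := hsv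
      rwa [hu0, chartMap_one, zero_smul, NormedSpace.exp_zero, one_mul, mul_one, mul_one,
        add_comm] at h7
    have hs : s = 0 := by
      by_contra hs
      have h7 : differential d φ v = -(s • Y) := by
        rw [eq_neg_iff_add_eq_zero, add_comm]; exact h6
      refine hY ⟨(-s⁻¹) • (v : GroupLieAlgebra (𝓡 d) G), (map_smul (differential d φ) _ _).trans ?_⟩
      refine (congrArg (fun M => (-s⁻¹) • M) h7).trans ?_
      rw [smul_neg, neg_smul, neg_neg, smul_smul, inv_mul_cancel₀ hs, one_smul]
    rw [hs, zero_smul, zero_add] at h6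
    have hv : v = 0 := hinj (h6.trans (map_zero _).symm)
    rw [hs, hv]; rfl)
  rw [nhds_prod_eq, Filter.mem_prod_iff] at hU
  obtain ⟨I, hI, W, hW, hIW⟩ := hU
  obtain ⟨δ, hδ, hball⟩ := Metric.mem_nhds_iff.mp hI
  refine ⟨δ, hδ, (extChartAt (𝓡 d) (1 : G)).source ∩ extChartAt (𝓡 d) (1 : G) ⁻¹' W,
    Filter.inter_mem (extChartAt_source_mem_nhds 1)
      ((continuousAt_extChartAt (1 : G)).preimage_mem_nhds hW), ?_⟩
  intro s s' hs hs' x hx x' hx' heq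
  have h9 : ∀ y ∈ (extChartAt (𝓡 d) (1 : G)).source,
      chartMap (d := d) φ (extChartAt (𝓡 d) (1 : G) y) = φ y := by
    intro y hy
    rw [chartMap, (extChartAt (𝓡 d) (1 : G)).left_inv hy]
  have h11 : (s, extChartAt (𝓡 d) (1 : G) x) ∈ U := hIW ⟨hball (by simpa using hs), hx.2⟩
  have h12 : (s', extChartAt (𝓡 d) (1 : G) x') ∈ U := hIW ⟨hball (by simpa using hs'), hx'.2⟩
  have h10 := hUinj h11 h12 (by
    simp only
    rw [h9 x hx.1, h9 x' hx'.1]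
    exact heq)
  exact congrArg Prod.fst h10

/-- A one-parameter group of matrices that lies, near the identity, in the image of `φ` has its
velocity in the image of the differential of `φ`. -/
lemma mem_range_differential [SecondCountableTopology G] {φ : G →* GL (Fin n) ℝ}
    (hφ : IsSmoothMorphism d φ)
    (hinj : Function.Injective (differential d φ)) {Y : Matrix (Fin n) (Fin n) ℝ}
    (hY : ∀ᶠ t : ℝ in nhds 0, ∃ g, (φ g : Matrix (Fin n) (Fin n) ℝ) = NormedSpace.exp (t • Y)) :
    Y ∈ LinearMap.range (differential d φ) := by
  have : IsTopologicalGroup G := topologicalGroup_of_lieGroup (𝓡 d) ∞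
  by_contra hYr
  obtain ⟨δ, hδ, V, hV, hloc⟩ := locally_injective_exp_mul hφ hinj hYr
  obtain ⟨ε, hε, hball⟩ := Metric.eventually_nhds_iff.mp hY
  obtain ⟨V1, hV1, hVV⟩ : ∃ V1 ∈ nhds (1 : G), ∀ v ∈ V1, ∀ w ∈ V1, v / w ∈ V :=
    exists_nhds_split_inv hV
  obtain ⟨S, hS, hcov⟩ := TopologicalSpace.countable_cover_nhds
    (f := fun x : G => (fun y => y * x⁻¹) ⁻¹' V1) (fun x => by
      refine (continuous_mul_const x⁻¹).continuousAt.preimage_mem_nhds ?_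
      simpa using hV1)
  set η := min δ ε with hη
  have hη0 : 0 < η := lt_min hδ hε
  have hg : ∀ t : Set.Ioo (0 : ℝ) η, ∃ g, (φ g : Matrix (Fin n) (Fin n) ℝ) =
      NormedSpace.exp ((t : ℝ) • Y) := by
    intro t
    refine hball ?_
    rw [Real.dist_eq, sub_zero, abs_of_pos t.2.1]
    exact t.2.2.trans_le (min_le_right _ _)
  choose g hg using hg
  have hx : ∀ t : Set.Ioo (0 : ℝ) η, ∃ x : S, g t * (x : G)⁻¹ ∈ V1 := by
    intro t
    have : g t ∈ ⋃ x ∈ S, (fun y => y * x⁻¹) ⁻¹' V1 := by rw [hcov]; trivial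
    simp only [Set.mem_iUnion] at this
    obtain ⟨x, hx, h⟩ := this
    exact ⟨⟨x, hx⟩, h⟩
  choose x hx using hx
  have hnc : ¬ Function.Injective x := by
    intro hxi
    have : Countable S := hS.to_subtype
    have h1 : Countable (Set.Ioo (0 : ℝ) η) := hxi.countable
    have h2 : (Set.Ioo (0 : ℝ) η).Countable := h1
    exact absurd h2 (Cardinal.Real.Ioo_countable_iff.not.mpr (by simpa using hη0))
  simp only [Function.Injective, not_forall] at hnc
  obtain ⟨t, t', htt, hne⟩ := hnc
  apply hne
  have hv := hVV _ (hx t) _ (hx t')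
  rw [htt] at hv
  have h1 : g t * (x t' : G)⁻¹ / (g t' * (x t' : G)⁻¹) = g t * (g t')⁻¹ := by
    rw [div_eq_mul_inv]; group
  rw [h1] at hv
  have h2 : NormedSpace.exp ((0 : ℝ) • Y) * (φ (g t * (g t')⁻¹) : Matrix (Fin n) (Fin n) ℝ) =
      NormedSpace.exp (((t : ℝ) - t') • Y) * (φ 1 : Matrix (Fin n) (Fin n) ℝ) := by
    have h3 : (φ (g t) : Matrix (Fin n) (Fin n) ℝ) =
        NormedSpace.exp (((t : ℝ) - t') • Y) * (φ (g t') : Matrix (Fin n) (Fin n) ℝ) := by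
      rw [hg, hg, ← Matrix.exp_add_of_commute, ← add_smul, sub_add_cancel]
      exact ((Commute.refl Y).smul_left _).smul_right _
    rw [zero_smul, NormedSpace.exp_zero, one_mul, map_mul, map_inv, Units.val_mul, h3, mul_assoc,
      Units.mul_inv, map_one, Units.val_one]
  have h4 := hloc 0 (t - t') (by simpa using hδ) (by
    have := t.2; have := t'.2; simp only [Set.mem_Ioo] at *
    rw [abs_lt]
    have := min_le_left δ ε
    constructor <;> linarith) _ hv _ (mem_of_mem_nhds hV) h2
  exact Subtype.ext (by linarith)

end ChartAtOne

section OneParameter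

attribute [local instance] Matrix.linftyOpNormedRing Matrix.linftyOpNormedAlgebra

variable {d n : ℕ} {G : Type*} [TopologicalSpace G]
  [ChartedSpace (EuclideanSpace ℝ (Fin d)) G] [Group G] [LieGroup (𝓡 d) ∞ G]

/-- The exponential of a matrix as an invertible matrix. -/
def expUnit (A : Matrix (Fin n) (Fin n) ℝ) : GL (Fin n) ℝ where
  val := NormedSpace.exp A
  inv := NormedSpace.exp (-A)
  val_inv := by
    rw [← Matrix.exp_add_of_commute _ _ (Commute.refl A).neg_right, add_neg_cancel,
      NormedSpace.exp_zero]
  inv_val := by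
    rw [← Matrix.exp_add_of_commute _ _ (Commute.refl A).neg_left, neg_add_cancel,
      NormedSpace.exp_zero]

lemma continuous_expUnit (Y : Matrix (Fin n) (Fin n) ℝ) :
    Continuous (fun t : ℝ => expUnit (t • Y)) := by
  refine Units.continuous_iff.mpr ⟨continuous_exp_smul Y, ?_⟩
  have h := continuous_exp_smul (-Y)
  simp only [smul_neg] at h
  exact h

lemma eq_expUnit {g : GL (Fin n) ℝ} {A : Matrix (Fin n) (Fin n) ℝ}
    (h : (g : Matrix (Fin n) (Fin n) ℝ) = NormedSpace.exp A) : g = expUnit A := Units.ext h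

lemma mulInvariantVectorField_one' (X : GroupLieAlgebra (𝓡 d) G) {y : G} (hy : y = 1) :
    (mulInvariantVectorField (I := 𝓡 d) X y : EuclideanSpace ℝ (Fin d)) = X := by
  subst hy
  have : (fun x : G => 1 * x) = id := by ext; simp
  change mfderiv (𝓡 d) (𝓡 d) (fun x : G => 1 * x) 1 X = X
  rw [this, mfderiv_id]
  rfl

variable [T2Space G]

/-- An invariant form is infinitesimally invariant. -/
lemma lie_invariant_of_Ad_invariant {φ : G →* GL (Fin n) ℝ} (hφ : IsSmoothMorphism d φ)
    (hinj : Function.Injective (differential d φ))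
    {B : LinearMap.BilinForm ℝ (GroupLieAlgebra (𝓡 d) G)}
    (hB : ∀ (g : G) (X Y : GroupLieAlgebra (𝓡 d) G), B (Ad d g X) (Ad d g Y) = B X Y)
    (Z X Y : GroupLieAlgebra (𝓡 d) G) : B ⁅Z, X⁆ Y + B X ⁅Z, Y⁆ = 0 := by
  obtain ⟨γ, -, hadd, -, h0, hexp⟩ := exists_oneParameter hφ Z
  obtain ⟨π, hπ⟩ := LinearMap.exists_leftInverse_of_injective (differential d φ)
    (LinearMap.ker_eq_bot.mpr hinj)
  have hπ' : ∀ X, π (differential d φ X) = X := fun X => LinearMap.congr_fun hπ X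
  have hr : ∀ t X, differential d φ (Ad d (γ t) X) = NormedSpace.exp (t • differential d φ Z) *
      differential d φ X * NormedSpace.exp (-(t • differential d φ Z)) := by
    intro t X
    rw [differential_Ad hφ, eq_expUnit (hexp t)]
    rfl
  have hinv : ∀ t X, Ad d (γ t) (Ad d (γ (-t)) X) = X := by
    intro t X
    apply hinj
    have h1 : γ t * γ (-t) = 1 := by rw [← hadd, add_neg_cancel, h0]
    rw [differential_Ad hφ, differential_Ad hφ, ← mul_assoc, ← mul_assoc, ← Units.val_mul,
      ← map_mul, h1, mul_assoc, ← Units.val_mul, ← mul_inv_rev, ← map_mul, h1]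
    simp
  have h1 : ∀ t, B (Ad d (γ t) X) Y = B X (Ad d (γ (-t)) Y) := by
    intro t
    conv_lhs => rw [← hinv t Y]
    exact hB _ _ _
  have h2 := hasDerivAt_entry (hasDerivAt_conj_exp (differential d φ Z) (differential d φ X))
    (B.flip Y ∘ₗ π)
  have h3 := hasDerivAt_entry (hasDerivAt_conj_exp (-differential d φ Z) (differential d φ Y))
    (B X ∘ₗ π)
  have h4 : (fun t : ℝ => (B.flip Y ∘ₗ π) (NormedSpace.exp (t • differential d φ Z) *
      differential d φ X * NormedSpace.exp (-(t • differential d φ Z)))) =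
      fun t : ℝ => (B X ∘ₗ π) (NormedSpace.exp (t • (-differential d φ Z)) *
      differential d φ Y * NormedSpace.exp (-(t • (-differential d φ Z)))) := by
    funext t
    have h5 : t • (-differential d φ Z) = (-t) • differential d φ Z := by rw [smul_neg, neg_smul]
    rw [h5, ← hr, ← hr]
    simp only [LinearMap.comp_apply, hπ']
    exact h1 t
  rw [h4] at h2
  have h6 := h2.unique h3
  have h7 : -differential d φ Z * differential d φ Y - differential d φ Y * -differential d φ Z =
      -differential d φ ⁅Z, Y⁆ := by
    rw [differential_lie hφ]; noncomm_ring
  rw [h7, ← differential_lie hφ, ← map_neg] at h6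
  simp only [LinearMap.comp_apply, hπ'] at h6
  have h8 : B ⁅Z, X⁆ Y = B X (-⁅Z, Y⁆) := h6
  rw [h8, map_neg, neg_add_cancel]

lemma exists_isExp {φ : G →* GL (Fin n) ℝ} (hφ : IsSmoothMorphism d φ)
    (hinj : Function.Injective (differential d φ)) (X : GroupLieAlgebra (𝓡 d) G) :
    ∃ x : G, IsExp X x ∧
      (φ x : Matrix (Fin n) (Fin n) ℝ) = NormedSpace.exp (differential d φ X) := by
  obtain ⟨γ, hcont, hadd, hγ, h0, hexp⟩ := exists_oneParameter hφ X
  refine ⟨γ 1, ⟨γ, ?_, hadd, ?_, rfl⟩, by rw [hexp, one_smul]⟩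
  · set u0 := extChartAt (𝓡 d) (1 : G) 1 with hu0
    obtain ⟨g, hg⟩ := LinearMap.exists_leftInverse_of_injective (differential d φ)
      (LinearMap.ker_eq_bot.mpr hinj)
    set gc : Matrix (Fin n) (Fin n) ℝ →L[ℝ] EuclideanSpace ℝ (Fin d) :=
      LinearMap.toContinuousLinearMap (F' := EuclideanSpace ℝ (Fin d)) g with hgc
    have hd : HasFDerivAt (fun u => gc (chartMap (d := d) φ u))
        ((ContinuousLinearEquiv.refl ℝ (EuclideanSpace ℝ (Fin d)) :
          EuclideanSpace ℝ (Fin d) ≃L[ℝ] EuclideanSpace ℝ (Fin d)) :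
          EuclideanSpace ℝ (Fin d) →L[ℝ] EuclideanSpace ℝ (Fin d)) u0 := by
      have h2 := gc.hasFDerivAt.comp u0 (hasStrictFDerivAt_chartMap hφ).hasFDerivAt
      have h3 : gc.comp (differentialCLM d φ) =
          ((ContinuousLinearEquiv.refl ℝ (EuclideanSpace ℝ (Fin d)) :
          EuclideanSpace ℝ (Fin d) ≃L[ℝ] EuclideanSpace ℝ (Fin d)) :
          EuclideanSpace ℝ (Fin d) →L[ℝ] EuclideanSpace ℝ (Fin d)) :=
        ContinuousLinearMap.ext fun v => LinearMap.congr_fun hg v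
      convert! h2 using 1
      exact h3.symm
    have hcd : ContDiffAt ℝ ∞ (fun u => gc (chartMap (d := d) φ u)) u0 :=
      gc.contDiff.contDiffAt.comp u0 (contDiffAt_chartMap hφ)
    set e := hcd.toOpenPartialHomeomorph _ hd (by simp) with he
    have hmem : u0 ∈ e.source := hcd.mem_toOpenPartialHomeomorph_source hd (by simp)
    have hloc : ContDiffAt ℝ ∞ e.symm (e u0) := hcd.to_localInverse hd (by simp)
    have hψ : ContinuousAt (fun t => extChartAt (𝓡 d) (1 : G) (γ t)) 0 := by
      have h3 : ContinuousAt (extChartAt (𝓡 d) (1 : G)) (γ 0) := by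
        rw [h0]; exact continuousAt_extChartAt (1 : G)
      exact h3.comp hcont.continuousAt
    have hev1 : ∀ᶠ t in nhds (0 : ℝ), γ t ∈ (extChartAt (𝓡 d) (1 : G)).source :=
      hcont.continuousAt.preimage_mem_nhds (by rw [h0]; exact extChartAt_source_mem_nhds 1)
    have hev2 : ∀ᶠ t in nhds (0 : ℝ), extChartAt (𝓡 d) (1 : G) (γ t) ∈ e.source :=
      hψ.preimage_mem_nhds (by rw [h0]; exact e.open_source.mem_nhds hmem)
    have hev : (fun t => extChartAt (𝓡 d) (1 : G) (γ t)) =ᶠ[nhds 0]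
        fun t => e.symm (gc (NormedSpace.exp (t • differential d φ X))) := by
      filter_upwards [hev1, hev2] with t ht1 ht2
      have h5 : e (extChartAt (𝓡 d) (1 : G) (γ t)) =
          gc (NormedSpace.exp (t • differential d φ X)) := by
        change gc (chartMap (d := d) φ (extChartAt (𝓡 d) (1 : G) (γ t))) = _
        rw [chartMap, (extChartAt (𝓡 d) (1 : G)).left_inv ht1, hexp]
      rw [← h5, e.left_inv ht2]
    have hsm : ContDiffAt ℝ ∞ (fun t => extChartAt (𝓡 d) (1 : G) (γ t)) 0 := by
      refine ContDiffAt.congr_of_eventuallyEq ?_ hev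
      have h6 : ContDiffAt ℝ ∞ (fun t : ℝ => gc (NormedSpace.exp (t • differential d φ X))) 0 :=
        (gc.contDiff.comp (contDiff_exp_smul _)).contDiffAt
      refine ContDiffAt.comp (0 : ℝ) ?_ h6
      have h7 : gc (NormedSpace.exp ((0 : ℝ) • differential d φ X)) = e u0 := by
        change _ = gc (chartMap (d := d) φ u0)
        rw [hu0, chartMap_one, zero_smul, NormedSpace.exp_zero]
      rw [h7]
      exact hloc
    have hsm0 : ContMDiffAt 𝓘(ℝ, ℝ) (𝓡 d) ∞ γ 0 := by
      rw [contMDiffAt_iff_target_of_mem_source (y := (1 : G)) (by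
        rw [h0]; exact mem_chart_source _ _)]
      exact ⟨hcont.continuousAt, hsm.contMDiffAt⟩
    intro t
    have h8 : γ = (fun x => γ t * x) ∘ γ ∘ fun s => s - t := by
      funext s
      simp only [Function.comp_apply]
      rw [← hadd]; congr 1; ring
    rw [h8]
    refine (contMDiff_mul_left (n := ∞) (I := 𝓡 d) (a := γ t)).contMDiffAt.comp t ?_
    refine ContMDiffAt.comp t ?_ ((contDiff_id.sub contDiff_const).contMDiff.contMDiffAt)
    simpa using hsm0
  · have h1 := (hγ 0).mfderiv
    have h2 := DFunLike.congr_fun h1 (1 : ℝ)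
    refine Eq.trans h2 ?_
    change (1 : ℝ) • (mulInvariantVectorField (I := 𝓡 d) X (γ 0) : EuclideanSpace ℝ (Fin d)) = X
    rw [one_smul]
    exact mulInvariantVectorField_one' X h0

/-- The Lie algebra of an open subgroup of the group of real points of an algebraic group consists
of the matrices whose one-parameter group satisfies the equations of the algebraic group. -/
lemma exists_polynomials [SecondCountableTopology G] {𝔾 : Subgroup (GL (Fin n) ℂ)}
    {φ : G →* GL (Fin n) ℝ} (hG : IsReductiveRealGroup d 𝔾 φ) :
    ∃ S : Set (MvPolynomial (Fin n × Fin n) ℝ), ∀ Y : Matrix (Fin n) (Fin n) ℝ,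
      Y ∈ LinearMap.range (differential d φ) ↔ ∀ t : ℝ, ∀ p ∈ S,
        MvPolynomial.aeval (fun ij : Fin n × Fin n =>
          ((NormedSpace.exp (t • Y) : Matrix (Fin n) (Fin n) ℝ) ij.1 ij.2 : ℂ)) p = 0 := by
  have := hG.finite_ker
  have hinj := differential_injective hG.smooth hG.finite_ker
  obtain ⟨S, hS⟩ := hG.definedOverReal
  have hreal : ∀ A, expUnit A ∈ realPoints 𝔾 ↔ ∀ p ∈ S,
        MvPolynomial.aeval (fun ij : Fin n × Fin n =>
          ((NormedSpace.exp A : Matrix (Fin n) (Fin n) ℝ) ij.1 ij.2 : ℂ)) p = 0 := by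
    intro A
    rw [realPoints, Subgroup.mem_comap, hS]
    rfl
  refine ⟨S, fun Y => ⟨?_, fun h => ?_⟩⟩
  · rintro ⟨X, rfl⟩ t
    obtain ⟨γ, -, -, -, -, hexp⟩ := exists_oneParameter hG.smooth X
    rw [← hreal, ← eq_expUnit (hexp t)]
    exact hG.mem_realPoints _
  · refine mem_range_differential hG.smooth hinj ?_
    obtain ⟨U, hU, hrange⟩ := hG.open_range
    have h1 : expUnit ((0 : ℝ) • Y) ∈ U := by
      have h2 : expUnit ((0 : ℝ) • Y) = 1 := by
        ext1; simp [expUnit]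
      have h3 : (1 : GL (Fin n) ℝ) ∈ Set.range φ := ⟨1, map_one φ⟩
      rw [hrange] at h3
      rw [h2]; exact h3.1
    filter_upwards [(continuous_expUnit Y).continuousAt.preimage_mem_nhds (hU.mem_nhds h1)]
      with t ht
    have h4 : expUnit (t • Y) ∈ Set.range φ := by
      rw [hrange]
      exact ⟨ht, (hreal _).mpr (h t)⟩
    obtain ⟨g, hg⟩ := h4
    exact ⟨g, by rw [hg]; rfl⟩

end OneParameter

section Independence

open Polynomial

lemma hasDerivAt_eval_mul_exp (q : ℂ[X]) (μ : ℂ) (t : ℝ) :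
    HasDerivAt (fun t : ℝ => q.eval (t : ℂ) * Complex.exp (μ * t))
      ((derivative q + C μ * q).eval (t : ℂ) * Complex.exp (μ * t)) t := by
  have h := ((q.hasDerivAt (t : ℂ)).mul
    (((hasDerivAt_id (t : ℂ)).const_mul μ).cexp)).comp_ofReal
  convert! h using 1
  simp only [eval_add, eval_mul, eval_C, id]
  ring

lemma eq_zero_of_derivative_add_C_mul {c : ℂ} (hc : c ≠ 0) {q : ℂ[X]}
    (h : derivative q + C c * q = 0) : q = 0 := by
  by_contra hq
  have h1 := degree_derivative_lt hq
  have h2 : derivative q = -(C c * q) := eq_neg_of_add_eq_zero_left h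
  rw [h2, degree_neg, degree_C_mul hc] at h1
  exact lt_irrefl _ h1

lemma derivative_iterate_add_C_mul {c : ℂ} (hc : c ≠ 0) {q : ℂ[X]} {j : ℕ}
    (h : (fun q => derivative q + C c * q)^[j] q = 0) : q = 0 := by
  induction j generalizing q with
  | zero => simpa using h
  | succ j ih =>
    rw [Function.iterate_succ_apply] at h
    exact eq_zero_of_derivative_add_C_mul hc (ih h)

lemma sum_derivative_eq_zero {s : Finset ℂ} {q : ℂ → ℂ[X]} (c : ℂ)
    (h : ∀ t : ℝ, ∑ μ ∈ s, (q μ).eval (t : ℂ) * Complex.exp (μ * t) = 0) (t : ℝ) :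
    ∑ μ ∈ s, (derivative (q μ) + C (μ - c) * q μ).eval (t : ℂ) * Complex.exp (μ * t) = 0 := by
  have h1 : HasDerivAt (fun t : ℝ => ∑ μ ∈ s, (q μ).eval (t : ℂ) * Complex.exp (μ * t))
      (∑ μ ∈ s, (derivative (q μ) + C μ * q μ).eval (t : ℂ) * Complex.exp (μ * t)) t :=
    HasDerivAt.fun_sum fun μ _ => hasDerivAt_eval_mul_exp (q μ) μ t
  simp only [h] at h1
  have h2 := h1.unique (hasDerivAt_const t (0 : ℂ))
  have h3 := congrArg (c * ·) (h t)
  simp only [mul_zero, Finset.mul_sum] at h3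
  calc _ = ∑ μ ∈ s, (derivative (q μ) + C μ * q μ).eval (t : ℂ) * Complex.exp (μ * t) -
        ∑ μ ∈ s, c * ((q μ).eval (t : ℂ) * Complex.exp (μ * t)) := by
        rw [← Finset.sum_sub_distrib]
        refine Finset.sum_congr rfl fun μ _ => ?_
        simp only [eval_add, eval_mul, eval_C, map_sub, eval_sub]
        ring
    _ = 0 := by rw [h2, h3, sub_zero]

/-- The functions `t ↦ t ^ k * exp (μ * t)` are linearly independent. -/
lemma polynomial_eq_zero_of_sum_mul_exp (s : Finset ℂ) (q : ℂ → ℂ[X])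
    (h : ∀ t : ℝ, ∑ μ ∈ s, (q μ).eval (t : ℂ) * Complex.exp (μ * t) = 0) :
    ∀ μ ∈ s, q μ = 0 := by
  induction s using Finset.induction_on generalizing q with
  | empty => simp
  | insert a s ha ih =>
    have h1 : ∀ j : ℕ, ∀ t : ℝ, ∑ μ ∈ insert a s,
        ((fun q => derivative q + C (μ - a) * q)^[j] (q μ)).eval (t : ℂ) *
          Complex.exp (μ * t) = 0 := by
      intro j
      induction j with
      | zero => simpa using h
      | succ j ihj =>
        intro t
        simp only [Function.iterate_succ_apply']
        exact sum_derivative_eq_zero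
          (q := fun μ => (fun q => derivative q + C (μ - a) * q)^[j] (q μ)) a ihj t
    have h2 : ∀ μ ∈ s, q μ = 0 := by
      have h3 : (fun q => derivative q + C (a - a) * q)^[(q a).natDegree + 1] (q a) = 0 := by
        simp only [sub_self, map_zero, zero_mul, add_zero]
        exact iterate_derivative_eq_zero (Nat.lt_succ_self _)
      have h4 := ih (fun μ => (fun q => derivative q + C (μ - a) * q)^[(q a).natDegree + 1] (q μ))
        (fun t => by
          have := h1 ((q a).natDegree + 1) t
          rw [Finset.sum_insert ha, h3] at this
          simpa using this)
      intro μ hμ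
      refine derivative_iterate_add_C_mul (sub_ne_zero.mpr ?_) (h4 μ hμ)
      rintro rfl; exact ha hμ
    have h5 : q a = 0 := by
      have h6 : ∀ t : ℝ, (q a).eval (t : ℂ) = 0 := by
        intro t
        have h7 := h t
        rw [Finset.sum_insert ha, Finset.sum_eq_zero (fun μ hμ => by rw [h2 μ hμ]; simp),
          add_zero] at h7
        exact (mul_eq_zero.mp h7).resolve_right (Complex.exp_ne_zero _)
      refine Polynomial.eq_zero_of_infinite_isRoot _ (Set.infinite_of_injective_forall_mem
        (f := fun t : ℝ => (t : ℂ)) Complex.ofReal_injective h6)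
    intro μ hμ
    rcases Finset.mem_insert.mp hμ with rfl | hμ
    · exact h5
    · exact h2 μ hμ

/-- The character `(μ, k) ↦ exp (f μ * t) * b ^ k`. -/
def expMonomial (f : ℂ →+ ℂ) (t b : ℂ) : Multiplicative (ℂ × ℕ) →* ℂ where
  toFun x := Complex.exp (f x.toAdd.1 * t) * b ^ x.toAdd.2
  map_one' := by simp
  map_mul' x y := by
    simp only [toAdd_mul, Prod.fst_add, Prod.snd_add, map_add, add_mul, Complex.exp_add, pow_add]
    ring

lemma eq_zero_of_lift_expMonomial (x : AddMonoidAlgebra ℂ (ℂ × ℕ))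
    (h : ∀ t : ℝ, AddMonoidAlgebra.lift ℂ ℂ (ℂ × ℕ) (expMonomial (AddMonoidHom.id ℂ) t t) x = 0) :
    x = 0 := by
  classical
  set q : ℂ → ℂ[X] := fun μ => ∑ p ∈ x.coeff.support,
    if p.1 = μ then monomial p.2 (x.coeff p) else 0 with hq
  have h1 := polynomial_eq_zero_of_sum_mul_exp (x.coeff.support.image Prod.fst) q (by
    intro t
    rw [← h t, AddMonoidAlgebra.lift_apply, Finsupp.sum]
    simp only [hq, eval_finsetSum, Finset.sum_mul]
    rw [Finset.sum_comm]
    refine Finset.sum_congr rfl fun p hp => ?_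
    rw [Finset.sum_eq_single p.1]
    · simp [expMonomial]; ring
    · intro μ _ hμ
      rw [if_neg (Ne.symm hμ)]; simp
    · intro h2
      exact absurd (Finset.mem_image_of_mem _ hp) h2)
  have h2 : ∀ p, x.coeff p = 0 := by
    intro p
    by_contra hp
    have hps : p ∈ x.coeff.support := Finsupp.mem_support_iff.mpr hp
    have h3 := congrArg (fun P => coeff P p.2) (h1 p.1 (Finset.mem_image_of_mem _ hps))
    simp only [hq, finsetSum_coeff, coeff_zero] at h3
    rw [Finset.sum_eq_single p] at h3
    · simp at h3; exact hp h3
    · rintro ⟨a, b⟩ _ hab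
      split_ifs with h4
      · rw [coeff_monomial, if_neg]
        rintro rfl
        exact hab (Prod.ext h4 rfl)
      · simp
    · intro h4; exact absurd hps h4
  ext p
  simpa using h2 p

end Independence

section Replica

attribute [local instance] Matrix.linftyOpNormedRing Matrix.linftyOpNormedAlgebra

variable {n : ℕ}

/-- The complexification of a real matrix. -/
abbrev toC (M : Matrix (Fin n) (Fin n) ℝ) : Matrix (Fin n) (Fin n) ℂ := M.map Complex.ofRealHom

lemma toC_exp (M : Matrix (Fin n) (Fin n) ℝ) :
    toC (NormedSpace.exp M) = NormedSpace.exp (toC M) := by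
  refine NormedSpace.map_exp (Complex.ofRealHom.mapMatrix (m := Fin n)) ?_ M
  exact Continuous.matrix_map continuous_id Complex.continuous_ofReal

lemma hasSum_exp_mulVec (A : Matrix (Fin n) (Fin n) ℂ) (v : Fin n → ℂ) :
    HasSum (fun k : ℕ => ((k.factorial : ℂ)⁻¹) • ((A ^ k).mulVec v))
      ((NormedSpace.exp A).mulVec v) := by
  have h := NormedSpace.exp_series_hasSum_exp' (𝕂 := ℂ) A
  have h2 := h.mapL (LinearMap.toContinuousLinearMap ((Matrix.mulVecBilin ℂ ℂ).flip v))
  simp at h2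
  exact h2

lemma exp_mulVec_of_mulVec_eq_smul {A : Matrix (Fin n) (Fin n) ℂ} {v : Fin n → ℂ} {z : ℂ}
    (h : A.mulVec v = z • v) : (NormedSpace.exp A).mulVec v = Complex.exp z • v := by
  refine (hasSum_exp_mulVec A v).unique ?_
  have h1 : ∀ k : ℕ, (A ^ k).mulVec v = z ^ k • v := by
    intro k
    induction k with
    | zero => simp
    | succ k ih => rw [pow_succ', ← Matrix.mulVec_mulVec, ih, Matrix.mulVec_smul, h, smul_smul,
        pow_succ]
  have h2 := NormedSpace.exp_series_hasSum_exp' (𝕂 := ℂ) z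
  have h3 := h2.smul_const v
  rw [← Complex.exp_eq_exp_ℂ] at h3
  refine h3.congr_fun ?_ |> fun h => h
  intro k
  rw [h1]; simp [smul_smul]

lemma exp_mulVec_of_pow_eq_zero {A : Matrix (Fin n) (Fin n) ℂ} {m : ℕ} (h : A ^ m = 0)
    (v : Fin n → ℂ) : (NormedSpace.exp A).mulVec v =
      ∑ k ∈ Finset.range m, ((k.factorial : ℂ)⁻¹) • ((A ^ k).mulVec v) := by
  refine (hasSum_exp_mulVec A v).unique (hasSum_sum_of_ne_finset_zero ?_)
  intro k hk
  have : A ^ k = 0 := pow_eq_zero_of_le (by simpa using hk) h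
  rw [this]; simp

/-- If the one-parameter group of `S + N` (Jordan decomposition) satisfies a polynomial equation,
so does that of any matrix acting on each eigenspace of `S` by a scalar that depends additively on
the eigenvalue. -/
lemma aeval_exp_replica {S N S' : Matrix (Fin n) (Fin n) ℝ} (hSN : Commute S N)
    (hN : IsNilpotent N)
    (hS : ⨆ z, Module.End.eigenspace (Matrix.toLin' (toC S)) z = ⊤) (f : ℂ →+ ℂ)
    (hS' : ∀ (v : Fin n → ℂ) (z : ℂ), (toC S).mulVec v = z • v → (toC S').mulVec v = f z • v)
    (p : MvPolynomial (Fin n × Fin n) ℝ)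
    (hp : ∀ t : ℝ, MvPolynomial.aeval (fun ij : Fin n × Fin n =>
      ((NormedSpace.exp (t • (S + N)) : Matrix (Fin n) (Fin n) ℝ) ij.1 ij.2 : ℂ)) p = 0) (t : ℝ) :
    MvPolynomial.aeval (fun ij : Fin n × Fin n =>
      ((NormedSpace.exp (t • S') : Matrix (Fin n) (Fin n) ℝ) ij.1 ij.2 : ℂ)) p = 0 := by
  obtain ⟨m, hm⟩ := hN
  have hm' : N ^ (m + 1) = 0 := pow_eq_zero_of_le (Nat.le_succ m) hm
  have h1 : ∀ j : Fin n, ∃ v : ℂ →₀ (Fin n → ℂ),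
      (∀ z, v z ∈ Module.End.eigenspace (Matrix.toLin' (toC S)) z) ∧
        v.sum (fun _ x => x) = Pi.single j 1 := fun j =>
    (Submodule.mem_iSup_iff_exists_finsupp _ _).mp (by rw [hS]; trivial)
  choose v hv hvs using h1
  have hv' : ∀ j z, (toC S).mulVec (v j z) = z • v j z := fun j z => by
    have := hv j z
    rwa [Module.End.mem_eigenspace_iff, Matrix.toLin'_apply] at this
  set E : Fin n × Fin n → AddMonoidAlgebra ℂ (ℂ × ℕ) := fun ij =>
    ∑ z ∈ (v ij.2).support, ∑ k ∈ Finset.range (m + 1), AddMonoidAlgebra.single (z, k)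
      ((k.factorial : ℂ)⁻¹ * ((toC N) ^ k).mulVec (v ij.2 z) ij.1) with hE
  have entry : ∀ (M : Matrix (Fin n) (Fin n) ℝ) (i j : Fin n),
      ((NormedSpace.exp M : Matrix (Fin n) (Fin n) ℝ) i j : ℂ) =
        ∑ z ∈ (v j).support, (NormedSpace.exp (toC M)).mulVec (v j z) i := by
    intro M i j
    have h2 : (NormedSpace.exp (toC M)).mulVec (Pi.single j 1) =
        ∑ z ∈ (v j).support, (NormedSpace.exp (toC M)).mulVec (v j z) := by
      rw [← hvs j, Finsupp.sum, Matrix.mulVec_sum]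
    rw [← Finset.sum_apply, ← h2, ← toC_exp]
    simp
  have toC_smul : ∀ (t : ℝ) (M : Matrix (Fin n) (Fin n) ℝ), toC (t • M) = (t : ℂ) • toC M := by
    intro t M; ext; simp
  have e1 : ∀ (t : ℝ) (ij : Fin n × Fin n),
      AddMonoidAlgebra.lift ℂ ℂ (ℂ × ℕ) (expMonomial (AddMonoidHom.id ℂ) t t) (E ij) =
      ((NormedSpace.exp (t • (S + N)) : Matrix (Fin n) (Fin n) ℝ) ij.1 ij.2 : ℂ) := by
    intro t ij
    rw [entry, hE]
    simp only [map_sum, AddMonoidAlgebra.lift_single]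
    refine Finset.sum_congr rfl fun z _ => ?_
    have h3 : toC (t • (S + N)) = (t : ℂ) • toC N + (t : ℂ) • toC S := by
      rw [toC_smul, ← smul_add]; congr 1; ext; simp [add_comm]
    have h4 : Commute ((t : ℂ) • toC N) ((t : ℂ) • toC S) :=
      ((hSN.symm.map (Complex.ofRealHom.mapMatrix (m := Fin n))).smul_left _).smul_right _
    have h5 : ((t : ℂ) • toC N) ^ (m + 1) = 0 := by
      have : (toC N) ^ (m + 1) = 0 := by
        have := congrArg (Complex.ofRealHom.mapMatrix (m := Fin n)) hm'
        rwa [map_pow, map_zero] at this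
      rw [smul_pow, this, smul_zero]
    rw [h3, Matrix.exp_add_of_commute _ _ h4, ← Matrix.mulVec_mulVec,
      exp_mulVec_of_mulVec_eq_smul (A := (t : ℂ) • toC S) (z := t * z) (by rw [Matrix.smul_mulVec, hv', smul_smul]),
      Matrix.mulVec_smul, exp_mulVec_of_pow_eq_zero h5, Finset.smul_sum, Finset.sum_apply]
    refine Finset.sum_congr rfl fun k _ => ?_
    simp only [expMonomial, MonoidHom.coe_mk, OneHom.coe_mk, toAdd_ofAdd, AddMonoidHom.id_apply,
      smul_pow, Matrix.smul_mulVec, Pi.smul_apply, smul_eq_mul]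
    rw [mul_comm (t : ℂ) z]
    ring
  have e2 : ∀ ij : Fin n × Fin n,
      AddMonoidAlgebra.lift ℂ ℂ (ℂ × ℕ) (expMonomial f t 0) (E ij) =
      ((NormedSpace.exp (t • S') : Matrix (Fin n) (Fin n) ℝ) ij.1 ij.2 : ℂ) := by
    intro ij
    rw [entry, hE]
    simp only [map_sum, AddMonoidAlgebra.lift_single]
    refine Finset.sum_congr rfl fun z _ => ?_
    rw [toC_smul, exp_mulVec_of_mulVec_eq_smul (z := t * f z)
      (by rw [Matrix.smul_mulVec, hS' _ _ (hv' _ _), smul_smul]), Finset.sum_eq_single 0]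
    · simp [expMonomial]; ring_nf
    · intro k _ hk
      simp [expMonomial, hk]
    · simp
  have h6 : MvPolynomial.aeval E p = 0 := by
    refine eq_zero_of_lift_expMonomial _ fun t => ?_
    have h7 := MvPolynomial.comp_aeval_apply E ((AddMonoidAlgebra.lift ℂ ℂ (ℂ × ℕ)
      (expMonomial (AddMonoidHom.id ℂ) t t)).restrictScalars ℝ) p
    simp only [AlgHom.restrictScalars_apply] at h7
    rw [h7]
    simp only [e1]
    exact hp t
  have h8 := MvPolynomial.comp_aeval_apply E ((AddMonoidAlgebra.lift ℂ ℂ (ℂ × ℕ)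
      (expMonomial f t 0)).restrictScalars ℝ) p
  simp only [AlgHom.restrictScalars_apply] at h8
  rw [h6, map_zero] at h8
  simp only [e2] at h8
  exact h8.symm

end Replica

section SemisimpleMatrix

open Polynomial

variable {n : ℕ}

lemma isSemisimple_of_intertwine {K V W : Type*} [Field K] [AddCommGroup V] [Module K V]
    [AddCommGroup W] [Module K W] [FiniteDimensional K W] {f : Module.End K V} {g : Module.End K W}
    (r : V →ₗ[K] W) (hr : Function.Injective r) (h : ∀ x, r (f x) = g (r x))
    (hg : g.IsSemisimple) : f.IsSemisimple := by
  refine Module.End.isSemisimple_of_squarefree_aeval_eq_zero hg.minpoly_squarefree ?_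
  have h1 : ∀ (p : K[X]) x, r (aeval f p x) = aeval g p (r x) := by
    intro p x
    induction p using Polynomial.induction_on' with
    | add p q hp hq => simp [hp, hq]
    | monomial k a =>
      simp only [aeval_monomial, Module.End.mul_apply, Module.algebraMap_end_apply, map_smul]
      congr 1
      induction k generalizing x with
      | zero => simp
      | succ k ih => rw [pow_succ, pow_succ, Module.End.mul_apply, Module.End.mul_apply, ih, h]
  ext x
  apply hr
  rw [h1, minpoly.aeval]
  simp

lemma toLin'_aeval {K : Type*} [Field K] (M : Matrix (Fin n) (Fin n) K) (q : K[X]) :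
    Matrix.toLin' (aeval M q) = aeval (Matrix.toLin' M : Module.End K (Fin n → K)) q := by
  have := aeval_algHom_apply (Matrix.toLinAlgEquiv' (R := K) (n := Fin n)).toAlgHom M q
  exact this.symm

lemma toC_aeval (M : Matrix (Fin n) (Fin n) ℝ) (q : ℝ[X]) :
    toC (aeval M q) = aeval (toC M) (q.map (algebraMap ℝ ℂ)) := by
  rw [aeval_map_algebraMap]
  exact (aeval_algHom_apply (Complex.ofRealAm.mapMatrix (m := Fin n)) M q).symm

lemma IsSemisimpleMatrix.iSup_eigenspace {M : Matrix (Fin n) (Fin n) ℝ}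
    (hM : IsSemisimpleMatrix M) :
    ⨆ z, Module.End.eigenspace (Matrix.toLin' (toC M)) z = ⊤ := by
  have h1 : (minpoly ℝ (Matrix.toLin' M : Module.End ℝ (Fin n → ℝ))).Separable :=
    PerfectField.separable_iff_squarefree.mpr hM.minpoly_squarefree
  have h2 := (h1.map (f := algebraMap ℝ ℂ)).squarefree
  have h3 : Module.End.IsSemisimple (Matrix.toLin' (toC M) : Module.End ℂ (Fin n → ℂ)) := by
    refine Module.End.isSemisimple_of_squarefree_aeval_eq_zero h2 ?_
    rw [← toLin'_aeval, ← toC_aeval]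
    have h4 := minpoly.aeval ℝ (Matrix.toLin' M : Module.End ℝ (Fin n → ℝ))
    rw [← toLin'_aeval] at h4
    have h5 : aeval M (minpoly ℝ (Matrix.toLin' M : Module.End ℝ (Fin n → ℝ))) = 0 := by
      simpa using h4
    rw [h5]
    simp
  exact h3.iSup_eigenspace_eq_top

lemma isComplexEigenvalue_iff {M : Matrix (Fin n) (Fin n) ℝ} {z : ℂ} :
    IsComplexEigenvalue M z ↔ ∃ v ≠ 0, (toC M).mulVec v = z • v := by
  rw [IsComplexEigenvalue, ← Matrix.charpoly_toLin', ← Module.End.hasEigenvalue_iff_isRoot_charpoly]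
  constructor
  · intro h
    obtain ⟨v, hv⟩ := h.exists_hasEigenvector
    exact ⟨v, hv.2, by simpa using hv.apply_eq_smul⟩
  · rintro ⟨v, hv, h⟩
    exact Module.End.hasEigenvalue_of_hasEigenvector
      ⟨Module.End.mem_eigenspace_iff.mpr (by simpa using h), hv⟩

/-- A commuting endomorphism has an eigenvector in each nonzero eigenspace. -/
lemma exists_common_eigenvector {V : Type*} [AddCommGroup V] [Module ℂ V] [FiniteDimensional ℂ V]
    {f g : Module.End ℂ V} (h : Commute f g) {z : ℂ} {v : V} (hv : v ≠ 0) (hf : f v = z • v) :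
    ∃ u ≠ 0, f u = z • u ∧ ∃ w : ℂ, g u = w • u := by
  have hst : ∀ x ∈ f.eigenspace z, g x ∈ f.eigenspace z := by
    intro x hx
    rw [Module.End.mem_eigenspace_iff] at hx ⊢
    rw [← Module.End.mul_apply, h.eq, Module.End.mul_apply, hx, map_smul]
  have : Nontrivial (f.eigenspace z) :=
    ⟨⟨⟨v, Module.End.mem_eigenspace_iff.mpr hf⟩, 0, fun h => hv (congrArg Subtype.val h)⟩⟩
  obtain ⟨w, hw⟩ := Module.End.exists_eigenvalue (g.restrict hst)
  obtain ⟨u, hu⟩ := hw.exists_hasEigenvector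
  refine ⟨u, fun h0 => hu.2 (Subtype.ext h0), Module.End.mem_eigenspace_iff.mp u.2, w, ?_⟩
  exact congrArg Subtype.val hu.apply_eq_smul

lemma exists_common_mulVec {A B : Matrix (Fin n) (Fin n) ℂ} (h : Commute A B) {z : ℂ}
    {v : Fin n → ℂ} (hv : v ≠ 0) (hA : A.mulVec v = z • v) :
    ∃ u ≠ 0, A.mulVec u = z • u ∧ ∃ w : ℂ, B.mulVec u = w • u := by
  have h1 : Commute (Matrix.toLin' A : Module.End ℂ (Fin n → ℂ)) (Matrix.toLin' B) :=
    h.map (Matrix.toLinAlgEquiv' (R := ℂ) (n := Fin n))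
  simpa using exists_common_eigenvector h1 hv (by simpa using hA)

lemma commute_toC {A B : Matrix (Fin n) (Fin n) ℝ} (h : Commute A B) :
    Commute (toC A) (toC B) := h.map (Complex.ofRealHom.mapMatrix (m := Fin n))

lemma toC_add (A B : Matrix (Fin n) (Fin n) ℝ) : toC (A + B) = toC A + toC B :=
  map_add (Complex.ofRealHom.mapMatrix (m := Fin n)) A B

lemma toC_mul (A B : Matrix (Fin n) (Fin n) ℝ) : toC (A * B) = toC A * toC B :=
  map_mul (Complex.ofRealHom.mapMatrix (m := Fin n)) A B

lemma toC_smul (t : ℝ) (A : Matrix (Fin n) (Fin n) ℝ) : toC (t • A) = (t : ℂ) • toC A := by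
  ext; simp

lemma IsSemisimpleMatrix.add {A B : Matrix (Fin n) (Fin n) ℝ} (hA : IsSemisimpleMatrix A)
    (hB : IsSemisimpleMatrix B) (h : Commute A B) : IsSemisimpleMatrix (A + B) := by
  rw [IsSemisimpleMatrix, map_add]
  exact hA.add_of_commute (h.map (Matrix.toLinAlgEquiv' (R := ℝ) (n := Fin n))) hB

lemma IsSemisimpleMatrix.mul {A B : Matrix (Fin n) (Fin n) ℝ} (hA : IsSemisimpleMatrix A)
    (hB : IsSemisimpleMatrix B) (h : Commute A B) : IsSemisimpleMatrix (A * B) := by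
  have := hA.mul_of_commute (h.map (Matrix.toLinAlgEquiv' (R := ℝ) (n := Fin n))) hB
  have h2 := Matrix.toLin'_mul A B
  rw [IsSemisimpleMatrix, h2]
  exact this

lemma IsSemisimpleMatrix.aeval {A : Matrix (Fin n) (Fin n) ℝ} (hA : IsSemisimpleMatrix A)
    (q : ℝ[X]) : IsSemisimpleMatrix (aeval A q) := by
  rw [IsSemisimpleMatrix, toLin'_aeval]
  exact Module.End.IsSemisimple.of_mem_adjoin_singleton hA (aeval_mem_adjoin_singleton ℝ _)

lemma IsSemisimpleMatrix.smul {A : Matrix (Fin n) (Fin n) ℝ} (hA : IsSemisimpleMatrix A)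
    (t : ℝ) : IsSemisimpleMatrix (t • A) := by
  have := hA.aeval (C t * X)
  simpa [Algebra.smul_def] using this

lemma eigenvalue_add {A B : Matrix (Fin n) (Fin n) ℝ} (h : Commute A B) {z : ℂ}
    (hz : IsComplexEigenvalue (A + B) z) :
    ∃ a b, IsComplexEigenvalue A a ∧ IsComplexEigenvalue B b ∧ z = a + b := by
  obtain ⟨v, hv, h1⟩ := isComplexEigenvalue_iff.mp hz
  have hc : Commute (toC (A + B)) (toC A) :=
    commute_toC ((Commute.refl A).add_left h.symm)
  obtain ⟨u, hu, h2, a, h3⟩ := exists_common_mulVec hc hv h1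
  refine ⟨a, z - a, isComplexEigenvalue_iff.mpr ⟨u, hu, h3⟩,
    isComplexEigenvalue_iff.mpr ⟨u, hu, ?_⟩, by ring⟩
  rw [toC_add, Matrix.add_mulVec, h3] at h2
  rw [sub_smul, ← h2, add_sub_cancel_left]

lemma eigenvalue_mul {A B : Matrix (Fin n) (Fin n) ℝ} (h : Commute A B) {z : ℂ}
    (hz : IsComplexEigenvalue (A * B) z) :
    ∃ a b, IsComplexEigenvalue A a ∧ IsComplexEigenvalue B b ∧ z = a * b := by
  obtain ⟨v, hv, h1⟩ := isComplexEigenvalue_iff.mp hz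
  have hc : Commute (toC (A * B)) (toC B) := commute_toC (h.mul_left (Commute.refl B))
  have hc2 : Commute (toC B) (toC A) := commute_toC h.symm
  obtain ⟨u, hu, h2, b, h3⟩ := exists_common_mulVec hc hv h1
  by_cases hb : b = 0
  · obtain ⟨x, hx, h4, a, h5⟩ := exists_common_mulVec hc2 hu h3
    refine ⟨a, b, isComplexEigenvalue_iff.mpr ⟨x, hx, h5⟩,
      isComplexEigenvalue_iff.mpr ⟨u, hu, h3⟩, ?_⟩
    rw [toC_mul, ← Matrix.mulVec_mulVec, h3, hb, zero_smul, Matrix.mulVec_zero] at h2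
    rw [hb, mul_zero]
    exact (smul_eq_zero.mp h2.symm).resolve_right hu
  · refine ⟨z / b, b, isComplexEigenvalue_iff.mpr ⟨u, hu, ?_⟩,
      isComplexEigenvalue_iff.mpr ⟨u, hu, h3⟩, by field_simp⟩
    rw [toC_mul, ← Matrix.mulVec_mulVec, h3, Matrix.mulVec_smul] at h2
    rw [div_eq_inv_mul, mul_smul, ← h2, smul_smul, inv_mul_cancel₀ hb, one_smul]

lemma aeval_mulVec_of_eigenvector {M : Matrix (Fin n) (Fin n) ℝ} (q : ℝ[X]) {v : Fin n → ℂ}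
    {z : ℂ} (h : (toC M).mulVec v = z • v) :
    (toC (aeval M q)).mulVec v = (aeval z q) • v := by
  by_cases hv : v = 0
  · simp [hv]
  have h1 : Module.End.HasEigenvector (Matrix.toLin' (toC M)) z v :=
    ⟨Module.End.mem_eigenspace_iff.mpr (by simpa using h), hv⟩
  have h2 := Module.End.aeval_apply_of_hasEigenvector (p := q.map (algebraMap ℝ ℂ)) h1
  rw [← toLin'_aeval, ← toC_aeval, Matrix.toLin'_apply, eval_map_algebraMap] at h2
  exact h2

lemma eigenvalue_aeval {M : Matrix (Fin n) (Fin n) ℝ} {q : ℝ[X]} {w : ℂ}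
    (h : IsComplexEigenvalue (aeval M q) w) : ∃ z, IsComplexEigenvalue M z ∧ w = aeval z q := by
  obtain ⟨v, hv, h1⟩ := isComplexEigenvalue_iff.mp h
  have hc : Commute (toC (aeval M q)) (toC M) := commute_toC (by
    have : Commute (aeval M q) (aeval M (X : ℝ[X])) := (Commute.all q X).map (aeval M)
    simpa using this)
  obtain ⟨u, hu, h2, z, h3⟩ := exists_common_mulVec hc hv h1
  refine ⟨z, isComplexEigenvalue_iff.mpr ⟨u, hu, h3⟩, ?_⟩
  rw [aeval_mulVec_of_eigenvector q h3] at h2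
  exact (smul_left_injective ℂ hu h2).symm

lemma exists_real_polynomial_re (s : Finset ℂ) :
    ∃ q : ℝ[X], ∀ z ∈ s, aeval z q = (z.re : ℂ) := by
  classical
  set Z := s ∪ s.image (starRingEnd ℂ) with hZ
  have hconj : ∀ z ∈ Z, starRingEnd ℂ z ∈ Z := by
    intro z hz
    rw [hZ, Finset.mem_union, Finset.mem_image] at hz ⊢
    rcases hz with hz | ⟨y, hy, rfl⟩
    · exact Or.inr ⟨z, hz, rfl⟩
    · left; simpa using hy
  set p : ℂ[X] := Lagrange.interpolate Z id (fun z => (z.re : ℂ)) with hp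
  have hpz : ∀ z ∈ Z, p.eval z = (z.re : ℂ) := fun z hz => by
    have := Lagrange.eval_interpolate_at_node (v := id) (fun z : ℂ => (z.re : ℂ))
      (Function.injective_id.injOn) hz
    exact this
  set P : ℂ[X] := C (1 / 2 : ℂ) * (p + p.map (starRingEnd ℂ)) with hP
  have hPz : ∀ z ∈ Z, P.eval z = (z.re : ℂ) := by
    intro z hz
    have h1 : (p.map (starRingEnd ℂ)).eval z = (z.re : ℂ) := by
      have h2 := eval_map_apply (f := starRingEnd ℂ) (p := p) (x := starRingEnd ℂ z)
      rw [Complex.conj_conj, hpz _ (hconj z hz)] at h2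
      simpa using h2
    rw [hP, eval_mul, eval_C, eval_add, hpz z hz, h1]
    ring
  have hlift : P ∈ lifts (algebraMap ℝ ℂ) := by
    rw [lifts_iff_coeff_lifts]
    intro k
    refine ⟨(p.coeff k).re, ?_⟩
    rw [hP, coeff_C_mul, coeff_add, coeff_map, Complex.add_conj]
    simp
  obtain ⟨q, hq⟩ := (mem_lifts _).mp hlift
  refine ⟨q, fun z hz => ?_⟩
  rw [← hPz z (Finset.mem_union_left _ hz), ← hq, eval_map_algebraMap]

lemma finite_eigenvalues (M : Matrix (Fin n) (Fin n) ℝ) :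
    {z | IsComplexEigenvalue M z}.Finite :=
  ((toC M).charpoly.finite_setOfPred_isRoot ((toC M).charpoly_monic.ne_zero)).subset fun _ h => h

/-- The hyperbolic part of a real matrix is a polynomial in it. -/
lemma exists_hyperbolic_part (M : Matrix (Fin n) (Fin n) ℝ) :
    ∃ q : ℝ[X], ∀ z, IsComplexEigenvalue M z → aeval z q = (z.re : ℂ) := by
  obtain ⟨q, hq⟩ := exists_real_polynomial_re (finite_eigenvalues M).toFinset
  exact ⟨q, fun z hz => hq z (by simpa using hz)⟩

lemma exists_jordan (M : Matrix (Fin n) (Fin n) ℝ) : ∃ p q : ℝ[X],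
    M = aeval M p + aeval M q ∧ IsSemisimpleMatrix (aeval M p) ∧ IsNilpotent (aeval M q) := by
  obtain ⟨N, hN, S, hS, h1, h2, h3⟩ :=
    Module.End.exists_isNilpotent_isSemisimple (f := (Matrix.toLin' M : Module.End ℝ (Fin n → ℝ)))
  rw [Algebra.adjoin_singleton_eq_range_aeval] at hN hS
  obtain ⟨q, rfl⟩ := hN
  obtain ⟨p, rfl⟩ := hS
  rw [show (aeval (Matrix.toLin' M : Module.End ℝ (Fin n → ℝ))).toRingHom q =
    Matrix.toLin' (aeval M q) from (toLin'_aeval M q).symm] at h1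
  rw [show (aeval (Matrix.toLin' M : Module.End ℝ (Fin n → ℝ))).toRingHom p =
    Matrix.toLin' (aeval M p) from (toLin'_aeval M p).symm] at h2
  refine ⟨p, q, ?_, h2, ?_⟩
  · apply (Matrix.toLin' (R := ℝ) (m := Fin n) (n := Fin n)).injective
    rw [map_add, toLin'_aeval, toLin'_aeval, add_comm]
    exact h3
  · obtain ⟨k, hk⟩ := h1
    refine ⟨k, ?_⟩
    apply (Matrix.toLin' (R := ℝ) (m := Fin n) (n := Fin n)).injective
    rw [Matrix.toLin'_pow, hk, map_zero]

end SemisimpleMatrix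

section Elements

open Polynomial

attribute [local instance] Matrix.linftyOpNormedRing Matrix.linftyOpNormedAlgebra

variable {n : ℕ}

lemma mulVec_aeval_sub {M : Matrix (Fin n) (Fin n) ℝ} (q : ℝ[X]) {v : Fin n → ℂ}
    {z : ℂ} (h : (toC M).mulVec v = z • v) (hv : v ≠ 0)
    (hq : ∀ z, IsComplexEigenvalue M z → aeval z q = (z.re : ℂ)) :
    (toC (aeval M q)).mulVec v = (z.re : ℂ) • v := by
  rw [aeval_mulVec_of_eigenvector q h, hq z (isComplexEigenvalue_iff.mpr ⟨v, hv, h⟩)]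

lemma mem_range_of_replica {L : Type*} [AddCommGroup L] [Module ℝ L]
    {r : L →ₗ[ℝ] Matrix (Fin n) (Fin n) ℝ} {S : Set (MvPolynomial (Fin n × Fin n) ℝ)}
    (hS : ∀ Y, Y ∈ LinearMap.range r ↔ ∀ t : ℝ, ∀ p ∈ S,
        MvPolynomial.aeval (fun ij : Fin n × Fin n =>
          ((NormedSpace.exp (t • Y) : Matrix (Fin n) (Fin n) ℝ) ij.1 ij.2 : ℂ)) p = 0)
    {A N A' : Matrix (Fin n) (Fin n) ℝ} (hY : A + N ∈ LinearMap.range r) (hAN : Commute A N)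
    (hA : IsSemisimpleMatrix A) (hN : IsNilpotent N) (f : ℂ →+ ℂ)
    (hA' : ∀ (v : Fin n → ℂ) (z : ℂ), (toC A).mulVec v = z • v → (toC A').mulVec v = f z • v) :
    A' ∈ LinearMap.range r :=
  (hS A').mpr fun t p hp => aeval_exp_replica hAN hN hA.iSup_eigenspace f hA' p
    (fun t => (hS _).mp hY t p hp) t

/-- A linear space of matrices is closed under Jordan parts and hyperbolic parts. -/
structure IsSplitting {L : Type*} [AddCommGroup L] [Module ℝ L]
    (r : L →ₗ[ℝ] Matrix (Fin n) (Fin n) ℝ) : Prop where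
  jordan : ∀ X : L, ∃ S N : L, X = S + N ∧ IsSemisimpleMatrix (r S) ∧ IsNilpotent (r N) ∧
    ∃ p : ℝ[X], r S = aeval (r X) p
  hyperbolic : ∀ X : L, IsSemisimpleMatrix (r X) → ∃ T A : L, X = T + A ∧
    (IsSemisimpleMatrix (r T) ∧ ∀ z, IsComplexEigenvalue (r T) z → z.re = 0) ∧
    (IsSemisimpleMatrix (r A) ∧ ∀ z, IsComplexEigenvalue (r A) z → z.im = 0) ∧
    ∃ p : ℝ[X], r A = aeval (r X) p

lemma isSplitting_of_polynomials {L : Type*} [AddCommGroup L] [Module ℝ L]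
    {r : L →ₗ[ℝ] Matrix (Fin n) (Fin n) ℝ}
    {S : Set (MvPolynomial (Fin n × Fin n) ℝ)}
    (hS : ∀ Y, Y ∈ LinearMap.range r ↔ ∀ t : ℝ, ∀ p ∈ S,
        MvPolynomial.aeval (fun ij : Fin n × Fin n =>
          ((NormedSpace.exp (t • Y) : Matrix (Fin n) (Fin n) ℝ) ij.1 ij.2 : ℂ)) p = 0) :
    IsSplitting r where
  jordan := by
    intro X
    obtain ⟨p, q, h1, h2, h3⟩ := exists_jordan (r X)
    have hc : Commute (aeval (r X) p) (aeval (r X) q) := (Commute.all p q).map (aeval (r X))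
    obtain ⟨A, hA⟩ := mem_range_of_replica hS (A' := aeval (r X) p) (by rw [← h1]; exact ⟨X, rfl⟩)
      hc h2 h3 (AddMonoidHom.id ℂ) (fun v z h => h)
    refine ⟨A, X - A, by abel, by rwa [hA], ?_, p, hA⟩
    rw [map_sub, hA, sub_eq_of_eq_add' h1]
    exact h3
  hyperbolic := by
    intro X hX
    obtain ⟨q, hq⟩ := exists_hyperbolic_part (r X)
    have hre : ∀ z : ℂ, Complex.ofRealHom.toAddMonoidHom.comp Complex.reAddGroupHom z =
      (z.re : ℂ) := fun z => rfl
    obtain ⟨A, hA⟩ := mem_range_of_replica hS (A := r X) (N := 0) (A' := aeval (r X) q)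
      (by rw [add_zero]; exact ⟨X, rfl⟩) (Commute.zero_right _) hX IsNilpotent.zero
      (Complex.ofRealHom.toAddMonoidHom.comp Complex.reAddGroupHom) (by
        intro v z h
        by_cases hv : v = 0
        · simp [hv]
        · rw [hre]; exact mulVec_aeval_sub q h hv hq)
    have hT : r (X - A) = aeval (r X) ((Polynomial.X : ℝ[X]) - q) := by
      rw [map_sub, hA, map_sub, aeval_X]
    refine ⟨X - A, A, by abel, ⟨?_, ?_⟩, ⟨?_, ?_⟩, q, hA⟩
    · rw [hT]; exact hX.aeval _
    · intro z hz
      rw [hT] at hz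
      obtain ⟨w, hw, rfl⟩ := eigenvalue_aeval hz
      rw [map_sub, aeval_X, hq w hw]; simp
    · rw [hA]; exact hX.aeval _
    · intro z hz
      rw [hA] at hz
      obtain ⟨w, hw, rfl⟩ := eigenvalue_aeval hz
      rw [hq w hw]; simp

lemma exp_mem_adjoin (A : Matrix (Fin n) (Fin n) ℝ) :
    ∃ q : ℝ[X], NormedSpace.exp A = aeval A q := by
  have h : NormedSpace.exp A ∈ (Algebra.adjoin ℝ {A}).toSubmodule := by
    have hcl : IsClosed ((Algebra.adjoin ℝ {A}).toSubmodule : Set (Matrix (Fin n) (Fin n) ℝ)) :=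
      Submodule.closed_of_finiteDimensional _
    refine hcl.mem_of_tendsto (NormedSpace.exp_series_hasSum_exp' (𝕂 := ℝ) A)
      (Filter.Eventually.of_forall fun s => ?_)
    refine Submodule.sum_mem _ fun k _ => Submodule.smul_mem _ _ ?_
    exact Subalgebra.pow_mem _ (Algebra.self_mem_adjoin_singleton ℝ A) k
  have h2 : NormedSpace.exp A ∈ Algebra.adjoin ℝ {A} := h
  rw [Algebra.adjoin_singleton_eq_range_aeval] at h2
  obtain ⟨q, hq⟩ := h2
  exact ⟨q, hq.symm⟩

lemma eigenvalue_exp {A : Matrix (Fin n) (Fin n) ℝ} {w : ℂ}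
    (h : IsComplexEigenvalue (NormedSpace.exp A) w) :
    ∃ z, IsComplexEigenvalue A z ∧ w = Complex.exp z := by
  obtain ⟨q, hq⟩ := exp_mem_adjoin A
  rw [hq] at h
  obtain ⟨v, hv, h1⟩ := isComplexEigenvalue_iff.mp h
  have hc : Commute (toC (aeval A q)) (toC A) := commute_toC (by
    have : Commute (aeval A q) (aeval A (X : ℝ[X])) := (Commute.all q X).map (aeval A)
    simpa using this)
  obtain ⟨u, hu, h2, z, h3⟩ := exists_common_mulVec hc hv h1
  refine ⟨z, isComplexEigenvalue_iff.mpr ⟨u, hu, h3⟩, ?_⟩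
  rw [← hq, toC_exp, exp_mulVec_of_mulVec_eq_smul h3] at h2
  exact (smul_left_injective ℂ hu h2).symm

lemma isElliptic_mul_exp {E A : Matrix (Fin n) (Fin n) ℝ} (h : Commute E A)
    (hE : IsSemisimpleMatrix E) (hE1 : ∀ z, IsComplexEigenvalue E z → ‖z‖ = 1)
    (hA : IsSemisimpleMatrix A) (hA1 : ∀ z, IsComplexEigenvalue A z → z.re = 0) :
    IsSemisimpleMatrix (E * NormedSpace.exp A) ∧
      ∀ z, IsComplexEigenvalue (E * NormedSpace.exp A) z → ‖z‖ = 1 := by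
  obtain ⟨q, hq⟩ := exp_mem_adjoin A
  have hc : Commute E (NormedSpace.exp A) := by
    rw [hq]
    have h1 : ∀ x ∈ Algebra.adjoin ℝ {A}, Commute E x := fun x hx =>
      Algebra.commute_of_mem_adjoin_singleton_of_commute hx h
    exact h1 _ (aeval_mem_adjoin_singleton ℝ A)
  constructor
  · refine hE.mul ?_ hc
    rw [hq]; exact hA.aeval q
  · intro z hz
    obtain ⟨a, b, ha, hb, rfl⟩ := eigenvalue_mul hc hz
    obtain ⟨c, hc, rfl⟩ := eigenvalue_exp hb
    rw [norm_mul, hE1 a ha, one_mul, Complex.norm_exp, hA1 c hc, Real.exp_zero]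

/-- Left multiplication by a semisimple matrix is semisimple. -/
lemma isSemisimple_mulLeft {A : Matrix (Fin n) (Fin n) ℝ} (hA : IsSemisimpleMatrix A) :
    Module.End.IsSemisimple (LinearMap.mulLeft ℝ A) := by
  refine Module.End.isSemisimple_of_squarefree_aeval_eq_zero hA.minpoly_squarefree ?_
  have h1 := minpoly.aeval ℝ (Matrix.toLin' A : Module.End ℝ (Fin n → ℝ))
  rw [← toLin'_aeval] at h1
  have h2 := (Matrix.toLin' (R := ℝ) (m := Fin n) (n := Fin n)).injective (h1.trans (map_zero _).symm)
  have h3 := aeval_algHom_apply (Algebra.lmul ℝ (Matrix (Fin n) (Fin n) ℝ)) A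
    (minpoly ℝ (Matrix.toLin' A : Module.End ℝ (Fin n → ℝ)))
  rw [h2, map_zero] at h3
  exact h3

/-- Right multiplication by a semisimple matrix is semisimple. -/
lemma isSemisimple_mulRight {A : Matrix (Fin n) (Fin n) ℝ} (hA : IsSemisimpleMatrix A) :
    Module.End.IsSemisimple (LinearMap.mulRight ℝ A) := by
  refine Module.End.isSemisimple_of_squarefree_aeval_eq_zero hA.minpoly_squarefree ?_
  have h1 := minpoly.aeval ℝ (Matrix.toLin' A : Module.End ℝ (Fin n → ℝ))
  rw [← toLin'_aeval] at h1
  have h2 := (Matrix.toLin' (R := ℝ) (m := Fin n) (n := Fin n)).injective (h1.trans (map_zero _).symm)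
  have h3 : ∀ p : ℝ[X], aeval (LinearMap.mulRight ℝ A) p = LinearMap.mulRight ℝ (aeval A p) := by
    intro p
    induction p using Polynomial.induction_on' with
    | add p q hp hq => rw [map_add, map_add, hp, hq]; ext; simp [mul_add]
    | monomial k a =>
      rw [aeval_monomial, aeval_monomial, LinearMap.pow_mulRight]
      ext M
      simp [Algebra.algebraMap_eq_smul_one]
  rw [h3, h2]
  ext; simp

lemma isSemisimple_of_mul_sub {V : Type*} [AddCommGroup V] [Module ℝ V]
    {f : Module.End ℝ V} (r : V →ₗ[ℝ] Matrix (Fin n) (Fin n) ℝ) (hr : Function.Injective r)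
    {A : Matrix (Fin n) (Fin n) ℝ} (hA : IsSemisimpleMatrix A)
    (h : ∀ x, r (f x) = A * r x - r x * A) : f.IsSemisimple := by
  refine isSemisimple_of_intertwine r hr (g := LinearMap.mulLeft ℝ A - LinearMap.mulRight ℝ A)
    (fun x => by simpa using h x) ?_
  exact (isSemisimple_mulLeft hA).sub_of_commute (LinearMap.commute_mulLeft_right A A)
    (isSemisimple_mulRight hA)

lemma isSemisimpleMatrix_inv {g : GL (Fin n) ℝ} (hg : IsSemisimpleMatrix (g : Matrix (Fin n) (Fin n) ℝ)) :
    IsSemisimpleMatrix ((g⁻¹ : GL (Fin n) ℝ) : Matrix (Fin n) (Fin n) ℝ) := by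
  have h1 : ∃ q : ℝ[X], ((g⁻¹ : GL (Fin n) ℝ) : Matrix (Fin n) (Fin n) ℝ) =
      aeval (g : Matrix (Fin n) (Fin n) ℝ) q := by
    have h2 : ((g⁻¹ : GL (Fin n) ℝ) : Matrix (Fin n) (Fin n) ℝ) ∈
        Algebra.adjoin ℝ {(g : Matrix (Fin n) (Fin n) ℝ)} := by
      set S := Algebra.adjoin ℝ {(g : Matrix (Fin n) (Fin n) ℝ)}
      have hgS : (g : Matrix (Fin n) (Fin n) ℝ) ∈ S := Algebra.self_mem_adjoin_singleton ℝ _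
      have hinj : Function.Injective (LinearMap.mulLeft ℝ (⟨g, hgS⟩ : S)) := by
        intro x y hxy
        have h3 : (g : Matrix (Fin n) (Fin n) ℝ) * x = g * y := congrArg Subtype.val hxy
        exact Subtype.ext (g.mul_right_inj.mp h3)
      obtain ⟨y, hy⟩ := (LinearMap.injective_iff_surjective.mp hinj) 1
      have h4 : (g : Matrix (Fin n) (Fin n) ℝ) * y = 1 := congrArg Subtype.val hy
      rw [Units.inv_eq_of_mul_eq_one_right h4]
      exact y.2
    rw [Algebra.adjoin_singleton_eq_range_aeval] at h2
    obtain ⟨q, hq⟩ := h2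
    exact ⟨q, hq.symm⟩
  obtain ⟨q, hq⟩ := h1
  rw [hq]; exact hg.aeval q

lemma isSemisimple_of_conj {V : Type*} [AddCommGroup V] [Module ℝ V]
    {f : Module.End ℝ V} (r : V →ₗ[ℝ] Matrix (Fin n) (Fin n) ℝ) (hr : Function.Injective r)
    {g : GL (Fin n) ℝ} (hg : IsSemisimpleMatrix (g : Matrix (Fin n) (Fin n) ℝ))
    (h : ∀ x, r (f x) = g * r x * (g⁻¹ : GL (Fin n) ℝ)) : f.IsSemisimple := by
  refine isSemisimple_of_intertwine r hr (g := LinearMap.mulLeft ℝ (g : Matrix (Fin n) (Fin n) ℝ) *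
    LinearMap.mulRight ℝ ((g⁻¹ : GL (Fin n) ℝ) : Matrix (Fin n) (Fin n) ℝ))
    (fun x => by simpa [mul_assoc] using h x) ?_
  exact (isSemisimple_mulLeft hg).mul_of_commute (LinearMap.commute_mulLeft_right _ _)
    (isSemisimple_mulRight (isSemisimpleMatrix_inv hg))

/-- An eigenvalue of the commutator with `A` is a difference of eigenvalues of `A`. -/
lemma eigenvalue_commutator {A : Matrix (Fin n) (Fin n) ℝ} {R : Matrix (Fin n) (Fin n) ℂ}
    (hR : R ≠ 0) {c : ℂ} (h : toC A * R - R * toC A = c • R) :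
    ∃ a b, IsComplexEigenvalue A a ∧ IsComplexEigenvalue A b ∧ c = a - b := by
  have hc : Commute (LinearMap.mulLeft ℂ (toC A) - LinearMap.mulRight ℂ (toC A))
      (LinearMap.mulLeft ℂ (toC A)) :=
    (Commute.refl _).sub_left (LinearMap.commute_mulLeft_right _ _).symm
  obtain ⟨R', hR', h1, a, h2⟩ := exists_common_eigenvector hc hR (by simpa using h)
  simp only [LinearMap.mulLeft_apply, LinearMap.sub_apply, LinearMap.mulRight_apply] at h1 h2
  refine ⟨a, a - c, ?_, ?_, by ring⟩
  · obtain ⟨j, hj⟩ : ∃ j, R'.col j ≠ 0 := by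
      by_contra hcon
      push Not at hcon
      apply hR'
      ext i j
      exact congrFun (hcon j) i
    refine isComplexEigenvalue_iff.mpr ⟨R'.col j, hj, ?_⟩
    ext i
    have := congrFun (congrFun h2 i) j
    simpa [Matrix.mul_apply, Matrix.mulVec, dotProduct, Matrix.col] using this
  · have h3 : R' * (toC A - (a - c) • 1) = 0 := by
      rw [mul_sub, mul_smul_comm, mul_one, sub_smul, ← h1, ← h2]; abel
    have h4 : (toC A - (a - c) • 1).det = 0 := by
      by_contra hdet
      have hu : IsUnit (toC A - (a - c) • 1 : Matrix (Fin n) (Fin n) ℂ) :=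
        (Matrix.isUnit_iff_isUnit_det _).mpr (isUnit_iff_ne_zero.mpr hdet)
      exact hR' (hu.mul_left_eq_zero.mp h3)
    obtain ⟨v, hv, h5⟩ := Matrix.exists_mulVec_eq_zero_iff.mpr h4
    refine isComplexEigenvalue_iff.mpr ⟨v, hv, ?_⟩
    rw [Matrix.sub_mulVec, Matrix.smul_mulVec, Matrix.one_mulVec] at h5
    exact sub_eq_zero.mp h5

end Elements

section Reductive

attribute [local instance 100] LieRing.ofAssociativeRing

variable {L : Type*} [LieRing L] [LieAlgebra ℝ L] [FiniteDimensional ℝ L]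
  {Q : Type*} [LieRing Q] [LieAlgebra ℝ Q]

lemma hasTrivialRadical_of_surjective {π : L →ₗ⁅ℝ⁆ Q} (hπ : Function.Surjective π)
    (hker : ∀ x, π x = 0 → x ∈ LieAlgebra.center ℝ L)
    (hrad : ∀ x ∈ LieAlgebra.radical ℝ L, π x = 0) : LieAlgebra.HasTrivialRadical ℝ Q := by
  rw [LieAlgebra.hasTrivialRadical_iff_no_abelian_ideals]
  intro I hI
  have h1 : ∀ x ∈ I, ∀ y ∈ I, ⁅x, y⁆ = 0 := by
    intro x hx y hy
    have := hI.trivial (⟨x, hx⟩ : I) (⟨y, hy⟩ : I)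
    exact congrArg Subtype.val this
  have h2 : LieAlgebra.IsSolvable (LieIdeal.comap π I) := by
    rw [LieAlgebra.isSolvable_iff ℝ]
    refine ⟨2, ?_⟩
    rw [LieIdeal.derivedSeries_eq_bot_iff, eq_bot_iff, LieAlgebra.derivedSeriesOfIdeal_succ,
      LieSubmodule.lie_le_iff]
    intro x hx y hy
    have h3 : LieAlgebra.derivedSeriesOfIdeal ℝ L 1 (LieIdeal.comap π I) ≤
        LieAlgebra.center ℝ L := by
      rw [LieAlgebra.derivedSeriesOfIdeal_succ, LieAlgebra.derivedSeriesOfIdeal_zero,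
        LieSubmodule.lie_le_iff]
      intro a ha b hb
      apply hker
      rw [LieHom.map_lie]
      exact h1 _ (LieIdeal.mem_comap.mp ha) _ (LieIdeal.mem_comap.mp hb)
    have h4 := (LieModule.mem_maxTrivSubmodule (R := ℝ) (L := L) (M := L) y).mp (h3 hy) x
    rw [h4]; exact Submodule.zero_mem _
  rw [LieAlgebra.LieIdeal.solvable_iff_le_radical] at h2
  rw [eq_bot_iff]
  intro q hq
  obtain ⟨x, rfl⟩ := hπ q
  exact hrad x (h2 (LieIdeal.mem_comap.mpr hq))

lemma isCartanSubalgebra_range_comp_incl {π : L →ₗ⁅ℝ⁆ Q} (hπ : Function.Surjective π)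
    (hker : ∀ x, π x = 0 → x ∈ LieAlgebra.center ℝ L) (h : LieSubalgebra ℝ L)
    [h.IsCartanSubalgebra] : (π.comp h.incl).range.IsCartanSubalgebra where
  nilpotent := Function.Surjective.lieAlgebra_isNilpotent (R := ℝ)
    (π.comp h.incl).surjective_rangeRestrict
  self_normalizing := by
    refine le_antisymm ?_ (LieSubalgebra.le_normalizer _)
    intro q hq
    obtain ⟨x, rfl⟩ := hπ q
    have hz : ∀ z, π z = 0 → z ∈ h := by
      intro z hz
      rw [← LieSubalgebra.IsCartanSubalgebra.self_normalizing (H := h),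
        LieSubalgebra.mem_normalizer_iff]
      intro y _
      have := (LieModule.mem_maxTrivSubmodule (R := ℝ) (L := L) (M := L) z).mp (hker z hz) y
      rw [← lie_skew, this, neg_zero]
      exact h.zero_mem
    have hx : x ∈ h.normalizer := by
      rw [LieSubalgebra.mem_normalizer_iff]
      intro y hy
      have h1 := (LieSubalgebra.mem_normalizer_iff _ _).mp hq (π y) ⟨⟨y, hy⟩, rfl⟩
      obtain ⟨⟨w, hw⟩, hw2⟩ := h1
      have h2 : π (⁅x, y⁆ - w) = 0 := by
        rw [map_sub, LieHom.map_lie]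
        exact sub_eq_zero.mpr hw2.symm
      have := h.add_mem (hz _ h2) hw
      rwa [sub_add_cancel] at this
    rw [LieSubalgebra.IsCartanSubalgebra.self_normalizing] at hx
    exact ⟨⟨x, hx⟩, rfl⟩

/-- In a Lie algebra whose radical is its centre, an ad-nilpotent element of a Cartan subalgebra is
central. -/
lemma mem_center_of_isNilpotent_ad
    (hred : LieAlgebra.radical ℝ L = LieAlgebra.center ℝ L) (h : LieSubalgebra ℝ L)
    [h.IsCartanSubalgebra] {N : L} (hN : N ∈ h) (hnil : IsNilpotent (LieAlgebra.ad ℝ L N)) :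
    N ∈ LieAlgebra.center ℝ L := by
  set π := (LieAlgebra.ad ℝ L).rangeRestrict with hπdef
  have hπ : Function.Surjective π := (LieAlgebra.ad ℝ L).surjective_rangeRestrict
  have hker : ∀ x, π x = 0 ↔ x ∈ LieAlgebra.center ℝ L := by
    intro x
    rw [LieModule.mem_maxTrivSubmodule]
    constructor
    · intro hx y
      have h1 : LieAlgebra.ad ℝ L x = 0 := congrArg Subtype.val hx
      have h2 := LinearMap.congr_fun h1 y
      rw [← lie_skew, ← LieAlgebra.ad_apply ℝ, h2]; simp
    · intro hx
      apply Subtype.ext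
      ext y
      change ⁅x, y⁆ = 0
      rw [← lie_skew, hx, neg_zero]
  have htriv : LieAlgebra.HasTrivialRadical ℝ (LieAlgebra.ad ℝ L).range :=
    hasTrivialRadical_of_surjective hπ (fun x => (hker x).mp)
      (fun x hx => (hker x).mpr (hred ▸ hx))
  have hcart := isCartanSubalgebra_range_comp_incl hπ (fun x => (hker x).mp) h
  rw [← hker]
  refine LieAlgebra.IsKilling.eq_zero_of_isNilpotent_ad_of_mem_isCartanSubalgebra ℝ _
    (π.comp h.incl).range ⟨⟨N, hN⟩, rfl⟩ ?_
  obtain ⟨k, hk⟩ := hnil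
  refine ⟨k, ?_⟩
  ext1 q
  obtain ⟨x, rfl⟩ := hπ q
  have h1 : ∀ j : ℕ, (LieAlgebra.ad ℝ (LieAlgebra.ad ℝ L).range (π N) ^ j) (π x) =
      π ((LieAlgebra.ad ℝ L N ^ j) x) := by
    intro j
    induction j with
    | zero => simp
    | succ j ih =>
      rw [pow_succ', Module.End.mul_apply, ih, pow_succ', Module.End.mul_apply,
        LieAlgebra.ad_apply, LieAlgebra.ad_apply, LieHom.map_lie]
  refine (h1 k).trans ?_
  rw [hk]; simp

end Reductive

section Structure

open Polynomial

lemma pow_add_apply_eq_zero {V : Type*} [AddCommGroup V] [Module ℝ V] {f g : Module.End ℝ V}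
    (h : Commute f g) {a b : ℕ} {v : V} (hf : (f ^ a) v = 0) (hg : g ^ b = 0) :
    ((f + g) ^ (a + b)) v = 0 := by
  rw [h.add_pow, LinearMap.sum_apply]
  refine Finset.sum_eq_zero fun m hm => ?_
  rw [← nsmul_eq_mul']
  rcases le_or_gt a m with hm1 | hm1
  · have : (f ^ m) v = 0 := by
      rw [← Nat.sub_add_cancel hm1, pow_add, Module.End.mul_apply, hf, map_zero]
    rw [((h.pow_pow m (a + b - m))).eq]
    simp [this]
  · have : g ^ (a + b - m) = 0 := pow_eq_zero_of_le (by omega) hg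
    rw [this]; simp

lemma eq_zero_of_pow_apply_eq_zero {V : Type*} [AddCommGroup V] [Module ℝ V] {f : Module.End ℝ V}
    (hf : f.IsSemisimple) {k : ℕ} {v : V} (h : (f ^ k) v = 0) : f v = 0 := by
  have h1 := hf.isFinitelySemisimple.genEigenspace_eq_eigenspace (μ := 0) (k := (k + 1 : ℕ)) (by simp)
  have h2 : v ∈ f.genEigenspace 0 (k + 1 : ℕ) := by
    rw [Module.End.mem_genEigenspace_nat, zero_smul, sub_zero, LinearMap.mem_ker, pow_succ',
      Module.End.mul_apply, h, map_zero]
  rw [h1, Module.End.mem_eigenspace_iff, zero_smul] at h2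
  exact h2

lemma exists_ker_add_range {V : Type*} [AddCommGroup V] [Module ℝ V] [FiniteDimensional ℝ V]
    {f : Module.End ℝ V} (hf : f.IsSemisimple) (v : V) : ∃ k w, f k = 0 ∧ v = k + f w := by
  obtain ⟨q, hq, hc⟩ := Module.End.isSemisimple_iff.mp hf (LinearMap.ker f) (by
    intro x hx
    simp only [Submodule.mem_comap, LinearMap.mem_ker] at hx ⊢
    rw [hx, map_zero])
  have hinj : Function.Injective (f.restrict hq) := by
    rw [← LinearMap.ker_eq_bot, LinearMap.ker_eq_bot']
    intro x hx
    have h1 : f x = 0 := congrArg Subtype.val hx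
    exact Subtype.ext (Submodule.disjoint_def.mp hc.disjoint x h1 x.2)
  obtain ⟨k, y, hk, hy, hky⟩ : ∃ k y, k ∈ LinearMap.ker f ∧ y ∈ q ∧ k + y = v := by
    have : v ∈ LinearMap.ker f ⊔ q := by rw [hc.sup_eq_top]; trivial
    obtain ⟨k, hk, y, hy, h⟩ := Submodule.mem_sup.mp this
    exact ⟨k, y, hk, hy, h⟩
  obtain ⟨w, hw⟩ := (LinearMap.injective_iff_surjective.mp hinj) ⟨y, hy⟩
  refine ⟨k, w, hk, ?_⟩
  rw [← hky, ← show f w = y from congrArg Subtype.val hw]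

variable {L : Type*} [LieRing L] [LieAlgebra ℝ L] [FiniteDimensional ℝ L] {n : ℕ}

/-- A faithful matrix representation and an invariant form. -/
structure IsInvariantPair (r : L →ₗ[ℝ] Matrix (Fin n) (Fin n) ℝ) (B : LinearMap.BilinForm ℝ L) :
    Prop where
  inj : Function.Injective r
  lie : ∀ X Y, r ⁅X, Y⁆ = r X * r Y - r Y * r X
  symm : ∀ X Y, B X Y = B Y X
  invariant : ∀ X Y Z, B ⁅X, Y⁆ Z = B X ⁅Y, Z⁆

variable {r : L →ₗ[ℝ] Matrix (Fin n) (Fin n) ℝ} {B : LinearMap.BilinForm ℝ L}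

lemma IsInvariantPair.isSemisimple_ad (hr : IsInvariantPair r B) {X : L}
    (hX : IsSemisimpleElt r X) : (LieAlgebra.ad ℝ L X).IsSemisimple :=
  isSemisimple_of_mul_sub r hr.inj hX fun Y => hr.lie X Y

lemma IsInvariantPair.isNilpotent_ad (hr : IsInvariantPair r B) {X : L}
    (hX : IsNilpotent (r X)) : IsNilpotent (LieAlgebra.ad ℝ L X) := by
  have h1 : IsNilpotent (LinearMap.mulLeft ℝ (r X) - LinearMap.mulRight ℝ (r X)) :=
    (LinearMap.commute_mulLeft_right (R := ℝ) (r X) (r X)).isNilpotent_sub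
      ((LinearMap.isNilpotent_mulLeft_iff ℝ _).mpr hX)
      ((LinearMap.isNilpotent_mulRight_iff ℝ _).mpr hX)
  obtain ⟨k, hk⟩ := h1
  refine ⟨k, ?_⟩
  ext Y
  apply hr.inj
  have h2 : ∀ j : ℕ, r ((LieAlgebra.ad ℝ L X ^ j) Y) =
      ((LinearMap.mulLeft ℝ (r X) - LinearMap.mulRight ℝ (r X)) ^ j) (r Y) := by
    intro j
    induction j with
    | zero => simp
    | succ j ih =>
      rw [pow_succ', Module.End.mul_apply, LieAlgebra.ad_apply, hr.lie, ih, pow_succ',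
        Module.End.mul_apply]
      simp
  rw [h2, hk]; simp

lemma IsInvariantPair.lie_eq_zero_iff (hr : IsInvariantPair r B) {X Y : L} :
    ⁅X, Y⁆ = 0 ↔ Commute (r X) (r Y) := by
  rw [← hr.inj.eq_iff, hr.lie, map_zero, sub_eq_zero]; rfl

/-- `h` is a toral selfcentralizing subalgebra of `m`, on which the form `B` has the usual signs,
and the restriction of `B` to `m` is nondegenerate. -/
structure CartanPair (r : L →ₗ[ℝ] Matrix (Fin n) (Fin n) ℝ) (B : LinearMap.BilinForm ℝ L)
    (m h : LieSubalgebra ℝ L) : Prop extends IsInvariantPair r B where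
  nondeg : ∀ X ∈ m, (∀ Y ∈ m, B X Y = 0) → X = 0
  le : h ≤ m
  comm : ∀ X ∈ h, ∀ Y ∈ h, ⁅X, Y⁆ = 0
  self_centralizing : ∀ X ∈ m, (∀ H ∈ h, ⁅H, X⁆ = 0) → X ∈ h
  decomp : ∀ H ∈ h, ∃ T ∈ h, ∃ A ∈ h, H = T + A ∧ IsInfElliptic r T ∧ IsInfHyperbolic r A
  neg : ∀ X ∈ h, IsInfElliptic r X → X ≠ 0 → B X X < 0
  pos : ∀ X ∈ h, IsInfHyperbolic r X → X ≠ 0 → 0 < B X X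
  orth : ∀ X ∈ h, IsInfElliptic r X → ∀ Y ∈ h, IsInfHyperbolic r Y → B X Y = 0

/-- The properties of the Lie algebra of a reductive group and of its admissible form. -/
structure IsReductivePair (r : L →ₗ[ℝ] Matrix (Fin n) (Fin n) ℝ) (B : LinearMap.BilinForm ℝ L) :
    Prop extends IsInvariantPair r B where
  nondeg : ∀ X, (∀ Y, B X Y = 0) → X = 0
  splitting : IsSplitting r
  reductive : LieAlgebra.radical ℝ L = LieAlgebra.center ℝ L
  semisimple_center : ∀ X ∈ LieAlgebra.center ℝ L, IsSemisimpleElt r X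
  neg : ∀ h : LieSubalgebra ℝ L, h.IsCartanSubalgebra →
    ∀ X ∈ h, IsInfElliptic r X → X ≠ 0 → B X X < 0
  pos : ∀ h : LieSubalgebra ℝ L, h.IsCartanSubalgebra →
    ∀ X ∈ h, IsInfHyperbolic r X → X ≠ 0 → 0 < B X X
  orth : ∀ h : LieSubalgebra ℝ L, h.IsCartanSubalgebra →
    ∀ X ∈ h, IsInfElliptic r X → ∀ Y ∈ h, IsInfHyperbolic r Y → B X Y = 0

lemma commute_of_aeval {A C : Matrix (Fin n) (Fin n) ℝ} (h : Commute A C) {p : ℝ[X]}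
    {D : Matrix (Fin n) (Fin n) ℝ} (hD : D = aeval A p) : Commute D C := by
  rw [hD]
  exact (Algebra.commute_of_mem_adjoin_singleton_of_commute (aeval_mem_adjoin_singleton ℝ A)
    h.symm).symm

lemma IsReductivePair.isSemisimpleElt_of_mem_cartan (hr : IsReductivePair r B)
    (h : LieSubalgebra ℝ L) [h.IsCartanSubalgebra] {H : L} (hH : H ∈ h) :
    IsSemisimpleElt r H ∧ ∀ Y ∈ h, ⁅H, Y⁆ = 0 := by
  obtain ⟨S, N, hSN, hS, hN, p, hp⟩ := hr.splitting.jordan H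
  have hcomm : Commute (LieAlgebra.ad ℝ L H) (-LieAlgebra.ad ℝ L N) := by
    have h1 : ⁅S, H⁆ = 0 :=
      hr.lie_eq_zero_iff.mpr (commute_of_aeval (Commute.refl (r H)) hp)
    have h2 : ⁅H, N⁆ = 0 := by
      have : N = H - S := by rw [hSN]; abel
      rw [this, lie_sub, lie_self, ← lie_skew, h1]; simp
    refine Commute.neg_right ?_
    ext Y
    have h3 := leibniz_lie H N Y
    rw [h2, zero_lie, zero_add] at h3
    simpa using h3
  have hadS : LieAlgebra.ad ℝ L S = LieAlgebra.ad ℝ L H + -LieAlgebra.ad ℝ L N := by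
    rw [hSN, map_add]; abel
  have hSY : ∀ Y ∈ h, ⁅S, Y⁆ = 0 := by
    intro Y hY
    obtain ⟨k, hk⟩ : ∃ k : ℕ, (LieAlgebra.ad ℝ L H ^ k) Y = 0 := by
      obtain ⟨k, hk⟩ := LieModule.exists_forall_pow_toEnd_eq_zero ℝ h h
      refine ⟨k, ?_⟩
      have h3 : ∀ j : ℕ, (LieAlgebra.ad ℝ L H ^ j) Y =
          ((LieAlgebra.ad ℝ h ⟨H, hH⟩ ^ j) ⟨Y, hY⟩ : h) := by
        intro j
        induction j with
        | zero => simp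
        | succ j ih =>
          rw [pow_succ', Module.End.mul_apply, ih, pow_succ', Module.End.mul_apply]
          rfl
      have hk' : LieAlgebra.ad ℝ h ⟨H, hH⟩ ^ k = 0 := hk _
      rw [h3, hk']; rfl
    obtain ⟨l, hl⟩ := (hr.isNilpotent_ad hN).neg
    have h4 := pow_add_apply_eq_zero hcomm hk hl
    rw [← hadS] at h4
    exact eq_zero_of_pow_apply_eq_zero (hr.isSemisimple_ad hS) h4
  have hSh : S ∈ h := by
    rw [← LieSubalgebra.IsCartanSubalgebra.self_normalizing (H := h),
      LieSubalgebra.mem_normalizer_iff]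
    intro y hy
    rw [hSY y hy]; exact h.zero_mem
  have hNh : N ∈ h := by
    have : N = H - S := by rw [hSN]; abel
    rw [this]; exact h.sub_mem hH hSh
  have hNc := mem_center_of_isNilpotent_ad hr.reductive h hNh (hr.isNilpotent_ad hN)
  have hN0 : N = 0 := by
    apply hr.inj
    rw [map_zero]
    have h5 := Module.End.eq_zero_of_isNilpotent_isSemisimple
      (f := (Matrix.toLin' (r N) : Module.End ℝ (Fin n → ℝ))) (by
        obtain ⟨k, hk⟩ := hN
        exact ⟨k, by rw [← Matrix.toLin'_pow, hk, map_zero]⟩) (hr.semisimple_center N hNc)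
    exact (LinearEquiv.map_eq_zero_iff _).mp h5
  rw [hN0, add_zero] at hSN
  rw [hSN]
  exact ⟨hS, hSY⟩

lemma mem_stab_iff_lie_eq_zero (hr : IsReductivePair r B) {f : Module.Dual ℝ L} {X₀ : L}
    (hf : ∀ Y, f Y = B X₀ Y) {X : L} : X ∈ stab f ↔ ⁅X₀, X⁆ = 0 := by
  constructor
  · intro hX
    apply hr.nondeg
    intro Y
    rw [hr.invariant, ← hf]; exact hX Y
  · intro hX Y
    rw [hf, ← hr.invariant, hX]; simp

lemma IsCartanOf.isNilpotent {m h : LieSubalgebra ℝ L} (hc : IsCartanOf m h) :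
    LieRing.IsNilpotent h := by
  have := hc.2.nilpotent
  let f : h →ₗ⁅ℝ⁆ h.comap m.incl :=
    { toFun := fun x => ⟨⟨x, hc.1 x.2⟩, x.2⟩
      map_add' := fun _ _ => rfl
      map_smul' := fun _ _ => rfl
      map_lie' := rfl }
  refine Function.Injective.lieAlgebra_isNilpotent (R := ℝ) (f := f) ?_
  intro x y hxy
  exact Subtype.ext (congrArg (fun z : h.comap m.incl => ((z : m) : L)) hxy)

lemma IsCartanOf.mem_of_normalizes {m h : LieSubalgebra ℝ L} (hc : IsCartanOf m h) {X : L}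
    (hX : X ∈ m) (hn : ∀ Y ∈ h, ⁅X, Y⁆ ∈ h) : X ∈ h := by
  have h1 : (⟨X, hX⟩ : m) ∈ (h.comap m.incl).normalizer := by
    rw [LieSubalgebra.mem_normalizer_iff]
    intro y hy
    exact hn _ hy
  rw [hc.2.self_normalizing] at h1
  exact h1

lemma IsReductivePair.isCartanSubalgebra (hr : IsReductivePair r B) {f : Module.Dual ℝ L} {X₀ : L}
    (hX₀ : IsSemisimpleElt r X₀) (hf : ∀ Y, f Y = B X₀ Y) {h : LieSubalgebra ℝ L}
    (hc : IsCartanOf (stab f) h) : X₀ ∈ h ∧ h.IsCartanSubalgebra := by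
  have h1 : X₀ ∈ h := by
    refine hc.mem_of_normalizes ((mem_stab_iff_lie_eq_zero hr hf).mpr (lie_self _)) ?_
    intro Y hY
    rw [(mem_stab_iff_lie_eq_zero hr hf).mp (hc.1 hY)]
    exact h.zero_mem
  refine ⟨h1, hc.isNilpotent, le_antisymm ?_ (LieSubalgebra.le_normalizer _)⟩
  intro X hX
  rw [LieSubalgebra.mem_normalizer_iff] at hX
  refine hc.mem_of_normalizes ?_ hX
  rw [mem_stab_iff_lie_eq_zero hr hf]
  refine eq_zero_of_pow_apply_eq_zero (hr.isSemisimple_ad hX₀) (k := 2) ?_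
  have h2 := h.neg_mem (hX X₀ h1)
  rw [lie_skew] at h2
  rw [pow_two, Module.End.mul_apply, LieAlgebra.ad_apply, LieAlgebra.ad_apply]
  exact (mem_stab_iff_lie_eq_zero hr hf).mp (hc.1 h2)

lemma IsReductivePair.nondeg_stab (hr : IsReductivePair r B) {f : Module.Dual ℝ L} {X₀ : L}
    (hX₀ : IsSemisimpleElt r X₀) (hf : ∀ Y, f Y = B X₀ Y) {X : L} (hX : X ∈ stab f)
    (h0 : ∀ Y ∈ stab f, B X Y = 0) : X = 0 := by
  apply hr.nondeg
  intro Y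
  obtain ⟨k, w, hk, rfl⟩ := exists_ker_add_range (hr.isSemisimple_ad hX₀) Y
  rw [map_add, h0 k ((mem_stab_iff_lie_eq_zero hr hf).mpr hk), zero_add, LieAlgebra.ad_apply,
    ← hr.invariant, ← lie_skew, (mem_stab_iff_lie_eq_zero hr hf).mp hX]
  simp

/-- A Cartan subalgebra of the stabilizer of a semisimple form. -/
lemma IsReductivePair.cartanPair (hr : IsReductivePair r B) {f : Module.Dual ℝ L}
    (hf : IsSemisimpleForm r B f) {h : LieSubalgebra ℝ L} (hc : IsCartanOf (stab f) h) :
    CartanPair r B (stab f) h := by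
  obtain ⟨X₀, hX₀, hf⟩ := hf
  obtain ⟨hX₀h, hcart⟩ := hr.isCartanSubalgebra hX₀ hf hc
  refine ⟨hr.toIsInvariantPair, fun X hX h0 => hr.nondeg_stab hX₀ hf hX h0, hc.1, ?_, ?_, ?_,
    hr.neg h hcart, hr.pos h hcart, hr.orth h hcart⟩
  · intro X hX Y hY
    exact (hr.isSemisimpleElt_of_mem_cartan h hX).2 Y hY
  · intro X hX h0
    refine hc.mem_of_normalizes hX fun Y hY => ?_
    rw [← lie_skew, h0 Y hY, neg_zero]; exact h.zero_mem
  · intro H hH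
    obtain ⟨hss, hcen⟩ := hr.isSemisimpleElt_of_mem_cartan h hH
    obtain ⟨T, A, hTA, hT, hA, p, hp⟩ := hr.splitting.hyperbolic H hss
    have hAh : A ∈ h := by
      rw [← LieSubalgebra.IsCartanSubalgebra.self_normalizing (H := h),
        LieSubalgebra.mem_normalizer_iff]
      intro Y hY
      have : ⁅A, Y⁆ = 0 :=
        hr.lie_eq_zero_iff.mpr (commute_of_aeval (hr.lie_eq_zero_iff.mp (hcen Y hY)) hp)
      rw [this]; exact h.zero_mem
    refine ⟨T, ?_, A, hAh, hTA, hT, hA⟩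
    have : T = H - A := by rw [hTA]; abel
    rw [this]; exact h.sub_mem hH hAh

end Structure

section Complexification

variable {V W : Type*} [AddCommGroup V] [Module ℝ V] [AddCommGroup W] [Module ℝ W]

/-- The real part of an element of the complexification. -/
def reV : ℂ ⊗[ℝ] V →ₗ[ℝ] V := (TensorProduct.lid ℝ V).toLinearMap ∘ₗ Complex.reLm.rTensor V

/-- The imaginary part of an element of the complexification. -/
def imV : ℂ ⊗[ℝ] V →ₗ[ℝ] V := (TensorProduct.lid ℝ V).toLinearMap ∘ₗ Complex.imLm.rTensor V

@[simp] lemma reV_tmul (c : ℂ) (x : V) : reV (c ⊗ₜ[ℝ] x) = c.re • x := by simp [reV]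

@[simp] lemma imV_tmul (c : ℂ) (x : V) : imV (c ⊗ₜ[ℝ] x) = c.im • x := by simp [imV]

/-- The element `x + i y` of the complexification. -/
def mkC (x y : V) : ℂ ⊗[ℝ] V := (1 : ℂ) ⊗ₜ[ℝ] x + Complex.I ⊗ₜ[ℝ] y

@[simp] lemma reV_mkC (x y : V) : reV (mkC x y) = x := by simp [mkC]

@[simp] lemma imV_mkC (x y : V) : imV (mkC x y) = y := by simp [mkC]

lemma mkC_re_im (z : ℂ ⊗[ℝ] V) : mkC (reV z) (imV z) = z := by
  induction z using TensorProduct.induction_on with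
  | zero => simp [mkC]
  | tmul c x =>
    simp only [mkC, reV_tmul, imV_tmul, TensorProduct.tmul_smul, TensorProduct.smul_tmul',
      ← TensorProduct.add_tmul]
    congr 1
    apply Complex.ext <;> simp
  | add z w hz hw =>
    conv_rhs => rw [← hz, ← hw]
    simp only [mkC, map_add, TensorProduct.tmul_add]
    abel

lemma ext_re_im {z w : ℂ ⊗[ℝ] V} (h1 : reV z = reV w) (h2 : imV z = imV w) : z = w := by
  rw [← mkC_re_im z, ← mkC_re_im w, h1, h2]

@[simp] lemma reV_smul (c : ℂ) (z : ℂ ⊗[ℝ] V) : reV (c • z) = c.re • reV z - c.im • imV z := by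
  conv_lhs => rw [← mkC_re_im z]
  simp [mkC, TensorProduct.smul_tmul', sub_eq_add_neg]

@[simp] lemma imV_smul (c : ℂ) (z : ℂ ⊗[ℝ] V) : imV (c • z) = c.re • imV z + c.im • reV z := by
  conv_lhs => rw [← mkC_re_im z]
  simp [mkC, TensorProduct.smul_tmul', add_comm]

@[simp] lemma reV_baseChange (f : V →ₗ[ℝ] W) (z : ℂ ⊗[ℝ] V) :
    reV (f.baseChange ℂ z) = f (reV z) := by
  conv_lhs => rw [← mkC_re_im z]
  simp [mkC]

@[simp] lemma imV_baseChange (f : V →ₗ[ℝ] W) (z : ℂ ⊗[ℝ] V) :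
    imV (f.baseChange ℂ z) = f (imV z) := by
  conv_lhs => rw [← mkC_re_im z]
  simp [mkC]

lemma mem_baseChange_iff {p : Submodule ℝ V} {z : ℂ ⊗[ℝ] V} :
    z ∈ p.baseChange ℂ ↔ reV z ∈ p ∧ imV z ∈ p := by
  constructor
  · intro hz
    rw [Submodule.baseChange_eq_span] at hz
    induction hz using Submodule.span_induction with
    | mem x hx =>
      obtain ⟨y, hy, rfl⟩ := hx
      exact ⟨by simpa using hy, by simp⟩
    | zero => simp
    | add x y _ _ hx hy => simp only [map_add]; exact ⟨p.add_mem hx.1 hy.1, p.add_mem hx.2 hy.2⟩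
    | smul c x _ hx =>
      rw [reV_smul, imV_smul]
      exact ⟨p.sub_mem (p.smul_mem _ hx.1) (p.smul_mem _ hx.2),
        p.add_mem (p.smul_mem _ hx.2) (p.smul_mem _ hx.1)⟩
  · rintro ⟨h1, h2⟩
    rw [← mkC_re_im z]
    exact Submodule.add_mem _ (Submodule.tmul_mem_baseChange_of_mem _ h1)
      (Submodule.tmul_mem_baseChange_of_mem _ h2)

/-- Complex conjugation. -/
def conjV : ℂ ⊗[ℝ] V →ₗ[ℝ] ℂ ⊗[ℝ] V where
  toFun z := mkC (reV z) (-imV z)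
  map_add' z w := by apply ext_re_im <;> simp [add_comm]
  map_smul' c z := by
    apply ext_re_im
    · simp only [map_smul, reV_mkC, RingHom.id_apply]
    · simp only [map_smul, imV_mkC, RingHom.id_apply, smul_neg]

@[simp] lemma reV_conjV (z : ℂ ⊗[ℝ] V) : reV (conjV z) = reV z := reV_mkC _ _

@[simp] lemma imV_conjV (z : ℂ ⊗[ℝ] V) : imV (conjV z) = -imV z := imV_mkC _ _

@[simp] lemma conjV_conjV (z : ℂ ⊗[ℝ] V) : conjV (conjV z) = z := by apply ext_re_im <;> simp

lemma conjV_smul (c : ℂ) (z : ℂ ⊗[ℝ] V) : conjV (c • z) = star c • conjV z := by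
  apply ext_re_im <;> simp [add_comm]

/-- The complexification of a bilinear form. -/
def bilC (B : LinearMap.BilinForm ℝ V) : LinearMap.BilinForm ℂ (ℂ ⊗[ℝ] V) :=
  LinearMap.mk₂ ℂ (fun z w => (⟨B (reV z) (reV w) - B (imV z) (imV w),
      B (reV z) (imV w) + B (imV z) (reV w)⟩ : ℂ))
    (fun x y z => by apply Complex.ext <;> simp <;> ring)
    (fun c x y => by apply Complex.ext <;> simp <;> ring)
    (fun x y z => by apply Complex.ext <;> simp <;> ring)
    (fun c x y => by apply Complex.ext <;> simp <;> ring)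

lemma bilC_apply (B : LinearMap.BilinForm ℝ V) (z w : ℂ ⊗[ℝ] V) : bilC B z w =
    (⟨B (reV z) (reV w) - B (imV z) (imV w), B (reV z) (imV w) + B (imV z) (reV w)⟩ : ℂ) := rfl

@[simp] lemma bilC_re (B : LinearMap.BilinForm ℝ V) (z w : ℂ ⊗[ℝ] V) : (bilC B z w).re =
    B (reV z) (reV w) - B (imV z) (imV w) := rfl

@[simp] lemma bilC_im (B : LinearMap.BilinForm ℝ V) (z w : ℂ ⊗[ℝ] V) : (bilC B z w).im =
    B (reV z) (imV w) + B (imV z) (reV w) := rfl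

lemma bilC_symm {B : LinearMap.BilinForm ℝ V} (hB : ∀ x y, B x y = B y x) (z w : ℂ ⊗[ℝ] V) :
    bilC B z w = bilC B w z := by
  apply Complex.ext
  · simp [hB (reV z), hB (imV z)]
  · simp [hB (reV z), hB (imV z), add_comm]

variable {L : Type*} [LieRing L] [LieAlgebra ℝ L]

@[simp] lemma reV_lie (z w : ℂ ⊗[ℝ] L) : reV ⁅z, w⁆ = ⁅reV z, reV w⁆ - ⁅imV z, imV w⁆ := by
  conv_lhs => rw [← mkC_re_im z, ← mkC_re_im w]
  simp [mkC, LieAlgebra.ExtendScalars.bracket_tmul, sub_eq_add_neg]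

@[simp] lemma imV_lie (z w : ℂ ⊗[ℝ] L) : imV ⁅z, w⁆ = ⁅reV z, imV w⁆ + ⁅imV z, reV w⁆ := by
  conv_lhs => rw [← mkC_re_im z, ← mkC_re_im w]
  simp [mkC, LieAlgebra.ExtendScalars.bracket_tmul]

lemma conjV_lie (z w : ℂ ⊗[ℝ] L) : conjV ⁅z, w⁆ = ⁅conjV z, conjV w⁆ := by
  apply ext_re_im
  · simp
  · simp [add_comm]

lemma smul_lieC (c : ℂ) (z w : ℂ ⊗[ℝ] L) : ⁅c • z, w⁆ = c • ⁅z, w⁆ := by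
  apply ext_re_im
  · simp only [reV_lie, reV_smul, imV_smul, imV_lie, sub_lie, add_lie, smul_lie, smul_sub, smul_add]
    abel
  · simp only [reV_lie, reV_smul, imV_smul, imV_lie, sub_lie, add_lie, smul_lie, smul_sub, smul_add]
    abel

lemma lie_smulC (c : ℂ) (z w : ℂ ⊗[ℝ] L) : ⁅z, c • w⁆ = c • ⁅z, w⁆ := by
  apply ext_re_im
  · simp only [reV_lie, reV_smul, imV_smul, imV_lie, lie_sub, lie_add, lie_smul, smul_sub, smul_add]
    abel
  · simp only [reV_lie, reV_smul, imV_smul, imV_lie, lie_sub, lie_add, lie_smul, smul_sub, smul_add]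
    abel

lemma bilC_invariant {B : LinearMap.BilinForm ℝ L} (hB : ∀ X Y Z, B ⁅X, Y⁆ Z = B X ⁅Y, Z⁆)
    (x y z : ℂ ⊗[ℝ] L) : bilC B ⁅x, y⁆ z = bilC B x ⁅y, z⁆ := by
  apply Complex.ext
  · simp [hB]; ring
  · simp [hB]; ring

lemma mem_rootSpace_iff {m h : LieSubalgebra ℝ L} {α : CForm h} {z : ℂ ⊗[ℝ] L} :
    z ∈ rootSpace m h α ↔ (reV z ∈ m ∧ imV z ∈ m) ∧
      ∀ H : h, ⁅(1 : ℂ) ⊗ₜ[ℝ] (H : L), z⁆ = α H • z := by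
  rw [rootSpace, Submodule.mem_inf, mem_baseChange_iff, Submodule.mem_iInf]
  simp only [Module.End.mem_eigenspace_iff, LieAlgebra.ad_apply]
  rfl

/-- The complex linear extension to the complexification. -/
lemma cext_apply (h : LieSubalgebra ℝ L) (β : CForm h) (z : ℂ ⊗[ℝ] h) :
    cext h β z = β (reV z) + Complex.I * β (imV z) := by
  conv_lhs => rw [← mkC_re_im z]
  simp [cext, mkC]

/-- The conjugate of a form: `H ↦ conj (α H)`. -/
def conjForm {h : LieSubalgebra ℝ L} (α : CForm h) : CForm h where
  toFun H := star (α H)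
  map_add' := by simp
  map_smul' := by simp

@[simp] lemma conjForm_apply {h : LieSubalgebra ℝ L} (α : CForm h) (H : h) :
    conjForm α H = star (α H) := rfl

lemma conjV_mem_rootSpace {m h : LieSubalgebra ℝ L} {α : CForm h} {z : ℂ ⊗[ℝ] L}
    (hz : z ∈ rootSpace m h α) : conjV z ∈ rootSpace m h (conjForm α) := by
  rw [mem_rootSpace_iff] at hz ⊢
  refine ⟨⟨by simpa using hz.1.1, by simpa using hz.1.2⟩, fun H => ?_⟩
  have h1 := congrArg conjV (hz.2 H)
  rw [conjV_lie, conjV_smul] at h1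
  rw [conjForm_apply, ← h1]
  congr 1
  apply ext_re_im <;> simp

lemma lie_mem_rootSpace {m h : LieSubalgebra ℝ L} {α β : CForm h} {x y : ℂ ⊗[ℝ] L}
    (hx : x ∈ rootSpace m h α) (hy : y ∈ rootSpace m h β) : ⁅x, y⁆ ∈ rootSpace m h (α + β) := by
  rw [mem_rootSpace_iff] at hx hy ⊢
  refine ⟨⟨?_, ?_⟩, fun H => ?_⟩
  · rw [reV_lie]
    exact m.sub_mem (m.lie_mem hx.1.1 hy.1.1) (m.lie_mem hx.1.2 hy.1.2)
  · rw [imV_lie]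
    exact m.add_mem (m.lie_mem hx.1.1 hy.1.2) (m.lie_mem hx.1.2 hy.1.1)
  · rw [leibniz_lie, hx.2, hy.2, smul_lieC, lie_smulC, LinearMap.add_apply, add_smul]

end Complexification

section Roots

open Polynomial

lemma isSemisimple_baseChange {V : Type*} [AddCommGroup V] [Module ℝ V] [FiniteDimensional ℝ V]
    {f : Module.End ℝ V} (hf : f.IsSemisimple) :
    Module.End.IsSemisimple (LinearMap.baseChange ℂ f : Module.End ℂ (ℂ ⊗[ℝ] V)) := by
  have h1 : (minpoly ℝ f).Separable :=
    PerfectField.separable_iff_squarefree.mpr hf.minpoly_squarefree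
  have h2 := (h1.map (f := algebraMap ℝ ℂ)).squarefree
  refine Module.End.isSemisimple_of_squarefree_aeval_eq_zero h2 ?_
  rw [aeval_map_algebraMap]
  have h3 := aeval_algHom_apply (Module.End.baseChangeHom ℝ ℂ V) f (minpoly ℝ f)
  rw [minpoly.aeval, map_zero] at h3
  exact h3

variable {L : Type*} [LieRing L] [LieAlgebra ℝ L] [FiniteDimensional ℝ L] {n : ℕ}
  {r : L →ₗ[ℝ] Matrix (Fin n) (Fin n) ℝ} {B : LinearMap.BilinForm ℝ L}
  {m h : LieSubalgebra ℝ L}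

lemma IsInfElliptic.smul {X : L} (hX : IsInfElliptic r X) (t : ℝ) : IsInfElliptic r (t • X) := by
  rw [IsInfElliptic, map_smul]
  refine ⟨hX.1.smul t, fun z hz => ?_⟩
  have h1 : t • r X = aeval (r X) (C t * Polynomial.X : ℝ[X]) := by simp [Algebra.smul_def]
  rw [h1] at hz
  obtain ⟨w, hw, rfl⟩ := eigenvalue_aeval hz
  simp [hX.2 w hw]

lemma IsInfHyperbolic.smul {X : L} (hX : IsInfHyperbolic r X) (t : ℝ) :
    IsInfHyperbolic r (t • X) := by
  rw [IsInfHyperbolic, map_smul]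
  refine ⟨hX.1.smul t, fun z hz => ?_⟩
  have h1 : t • r X = aeval (r X) (C t * Polynomial.X : ℝ[X]) := by simp [Algebra.smul_def]
  rw [h1] at hz
  obtain ⟨w, hw, rfl⟩ := eigenvalue_aeval hz
  simp [hX.2 w hw]

lemma IsInvariantPair.elliptic_add (hr : IsInvariantPair r B) {X Y : L} (hX : IsInfElliptic r X)
    (hY : IsInfElliptic r Y) (hc : ⁅X, Y⁆ = 0) : IsInfElliptic r (X + Y) := by
  have h1 := hr.lie_eq_zero_iff.mp hc
  rw [IsInfElliptic, map_add]
  refine ⟨hX.1.add hY.1 h1, fun z hz => ?_⟩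
  obtain ⟨a, b, ha, hb, rfl⟩ := eigenvalue_add h1 hz
  simp [hX.2 a ha, hY.2 b hb]

lemma IsInvariantPair.hyperbolic_add (hr : IsInvariantPair r B) {X Y : L}
    (hX : IsInfHyperbolic r X) (hY : IsInfHyperbolic r Y) (hc : ⁅X, Y⁆ = 0) :
    IsInfHyperbolic r (X + Y) := by
  have h1 := hr.lie_eq_zero_iff.mp hc
  rw [IsInfHyperbolic, map_add]
  refine ⟨hX.1.add hY.1 h1, fun z hz => ?_⟩
  obtain ⟨a, b, ha, hb, rfl⟩ := eigenvalue_add h1 hz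
  simp [hX.2 a ha, hY.2 b hb]

lemma IsInfElliptic.eq_zero_of_hyperbolic (hr : IsInvariantPair r B) {X : L}
    (hX : IsInfElliptic r X) (hX' : IsInfHyperbolic r X) : X = 0 := by
  have h0 : ∀ z, IsComplexEigenvalue (r X) z → z = 0 := fun z hz =>
    Complex.ext (hX.2 z hz) (hX'.2 z hz)
  have h1 := hX.1.iSup_eigenspace
  have h2 : ∀ z, Module.End.eigenspace (Matrix.toLin' (toC (r X))) z ≤
      LinearMap.ker (Matrix.toLin' (toC (r X))) := by
    intro z v hv
    rw [Module.End.mem_eigenspace_iff] at hv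
    rw [LinearMap.mem_ker, hv]
    by_cases hv0 : v = 0
    · simp [hv0]
    · rw [h0 z (isComplexEigenvalue_iff.mpr ⟨v, hv0, by simpa using hv⟩), zero_smul]
  have h3 : toC (r X) = 0 := by
    have : (⊤ : Submodule ℂ (Fin n → ℂ)) ≤ LinearMap.ker (Matrix.toLin' (toC (r X))) := by
      rw [← h1]; exact iSup_le h2
    rw [top_le_iff, LinearMap.ker_eq_top] at this
    exact (LinearEquiv.map_eq_zero_iff _).mp this
  apply hr.inj
  rw [map_zero]
  ext i j
  have := congrFun (congrFun h3 i) j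
  simpa using this

lemma CartanPair.isSemisimpleElt (hc : CartanPair r B m h) {H : L} (hH : H ∈ h) :
    IsSemisimpleElt r H := by
  obtain ⟨T, hT, A, hA, rfl, hT1, hA1⟩ := hc.decomp H hH
  rw [IsSemisimpleElt, map_add]
  exact hT1.1.add hA1.1 (hc.lie_eq_zero_iff.mp (hc.comm T hT A hA))

lemma rootSpace_le_baseChange (α : CForm h) :
    rootSpace m h α ≤ m.toSubmodule.baseChange ℂ := inf_le_left

/-- The root space decomposition. -/
lemma CartanPair.baseChange_le_iSup (hc : CartanPair r B m h) :
    m.toSubmodule.baseChange ℂ ≤ ⨆ α : CForm h, rootSpace m h α := by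
  let D : h → Module.End ℂ (ℂ ⊗[ℝ] m) := fun H =>
    LinearMap.baseChange ℂ (LieAlgebra.ad ℝ m ⟨H, hc.le H.2⟩)
  have hss : ∀ H, (D H).IsSemisimple := by
    intro H
    refine isSemisimple_baseChange ?_
    refine isSemisimple_of_mul_sub (r ∘ₗ m.toSubmodule.subtype)
      (hc.inj.comp Subtype.val_injective) (hc.isSemisimpleElt H.2) fun x => ?_
    exact hc.lie H x
  have hcomm : ∀ H H', Commute (D H) (D H') := by
    intro H H'
    have h1 : Commute (LieAlgebra.ad ℝ m ⟨H, hc.le H.2⟩) (LieAlgebra.ad ℝ m ⟨H', hc.le H'.2⟩) := by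
      ext x
      have h2 := leibniz_lie (H : L) (H' : L) (x : L)
      rw [hc.comm H H.2 H' H'.2, zero_lie, zero_add] at h2
      exact h2
    exact h1.map (Module.End.baseChangeHom ℝ ℂ m)
  have htop := Module.End.iSup_iInf_maxGenEigenspace_eq_top_of_iSup_maxGenEigenspace_eq_top_of_commute
    D (fun H H' _ => hcomm H H') (fun H => by
      simp only [(hss H).isFinitelySemisimple.maxGenEigenspace_eq_eigenspace]
      exact (hss H).iSup_eigenspace_eq_top)
  simp only [(hss _).isFinitelySemisimple.maxGenEigenspace_eq_eigenspace] at htop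
  set ι : ℂ ⊗[ℝ] m →ₗ[ℂ] ℂ ⊗[ℝ] L := m.toSubmodule.subtype.baseChange ℂ with hι
  have hιinj : Function.Injective ι := by
    intro x y hxy
    have h1 := congrArg reV hxy
    have h2 := congrArg imV hxy
    rw [hι, reV_baseChange, reV_baseChange] at h1
    rw [hι, imV_baseChange, imV_baseChange] at h2
    exact ext_re_im (Subtype.ext h1) (Subtype.ext h2)
  have hιD : ∀ (H : h) x, ι (D H x) = ⁅(1 : ℂ) ⊗ₜ[ℝ] (H : L), ι x⁆ := by
    intro H x
    apply ext_re_im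
    · simp [hι, D]
    · simp [hι, D]
  intro z hz
  obtain ⟨w, rfl⟩ : ∃ w, ι w = z := by
    rw [mem_baseChange_iff] at hz
    exact ⟨mkC ⟨reV z, hz.1⟩ ⟨imV z, hz.2⟩, by apply ext_re_im <;> simp [hι]⟩
  have hw : w ∈ ⨆ χ : h → ℂ, ⨅ H, (D H).eigenspace (χ H) := by rw [htop]; trivial
  refine (?_ : (⨆ χ : h → ℂ, ⨅ H, (D H).eigenspace (χ H)) ≤ (⨆ α, rootSpace m h α).comap ι) hw
  refine iSup_le fun χ w hw => ?_
  rw [Submodule.mem_iInf] at hw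
  have hw1 : ∀ H : h, ⁅(1 : ℂ) ⊗ₜ[ℝ] (H : L), ι w⁆ = χ H • ι w := by
    intro H
    rw [← hιD, Module.End.mem_eigenspace_iff.mp (hw H), map_smul]
  by_cases hw0 : ι w = 0
  · rw [Submodule.mem_comap, hw0]; exact Submodule.zero_mem _
  let α : CForm h :=
    { toFun := χ
      map_add' := fun H H' => by
        apply smul_left_injective ℂ hw0
        change χ (H + H') • ι w = (χ H + χ H') • ι w
        rw [add_smul, ← hw1, ← hw1, ← hw1]
        apply ext_re_im <;> simp
      map_smul' := fun c H => by
        apply smul_left_injective ℂ hw0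
        change χ (c • H) • ι w = (c • χ H) • ι w
        rw [smul_assoc, ← hw1, ← hw1]
        apply ext_re_im <;> simp }
  refine Submodule.mem_iSup_of_mem α (mem_rootSpace_iff.mpr ⟨⟨?_, ?_⟩, hw1⟩)
  · rw [hι, reV_baseChange]; exact (reV w).2
  · rw [hι, imV_baseChange]; exact (imV w).2

lemma CartanPair.iSupIndep_rootSpace (hc : CartanPair r B m h) :
    iSupIndep fun α : CForm h => rootSpace m h α := by
  let D : h → Module.End ℂ (ℂ ⊗[ℝ] L) := fun H =>
    LieAlgebra.ad ℂ (ℂ ⊗[ℝ] L) ((1 : ℂ) ⊗ₜ[ℝ] (H : L))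
  have hcomm : ∀ H H', Commute (D H) (D H') := by
    intro H H'
    ext x
    have h2 := leibniz_lie ((1 : ℂ) ⊗ₜ[ℝ] (H : L)) ((1 : ℂ) ⊗ₜ[ℝ] (H' : L)) ((1 : ℂ) ⊗ₜ[ℝ] x)
    have h3 : ⁅(1 : ℂ) ⊗ₜ[ℝ] (H : L), (1 : ℂ) ⊗ₜ[ℝ] (H' : L)⁆ = 0 := by
      apply ext_re_im <;> simp [hc.comm H H.2 H' H'.2]
    rw [h3, zero_lie, zero_add] at h2
    exact h2
  have h1 := Module.End.independent_iInf_maxGenEigenspace_of_forall_mapsTo D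
    (fun i j φ => Module.End.mapsTo_maxGenEigenspace_of_comm (hcomm j i) φ)
  have h2 := h1.comp (f := fun α : CForm h => (α : h → ℂ)) DFunLike.coe_injective
  refine h2.mono fun α => ?_
  refine inf_le_right.trans (iInf_mono fun H => ?_)
  exact Module.End.genEigenspace_le_maximal (D H) (α H) 1 

lemma CartanPair.finite_roots (hc : CartanPair r B m h) : {α | IsRoot m h α}.Finite :=
  (WellFoundedGT.finite_ne_bot_of_iSupIndep hc.iSupIndep_rootSpace).subset fun _ hα => hα.2

lemma CartanPair.mem_rootSpace_zero_iff (hc : CartanPair r B m h) {z : ℂ ⊗[ℝ] L} :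
    z ∈ rootSpace m h 0 ↔ reV z ∈ h ∧ imV z ∈ h := by
  rw [mem_rootSpace_iff]
  constructor
  · rintro ⟨⟨h1, h2⟩, h3⟩
    refine ⟨hc.self_centralizing _ h1 fun H hH => ?_, hc.self_centralizing _ h2 fun H hH => ?_⟩
    · have := congrArg reV (h3 ⟨H, hH⟩)
      simpa using this
    · have := congrArg imV (h3 ⟨H, hH⟩)
      simpa using this
  · rintro ⟨h1, h2⟩
    refine ⟨⟨hc.le h1, hc.le h2⟩, fun H => ?_⟩
    apply ext_re_im <;> simp [hc.comm H H.2 _ h1, hc.comm H H.2 _ h2]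

lemma CartanPair.bilC_rootSpace (hc : CartanPair r B m h) {α β : CForm h} (hαβ : α + β ≠ 0)
    {x y : ℂ ⊗[ℝ] L} (hx : x ∈ rootSpace m h α) (hy : y ∈ rootSpace m h β) : bilC B x y = 0 := by
  rw [mem_rootSpace_iff] at hx hy
  obtain ⟨H, hH⟩ : ∃ H, (α + β) H ≠ 0 := by
    by_contra hcon
    push Not at hcon
    exact hαβ (LinearMap.ext hcon)
  have h1 : bilC B ⁅(1 : ℂ) ⊗ₜ[ℝ] (H : L), x⁆ y = -bilC B x ⁅(1 : ℂ) ⊗ₜ[ℝ] (H : L), y⁆ := by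
    rw [← lie_skew, map_neg, LinearMap.neg_apply, bilC_invariant hc.invariant]
  rw [hx.2, hy.2, map_smul, map_smul, LinearMap.smul_apply, smul_eq_mul, smul_eq_mul] at h1
  have h2 : (α + β) H * bilC B x y = 0 := by
    rw [LinearMap.add_apply, add_mul, h1]; ring
  exact (mul_eq_zero.mp h2).resolve_left hH

lemma CartanPair.exists_bilC_ne_zero (hc : CartanPair r B m h) {α : CForm h}
    {x : ℂ ⊗[ℝ] L} (hx : x ∈ rootSpace m h α) (hx0 : x ≠ 0) :
    ∃ y ∈ rootSpace m h (-α), bilC B x y ≠ 0 := by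
  by_contra hcon
  push Not at hcon
  have h1 : m.toSubmodule.baseChange ℂ ≤ LinearMap.ker (bilC B x) := by
    refine hc.baseChange_le_iSup.trans (iSup_le fun β y hy => ?_)
    by_cases hβ : α + β = 0
    · rw [add_eq_zero_iff_neg_eq] at hβ
      exact hcon y (hβ ▸ hy)
    · exact hc.bilC_rootSpace hβ hx hy
  apply hx0
  have hxm := mem_baseChange_iff.mp (rootSpace_le_baseChange α hx)
  have h2 : ∀ Y ∈ m, bilC B x ((1 : ℂ) ⊗ₜ[ℝ] Y) = 0 := fun Y hY =>
    h1 (mem_baseChange_iff.mpr ⟨by simpa using hY, by simp⟩)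
  apply ext_re_im
  · rw [map_zero]
    refine hc.nondeg _ hxm.1 fun Y hY => ?_
    simpa using congrArg Complex.re (h2 Y hY)
  · rw [map_zero]
    refine hc.nondeg _ hxm.2 fun Y hY => ?_
    simpa using congrArg Complex.im (h2 Y hY)

lemma CartanPair.nondeg_cartan (hc : CartanPair r B m h) {H : L} (hH : H ∈ h)
    (h0 : ∀ Y ∈ h, B H Y = 0) : H = 0 := by
  obtain ⟨T, hT, A, hA, rfl, hT1, hA1⟩ := hc.decomp H hH
  have h1 : T = 0 := by
    by_contra hne
    have h2 := h0 T hT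
    rw [map_add, LinearMap.add_apply, hc.symm A T, hc.orth T hT hT1 A hA hA1, add_zero] at h2
    exact (hc.neg T hT hT1 hne).ne h2
  have h2 : A = 0 := by
    by_contra hne
    have h2 := h0 A hA
    rw [map_add, LinearMap.add_apply, hc.orth T hT hT1 A hA hA1, zero_add] at h2
    exact (hc.pos A hA hA1 hne).ne' h2
  rw [h1, h2, add_zero]

lemma CartanPair.exists_riesz (hc : CartanPair r B m h) (f : h →ₗ[ℝ] ℝ) :
    ∃ x : h, ∀ Y : h, B (x : L) Y = f Y := by
  let Φ : h →ₗ[ℝ] (h →ₗ[ℝ] ℝ) := B.compl₁₂ h.toSubmodule.subtype h.toSubmodule.subtype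
  have hinj : Function.Injective Φ := by
    rw [← LinearMap.ker_eq_bot, LinearMap.ker_eq_bot']
    intro x hx
    exact Subtype.ext (hc.nondeg_cartan x.2 fun Y hY => LinearMap.congr_fun hx ⟨Y, hY⟩)
  have hdim : Module.finrank ℝ h = Module.finrank ℝ (h →ₗ[ℝ] ℝ) :=
    (Subspace.dual_finrank_eq (K := ℝ) (V := h)).symm
  obtain ⟨x, hx⟩ := (LinearMap.injective_iff_surjective_of_finrank_eq_finrank hdim).mp hinj f
  exact ⟨x, fun Y => LinearMap.congr_fun hx Y⟩

/-- The element of `h` representing a real linear form. -/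
def riesz (B : LinearMap.BilinForm ℝ L) (h : LieSubalgebra ℝ L) (f : h →ₗ[ℝ] ℝ) : h :=
  Classical.epsilon fun x : h => ∀ Y : h, B (x : L) Y = f Y

lemma CartanPair.riesz_spec (hc : CartanPair r B m h) (f : h →ₗ[ℝ] ℝ) (Y : h) :
    B (riesz B h f : L) Y = f Y :=
  Classical.epsilon_spec (hc.exists_riesz f) Y

/-- The element of the complexification of `h` representing a form. -/
def tC (B : LinearMap.BilinForm ℝ L) {h : LieSubalgebra ℝ L} (β : CForm h) : ℂ ⊗[ℝ] L :=
  mkC (riesz B h (Complex.reLm ∘ₗ β) : L) (riesz B h (Complex.imLm ∘ₗ β) : L)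

lemma reV_tC_mem (β : CForm h) : reV (tC B β) ∈ h := by
  rw [tC, reV_mkC]; exact Subtype.mem _

lemma imV_tC_mem (β : CForm h) : imV (tC B β) ∈ h := by
  rw [tC, imV_mkC]; exact Subtype.mem _

lemma CartanPair.bilC_tC (hc : CartanPair r B m h) (β : CForm h) (H : h) :
    bilC B (tC B β) ((1 : ℂ) ⊗ₜ[ℝ] (H : L)) = β H := by
  apply Complex.ext
  · simp [tC, hc.riesz_spec]
  · simp [tC, hc.riesz_spec]

lemma CartanPair.ext_bilC (hc : CartanPair r B m h) {z w : ℂ ⊗[ℝ] L}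
    (hz : reV z ∈ h ∧ imV z ∈ h) (hw : reV w ∈ h ∧ imV w ∈ h)
    (h0 : ∀ H : h, bilC B z ((1 : ℂ) ⊗ₜ[ℝ] (H : L)) = bilC B w ((1 : ℂ) ⊗ₜ[ℝ] (H : L))) :
    z = w := by
  apply ext_re_im
  · rw [← sub_eq_zero]
    refine hc.nondeg_cartan (h.sub_mem hz.1 hw.1) fun Y hY => ?_
    have := congrArg Complex.re (h0 ⟨Y, hY⟩)
    rw [map_sub, LinearMap.sub_apply, sub_eq_zero]
    simpa using this
  · rw [← sub_eq_zero]
    refine hc.nondeg_cartan (h.sub_mem hz.2 hw.2) fun Y hY => ?_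
    have := congrArg Complex.im (h0 ⟨Y, hY⟩)
    rw [map_sub, LinearMap.sub_apply, sub_eq_zero]
    simpa using this

lemma CartanPair.tC_add (hc : CartanPair r B m h) (β γ : CForm h) :
    tC B (β + γ) = tC B β + tC B γ := by
  refine hc.ext_bilC ⟨reV_tC_mem _, imV_tC_mem _⟩ ⟨?_, ?_⟩ fun H => ?_
  · rw [map_add]; exact h.add_mem (reV_tC_mem _) (reV_tC_mem _)
  · rw [map_add]; exact h.add_mem (imV_tC_mem _) (imV_tC_mem _)
  · rw [map_add, LinearMap.add_apply, hc.bilC_tC, hc.bilC_tC, hc.bilC_tC, LinearMap.add_apply]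

lemma CartanPair.tC_smul (hc : CartanPair r B m h) (c : ℂ) (β : CForm h) :
    tC B (c • β) = c • tC B β := by
  refine hc.ext_bilC ⟨reV_tC_mem _, imV_tC_mem _⟩ ⟨?_, ?_⟩ fun H => ?_
  · rw [reV_smul]; exact h.sub_mem (h.smul_mem _ (reV_tC_mem _)) (h.smul_mem _ (imV_tC_mem _))
  · rw [imV_smul]; exact h.add_mem (h.smul_mem _ (imV_tC_mem _)) (h.smul_mem _ (reV_tC_mem _))
  · rw [map_smul, LinearMap.smul_apply, hc.bilC_tC, hc.bilC_tC, LinearMap.smul_apply]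

/-- The bilinear form on the forms on the complexification of `h` transported from `B`. -/
def bForm (hc : CartanPair r B m h) : LinearMap.BilinForm ℂ (CForm h) :=
  LinearMap.mk₂ ℂ (fun β γ => bilC B (tC B β) (tC B γ))
    (fun x y z => by rw [hc.tC_add, map_add, LinearMap.add_apply])
    (fun c x y => by rw [hc.tC_smul, map_smul, LinearMap.smul_apply])
    (fun x y z => by rw [hc.tC_add, map_add])
    (fun c x y => by rw [hc.tC_smul, map_smul])

lemma bForm_apply (hc : CartanPair r B m h) (β γ : CForm h) :
    bForm hc β γ = bilC B (tC B β) (tC B γ) := rfl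

lemma bForm_symm (hc : CartanPair r B m h) (β γ : CForm h) : bForm hc β γ = bForm hc γ β :=
  bilC_symm hc.symm _ _

/-- The value of the complex linear extension of a form. -/
lemma CartanPair.bilC_tC_eq_cext (hc : CartanPair r B m h) (β : CForm h) (z : ℂ ⊗[ℝ] h) :
    bilC B (tC B β) (h.toSubmodule.subtype.baseChange ℂ z) = cext h β z := by
  rw [cext_apply]
  have : h.toSubmodule.subtype.baseChange ℂ z =
      (1 : ℂ) ⊗ₜ[ℝ] ((reV z : h) : L) + Complex.I • ((1 : ℂ) ⊗ₜ[ℝ] ((imV z : h) : L)) := by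
    apply ext_re_im <;> simp
  rw [this, map_add, map_smul, hc.bilC_tC, hc.bilC_tC, smul_eq_mul]

lemma CartanPair.lie_rootSpace (hc : CartanPair r B m h) {z : ℂ ⊗[ℝ] L}
    (hz : reV z ∈ h ∧ imV z ∈ h) {α : CForm h} {x : ℂ ⊗[ℝ] L} (hx : x ∈ rootSpace m h α) :
    ⁅z, x⁆ = bilC B (tC B α) z • x := by
  rw [mem_rootSpace_iff] at hx
  have h1 : z = (1 : ℂ) ⊗ₜ[ℝ] ((⟨reV z, hz.1⟩ : h) : L) +
      Complex.I • ((1 : ℂ) ⊗ₜ[ℝ] ((⟨imV z, hz.2⟩ : h) : L)) := by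
    apply ext_re_im <;> simp
  rw [h1, add_lie, smul_lieC, hx.2, hx.2, map_add, map_smul, hc.bilC_tC, hc.bilC_tC, add_smul,
    smul_assoc]

lemma CartanPair.lie_tC (hc : CartanPair r B m h) (β : CForm h) {α : CForm h} {x : ℂ ⊗[ℝ] L}
    (hx : x ∈ rootSpace m h α) : ⁅tC B β, x⁆ = bForm hc β α • x := by
  rw [hc.lie_rootSpace ⟨reV_tC_mem _, imV_tC_mem _⟩ hx, bForm_symm]
  rfl

lemma CartanPair.lie_root_neg (hc : CartanPair r B m h) {α : CForm h} {x y : ℂ ⊗[ℝ] L}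
    (hx : x ∈ rootSpace m h α) (hy : y ∈ rootSpace m h (-α)) :
    ⁅x, y⁆ = bilC B x y • tC B α := by
  have h1 : ⁅x, y⁆ ∈ rootSpace m h 0 := by
    have := lie_mem_rootSpace hx hy
    rwa [add_neg_cancel] at this
  refine hc.ext_bilC (hc.mem_rootSpace_zero_iff.mp h1) ?_ fun H => ?_
  · rw [reV_smul, imV_smul]
    exact ⟨h.sub_mem (h.smul_mem _ (reV_tC_mem _)) (h.smul_mem _ (imV_tC_mem _)),
      h.add_mem (h.smul_mem _ (imV_tC_mem _)) (h.smul_mem _ (reV_tC_mem _))⟩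
  · rw [map_smul, LinearMap.smul_apply, hc.bilC_tC, bilC_invariant hc.invariant, ← lie_skew,
      (mem_rootSpace_iff.mp hy).2]
    simp [mul_comm]

end Roots

section RealDual

variable {L : Type*} [LieRing L] [LieAlgebra ℝ L] [FiniteDimensional ℝ L] {n : ℕ}
  {r : L →ₗ[ℝ] Matrix (Fin n) (Fin n) ℝ} {B : LinearMap.BilinForm ℝ L}
  {m h : LieSubalgebra ℝ L}

variable (r h) in
/-- The real vector space of forms that are imaginary on elliptic and real on hyperbolic
elements. -/
def realSub : Submodule ℝ (CForm h) where
  carrier := realDual r h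
  add_mem' := fun {β γ} hβ hγ => ⟨fun X hX => by simp [hβ.1 X hX, hγ.1 X hX],
    fun X hX => by simp [hβ.2 X hX, hγ.2 X hX]⟩
  zero_mem' := ⟨fun X hX => by simp, fun X hX => by simp⟩
  smul_mem' := fun c β hβ => ⟨fun X hX => by simp [hβ.1 X hX], fun X hX => by simp [hβ.2 X hX]⟩

lemma CartanPair.hyperbolic_reV_tC (hc : CartanPair r B m h) {β : CForm h}
    (hβ : β ∈ realSub r h) : IsInfHyperbolic r (reV (tC B β)) := by
  obtain ⟨T, hT, A, hA, hTA, hT1, hA1⟩ := hc.decomp _ (reV_tC_mem (B := B) β)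
  have h1 : T = 0 := by
    by_contra hne
    have h2 := hc.neg T hT hT1 hne
    have h3 := congrArg Complex.re (hc.bilC_tC β ⟨T, hT⟩)
    rw [hβ.1 ⟨T, hT⟩ hT1] at h3
    simp [hTA, hc.symm A T, hc.orth T hT hT1 A hA hA1] at h3
    exact h2.ne h3
  rw [hTA, h1, zero_add]; exact hA1

lemma CartanPair.elliptic_imV_tC (hc : CartanPair r B m h) {β : CForm h}
    (hβ : β ∈ realSub r h) : IsInfElliptic r (imV (tC B β)) := by
  obtain ⟨T, hT, A, hA, hTA, hT1, hA1⟩ := hc.decomp _ (imV_tC_mem (B := B) β)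
  have h1 : A = 0 := by
    by_contra hne
    have h2 := hc.pos A hA hA1 hne
    have h3 := congrArg Complex.im (hc.bilC_tC β ⟨A, hA⟩)
    rw [hβ.2 ⟨A, hA⟩ hA1] at h3
    simp [hTA, hc.orth T hT hT1 A hA hA1] at h3
    exact h2.ne' h3
  rw [hTA, h1, add_zero]; exact hT1

lemma bForm_im (hc : CartanPair r B m h) {β γ : CForm h} (hβ : β ∈ realSub r h)
    (hγ : γ ∈ realSub r h) : (bForm hc β γ).im = 0 := by
  rw [bForm_apply, bilC_im, hc.orth _ (imV_tC_mem _) (hc.elliptic_imV_tC hβ) _ (reV_tC_mem _)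
    (hc.hyperbolic_reV_tC hγ), hc.symm, hc.orth _ (imV_tC_mem _) (hc.elliptic_imV_tC hγ) _
    (reV_tC_mem _) (hc.hyperbolic_reV_tC hβ), add_zero]

lemma bForm_re_pos (hc : CartanPair r B m h) {β : CForm h} (hβ : β ∈ realSub r h) (h0 : β ≠ 0) :
    0 < (bForm hc β β).re := by
  rw [bForm_apply, bilC_re]
  have h1 : 0 ≤ B (reV (tC B β)) (reV (tC B β)) := by
    by_cases h2 : reV (tC B β) = 0
    · simp [h2]
    · exact (hc.pos _ (reV_tC_mem _) (hc.hyperbolic_reV_tC hβ) h2).le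
  have h1' : B (imV (tC B β)) (imV (tC B β)) ≤ 0 := by
    by_cases h2 : imV (tC B β) = 0
    · simp [h2]
    · exact (hc.neg _ (imV_tC_mem _) (hc.elliptic_imV_tC hβ) h2).le
  by_contra hcon
  apply h0
  have h3 : reV (tC B β) = 0 := by
    by_contra h2
    have := hc.pos _ (reV_tC_mem _) (hc.hyperbolic_reV_tC hβ) h2
    linarith
  have h4 : imV (tC B β) = 0 := by
    by_contra h2
    have := hc.neg _ (imV_tC_mem _) (hc.elliptic_imV_tC hβ) h2
    linarith
  ext H
  rw [← hc.bilC_tC, ext_re_im (z := tC B β) (w := 0) (by simpa using h3) (by simpa using h4)]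
  simp

/-- The matrix over `ℂ` representing an element of the complexified Lie algebra. -/
def repC (r : L →ₗ[ℝ] Matrix (Fin n) (Fin n) ℝ) (z : ℂ ⊗[ℝ] L) : Matrix (Fin n) (Fin n) ℂ :=
  toC (r (reV z)) + Complex.I • toC (r (imV z))

lemma IsInvariantPair.repC_injective (hr : IsInvariantPair r B) :
    Function.Injective (repC r) := by
  intro z w hzw
  apply ext_re_im <;> apply hr.inj <;> ext i j
  · simpa [repC] using congrArg Complex.re (congrFun (congrFun hzw i) j)
  · simpa [repC] using congrArg Complex.im (congrFun (congrFun hzw i) j)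

lemma IsInvariantPair.repC_rootSpace (hr : IsInvariantPair r B) {α : CForm h} {x : ℂ ⊗[ℝ] L}
    (hx : x ∈ rootSpace m h α) (H : h) :
    toC (r H) * repC r x - repC r x * toC (r H) = α H • repC r x := by
  have h1 := (mem_rootSpace_iff.mp hx).2 H
  have h2 : r ⁅(H : L), reV x⁆ = (α H).re • r (reV x) - (α H).im • r (imV x) := by
    have := congrArg (fun z => r (reV z)) h1
    simpa using this
  have h3 : r ⁅(H : L), imV x⁆ = (α H).re • r (imV x) + (α H).im • r (reV x) := by
    have := congrArg (fun z => r (imV z)) h1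
    simpa using this
  rw [hr.lie] at h2 h3
  have h4 := congrArg toC h2
  have h5 := congrArg toC h3
  have toC_sub : ∀ A C : Matrix (Fin n) (Fin n) ℝ, toC (A - C) = toC A - toC C :=
    fun A C => map_sub (Complex.ofRealHom.mapMatrix (m := Fin n)) A C
  rw [toC_sub, toC_mul, toC_mul, toC_sub, toC_smul, toC_smul] at h4
  rw [toC_sub, toC_mul, toC_mul, toC_add, toC_smul, toC_smul] at h5
  have h6 : toC (r H) * repC r x - repC r x * toC (r H) =
      (toC (r H) * toC (r (reV x)) - toC (r (reV x)) * toC (r H)) +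
        Complex.I • (toC (r H) * toC (r (imV x)) - toC (r (imV x)) * toC (r H)) := by
    rw [repC, mul_add, add_mul, mul_smul_comm, smul_mul_assoc, smul_sub]; abel
  rw [h6, h4, h5, repC]
  ext i j
  simp only [Matrix.add_apply, Matrix.sub_apply, Matrix.smul_apply, smul_eq_mul]
  conv_rhs => rw [← Complex.re_add_im (α H)]
  linear_combination (-(α H).im * toC (r (imV x)) i j) * Complex.I_sq

lemma CartanPair.eigenvalue_root (hc : CartanPair r B m h) {α : CForm h} {x : ℂ ⊗[ℝ] L}
    (hx : x ∈ rootSpace m h α) (hx0 : x ≠ 0) (H : h) :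
    ∃ a b, IsComplexEigenvalue (r H) a ∧ IsComplexEigenvalue (r H) b ∧ α H = a - b := by
  refine eigenvalue_commutator (fun h0 => hx0 (hc.repC_injective (h0.trans ?_)))
    (hc.repC_rootSpace hx H)
  ext i j
  simp [repC]

lemma CartanPair.root_mem_realSub (hc : CartanPair r B m h) {α : CForm h}
    (hα : rootSpace m h α ≠ ⊥) : α ∈ realSub r h := by
  obtain ⟨x, hx, hx0⟩ := Submodule.exists_mem_ne_zero_of_ne_bot hα
  constructor
  · intro X hX
    obtain ⟨a, b, ha, hb, hab⟩ := hc.eigenvalue_root hx hx0 X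
    rw [hab, Complex.sub_re, hX.2 a ha, hX.2 b hb, sub_zero]
  · intro X hX
    obtain ⟨a, b, ha, hb, hab⟩ := hc.eigenvalue_root hx hx0 X
    rw [hab, Complex.sub_im, hX.2 a ha, hX.2 b hb, sub_zero]

lemma bForm_root_ne_zero (hc : CartanPair r B m h) {α : CForm h} (hα : IsRoot m h α) :
    bForm hc α α ≠ 0 := fun h0 => by
  have := bForm_re_pos hc (hc.root_mem_realSub hα.2) hα.1
  rw [h0] at this
  exact lt_irrefl _ this

lemma CartanPair.isRoot_neg (hc : CartanPair r B m h) {α : CForm h} (hα : IsRoot m h α) :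
    IsRoot m h (-α) := by
  obtain ⟨x, hx, hx0⟩ := Submodule.exists_mem_ne_zero_of_ne_bot hα.2
  obtain ⟨y, hy, hxy⟩ := hc.exists_bilC_ne_zero hx hx0
  refine ⟨neg_ne_zero.mpr hα.1, ?_⟩
  intro h0
  rw [h0, Submodule.mem_bot] at hy
  apply hxy; rw [hy, map_zero]

lemma CartanPair.coroot_eq (hc : CartanPair r B m h) {α : CForm h} (hα : IsRoot m h α) :
    h.toSubmodule.subtype.baseChange ℂ (coroot m h α) = (2 / bForm hc α α) • tC B α := by
  set S := Submodule.span ℂ {z : ℂ ⊗[ℝ] L | ∃ x ∈ rootSpace m h α, ∃ y ∈ rootSpace m h (-α),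
        LieAlgebra.ad ℂ (ℂ ⊗[ℝ] L) x y = z} with hS
  have h1 : tC B α ∈ S := by
    obtain ⟨x, hx, hx0⟩ := Submodule.exists_mem_ne_zero_of_ne_bot hα.2
    obtain ⟨y, hy, hxy⟩ := hc.exists_bilC_ne_zero hx hx0
    have h2 : ⁅x, y⁆ ∈ S := Submodule.subset_span ⟨x, hx, y, hy, rfl⟩
    rw [hc.lie_root_neg hx hy] at h2
    exact (Submodule.smul_mem_iff _ hxy).mp h2
  have h2 : ∀ z ∈ S, ∃ c : ℂ, z = c • tC B α := by
    intro z hz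
    have : S ≤ Submodule.span ℂ {tC B α} := by
      rw [hS, Submodule.span_le]
      rintro _ ⟨x, hx, y, hy, rfl⟩
      exact Submodule.mem_span_singleton.mpr ⟨_, (hc.lie_root_neg hx hy).symm⟩
    obtain ⟨c, hc'⟩ := Submodule.mem_span_singleton.mp (this hz)
    exact ⟨c, hc'.symm⟩
  have hb := bForm_root_ne_zero hc hα
  have hex : ∃ H, IsCoroot m h α H := by
    have h4 : h.toSubmodule.subtype.baseChange ℂ
        ((2 / bForm hc α α) • mkC ⟨_, reV_tC_mem (B := B) α⟩ ⟨_, imV_tC_mem (B := B) α⟩) =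
        (2 / bForm hc α α) • tC B α := by
      rw [map_smul]; congr 1
      apply ext_re_im <;> simp
    refine ⟨(2 / bForm hc α α) • mkC ⟨_, reV_tC_mem (B := B) α⟩ ⟨_, imV_tC_mem (B := B) α⟩,
      ?_, ?_⟩
    · rw [h4]; exact S.smul_mem _ h1
    · rw [← hc.bilC_tC_eq_cext, h4, map_smul, smul_eq_mul, ← bForm_apply hc]
      field_simp
  have hcor : IsCoroot m h α (coroot m h α) := Classical.epsilon_spec hex
  obtain ⟨c, hc'⟩ := h2 _ hcor.1
  have h3 := hcor.2
  rw [← hc.bilC_tC_eq_cext, hc', map_smul, smul_eq_mul, ← bForm_apply hc] at h3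
  rw [hc', ← h3, mul_div_cancel_right₀ _ hb]

lemma CartanPair.pair_eq (hc : CartanPair r B m h) {α : CForm h} (hα : IsRoot m h α)
    (β : CForm h) : pair m h β α = 2 * bForm hc β α / bForm hc α α := by
  rw [pair, ← hc.bilC_tC_eq_cext, hc.coroot_eq hα, map_smul, smul_eq_mul, ← bForm_apply hc]
  ring

end RealDual

section Sl2

variable {L : Type*} [LieRing L] [LieAlgebra ℝ L] [FiniteDimensional ℝ L] {n : ℕ}
  {r : L →ₗ[ℝ] Matrix (Fin n) (Fin n) ℝ} {B : LinearMap.BilinForm ℝ L}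
  {m h : LieSubalgebra ℝ L}

lemma CartanPair.exists_sl2 (hc : CartanPair r B m h) {α : CForm h} (hα : IsRoot m h α)
    {x : ℂ ⊗[ℝ] L} (hx : x ∈ rootSpace m h α) (hx0 : x ≠ 0) :
    ∃ y ∈ rootSpace m h (-α), IsSl2Triple ((2 / bForm hc α α) • tC B α) x y := by
  obtain ⟨y, hy, hxy⟩ := hc.exists_bilC_ne_zero hx hx0
  have hb := bForm_root_ne_zero hc hα
  set c := 2 / bForm hc α α / bilC B x y with hcdef
  have hy' : c • y ∈ rootSpace m h (-α) := Submodule.smul_mem _ _ hy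
  refine ⟨c • y, hy', ?_, ?_, ?_, ?_⟩
  · intro h0
    rcases smul_eq_zero.mp h0 with h1 | h1
    · exact div_ne_zero two_ne_zero hb h1
    · apply hb; rw [bForm_apply, h1, map_zero]
  · rw [hc.lie_root_neg hx hy', map_smul, smul_eq_mul, hcdef, div_mul_cancel₀ _ hxy]
  · rw [smul_lieC, hc.lie_tC _ hx, smul_smul, div_mul_cancel₀ _ hb]
    rw [two_smul, two_nsmul]
  · rw [smul_lieC, hc.lie_tC _ hy', map_neg, neg_smul, smul_neg, smul_smul, div_mul_cancel₀ _ hb]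
    rw [two_smul, two_nsmul]

lemma CartanPair.string_of_primitive (hc : CartanPair r B m h) {α γ : CForm h}
    {x y v : ℂ ⊗[ℝ] L} (hy : y ∈ rootSpace m h (-α))
    (t : IsSl2Triple ((2 / bForm hc α α) • tC B α) x y) (hv : v ∈ rootSpace m h γ) (hv0 : v ≠ 0)
    (hxv : ⁅x, v⁆ = 0) :
    t.HasPrimitiveVectorWith v (2 / bForm hc α α * bForm hc α γ) ∧
    ∃ N : ℕ, 2 / bForm hc α α * bForm hc α γ = N ∧ ∀ k ≤ N,
      ((LieModule.toEnd ℂ (ℂ ⊗[ℝ] L) (ℂ ⊗[ℝ] L) y) ^ k) v ∈ rootSpace m h (γ - (k : ℂ) • α) ∧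
      ((LieModule.toEnd ℂ (ℂ ⊗[ℝ] L) (ℂ ⊗[ℝ] L) y) ^ k) v ≠ 0 := by
  have P : t.HasPrimitiveVectorWith v (2 / bForm hc α α * bForm hc α γ) :=
    ⟨hv0, by rw [smul_lieC, hc.lie_tC _ hv, smul_smul], hxv⟩
  refine ⟨P, ?_⟩
  obtain ⟨N, hN⟩ := P.exists_nat
  refine ⟨N, hN, fun k hk => ⟨?_, P.pow_toEnd_f_ne_zero_of_eq_nat hN hk⟩⟩
  clear hk
  induction k with
  | zero => simpa using hv
  | succ k ih =>
    rw [pow_succ', Module.End.mul_apply, LieModule.toEnd_apply_apply]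
    have := lie_mem_rootSpace hy ih
    have e : γ - ((k + 1 : ℕ) : ℂ) • α = -α + (γ - (k : ℂ) • α) := by push_cast; module
    rw [e]; exact this

lemma CartanPair.exists_top (hc : CartanPair r B m h) {α β : CForm h} (hα : IsRoot m h α)
    (hβ : rootSpace m h β ≠ ⊥) : ∃ p : ℕ, rootSpace m h (β + (p : ℂ) • α) ≠ ⊥ ∧
      rootSpace m h (α + (β + (p : ℂ) • α)) = ⊥ := by
  have hfin : {γ | rootSpace m h γ ≠ ⊥}.Finite :=
    WellFoundedGT.finite_ne_bot_of_iSupIndep hc.iSupIndep_rootSpace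
  have hinj : Function.Injective fun p : ℕ => β + (p : ℂ) • α := by
    intro p q hpq
    have h1 := smul_left_injective ℂ hα.1 (add_left_cancel hpq)
    exact_mod_cast h1
  have hex : ∃ p : ℕ, rootSpace m h (β + (p : ℂ) • α) = ⊥ := by
    by_contra hcon
    push Not at hcon
    exact Set.infinite_of_injective_forall_mem hinj hcon hfin
  classical
  obtain ⟨p, hp⟩ : ∃ p, Nat.find hex = p + 1 := by
    refine Nat.exists_eq_succ_of_ne_zero fun h0 => ?_
    have := Nat.find_spec hex
    rw [h0] at this
    apply hβ; simpa using this
  refine ⟨p, Nat.find_min hex (by omega), ?_⟩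
  have := Nat.find_spec hex
  rw [hp] at this
  rw [← this]; congr 1
  push_cast; module

/-- The `α`-string through `β`. -/
lemma CartanPair.exists_string (hc : CartanPair r B m h) {α β : CForm h} (hα : IsRoot m h α)
    (hβ : rootSpace m h β ≠ ⊥) : ∃ p N : ℕ,
      2 / bForm hc α α * bForm hc α β = (N : ℂ) - 2 * p ∧
      ∀ k : ℕ, k ≤ N → rootSpace m h (β + ((p : ℂ) - k) • α) ≠ ⊥ := by
  obtain ⟨p, hp1, hp2⟩ := hc.exists_top hα hβ
  obtain ⟨x, hx, hx0⟩ := Submodule.exists_mem_ne_zero_of_ne_bot hα.2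
  obtain ⟨v, hv, hv0⟩ := Submodule.exists_mem_ne_zero_of_ne_bot hp1
  obtain ⟨y, hy, t⟩ := hc.exists_sl2 hα hx hx0
  have hxv : ⁅x, v⁆ = 0 := by
    have := lie_mem_rootSpace hx hv
    rwa [hp2, Submodule.mem_bot] at this
  obtain ⟨-, N, hN, hk⟩ := hc.string_of_primitive hy t hv hv0 hxv
  have hb := bForm_root_ne_zero hc hα
  refine ⟨p, N, ?_, fun k hkN => ?_⟩
  · rw [← hN, map_add, map_smul, smul_eq_mul]
    field_simp; ring
  · have h1 := hk k hkN
    intro h0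
    rw [show β + (p : ℂ) • α - (k : ℂ) • α = β + ((p : ℂ) - k) • α by module, h0,
      Submodule.mem_bot] at h1
    exact h1.2 h1.1

lemma CartanPair.rootSpace_reflect (hc : CartanPair r B m h) {α β : CForm h} (hα : IsRoot m h α)
    (hβ : rootSpace m h β ≠ ⊥) :
    rootSpace m h (β - (2 * bForm hc β α / bForm hc α α) • α) ≠ ⊥ := by
  have key : ∀ α, IsRoot m h α → ∀ p N : ℕ, p ≤ N →
      2 / bForm hc α α * bForm hc α β = (N : ℂ) - 2 * p →
      (∀ k : ℕ, k ≤ N → rootSpace m h (β + ((p : ℂ) - k) • α) ≠ ⊥) →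
      rootSpace m h (β - (2 * bForm hc β α / bForm hc α α) • α) ≠ ⊥ := by
    intro α hα p N hpN h1 h2
    have h3 := h2 (N - p) (Nat.sub_le _ _)
    convert h3 using 2
    rw [bForm_symm hc β α, mul_div_right_comm, h1, sub_eq_add_neg β, ← neg_smul]
    congr 2
    push_cast [hpN]; ring
  obtain ⟨p, N, h1, h2⟩ := hc.exists_string hα hβ
  rcases le_or_gt p N with hpN | hpN
  · exact key α hα p N hpN h1 h2
  · have hα' := hc.isRoot_neg hα
    obtain ⟨p', N', h1', h2'⟩ := hc.exists_string hα' hβ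
    have h3 : ((N' : ℂ) - 2 * p') = -((N : ℂ) - 2 * p) := by
      rw [← h1, ← h1']; simp
    have h4 : (N' : ℤ) - 2 * p' = -((N : ℤ) - 2 * p) := by exact_mod_cast h3
    have h5 := key (-α) hα' p' N' (by omega) h1' h2'
    convert h5 using 2
    simp [sub_eq_add_neg, neg_div]

lemma CartanPair.rootSpace_sub (hc : CartanPair r B m h) {α β : CForm h} (hα : IsRoot m h α)
    (hβ : rootSpace m h β ≠ ⊥) (hpos : 0 < (bForm hc α β).re) :
    rootSpace m h (β - α) ≠ ⊥ := by
  obtain ⟨p, N, h1, h2⟩ := hc.exists_string hα hβ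
  have h3 := bForm_re_pos hc (hc.root_mem_realSub hα.2) hα.1
  have h4 := bForm_im hc (hc.root_mem_realSub hα.2) (hc.root_mem_realSub hα.2)
  have h5 := bForm_im hc (hc.root_mem_realSub hα.2) (hc.root_mem_realSub hβ)
  have h6 : (2 / (bForm hc α α).re * (bForm hc α β).re : ℝ) = (N : ℝ) - 2 * p := by
    have e1 : bForm hc α α = ((bForm hc α α).re : ℂ) := Complex.ext (by simp) (by simp [h4])
    have e2 : bForm hc α β = ((bForm hc α β).re : ℂ) := Complex.ext (by simp) (by simp [h5])
    rw [e1, e2] at h1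
    exact_mod_cast h1
  have h7 : (0 : ℝ) < (N : ℝ) - 2 * p := by rw [← h6]; positivity
  have h8 : 2 * p < N := by
    have : (2 * p : ℝ) < N := by linarith
    exact_mod_cast this
  have h9 := h2 (p + 1) (by omega)
  convert h9 using 2
  push_cast
  module

lemma CartanPair.rootSpace_one_dim (hc : CartanPair r B m h) {α : CForm h} (hα : IsRoot m h α)
    {x v : ℂ ⊗[ℝ] L} (hx : x ∈ rootSpace m h α) (hx0 : x ≠ 0) (hv : v ∈ rootSpace m h α) :
    ∃ c : ℂ, v = c • x := by
  obtain ⟨y, hy, hxy⟩ := hc.exists_bilC_ne_zero hx hx0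
  have hy0 : y ≠ 0 := by rintro rfl; simp at hxy
  set u := v - (bilC B v y / bilC B x y) • x with hu
  have hum : u ∈ rootSpace m h (-(-α)) := by
    rw [neg_neg]; exact Submodule.sub_mem _ hv (Submodule.smul_mem _ _ hx)
  by_cases hu0 : u = 0
  · exact ⟨_, sub_eq_zero.mp hu0⟩
  exfalso
  have h1 : ⁅y, u⁆ = 0 := by
    rw [hc.lie_root_neg hy hum, bilC_symm hc.symm, hu, map_sub, map_smul, LinearMap.sub_apply,
      LinearMap.smul_apply, smul_eq_mul, div_mul_cancel₀ _ hxy, sub_self, zero_smul]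
  obtain ⟨y', hy', t⟩ := hc.exists_sl2 (hc.isRoot_neg hα) hy hy0
  rw [neg_neg] at hum
  obtain ⟨-, N, hN, -⟩ := hc.string_of_primitive hy' t hum hu0 h1
  have hb := bForm_root_ne_zero hc hα
  have h2 : ((N : ℂ) + 2) = 0 := by
    rw [← hN]; simp only [map_neg, LinearMap.neg_apply, neg_neg]; field_simp; ring
  have h3 : ((N + 2 : ℕ) : ℂ) = 0 := by push_cast; exact h2
  exact absurd (Nat.cast_eq_zero.mp h3) (by omega)

lemma CartanPair.rootSpace_two_smul (hc : CartanPair r B m h) {α : CForm h} (hα : IsRoot m h α) :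
    rootSpace m h (α + α) = ⊥ := by
  by_contra hcon
  obtain ⟨p, hp1, hp2⟩ := hc.exists_top hα hcon
  obtain ⟨x, hx, hx0⟩ := Submodule.exists_mem_ne_zero_of_ne_bot hα.2
  obtain ⟨v, hv, hv0⟩ := Submodule.exists_mem_ne_zero_of_ne_bot hp1
  obtain ⟨y, hy, t⟩ := hc.exists_sl2 hα hx hx0
  have hxv : ⁅x, v⁆ = 0 := by
    have := lie_mem_rootSpace hx hv
    rwa [hp2, Submodule.mem_bot] at this
  have hb := bForm_root_ne_zero hc hα
  obtain ⟨P, N, hN, hk⟩ := hc.string_of_primitive hy t hv hv0 hxv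
  have h1 : (N : ℂ) = 2 * (p + 2) := by
    rw [← hN, map_add, map_smul, smul_eq_mul, map_add]; field_simp; ring
  have h2 : N = 2 * (p + 2) := by exact_mod_cast h1
  have h3 := (hk (p + 1) (by omega)).1
  rw [show α + α + (p : ℂ) • α - ((p + 1 : ℕ) : ℂ) • α = α by push_cast; module] at h3
  obtain ⟨c, h4⟩ := hc.rootSpace_one_dim hα hx hx0 h3
  have h5 := P.lie_e_pow_succ_toEnd_f p
  rw [h4, lie_smulC, lie_self, smul_zero, hN, h1] at h5
  rcases smul_eq_zero.mp h5.symm with h6 | h6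
  · have h7 : (((p + 1) * (p + 4) : ℕ) : ℂ) = 0 := by
      push_cast; linear_combination h6
    have := Nat.cast_eq_zero.mp h7
    rcases Nat.mul_eq_zero.mp this with h | h <;> omega
  · exact (hk p (by omega)).2 h6

end Sl2

section Compact

lemma su2_entries {A : Matrix (Fin 2) (Fin 2) ℂ} (hA : A ∈ su2) :
    A 0 0 = Complex.I * (A 0 0).im ∧ A 1 0 = -star (A 0 1) ∧ A 1 1 = -A 0 0 := by
  obtain ⟨h1, h2⟩ := hA
  have e00 := congrFun (congrFun h1 0) 0
  have e10 := congrFun (congrFun h1 1) 0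
  simp only [Matrix.conjTranspose_apply, Matrix.neg_apply] at e00 e10
  rw [Matrix.trace_fin_two] at h2
  refine ⟨?_, by rw [e10, neg_neg], by linear_combination h2⟩
  have h3 := congrArg Complex.re e00
  simp at h3
  apply Complex.ext <;> simp
  linarith

lemma su2_trace_sq {A : Matrix (Fin 2) (Fin 2) ℂ} (hA : A ∈ su2) :
    (A * A).trace.re = -2 * (Complex.normSq (A 0 0) + Complex.normSq (A 0 1)) := by
  obtain ⟨h1, h2, h3⟩ := su2_entries hA
  have h4 : (A 0 0).re = 0 := by rw [h1]; simp
  rw [Matrix.trace_fin_two, Matrix.mul_apply, Matrix.mul_apply, Fin.sum_univ_two, Fin.sum_univ_two,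
    h2, h3]
  simp [Complex.normSq_apply, h4]
  ring

lemma su2_eq_zero {A : Matrix (Fin 2) (Fin 2) ℂ} (hA : A ∈ su2) (h00 : A 0 0 = 0)
    (h01 : A 0 1 = 0) : A = 0 := by
  obtain ⟨-, h2, h3⟩ := su2_entries hA
  ext i j
  fin_cases i <;> fin_cases j <;> simp [h00, h01, h2, h3]

lemma commutator_mem_su2 {A C : Matrix (Fin 2) (Fin 2) ℂ} (hA : A ∈ su2) (hC : C ∈ su2) :
    A * C - C * A ∈ su2 := by
  constructor
  · rw [Matrix.conjTranspose_sub, Matrix.conjTranspose_mul, Matrix.conjTranspose_mul, hA.1, hC.1]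
    noncomm_ring
  · rw [Matrix.trace_sub, Matrix.trace_mul_comm, sub_self]

/-- In `su(2)` the square of an adjoint map has no positive eigenvalue. -/
lemma su2_not_pos {A C : Matrix (Fin 2) (Fin 2) ℂ} (hA : A ∈ su2) (hC : C ∈ su2) (hC0 : C ≠ 0)
    {μ : ℝ} (hμ : 0 < μ)
    (h : A * (A * C - C * A) - (A * C - C * A) * A = (μ : ℂ) • C) : False := by
  have hD := commutator_mem_su2 hA hC
  set D := A * C - C * A with hDdef
  have h1 : ((A * D - D * A) * C).trace = -(D * D).trace := by
    have e1 : (A * D * C).trace = (D * (C * A)).trace := by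
      rw [Matrix.mul_assoc, Matrix.trace_mul_comm, Matrix.mul_assoc]
    have e2 : D * D = D * (A * C) - D * (C * A) := by
      nth_rewrite 2 [hDdef]; rw [mul_sub]
    rw [sub_mul, Matrix.trace_sub, e1, e2, Matrix.trace_sub, Matrix.mul_assoc]; ring
  rw [h, Matrix.smul_mul, Matrix.trace_smul] at h1
  have h2 := congrArg Complex.re h1
  rw [smul_eq_mul, Complex.re_ofReal_mul, Complex.neg_re, su2_trace_sq hC, su2_trace_sq hD] at h2
  have h3 := Complex.normSq_nonneg (D 0 0)
  have h4 := Complex.normSq_nonneg (D 0 1)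
  have h5 := Complex.normSq_nonneg (C 0 0)
  have h6 := Complex.normSq_nonneg (C 0 1)
  have h7 : Complex.normSq (C 0 0) + Complex.normSq (C 0 1) = 0 := by
    by_contra hne
    have h8 : 0 < Complex.normSq (C 0 0) + Complex.normSq (C 0 1) :=
      lt_of_le_of_ne (by positivity) (Ne.symm hne)
    nlinarith [mul_pos hμ h8]
  exact hC0 (su2_eq_zero hC (Complex.normSq_eq_zero.mp (by linarith))
    (Complex.normSq_eq_zero.mp (by linarith)))

lemma lie_three {L : Type*} [LieRing L] [LieAlgebra ℝ L] (T u v : L) (a p q a' p' q' : ℝ) :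
    ⁅a • T + p • u + q • v, a' • T + p' • u + q' • v⁆ =
      (a * p' - a' * p) • ⁅T, u⁆ + (a * q' - a' * q) • ⁅T, v⁆ + (p * q' - p' * q) • ⁅u, v⁆ := by
  simp only [lie_add, add_lie, lie_smul, smul_lie, lie_self, smul_zero, ← lie_skew T u,
    ← lie_skew T v, ← lie_skew u v]
  module

/-- A three-dimensional Lie algebra of compact type is isomorphic to `su(2)`. -/
lemma exists_su2_equiv {L : Type*} [LieRing L] [LieAlgebra ℝ L] {T u v : L} {b N : ℝ}
    (hb : 0 < b) (hN : N < 0) (hTu : ⁅T, u⁆ = b • v) (hTv : ⁅T, v⁆ = -(b • u))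
    (huv : ⁅u, v⁆ = -((2 * N) • T))
    (hind : ∀ a p q : ℝ, a • T + p • u + q • v = 0 → a = 0 ∧ p = 0 ∧ q = 0) :
    ∃ s : LieSubalgebra ℝ L, (∀ X, X ∈ s ↔ ∃ a p q : ℝ, X = a • T + p • u + q • v) ∧
      ∃ ψ : s ≃ₗ[ℝ] su2, ∀ X Y : s,
        (ψ ⁅X, Y⁆ : Matrix (Fin 2) (Fin 2) ℂ) = ψ X * ψ Y - ψ Y * ψ X := by
  obtain ⟨l, hl0, hl⟩ : ∃ l : ℝ, 0 < l ∧ l * l = -N * b / 2 := by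
    have : 0 < -N * b / 2 := by nlinarith
    exact ⟨Real.sqrt (-N * b / 2), Real.sqrt_pos.mpr this, Real.mul_self_sqrt this.le⟩
  let f : su2 →ₗ[ℝ] L :=
    { toFun := fun A => ((A : Matrix (Fin 2) (Fin 2) ℂ) 0 0).im • ((2 / b) • T) +
        ((A : Matrix (Fin 2) (Fin 2) ℂ) 0 1).re • (l⁻¹ • u) +
        ((A : Matrix (Fin 2) (Fin 2) ℂ) 0 1).im • (l⁻¹ • v)
      map_add' := fun A C => by simp; module
      map_smul' := fun c A => by simp; module }
  have hf : ∀ A : su2, f A = (((A : Matrix (Fin 2) (Fin 2) ℂ) 0 0).im * (2 / b)) • T +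
        (((A : Matrix (Fin 2) (Fin 2) ℂ) 0 1).re * l⁻¹) • u +
        (((A : Matrix (Fin 2) (Fin 2) ℂ) 0 1).im * l⁻¹) • v := by
    intro A
    change _ • (_ • T) + _ • (_ • u) + _ • (_ • v) = _
    simp only [smul_smul]
  have hinj : Function.Injective f := by
    rw [← LinearMap.ker_eq_bot, LinearMap.ker_eq_bot']
    intro A hA
    rw [hf] at hA
    obtain ⟨h1, h2, h3⟩ := hind _ _ _ hA
    have h1' := (mul_eq_zero.mp h1).resolve_right (by positivity)
    have h2' := (mul_eq_zero.mp h2).resolve_right (by positivity)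
    have h3' := (mul_eq_zero.mp h3).resolve_right (by positivity)
    apply Subtype.ext
    refine su2_eq_zero A.2 ?_ (Complex.ext h2' h3')
    rw [(su2_entries A.2).1, h1']; simp
  have hlie : ∀ A C : su2, ⁅f A, f C⁆ = f ⟨_, commutator_mem_su2 A.2 C.2⟩ := by
    intro A C
    rw [hf, hf, hf, lie_three, hTu, hTv, huv]
    obtain ⟨hA1, hA2, hA3⟩ := su2_entries A.2
    obtain ⟨hC1, hC2, hC3⟩ := su2_entries C.2
    have hA0 : ((A : Matrix (Fin 2) (Fin 2) ℂ) 0 0).re = 0 := by rw [hA1]; simp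
    have hC0 : ((C : Matrix (Fin 2) (Fin 2) ℂ) 0 0).re = 0 := by rw [hC1]; simp
    simp only [Matrix.sub_apply, Matrix.mul_apply, Fin.sum_univ_two, hA2, hA3, hC2, hC3]
    simp only [Complex.sub_im, Complex.add_im, Complex.mul_im, Complex.sub_re, Complex.add_re,
      Complex.mul_re, Complex.neg_re, Complex.neg_im, hA0, hC0, RCLike.star_def, Complex.conj_re,
      Complex.conj_im]
    have hN' : N = -2 * (l * l) / b := by rw [hl]; field_simp
    rw [hN']
    match_scalars <;> field_simp <;> ring
  let s : LieSubalgebra ℝ L :=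
    { LinearMap.range f with
      lie_mem' := by
        rintro _ _ ⟨A, rfl⟩ ⟨C, rfl⟩
        exact ⟨_, (hlie A C).symm⟩ }
  let ψ : s ≃ₗ[ℝ] su2 := (LinearEquiv.ofInjective f hinj).symm
  refine ⟨s, fun X => ⟨?_, ?_⟩, ψ, ?_⟩
  · rintro ⟨A, rfl⟩
    exact ⟨_, _, _, hf A⟩
  · rintro ⟨a, p, q, rfl⟩
    refine ⟨⟨!![Complex.I * (a * b / 2 : ℝ), ⟨p * l, q * l⟩; -star ⟨p * l, q * l⟩,
      -(Complex.I * (a * b / 2 : ℝ))], ?_, ?_⟩, ?_⟩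
    · ext i j
      fin_cases i <;> fin_cases j <;> simp
    · simp [Matrix.trace_fin_two]
    · rw [hf]
      simp
      have e1 : a * b / 2 * (2 / b) = a := by field_simp
      have e2 : p * l * l⁻¹ = p := by field_simp
      have e3 : q * l * l⁻¹ = q := by field_simp
      rw [e1, e2, e3]
  · rintro ⟨_, A, rfl⟩ ⟨_, C, rfl⟩
    have h1 : ∀ D : su2, ψ ⟨f D, D, rfl⟩ = D := fun D =>
      (LinearEquiv.ofInjective f hinj).symm_apply_apply D
    have h2 : (⁅(⟨f A, A, rfl⟩ : s), (⟨f C, C, rfl⟩ : s)⁆ : s) =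
        ⟨f ⟨_, commutator_mem_su2 A.2 C.2⟩, _, rfl⟩ := Subtype.ext (hlie A C)
    rw [h2, h1, h1, h1]

variable {L : Type*} [LieRing L] [LieAlgebra ℝ L] [FiniteDimensional ℝ L] {n : ℕ}
  {r : L →ₗ[ℝ] Matrix (Fin n) (Fin n) ℝ} {B : LinearMap.BilinForm ℝ L}
  {m h : LieSubalgebra ℝ L}

lemma conjForm_eq_neg {α : CForm h} (him : IsImaginary h α) : conjForm α = -α := by
  ext H; simpa using him H

lemma CartanPair.bilC_conj (hc : CartanPair r B m h) {α : CForm h} (hα : IsRoot m h α)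
    (him : IsImaginary h α) {x : ℂ ⊗[ℝ] L} (hx : x ∈ rootSpace m h α) (hx0 : x ≠ 0) :
    (bilC B x (conjV x)).re ≠ 0 ∧ bilC B x (conjV x) = ((bilC B x (conjV x)).re : ℂ) := by
  have h0 : (bilC B x (conjV x)).im = 0 := by
    simp [hc.symm (imV x) (reV x)]
  have h1 : bilC B x (conjV x) = ((bilC B x (conjV x)).re : ℂ) :=
    Complex.ext (by simp) (by rw [h0]; simp)
  refine ⟨fun h2 => ?_, h1⟩
  rw [h2, Complex.ofReal_zero] at h1
  obtain ⟨y, hy, hxy⟩ := hc.exists_bilC_ne_zero hx hx0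
  have h3 : conjV x ∈ rootSpace m h (-α) := by
    rw [← conjForm_eq_neg him]; exact conjV_mem_rootSpace hx
  have h4 : conjV x ≠ 0 := fun h => hx0 (by rw [← conjV_conjV x, h, map_zero])
  obtain ⟨c, rfl⟩ := hc.rootSpace_one_dim (hc.isRoot_neg hα) h3 h4 hy
  rw [map_smul, h1, smul_zero] at hxy
  exact hxy rfl

/-- An imaginary root is compact if and only if `B(x, σ x) < 0` for a root vector `x`, where `σ` is
the conjugation. -/
lemma CartanPair.isCompactRoot_iff (hc : CartanPair r B m h) {α : CForm h} (hα : IsRoot m h α)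
    (him : IsImaginary h α) {x : ℂ ⊗[ℝ] L} (hx : x ∈ rootSpace m h α) (hx0 : x ≠ 0) :
    IsCompactRoot m h α ↔ (bilC B x (conjV x)).re < 0 := by
  obtain ⟨hN0, hN⟩ := hc.bilC_conj hα him hx hx0
  set N := (bilC B x (conjV x)).re with hNdef
  have hσx : conjV x ∈ rootSpace m h (-α) := by
    rw [← conjForm_eq_neg him]; exact conjV_mem_rootSpace hx
  have hσx0 : conjV x ≠ 0 := fun h => hx0 (by rw [← conjV_conjV x, h, map_zero])
  have hαr := hc.root_mem_realSub hα.2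
  set b := (bForm hc α α).re with hbdef
  have hb : 0 < b := bForm_re_pos hc hαr hα.1
  have hbC : bForm hc α α = (b : ℂ) := Complex.ext (by simp [hbdef]) (by
    rw [bForm_im hc hαr hαr]; simp)
  have ht0 : reV (tC B α) = 0 := by
    refine hc.nondeg_cartan (reV_tC_mem α) fun Y hY => ?_
    have h1 := congrArg Complex.re (hc.bilC_tC α ⟨Y, hY⟩)
    have h2 := congrArg Complex.re (him ⟨Y, hY⟩)
    simp at h1 h2
    rw [h1]; linarith
  set y := imV (tC B α) with hydef
  have hy0 : y ≠ 0 := by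
    intro h0
    have : tC B α = 0 := ext_re_im (by simpa using ht0) (by simpa using h0)
    apply bForm_root_ne_zero hc hα
    rw [bForm_apply, this, map_zero]
  -- brackets
  have e1 := hc.lie_tC α hx
  rw [hbC] at e1
  have e1r := congrArg reV e1
  have e1i := congrArg imV e1
  simp only [reV_lie, imV_lie, reV_smul, imV_smul, ht0, zero_lie, Complex.ofReal_re,
    Complex.ofReal_im, zero_smul, sub_zero, add_zero, zero_sub, zero_add, ← hydef] at e1r e1i
  have e2 := hc.lie_root_neg hx hσx
  rw [hN] at e2
  have e2i := congrArg imV e2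
  simp only [imV_lie, imV_smul, reV_conjV, imV_conjV, ht0, Complex.ofReal_re,
    Complex.ofReal_im, zero_smul, add_zero, ← hydef, lie_neg] at e2i
  rw [← lie_skew (reV x) (imV x), neg_neg] at e2i
  set T := -y with hT
  set u := (2 : ℝ) • reV x with hu
  set v := -((2 : ℝ) • imV x) with hv
  have hTu : ⁅T, u⁆ = b • v := by
    rw [hT, hu, hv, neg_lie, lie_smul, e1i]; module
  have hTv : ⁅T, v⁆ = -(b • u) := by
    rw [hT, hu, hv, neg_lie, lie_neg, lie_smul, neg_neg, ← smul_neg]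
    rw [neg_eq_iff_eq_neg] at e1r
    rw [e1r]; module
  have huv : ⁅u, v⁆ = -((2 * N) • T) := by
    have h3 : ⁅imV x, reV x⁆ = (N / 2) • y := by
      have : (2 : ℝ) • ⁅imV x, reV x⁆ = N • y := by rw [two_smul]; exact e2i
      rw [show (N / 2) • y = (1 / 2 : ℝ) • N • y by module, ← this]; module
    rw [hT, hu, hv, lie_neg, smul_lie, lie_smul, ← lie_skew, h3]; module
  -- orthogonality
  have hxx := hc.bilC_rootSpace (fun h => hα.1 (by
    have : (2 : ℂ) • α = 0 := by rw [two_smul]; exact h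
    exact (smul_eq_zero.mp this).resolve_left two_ne_zero)) hx hx
  have htx := hc.bilC_rootSpace (α := 0) (by rw [zero_add]; exact hα.1)
    (hc.mem_rootSpace_zero_iff.mpr ⟨reV_tC_mem (B := B) α, imV_tC_mem (B := B) α⟩) hx
  have hxr := congrArg Complex.re hxx
  have hxi := congrArg Complex.im hxx
  have htr := congrArg Complex.re htx
  have hti := congrArg Complex.im htx
  simp [ht0, ← hydef, hc.symm (imV x) (reV x)] at hxr hxi htr hti
  have hNr : N = 2 * B (reV x) (reV x) := by
    rw [hNdef, bilC_re]; simp; linarith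
  have hind : ∀ a p q : ℝ, a • T + p • u + q • v = 0 → a = 0 ∧ p = 0 ∧ q = 0 := by
    intro a p q h0
    have h1 := congrArg (fun Z => B Z (reV x)) h0
    have h2 := congrArg (fun Z => B Z (imV x)) h0
    simp [hT, hu, hv, hti, htr, hxi, hc.symm (imV x) (reV x)] at h1 h2
    have h3 : B (reV x) (reV x) ≠ 0 := fun h => hN0 (by rw [hNr, h, mul_zero])
    have h4 : B (imV x) (imV x) ≠ 0 := fun h => h3 (by linarith)
    have hp : p = 0 := by tauto
    have hq : q = 0 := by tauto
    refine ⟨?_, hp, hq⟩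
    rw [hp, hq] at h0
    simpa [hT, hy0] using h0
  have hcor := hc.coroot_eq hα
  rw [hbC] at hcor
  have hbc : (2 / (b : ℂ)) ≠ 0 := div_ne_zero two_ne_zero (by exact_mod_cast hb.ne')
  have hmem : ∀ X : L, ((1 : ℂ) ⊗ₜ[ℝ] X ∈
      Submodule.span ℂ {h.toSubmodule.subtype.baseChange ℂ (coroot m h α)} ⊔
        rootSpace m h α ⊔ rootSpace m h (-α)) ↔ ∃ a p q : ℝ, X = a • T + p • u + q • v := by
    intro X
    rw [hcor]
    constructor
    · intro hX
      obtain ⟨z, hz, w, hw, hzw⟩ := Submodule.mem_sup.mp hX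
      obtain ⟨z1, hz1, z2, hz2, rfl⟩ := Submodule.mem_sup.mp hz
      obtain ⟨c, rfl⟩ := Submodule.mem_span_singleton.mp hz1
      obtain ⟨c1, rfl⟩ := hc.rootSpace_one_dim hα hx hx0 hz2
      obtain ⟨c2, rfl⟩ := hc.rootSpace_one_dim (hc.isRoot_neg hα) hσx hσx0 hw
      have h1 := congrArg reV hzw
      rw [smul_smul] at h1
      simp only [map_add, reV_smul, reV_conjV, imV_conjV, reV_tmul, Complex.one_re, one_smul, ht0,
        smul_zero, ← hydef] at h1
      refine ⟨(c * (2 / (b : ℂ))).im, (c1.re + c2.re) / 2, (c1.im - c2.im) / 2, ?_⟩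
      rw [← h1, hT, hu, hv]; module
    · rintro ⟨a, p, q, rfl⟩
      have h1 : (1 : ℂ) ⊗ₜ[ℝ] (a • T + p • u + q • v) =
          (a * Complex.I / (2 / (b : ℂ))) • ((2 / (b : ℂ)) • tC B α) +
            ((p : ℂ) + q * Complex.I) • x + ((p : ℂ) - q * Complex.I) • conjV x := by
        have h2 : (a * Complex.I / (2 / (b : ℂ))) • ((2 / (b : ℂ)) • tC B α) =
            (a * Complex.I) • tC B α := by
          rw [smul_smul, div_mul_cancel₀ _ hbc]
        rw [h2]
        apply ext_re_im
        · simp [ht0, ← hydef, hT, hu, hv]; module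
        · simp [ht0, hT, hu, hv, ← hydef]; try module
      rw [h1]
      refine Submodule.add_mem_sup (Submodule.add_mem_sup ?_ ?_) ?_
      · exact Submodule.smul_mem _ _ (Submodule.mem_span_singleton_self _)
      · exact Submodule.smul_mem _ _ hx
      · exact Submodule.smul_mem _ _ hσx
  constructor
  · rintro ⟨s, hs, ψ, hψ⟩
    by_contra hcon
    have hNpos : 0 < N := lt_of_le_of_ne (not_lt.mp hcon) (Ne.symm hN0)
    have hTs : T ∈ s := (hs T).mpr ((hmem T).mpr ⟨1, 0, 0, by module⟩)
    have hus : u ∈ s := (hs u).mpr ((hmem u).mpr ⟨0, 1, 0, by module⟩)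
    have h1 : (⁅(⟨u, hus⟩ : s), ⁅(⟨u, hus⟩ : s), (⟨T, hTs⟩ : s)⁆⁆ : s) =
        (2 * b * N) • (⟨T, hTs⟩ : s) := by
      apply Subtype.ext
      change ⁅u, ⁅u, T⁆⁆ = (2 * b * N) • T
      rw [← lie_skew u T, hTu, lie_neg, lie_smul, huv]; module
    have h2 := congrArg (fun Z => (ψ Z : Matrix (Fin 2) (Fin 2) ℂ)) h1
    simp only [hψ, map_smul] at h2
    refine su2_not_pos (ψ ⟨u, hus⟩).2 (ψ ⟨T, hTs⟩).2 ?_ (μ := 2 * b * N) (by positivity) ?_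
    · intro h3
      have h4 : ψ ⟨T, hTs⟩ = 0 := Subtype.ext h3
      rw [LinearEquiv.map_eq_zero_iff] at h4
      have h5 : T = 0 := congrArg Subtype.val h4
      exact hy0 (neg_eq_zero.mp h5)
    · rw [h2]
      ext i j
      simp
  · intro hneg
    obtain ⟨s, hs, ψ, hψ⟩ := exists_su2_equiv hb hneg hTu hTv huv hind
    exact ⟨s, fun X => (hs X).trans (hmem X).symm, ψ, hψ⟩

end Compact

/-! ## Finite root systems in a complex space with a bilinear form -/

section RootSystem

variable {E : Type*} [AddCommGroup E] [Module ℂ E]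

/-- A finite reduced root system `Φ` contained in a real subspace `V` on which the bilinear form `b`
is real and positive definite. -/
structure IsRootSys (b : LinearMap.BilinForm ℂ E) (V : Submodule ℝ E) (Φ : Set E) : Prop where
  symm : ∀ x y, b x y = b y x
  im_eq : ∀ x ∈ V, ∀ y ∈ V, (b x y).im = 0
  pos : ∀ x ∈ V, x ≠ 0 → 0 < (b x x).re
  finite : Φ.Finite
  sub : Φ ⊆ V
  ne_zero : ∀ α ∈ Φ, α ≠ 0
  refl : ∀ α ∈ Φ, ∀ β ∈ Φ, β - (2 * b β α / b α α) • α ∈ Φ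
  diff : ∀ α ∈ Φ, ∀ β ∈ Φ, 0 < (b α β).re → α ≠ β → α - β ∈ Φ
  two : ∀ α ∈ Φ, α + α ∉ Φ

/-- The reflection defined by `α`. -/
def rootRefl (b : LinearMap.BilinForm ℂ E) (α : E) : E ≃ₗ[ℂ] E :=
  LinearEquiv.ofInvolutive
    (LinearMap.id - (2 / b α α) • (b.flip α).smulRight α) (by
      have key : ∀ y, (LinearMap.id - (2 / b α α) • (b.flip α).smulRight α : E →ₗ[ℂ] E) y =
          y - (2 / b α α * b y α) • α := fun y => by
        change y - (2 / b α α) • (b y α • α) = _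
        rw [smul_smul]
      intro x
      rw [key, key, map_sub, LinearMap.sub_apply, map_smul, LinearMap.smul_apply, smul_eq_mul,
        sub_sub, ← add_smul]
      by_cases h : b α α = 0
      · simp [h]
      · have : 2 / b α α * b x α + 2 / b α α * (b x α - 2 / b α α * b x α * b α α) = 0 := by
          field_simp; ring
        rw [this, zero_smul, sub_zero])

lemma rootRefl_apply (b : LinearMap.BilinForm ℂ E) (α β : E) :
    rootRefl b α β = β - (2 * b β α / b α α) • α := by
  change β - (2 / b α α) • (b β α • α) = _
  rw [smul_smul, div_mul_eq_mul_div]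

lemma rootRefl_mul_self (b : LinearMap.BilinForm ℂ E) (α : E) :
    rootRefl b α * rootRefl b α = 1 := by
  ext x
  exact (rootRefl b α).left_inv x

/-- The group generated by the reflections defined by the elements of `Φ`. -/
def reflGroup (b : LinearMap.BilinForm ℂ E) (Φ : Set E) : Subgroup (E ≃ₗ[ℂ] E) :=
  Subgroup.closure (rootRefl b '' Φ)

/-- The roots that are positive with respect to `x`. -/
def posSys (b : LinearMap.BilinForm ℂ E) (Φ : Set E) (x : E) : Set E :=
  {β | β ∈ Φ ∧ 0 < (b β x).re}

/-- The indecomposable positive roots. -/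
def simpleSys (b : LinearMap.BilinForm ℂ E) (Φ : Set E) (x : E) : Set E :=
  {α | α ∈ posSys b Φ x ∧ ¬ ∃ β ∈ posSys b Φ x, ∃ γ ∈ posSys b Φ x, α = β + γ}

/-- `x` belongs to `V` and is orthogonal to no root. -/
def IsRegularVec (b : LinearMap.BilinForm ℂ E) (V : Submodule ℝ E) (Φ : Set E) (x : E) : Prop :=
  x ∈ V ∧ ∀ α ∈ Φ, (b α x).re ≠ 0

/-- `g` preserves `b`. -/
def IsIsom (b : LinearMap.BilinForm ℂ E) (g : E ≃ₗ[ℂ] E) : Prop :=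
  ∀ x y, b (g x) (g y) = b x y

variable {b : LinearMap.BilinForm ℂ E} {V : Submodule ℝ E} {Φ : Set E}

lemma IsIsom.mul {g g' : E ≃ₗ[ℂ] E} (h : IsIsom b g) (h' : IsIsom b g') : IsIsom b (g * g') :=
  fun x y => (h _ _).trans (h' x y)

lemma IsIsom.conj_rootRefl {g : E ≃ₗ[ℂ] E} (h : IsIsom b g) (α : E) :
    rootRefl b (g α) = g * rootRefl b α * g⁻¹ := by
  ext x
  change _ = g (rootRefl b α (g.symm x))
  rw [rootRefl_apply, rootRefl_apply, map_sub, map_smul, LinearEquiv.apply_symm_apply, h α α]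
  congr 4
  rw [← h (g.symm x) α, LinearEquiv.apply_symm_apply]

namespace IsRootSys

variable (hΦ : IsRootSys b V Φ)
include hΦ

lemma b_eq {x y : E} (hx : x ∈ V) (hy : y ∈ V) : b x y = ((b x y).re : ℂ) :=
  Complex.ext rfl (by simp [hΦ.im_eq x hx y hy])

lemma re_symm (x y : E) : (b x y).re = (b y x).re := by rw [hΦ.symm]

lemma re_pos {α : E} (hα : α ∈ Φ) : 0 < (b α α).re := hΦ.pos α (hΦ.sub hα) (hΦ.ne_zero α hα)

lemma b_ne {α : E} (hα : α ∈ Φ) : b α α ≠ 0 := fun h => by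
  have := hΦ.re_pos hα
  rw [h] at this; exact lt_irrefl _ this

lemma rootRefl_self {α : E} (hα : α ∈ Φ) : rootRefl b α α = -α := by
  rw [rootRefl_apply, mul_div_assoc, div_self (hΦ.b_ne hα), two_mul, add_smul]
  simp

lemma rootRefl_real {α x : E} (hα : α ∈ Φ) (hx : x ∈ V) :
    rootRefl b α x = x - (2 * (b x α).re / (b α α).re : ℝ) • α := by
  rw [rootRefl_apply, hΦ.b_eq hx (hΦ.sub hα), hΦ.b_eq (hΦ.sub hα) (hΦ.sub hα)]
  congr 1
  rw [← Complex.coe_smul]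
  congr 1
  push_cast
  simp

lemma rootRefl_mem {α x : E} (hα : α ∈ Φ) (hx : x ∈ V) : rootRefl b α x ∈ V := by
  rw [hΦ.rootRefl_real hα hx]
  exact V.sub_mem hx (V.smul_mem _ (hΦ.sub hα))

lemma rootRefl_root {α β : E} (hα : α ∈ Φ) (hβ : β ∈ Φ) : rootRefl b α β ∈ Φ := by
  rw [rootRefl_apply]; exact hΦ.refl α hα β hβ

lemma neg_mem {α : E} (hα : α ∈ Φ) : -α ∈ Φ := by
  rw [← hΦ.rootRefl_self hα]; exact hΦ.rootRefl_root hα hα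

lemma isIsom_rootRefl {α : E} (hα : α ∈ Φ) : IsIsom b (rootRefl b α) := by
  intro x y
  have h := hΦ.b_ne hα
  simp only [rootRefl_apply, map_sub, LinearMap.sub_apply, map_smul, LinearMap.smul_apply,
    smul_eq_mul]
  rw [hΦ.symm α y]
  field_simp
  ring

lemma group_induction {w : E ≃ₗ[ℂ] E} (hw : w ∈ reflGroup b Φ) {p : (E ≃ₗ[ℂ] E) → Prop}
    (one : p 1) (mul : ∀ α ∈ Φ, ∀ u, u ∈ reflGroup b Φ → p u → p (rootRefl b α * u)) : p w := by
  refine Subgroup.closure_induction_left (p := fun u _ => p u) one ?_ ?_ hw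
  · rintro _ ⟨α, hα, rfl⟩ u hu hpu
    exact mul α hα u hu hpu
  · rintro _ ⟨α, hα, rfl⟩ u hu hpu
    rw [inv_eq_of_mul_eq_one_left (rootRefl_mul_self b α)]
    exact mul α hα u hu hpu

lemma rootRefl_mem_group {α : E} (hα : α ∈ Φ) : rootRefl b α ∈ reflGroup b Φ :=
  Subgroup.subset_closure ⟨α, hα, rfl⟩

lemma isom {w : E ≃ₗ[ℂ] E} (hw : w ∈ reflGroup b Φ) : IsIsom b w :=
  hΦ.group_induction hw (fun _ _ => rfl) fun _ hα _ _ h => (hΦ.isIsom_rootRefl hα).mul h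

lemma map_root {w : E ≃ₗ[ℂ] E} (hw : w ∈ reflGroup b Φ) {α : E} (hα : α ∈ Φ) : w α ∈ Φ :=
  hΦ.group_induction hw (p := fun w => w α ∈ Φ) hα
    fun _ hβ _ _ h => hΦ.rootRefl_root hβ h

lemma map_real {w : E ≃ₗ[ℂ] E} (hw : w ∈ reflGroup b Φ) {x : E} (hx : x ∈ V) : w x ∈ V :=
  hΦ.group_induction hw (p := fun w => w x ∈ V) hx fun _ hβ _ _ h => hΦ.rootRefl_mem hβ h

lemma map_sub_mem {w : E ≃ₗ[ℂ] E} (hw : w ∈ reflGroup b Φ) (x : E) :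
    w x - x ∈ Submodule.span ℂ Φ := by
  refine hΦ.group_induction hw (p := fun w => w x - x ∈ Submodule.span ℂ Φ) (by simp) ?_
  intro α hα u _ h
  change rootRefl b α (u x) - x ∈ _
  rw [rootRefl_apply, sub_right_comm]
  exact Submodule.sub_mem _ h (Submodule.smul_mem _ _ (Submodule.subset_span hα))

lemma isRegularVec_map {w : E ≃ₗ[ℂ] E} (hw : w ∈ reflGroup b Φ) {x : E}
    (hx : IsRegularVec b V Φ x) : IsRegularVec b V Φ (w x) := by
  refine ⟨hΦ.map_real hw hx.1, fun α hα => ?_⟩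
  have h := hx.2 (w⁻¹ α) (hΦ.map_root (Subgroup.inv_mem _ hw) hα)
  rwa [← hΦ.isom hw, show w (w⁻¹ α) = α from w.apply_symm_apply α] at h

lemma b_smul_left (c : ℝ) (x y : E) : (b (c • x) y).re = c * (b x y).re := by
  rw [← Complex.coe_smul, map_smul, LinearMap.smul_apply, smul_eq_mul, Complex.re_ofReal_mul]

lemma neg_pos_or {x : E} (hx : IsRegularVec b V Φ x) {α : E} (hα : α ∈ Φ) :
    α ∈ posSys b Φ x ∨ -α ∈ posSys b Φ x := by
  rcases lt_or_gt_of_ne (hx.2 α hα) with h | h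
  · right
    exact ⟨hΦ.neg_mem hα, by simpa using h⟩
  · left; exact ⟨hα, h⟩

/-- Induction on the height of a positive root. -/
lemma height_induction (x : E) {p : E → Prop}
    (h : ∀ β ∈ posSys b Φ x, (∀ γ ∈ posSys b Φ x, (b γ x).re < (b β x).re → p γ) → p β) :
    ∀ β ∈ posSys b Φ x, p β := by
  by_contra! hcon
  have hfin : {β | β ∈ posSys b Φ x ∧ ¬ p β}.Finite := hΦ.finite.subset fun β hβ => hβ.1.1
  obtain ⟨β, hβ, hmin⟩ := hfin.exists_minimalFor (fun β => (b β x).re) _ hcon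
  refine hβ.2 (h β hβ.1 fun γ hγ hlt => ?_)
  by_contra hpγ
  exact absurd (hmin ⟨hγ, hpγ⟩ hlt.le) (not_le.mpr hlt)

lemma posSys_le_closure (x : E) :
    ∀ β ∈ posSys b Φ x, β ∈ AddSubmonoid.closure (simpleSys b Φ x) := by
  refine hΦ.height_induction x fun β hβ ih => ?_
  by_cases hs : β ∈ simpleSys b Φ x
  · exact AddSubmonoid.subset_closure hs
  · have : ∃ γ ∈ posSys b Φ x, ∃ δ ∈ posSys b Φ x, β = γ + δ := by
      by_contra hcon; exact hs ⟨hβ, hcon⟩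
    obtain ⟨γ, hγ, δ, hδ, rfl⟩ := this
    have h1 := hγ.2
    have h2 := hδ.2
    refine AddSubmonoid.add_mem _ (ih γ hγ ?_) (ih δ hδ ?_) <;>
      simp only [map_add, LinearMap.add_apply, Complex.add_re] <;> linarith

omit hΦ in
lemma closure_re_pos {S : Set E} {y : E} (h : ∀ α ∈ S, 0 < (b α y).re) :
    ∀ β ∈ AddSubmonoid.closure S, β = 0 ∨ 0 < (b β y).re := by
  intro β hβ
  refine AddSubmonoid.closure_induction (motive := fun β _ => β = 0 ∨ 0 < (b β y).re)
    (fun α hα => Or.inr (h α hα)) (Or.inl rfl) ?_ hβ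
  rintro u v _ _ (rfl | hu) (rfl | hv)
  · simp
  · simp [hv]
  · simp [hu]
  · right; simp only [map_add, LinearMap.add_apply, Complex.add_re]; linarith

lemma pos_of_simple {x y : E} (h : ∀ α ∈ simpleSys b Φ x, 0 < (b α y).re) {β : E}
    (hβ : β ∈ posSys b Φ x) : 0 < (b β y).re :=
  (closure_re_pos h β (hΦ.posSys_le_closure x β hβ)).resolve_left (hΦ.ne_zero β hβ.1)

lemma exists_simple_re_pos {x β : E} (hβ : β ∈ posSys b Φ x) :
    ∃ α ∈ simpleSys b Φ x, 0 < (b β α).re := by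
  by_contra! hcon
  have h := AddSubmonoid.closure_induction (motive := fun γ _ => (b β γ).re ≤ 0)
    (fun α hα => hcon α hα) (by simp)
    (fun u v _ _ hu hv => by rw [map_add, Complex.add_re]; linarith)
    (hΦ.posSys_le_closure x β hβ)
  exact absurd (hΦ.re_pos hβ.1) (not_lt.mpr h)

lemma sub_simple_pos {x α γ : E} (hx : IsRegularVec b V Φ x) (hα : α ∈ simpleSys b Φ x)
    (hγ : γ ∈ posSys b Φ x) (h : γ - α ∈ Φ) : γ - α ∈ posSys b Φ x := by
  rcases hΦ.neg_pos_or hx h with h1 | h1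
  · exact h1
  · exact absurd ⟨γ, hγ, _, h1, by abel⟩ hα.2

/-- A simple reflection permutes the other positive roots. -/
lemma rootRefl_pos {x α : E} (hx : IsRegularVec b V Φ x) (hα : α ∈ simpleSys b Φ x) :
    ∀ γ ∈ posSys b Φ x, γ ≠ α → rootRefl b α γ ∈ posSys b Φ x := by
  refine hΦ.height_induction x fun γ hγ ih hne => ?_
  have hαΦ := hα.1.1
  rcases le_or_gt (b γ α).re 0 with h | h
  · refine ⟨hΦ.rootRefl_root hαΦ hγ.1, ?_⟩
    rw [hΦ.rootRefl_real hαΦ (hΦ.sub hγ.1), map_sub, LinearMap.sub_apply, Complex.sub_re,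
      hΦ.b_smul_left]
    have h1 : 2 * (b γ α).re / (b α α).re ≤ 0 :=
      div_nonpos_of_nonpos_of_nonneg (by linarith) (hΦ.re_pos hαΦ).le
    have h2 := mul_nonpos_of_nonpos_of_nonneg h1 hα.1.2.le
    linarith [hγ.2]
  · have h1 := hΦ.sub_simple_pos hx hα hγ (hΦ.diff γ hγ.1 α hαΦ h hne)
    have h2 : γ - α ≠ α := fun h2 => hΦ.two α hαΦ (by rw [← sub_eq_iff_eq_add.mp h2]; exact hγ.1)
    have h3 := ih _ h1 (by
      simp only [map_sub, LinearMap.sub_apply, Complex.sub_re]; linarith [hα.1.2]) h2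
    have h4 : rootRefl b α γ = rootRefl b α (γ - α) - α := by
      rw [map_sub, hΦ.rootRefl_self hαΦ]; abel
    rw [h4]
    exact hΦ.sub_simple_pos hx hα h3 (by rw [← h4]; exact hΦ.rootRefl_root hαΦ hγ.1)

/-- If a simple root is a sum of positive roots, it is one of them. -/
lemma simple_mem_of_mem_closure {x α : E} (hα : α ∈ simpleSys b Φ x) {S : Set E} (hS : S ⊆ posSys b Φ x)
    (h : α ∈ AddSubmonoid.closure S) : α ∈ S := by
  have key : ∀ l : List E, (∀ s ∈ l, s ∈ S) → 0 < (b α l.sum).re →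
      ∃ s ∈ l, 0 < (b α s).re := by
    intro l
    induction l with
    | nil => intro _ h; simp at h
    | cons s l ih =>
      intro hl hpos
      by_cases hs : 0 < (b α s).re
      · exact ⟨s, by simp, hs⟩
      · rw [List.sum_cons, map_add, Complex.add_re] at hpos
        obtain ⟨s', hs', h'⟩ := ih (fun s hs => hl s (by simp [hs])) (by linarith)
        exact ⟨s', by simp [hs'], h'⟩
  obtain ⟨l, hl, hsum⟩ := AddSubmonoid.exists_list_of_mem_closure h
  obtain ⟨s, hs, hpos⟩ := key l hl (by rw [hsum]; exact hΦ.re_pos hα.1.1)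
  by_cases hne : α = s
  · rw [hne]; exact hl s hs
  exfalso
  have hsS := hS (hl s hs)
  have h1 : α - s ∈ Φ := hΦ.diff α hα.1.1 s hsS.1 hpos hne
  refine hα.2 ⟨s, hsS, α - s, ⟨h1, ?_⟩, by abel⟩
  obtain ⟨l1, l2, rfl⟩ := List.append_of_mem hs
  have h2 : α - s ∈ AddSubmonoid.closure S := by
    have : α - s = l1.sum + l2.sum := by
      rw [← hsum, List.sum_append, List.sum_cons]; abel
    rw [this]
    exact AddSubmonoid.add_mem _
      (AddSubmonoid.list_sum_mem _ fun y hy => AddSubmonoid.subset_closure (hl y (by simp [hy])))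
      (AddSubmonoid.list_sum_mem _ fun y hy => AddSubmonoid.subset_closure (hl y (by simp [hy])))
  exact (closure_re_pos (fun α hα => (hS hα).2) _ h2).resolve_left (sub_ne_zero.mpr hne)

end IsRootSys

end RootSystem

section RootSystem

variable {E : Type*} [AddCommGroup E] [Module ℂ E]
variable {b : LinearMap.BilinForm ℂ E} {V : Submodule ℝ E} {Φ : Set E}

lemma rootRefl_neg (b : LinearMap.BilinForm ℂ E) (α : E) : rootRefl b (-α) = rootRefl b α := by
  ext x
  simp only [rootRefl_apply, map_neg, LinearMap.neg_apply, neg_neg, smul_neg]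
  rw [mul_neg, neg_div, neg_smul, neg_neg]

lemma image_posSys {g : E ≃ₗ[ℂ] E} (hg : IsIsom b g) (hΦ : ∀ α, g α ∈ Φ ↔ α ∈ Φ) (x : E) :
    g '' posSys b Φ x = posSys b Φ (g x) := by
  ext β
  constructor
  · rintro ⟨α, hα, rfl⟩
    exact ⟨(hΦ α).mpr hα.1, by rw [hg]; exact hα.2⟩
  · intro hβ
    have h : g (g.symm β) = β := g.apply_symm_apply β
    exact ⟨g.symm β, ⟨(hΦ _).mp (by rw [h]; exact hβ.1), by rw [← hg, h]; exact hβ.2⟩, h⟩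

lemma map_finsum_posSys (hfin : Φ.Finite) {g : E ≃ₗ[ℂ] E} (hg : IsIsom b g)
    (hΦ : ∀ α, g α ∈ Φ ↔ α ∈ Φ) (x : E) :
    g (∑ᶠ α ∈ posSys b Φ x, α) = ∑ᶠ α ∈ posSys b Φ (g x), α := by
  rw [← image_posSys hg hΦ, finsum_mem_image g.injective.injOn]
  have := (g : E →+ E).map_finsum_mem (s := posSys b Φ x) (fun α => α)
    (hfin.subset fun α hα => hα.1)
  exact this

namespace IsRootSys

variable (hΦ : IsRootSys b V Φ)
include hΦ

lemma map_root_iff {w : E ≃ₗ[ℂ] E} (hw : w ∈ reflGroup b Φ) (α : E) : w α ∈ Φ ↔ α ∈ Φ := by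
  refine ⟨fun h => ?_, hΦ.map_root hw⟩
  have := hΦ.map_root (Subgroup.inv_mem _ hw) h
  rwa [show w⁻¹ (w α) = α from w.symm_apply_apply α] at this

lemma exists_simple_conj {x : E} (hx : IsRegularVec b V Φ x) : ∀ β ∈ posSys b Φ x,
    ∃ u ∈ Subgroup.closure (rootRefl b '' simpleSys b Φ x), u β ∈ simpleSys b Φ x := by
  refine hΦ.height_induction x fun β hβ ih => ?_
  by_cases hs : β ∈ simpleSys b Φ x
  · exact ⟨1, one_mem _, hs⟩
  obtain ⟨α, hα, hpos⟩ := hΦ.exists_simple_re_pos hβ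
  have hne : β ≠ α := fun h => hs (h ▸ hα)
  obtain ⟨u, hu, h⟩ := ih _ (hΦ.rootRefl_pos hx hα β hβ hne) (by
    rw [hΦ.rootRefl_real hα.1.1 (hΦ.sub hβ.1), map_sub, LinearMap.sub_apply, Complex.sub_re,
      hΦ.b_smul_left]
    have := mul_pos (div_pos (mul_pos two_pos hpos) (hΦ.re_pos hα.1.1)) hα.1.2
    linarith)
  exact ⟨u * rootRefl b α, mul_mem hu (Subgroup.subset_closure ⟨α, hα, rfl⟩), h⟩

lemma closure_simple_le (x : E) :
    Subgroup.closure (rootRefl b '' simpleSys b Φ x) ≤ reflGroup b Φ :=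
  Subgroup.closure_mono (Set.image_mono fun _ hα => hα.1.1)

lemma reflGroup_le_closure_simple {x : E} (hx : IsRegularVec b V Φ x) :
    reflGroup b Φ ≤ Subgroup.closure (rootRefl b '' simpleSys b Φ x) := by
  have key : ∀ α ∈ posSys b Φ x,
      rootRefl b α ∈ Subgroup.closure (rootRefl b '' simpleSys b Φ x) := by
    intro α hα
    obtain ⟨u, hu, h⟩ := hΦ.exists_simple_conj hx α hα
    have h1 := (hΦ.isom (hΦ.closure_simple_le x hu)).conj_rootRefl α
    have h2 : rootRefl b α = u⁻¹ * rootRefl b (u α) * u := by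
      rw [h1]; group
    rw [h2]
    exact mul_mem (mul_mem (inv_mem hu) (Subgroup.subset_closure ⟨_, h, rfl⟩)) hu
  rw [reflGroup, Subgroup.closure_le]
  rintro _ ⟨α, hα, rfl⟩
  rcases hΦ.neg_pos_or hx hα with h | h
  · exact key α h
  · rw [← rootRefl_neg]; exact key _ h

lemma exists_list {x : E} (hx : IsRegularVec b V Φ x) {w : E ≃ₗ[ℂ] E}
    (hw : w ∈ reflGroup b Φ) :
    ∃ l : List E, (∀ s ∈ l, s ∈ simpleSys b Φ x) ∧ w = (l.map (rootRefl b)).prod := by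
  refine Subgroup.closure_induction_left
    (p := fun w _ => ∃ l : List E, (∀ s ∈ l, s ∈ simpleSys b Φ x) ∧
      w = (l.map (rootRefl b)).prod) ⟨[], by simp, by simp⟩ ?_ ?_
    (hΦ.reflGroup_le_closure_simple hx hw)
  · rintro _ ⟨α, hα, rfl⟩ u hu ⟨l, hl, rfl⟩
    exact ⟨α :: l, by simpa [hα] using hl, by simp⟩
  · rintro _ ⟨α, hα, rfl⟩ u hu ⟨l, hl, rfl⟩
    exact ⟨α :: l, by simpa [hα] using hl, by
      simp [inv_eq_of_mul_eq_one_left (rootRefl_mul_self b α)]⟩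

omit hΦ in
lemma list_prod_mem {x : E} {l : List E} (hl : ∀ s ∈ l, s ∈ simpleSys b Φ x) :
    (l.map (rootRefl b)).prod ∈ reflGroup b Φ := by
  refine Subgroup.list_prod_mem _ fun u hu => ?_
  obtain ⟨s, hs, rfl⟩ := List.mem_map.mp hu
  exact Subgroup.subset_closure ⟨s, (hl s hs).1.1, rfl⟩

lemma exists_deletion {x : E} (hx : IsRegularVec b V Φ x) {β : E} (hβ : β ∈ simpleSys b Φ x) :
    ∀ l : List E, (∀ s ∈ l, s ∈ simpleSys b Φ x) →
      (l.map (rootRefl b)).prod β ∉ posSys b Φ x →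
      ∃ l' : List E, (∀ s ∈ l', s ∈ simpleSys b Φ x) ∧ l'.length + 1 = l.length ∧
        (l.map (rootRefl b)).prod * rootRefl b β = (l'.map (rootRefl b)).prod := by
  intro l
  induction l with
  | nil => intro _ h; exact absurd hβ.1 (by simpa using h)
  | cons α l ih =>
    intro hl hneg
    have hl' : ∀ s ∈ l, s ∈ simpleSys b Φ x := fun s hs => hl s (by simp [hs])
    have hα : α ∈ simpleSys b Φ x := hl α (by simp)
    have hmem := list_prod_mem hl'
    by_cases hp : (l.map (rootRefl b)).prod β ∈ posSys b Φ x
    · have h1 : (l.map (rootRefl b)).prod β = α := by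
        by_contra hne
        refine hneg ?_
        rw [List.map_cons, List.prod_cons]
        exact hΦ.rootRefl_pos hx hα _ hp hne
      refine ⟨l, hl', by simp, ?_⟩
      have h2 := (hΦ.isom hmem).conj_rootRefl β
      rw [h1] at h2
      rw [List.map_cons, List.prod_cons, h2]
      have h3 := rootRefl_mul_self b β
      calc _ = (l.map (rootRefl b)).prod * (rootRefl b β * rootRefl b β) := by group
        _ = _ := by rw [h3, mul_one]
    · obtain ⟨l', h1, h2, h3⟩ := ih hl' hp
      refine ⟨α :: l', by simpa [hα] using h1, by simp [h2], ?_⟩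
      rw [List.map_cons, List.prod_cons, mul_assoc, h3, List.map_cons, List.prod_cons]

/-- An element of the reflection group that preserves the positive roots is trivial. -/
lemma eq_one_of_pos {x : E} (hx : IsRegularVec b V Φ x) {w : E ≃ₗ[ℂ] E}
    (hw : w ∈ reflGroup b Φ) (h : ∀ β ∈ posSys b Φ x, w β ∈ posSys b Φ x) : w = 1 := by
  have key : ∀ k : ℕ, ∀ l : List E, l.length ≤ k → (∀ s ∈ l, s ∈ simpleSys b Φ x) →
      (∀ β ∈ posSys b Φ x, (l.map (rootRefl b)).prod β ∈ posSys b Φ x) →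
      (l.map (rootRefl b)).prod = 1 := by
    intro k
    induction k with
    | zero =>
      intro l hl _ _
      rw [List.length_eq_zero_iff.mp (Nat.le_zero.mp hl)]; simp
    | succ k ih =>
      intro l hlen hl hp
      rcases List.eq_nil_or_concat l with rfl | ⟨l1, β, rfl⟩
      · simp
      rw [List.concat_eq_append] at hlen hl hp ⊢
      have hβ : β ∈ simpleSys b Φ x := hl β (by simp)
      have hl1 : ∀ s ∈ l1, s ∈ simpleSys b Φ x := fun s hs => hl s (by simp [hs])
      have h1 : (l1.map (rootRefl b)).prod β ∉ posSys b Φ x := by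
        intro hcon
        have h2 := hp β hβ.1
        rw [List.map_append, List.prod_append, List.map_singleton, List.prod_singleton] at h2
        change (l1.map (rootRefl b)).prod (rootRefl b β β) ∈ _ at h2
        rw [hΦ.rootRefl_self hβ.1.1, map_neg] at h2
        have h3 := h2.2
        have h4 := hcon.2
        simp only [map_neg, LinearMap.neg_apply, Complex.neg_re] at h3
        linarith
      obtain ⟨l', h2, h3, h4⟩ := hΦ.exists_deletion hx hβ l1 hl1 h1
      have h5 : ((l1 ++ [β]).map (rootRefl b)).prod = (l'.map (rootRefl b)).prod := by
        rw [← h4]; simp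
      rw [h5] at hp ⊢
      exact ih l' (by simp at hlen; omega) h2 hp
  obtain ⟨l, hl, rfl⟩ := hΦ.exists_list hx hw
  exact key _ l le_rfl hl h

/-- The reflection group acts freely on chambers. -/
lemma eq_one_of_chamber {x y : E} (hx : IsRegularVec b V Φ x) {w : E ≃ₗ[ℂ] E}
    (hw : w ∈ reflGroup b Φ) (h1 : ∀ α ∈ Φ, 0 < (b α x).re * (b α y).re)
    (h2 : ∀ α ∈ Φ, 0 < (b α (w x)).re * (b α y).re) : w = 1 := by
  refine hΦ.eq_one_of_pos hx hw fun β hβ => ?_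
  have hwβ := hΦ.map_root hw hβ.1
  refine ⟨hwβ, ?_⟩
  have h3 := h2 _ hwβ
  rw [hΦ.isom hw] at h3
  have h4 := pos_of_mul_pos_right h3 hβ.2.le
  exact pos_of_mul_pos_left (h1 _ hwβ) h4.le

lemma sq_pos_of_regular {x : E} (hx : IsRegularVec b V Φ x) {α : E} (hα : α ∈ Φ) :
    0 < (b α x).re * (b α x).re := mul_self_pos.mpr (hx.2 α hα)

lemma eq_of_map_eq {x : E} (hx : IsRegularVec b V Φ x) {w w' : E ≃ₗ[ℂ] E}
    (hw : w ∈ reflGroup b Φ) (hw' : w' ∈ reflGroup b Φ) (h : w x = w' x) : w = w' := by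
  have h1 : w'⁻¹ * w = 1 := by
    refine hΦ.eq_one_of_chamber (y := x) hx (mul_mem (inv_mem hw') hw)
      (fun α hα => hΦ.sq_pos_of_regular hx hα) fun α hα => ?_
    have : (w'⁻¹ * w) x = x := by
      change w'.symm (w x) = x
      rw [h, LinearEquiv.symm_apply_apply]
    rw [this]
    exact hΦ.sq_pos_of_regular hx hα
  rw [inv_mul_eq_one] at h1
  exact h1.symm

lemma eq_zero_of_span {u : E} (hu : u ∈ Submodule.span ℂ Φ) (h : ∀ α ∈ Φ, b u α = 0) :
    u = 0 := by
  have hdec : ∃ u1 ∈ V, ∃ u2 ∈ V, u1 ∈ Submodule.span ℝ Φ ∧ u2 ∈ Submodule.span ℝ Φ ∧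
      u = u1 + Complex.I • u2 := by
    refine Submodule.span_induction (p := fun u _ => ∃ u1 ∈ V, ∃ u2 ∈ V,
      u1 ∈ Submodule.span ℝ Φ ∧ u2 ∈ Submodule.span ℝ Φ ∧ u = u1 + Complex.I • u2) ?_ ?_ ?_ ?_ hu
    · intro α hα
      exact ⟨α, hΦ.sub hα, 0, V.zero_mem, Submodule.subset_span hα, Submodule.zero_mem _,
        by simp⟩
    · exact ⟨0, V.zero_mem, 0, V.zero_mem, Submodule.zero_mem _, Submodule.zero_mem _, by simp⟩
    · rintro x y _ _ ⟨x1, h1, x2, h2, h3, h4, rfl⟩ ⟨y1, k1, y2, k2, k3, k4, rfl⟩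
      exact ⟨x1 + y1, V.add_mem h1 k1, x2 + y2, V.add_mem h2 k2, Submodule.add_mem _ h3 k3,
        Submodule.add_mem _ h4 k4, by module⟩
    · rintro c x _ ⟨x1, h1, x2, h2, h3, h4, rfl⟩
      refine ⟨c.re • x1 - c.im • x2, V.sub_mem (V.smul_mem _ h1) (V.smul_mem _ h2),
        c.im • x1 + c.re • x2, V.add_mem (V.smul_mem _ h1) (V.smul_mem _ h2),
        Submodule.sub_mem _ (Submodule.smul_mem _ _ h3) (Submodule.smul_mem _ _ h4),
        Submodule.add_mem _ (Submodule.smul_mem _ _ h3) (Submodule.smul_mem _ _ h4), ?_⟩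
      simp only [← Complex.coe_smul]
      rw [show c • (x1 + Complex.I • x2) = ((c.re : ℂ) + c.im * Complex.I) •
        (x1 + Complex.I • x2) by rw [Complex.re_add_im]]
      match_scalars
      · ring
      · have := Complex.I_sq
        linear_combination (c.im : ℂ) * this
  obtain ⟨u1, h1, u2, h2, h3, h4, rfl⟩ := hdec
  have key : ∀ α ∈ Φ, (b u1 α).re = 0 ∧ (b u2 α).re = 0 := by
    intro α hα
    have := h α hα
    rw [map_add, LinearMap.add_apply, map_smul, LinearMap.smul_apply,
      hΦ.b_eq h1 (hΦ.sub hα), hΦ.b_eq h2 (hΦ.sub hα)] at this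
    have hr := congrArg Complex.re this
    have hi := congrArg Complex.im this
    simp at hr hi
    exact ⟨hr, hi⟩
  have hz : ∀ v ∈ V, v ∈ Submodule.span ℝ Φ → (∀ α ∈ Φ, (b v α).re = 0) → v = 0 := by
    intro v hv hs h0
    by_contra hne
    have : ∀ w ∈ Submodule.span ℝ Φ, (b w v).re = 0 := by
      intro w hw
      refine Submodule.span_induction (p := fun w _ => (b w v).re = 0) ?_ (by simp) ?_ ?_ hw
      · intro α hα; rw [hΦ.re_symm]; exact h0 α hα
      · intro x y _ _ hx hy; simp [hx, hy]
      · intro c x _ hx; rw [hΦ.b_smul_left, hx, mul_zero]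
    exact absurd (hΦ.pos v hv hne) (by rw [this v hs]; exact lt_irrefl _)
  rw [hz u1 h1 h3 fun α hα => (key α hα).1, hz u2 h2 h4 fun α hα => (key α hα).2]
  simp

lemma eq_one_of_fix_roots {w : E ≃ₗ[ℂ] E} (hw : w ∈ reflGroup b Φ) (h : ∀ α ∈ Φ, w α = α) :
    w = 1 := by
  ext y
  refine sub_eq_zero.mp (hΦ.eq_zero_of_span (hΦ.map_sub_mem hw y) fun α hα => ?_)
  rw [map_sub, LinearMap.sub_apply]
  nth_rewrite 1 [← h α hα]
  rw [hΦ.isom hw]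
  exact sub_self _

lemma finite_reflGroup : Finite (reflGroup b Φ) := by
  have := hΦ.finite.to_subtype
  refine Finite.of_injective
    (fun (w : reflGroup b Φ) (α : Φ) => (⟨w.1 α, hΦ.map_root w.2 α.2⟩ : Φ)) ?_
  intro w w' h
  apply Subtype.ext
  have h1 : (w'.1)⁻¹ * w.1 = 1 := by
    refine hΦ.eq_one_of_fix_roots (mul_mem (inv_mem w'.2) w.2) fun α hα => ?_
    have := congrArg Subtype.val (congrFun h ⟨α, hα⟩)
    change w'.1.symm (w.1 α) = α
    change w.1 α = w'.1 α at this
    rw [this, LinearEquiv.symm_apply_apply]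
  rw [inv_mul_eq_one] at h1
  exact h1.symm

/-- The reflection group acts transitively on chambers. -/
lemma exists_map_chamber {x y : E} (hx : IsRegularVec b V Φ x) (hy : IsRegularVec b V Φ y) :
    ∃ w ∈ reflGroup b Φ, ∀ α ∈ Φ, 0 < (b α x).re * (b α (w y)).re := by
  have := hΦ.finite_reflGroup
  obtain ⟨⟨w, hw⟩, hmax⟩ := Finite.exists_max fun w : reflGroup b Φ => (b (w.1 y) x).re
  refine ⟨w, hw, fun α hα => ?_⟩
  have hreg := (hΦ.isRegularVec_map hw hy)
  have h1 := hmax ⟨rootRefl b α * w, mul_mem (hΦ.rootRefl_mem_group hα) hw⟩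
  change (b (rootRefl b α (w y)) x).re ≤ _ at h1
  rw [hΦ.rootRefl_real hα hreg.1, map_sub, LinearMap.sub_apply, Complex.sub_re,
    hΦ.b_smul_left, hΦ.re_symm (w y) α] at h1
  have h2 : 0 ≤ (b α x).re * (b α (w y)).re := by
    have h3 : 0 ≤ 2 * (b α (w y)).re / (b α α).re * (b α x).re := by linarith
    have h4 := mul_nonneg h3 (hΦ.re_pos hα).le
    have h5 : 2 * (b α (w y)).re / (b α α).re * (b α x).re * (b α α).re =
        2 * ((b α x).re * (b α (w y)).re) := by
      have := (hΦ.re_pos hα).ne'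
      field_simp
    linarith
  exact lt_of_le_of_ne h2 (Ne.symm (mul_ne_zero (hx.2 α hα) (hreg.2 α hα)))

lemma finite_posSys (x : E) : (posSys b Φ x).Finite := hΦ.finite.subset fun _ h => h.1

/-- The sum of the positive roots is strictly dominant. -/
lemma sum_pos_dominant {x : E} (hx : IsRegularVec b V Φ x) {β : E} (hβ : β ∈ posSys b Φ x) :
    0 < (b β (∑ᶠ α ∈ posSys b Φ x, α)).re := by
  refine hΦ.pos_of_simple (fun α hα => ?_) hβ
  set ρ := ∑ᶠ α ∈ posSys b Φ x, α with hρ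
  have hfin := hΦ.finite_posSys x
  have hfin' : (posSys b Φ x \ {α}).Finite := hfin.subset Set.sdiff_subset
  set σ := ∑ᶠ γ ∈ posSys b Φ x \ {α}, γ with hσ
  have h1 : ρ = α + σ := by
    have h2 := finsum_mem_insert (fun γ : E => γ) (a := α) (s := posSys b Φ x \ {α})
      (by simp) hfin'
    rwa [Set.insert_sdiff_singleton, Set.insert_eq_of_mem hα.1] at h2
  have himg : rootRefl b α '' (posSys b Φ x \ {α}) = posSys b Φ x \ {α} := by
    have hsub : ∀ γ ∈ posSys b Φ x \ {α}, rootRefl b α γ ∈ posSys b Φ x \ {α} := by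
      intro γ hγ
      refine ⟨hΦ.rootRefl_pos hx hα γ hγ.1 hγ.2, fun h => ?_⟩
      have h2 : γ = -α := by
        have h3 : rootRefl b α (rootRefl b α γ) = γ := (rootRefl b α).left_inv γ
        rw [← h3, Set.mem_singleton_iff.mp h, hΦ.rootRefl_self hα.1.1]
      have h4 := hγ.1.2
      rw [h2] at h4
      simp only [map_neg, LinearMap.neg_apply, Complex.neg_re] at h4
      linarith [hα.1.2]
    apply Set.Subset.antisymm
    · rintro _ ⟨γ, hγ, rfl⟩; exact hsub γ hγ
    · intro γ hγ
      exact ⟨_, hsub γ hγ, (rootRefl b α).left_inv γ⟩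
  have h2 : rootRefl b α σ = σ := by
    have h3 := (rootRefl b α : E →+ E).map_finsum_mem (s := posSys b Φ x \ {α}) (fun α => α) hfin'
    have h4 := finsum_mem_image (f := fun γ : E => γ) (s := posSys b Φ x \ {α})
      (rootRefl b α).injective.injOn
    rw [himg] at h4
    exact h3.trans h4.symm
  have h3 : b σ α = 0 := by
    have h4 := hΦ.isIsom_rootRefl hα.1.1 σ α
    rw [h2, hΦ.rootRefl_self hα.1.1, map_neg] at h4
    exact self_eq_neg.mp h4.symm
  rw [h1, map_add, hΦ.symm α σ, h3, add_zero]
  exact hΦ.re_pos hα.1.1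

lemma sum_pos_mem (x : E) : ∑ᶠ α ∈ posSys b Φ x, α ∈ V :=
  finsum_mem_induction (· ∈ V) V.zero_mem (fun _ _ => V.add_mem) fun _ h => hΦ.sub h.1

lemma sum_pos_regular {x : E} (hx : IsRegularVec b V Φ x) :
    ∀ α ∈ Φ, 0 < (b α x).re * (b α (∑ᶠ α ∈ posSys b Φ x, α)).re := by
  intro α hα
  rcases hΦ.neg_pos_or hx hα with h | h
  · exact mul_pos h.2 (hΦ.sum_pos_dominant hx h)
  · have h1 := h.2
    have h2 := hΦ.sum_pos_dominant hx h
    simp only [map_neg, LinearMap.neg_apply, Complex.neg_re] at h1 h2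
    nlinarith

/-- Subsystems cut out by a real subspace. -/
lemma inter_real (U : Submodule ℝ E) : IsRootSys b V (Φ ∩ U) where
  symm := hΦ.symm
  im_eq := hΦ.im_eq
  pos := hΦ.pos
  finite := hΦ.finite.subset Set.inter_subset_left
  sub := fun _ h => hΦ.sub h.1
  ne_zero := fun α h => hΦ.ne_zero α h.1
  refl := fun α hα β hβ => by
    refine ⟨hΦ.refl α hα.1 β hβ.1, ?_⟩
    rw [← rootRefl_apply, hΦ.rootRefl_real hα.1 (hΦ.sub hβ.1)]
    exact U.sub_mem hβ.2 (U.smul_mem _ hα.2)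
  diff := fun α hα β hβ h hne => ⟨hΦ.diff α hα.1 β hβ.1 h hne, U.sub_mem hα.2 hβ.2⟩
  two := fun α hα h => hΦ.two α hα.1 h.1

omit hΦ in
lemma regular_inter (U : Submodule ℝ E) {x : E} (hx : IsRegularVec b V Φ x) :
    IsRegularVec b V (Φ ∩ U) x := ⟨hx.1, fun α hα => hx.2 α hα.1⟩

end IsRootSys

end RootSystem

section RootSystem

variable {E : Type*} [AddCommGroup E] [Module ℂ E]
variable {b : LinearMap.BilinForm ℂ E} {V : Submodule ℝ E} {Φ : Set E}

lemma conj_mem_reflGroup {g : E ≃ₗ[ℂ] E} (hg : IsIsom b g) (hΦ : ∀ α, g α ∈ Φ ↔ α ∈ Φ)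
    {w : E ≃ₗ[ℂ] E} (hw : w ∈ reflGroup b Φ) : g * w * g⁻¹ ∈ reflGroup b Φ := by
  have : reflGroup b Φ ≤ (reflGroup b Φ).comap (MulAut.conj g).toMonoidHom := by
    rw [reflGroup, Subgroup.closure_le]
    rintro _ ⟨α, hα, rfl⟩
    change g * rootRefl b α * g⁻¹ ∈ reflGroup b Φ
    rw [← hg.conj_rootRefl]
    exact Subgroup.subset_closure ⟨_, (hΦ α).mpr hα, rfl⟩
  exact this hw

/-- The sum of the orbit of a root under an automorphism of the root system. -/
def orbitSum (g : E ≃ₗ[ℂ] E) (α : E) : E :=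
  ∑ᶠ β ∈ {β | ∃ k : ℕ, β = (g ^ k) α}, β

/-- The orbit of a root. -/
def orbitSet (g : E ≃ₗ[ℂ] E) (α : E) : Set E := {β | ∃ k : ℕ, β = (g ^ k) α}

namespace IsRootSys

variable (hΦ : IsRootSys b V Φ)
include hΦ

lemma orbit_subset {g : E ≃ₗ[ℂ] E} (hgΦ : ∀ α, g α ∈ Φ ↔ α ∈ Φ) {α : E} (hα : α ∈ Φ) :
    orbitSet g α ⊆ Φ := by
  rintro _ ⟨k, rfl⟩
  induction k with
  | zero => simpa using hα
  | succ k ih =>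
    rw [pow_succ']
    exact (hgΦ _).mpr ih

lemma exists_period {g : E ≃ₗ[ℂ] E} (hgΦ : ∀ α, g α ∈ Φ ↔ α ∈ Φ) {α : E} (hα : α ∈ Φ) :
    ∃ k : ℕ, 0 < k ∧ (g ^ k) α = α := by
  have hfin : (orbitSet g α).Finite := hΦ.finite.subset (hΦ.orbit_subset hgΦ hα)
  have : ¬ Function.Injective fun k : ℕ => (g ^ k) α := fun hinj =>
    Set.infinite_range_of_injective hinj (hfin.subset (by rintro _ ⟨k, rfl⟩; exact ⟨k, rfl⟩))
  simp only [Function.Injective, not_forall] at this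
  obtain ⟨i, j, hij, hne⟩ := this
  have key : ∀ i j : ℕ, i < j → (g ^ i) α = (g ^ j) α → ∃ k : ℕ, 0 < k ∧ (g ^ k) α = α := by
    intro i j hlt h
    refine ⟨j - i, by omega, (g ^ i).injective ?_⟩
    rw [h]
    change (g ^ i * g ^ (j - i)) α = _
    rw [← pow_add]; congr 2; omega
  rcases lt_or_gt_of_ne hne with h | h
  · exact key i j h hij
  · exact key j i h hij.symm

lemma image_orbit {g : E ≃ₗ[ℂ] E} (hgΦ : ∀ α, g α ∈ Φ ↔ α ∈ Φ) {α : E} (hα : α ∈ Φ) :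
    g '' orbitSet g α = orbitSet g α := by
  apply Set.Subset.antisymm
  · rintro _ ⟨_, ⟨k, rfl⟩, rfl⟩
    exact ⟨k + 1, by rw [pow_succ']; rfl⟩
  · rintro _ ⟨k, rfl⟩
    obtain ⟨p, hp, hpα⟩ := hΦ.exists_period hgΦ hα
    refine ⟨(g ^ (k + p - 1)) α, ⟨_, rfl⟩, ?_⟩
    change (g * g ^ (k + p - 1)) α = _
    rw [← pow_succ', show k + p - 1 + 1 = k + p by omega, pow_add]
    change (g ^ k) ((g ^ p) α) = _
    rw [hpα]

lemma map_orbitSum {g : E ≃ₗ[ℂ] E} (hgΦ : ∀ α, g α ∈ Φ ↔ α ∈ Φ) {α : E} (hα : α ∈ Φ) :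
    g (orbitSum g α) = orbitSum g α := by
  have hfin : (orbitSet g α).Finite := hΦ.finite.subset (hΦ.orbit_subset hgΦ hα)
  have h1 := (g : E →+ E).map_finsum_mem (s := orbitSet g α) (fun α => α) hfin
  have h2 := finsum_mem_image (f := fun γ : E => γ) (s := orbitSet g α) g.injective.injOn
  rw [hΦ.image_orbit hgΦ hα] at h2
  exact h1.trans h2.symm

omit hΦ in
lemma IsIsom.pow {g : E ≃ₗ[ℂ] E} (h : IsIsom b g) (k : ℕ) : IsIsom b (g ^ k) := by
  induction k with
  | zero => exact fun _ _ => rfl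
  | succ k ih => rw [pow_succ]; exact IsIsom.mul ih h

omit hΦ in
lemma pow_fix {g : E ≃ₗ[ℂ] E} {y : E} (hy : g y = y) (k : ℕ) : (g ^ k) y = y := by
  induction k with
  | zero => rfl
  | succ k ih => rw [pow_succ]; change (g ^ k) (g y) = y; rw [hy, ih]

/-- On fixed vectors, pairing with the orbit sum is a multiple of the pairing with the root. -/
lemma b_orbitSum {g : E ≃ₗ[ℂ] E} (hg : IsIsom b g) (hgΦ : ∀ α, g α ∈ Φ ↔ α ∈ Φ) {α : E}
    (hα : α ∈ Φ) {y : E} (hy : g y = y) :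
    b y (orbitSum g α) = (orbitSet g α).ncard * b y α := by
  have hfin : (orbitSet g α).Finite := hΦ.finite.subset (hΦ.orbit_subset hgΦ hα)
  have h1 := (b y : E →+ ℂ).map_finsum_mem (s := orbitSet g α) (fun α => α) hfin
  refine h1.trans ?_
  have h2 : ∑ᶠ β ∈ orbitSet g α, b y β = ∑ᶠ β ∈ orbitSet g α, b y α := by
    refine finsum_mem_congr rfl ?_
    rintro _ ⟨k, rfl⟩
    nth_rewrite 1 [← pow_fix hy k]
    exact IsIsom.pow hg k _ _
  refine h2.trans ?_
  rw [finsum_mem_eq_finite_toFinset_sum _ hfin, Finset.sum_const, Set.ncard_eq_toFinset_card _ hfin,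
    nsmul_eq_mul]

lemma ncard_orbit_pos {g : E ≃ₗ[ℂ] E} (hgΦ : ∀ α, g α ∈ Φ ↔ α ∈ Φ) {α : E}
    (hα : α ∈ Φ) : 0 < (orbitSet g α).ncard := by
  have hfin : (orbitSet g α).Finite := hΦ.finite.subset (hΦ.orbit_subset hgΦ hα)
  exact (Set.ncard_pos hfin).mpr ⟨α, 0, rfl⟩

/-- A fixed combination of the elements of an orbit is a multiple of their sum. -/
lemma span_orbit_fixed {g : E ≃ₗ[ℂ] E} (hgΦ : ∀ α, g α ∈ Φ ↔ α ∈ Φ) {α : E} (hα : α ∈ Φ) {u : E}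
    (hu : u ∈ Submodule.span ℂ (orbitSet g α)) (hgu : g u = u) :
    ∃ c : ℂ, u = c • orbitSum g α := by
  obtain ⟨p, hp, hpα⟩ := hΦ.exists_period hgΦ hα
  let S : E →ₗ[ℂ] E := ∑ j ∈ Finset.range p, ((g ^ j : E ≃ₗ[ℂ] E) : E →ₗ[ℂ] E)
  have hS : ∀ v, S v = ∑ j ∈ Finset.range p, (g ^ j) v := fun v => by
    simp [S, LinearMap.sum_apply]
  have hα' : ∀ k : ℕ, S ((g ^ k) α) = S α := by
    intro k
    induction k with
    | zero => rfl
    | succ k ih =>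
      rw [← ih, hS, hS]
      have h1 : ∀ j, (g ^ j) ((g ^ (k + 1)) α) = (g ^ (j + 1)) ((g ^ k) α) := fun j => by
        change (g ^ j * g ^ (k + 1)) α = (g ^ (j + 1) * g ^ k) α
        rw [← pow_add, ← pow_add]; congr 2; omega
      simp_rw [h1]
      have h2 := Finset.sum_range_succ (fun j => (g ^ j) ((g ^ k) α)) p
      rw [Finset.sum_range_succ'] at h2
      have h3 : (g ^ p) ((g ^ k) α) = (g ^ 0) ((g ^ k) α) := by
        change (g ^ p * g ^ k) α = (g ^ k) α
        rw [← pow_add, add_comm, pow_add]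
        change (g ^ k) ((g ^ p) α) = _
        rw [hpα]
      rw [h3] at h2
      exact add_right_cancel h2
  have h1 : ∀ v ∈ Submodule.span ℂ (orbitSet g α), ∃ c : ℂ, S v = c • S α := by
    intro v hv
    refine Submodule.span_induction (p := fun v _ => ∃ c : ℂ, S v = c • S α) ?_ ?_ ?_ ?_ hv
    · rintro _ ⟨k, rfl⟩; exact ⟨1, by rw [hα', one_smul]⟩
    · exact ⟨0, by simp⟩
    · rintro x y _ _ ⟨c, hc⟩ ⟨c', hc'⟩; exact ⟨c + c', by rw [map_add, hc, hc', add_smul]⟩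
    · rintro a x _ ⟨c, hc⟩; exact ⟨a * c, by rw [map_smul, hc, smul_smul]⟩
  have hfix : ∀ v, g v = v → S v = (p : ℂ) • v := by
    intro v hv
    rw [hS, Finset.sum_congr rfl fun j _ => pow_fix hv j, Finset.sum_const, Finset.card_range,
      Nat.cast_smul_eq_nsmul]
  have hp0 : (p : ℂ) ≠ 0 := Nat.cast_ne_zero.mpr hp.ne'
  have hfin : (orbitSet g α).Finite := hΦ.finite.subset (hΦ.orbit_subset hgΦ hα)
  have h2 : S (orbitSum g α) = ((orbitSet g α).ncard : ℂ) • S α := by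
    have h3 := (S : E →+ E).map_finsum_mem (s := orbitSet g α) (fun α => α) hfin
    refine h3.trans ?_
    have h4 : ∑ᶠ β ∈ orbitSet g α, S β = ∑ᶠ β ∈ orbitSet g α, S α := by
      refine finsum_mem_congr rfl ?_
      rintro _ ⟨k, rfl⟩
      exact hα' k
    refine h4.trans ?_
    rw [finsum_mem_eq_finite_toFinset_sum _ hfin, Finset.sum_const,
      Set.ncard_eq_toFinset_card _ hfin, Nat.cast_smul_eq_nsmul]
  rw [hfix _ (hΦ.map_orbitSum hgΦ hα)] at h2
  have hN : ((orbitSet g α).ncard : ℂ) ≠ 0 :=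
    Nat.cast_ne_zero.mpr (hΦ.ncard_orbit_pos hgΦ hα).ne'
  obtain ⟨c, hc⟩ := h1 u hu
  rw [hfix u hgu] at hc
  refine ⟨c / (orbitSet g α).ncard, ?_⟩
  have h5 : (p : ℂ) • u = (p : ℂ) • ((c / (orbitSet g α).ncard) • orbitSum g α) := by
    rw [hc, smul_comm, h2, smul_smul, div_mul_cancel₀ _ hN]
  exact smul_right_injective E hp0 h5

/-- The reflection defined on fixed vectors by the sum of an orbit of roots is induced by an element
of the reflection group commuting with the automorphism. -/
lemma exists_lift {g : E ≃ₗ[ℂ] E} (hg : IsIsom b g) (hgΦ : ∀ α, g α ∈ Φ ↔ α ∈ Φ) {x : E}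
    (hx : IsRegularVec b V Φ x) (hgx : g x = x) {α : E} (hα : α ∈ Φ) :
    ∃ w ∈ reflGroup b Φ, g * w = w * g ∧
      ∀ y, g y = y → w y = rootRefl b (orbitSum g α) y := by
  set U : Submodule ℝ E := Submodule.span ℝ (orbitSet g α) with hU
  have hΨ := hΦ.inter_real U
  have hxΨ : IsRegularVec b V (Φ ∩ U) x := regular_inter U hx
  have hxΨ' : IsRegularVec b V (Φ ∩ U) (-x) :=
    ⟨V.neg_mem hx.1, fun γ hγ => by simpa using hx.2 γ hγ.1⟩
  have hgU : ∀ γ, γ ∈ U → g γ ∈ U := by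
    intro γ hγ
    refine Submodule.span_induction (p := fun γ _ => g γ ∈ U) ?_ (by simp) ?_ ?_ hγ
    · rintro _ ⟨k, rfl⟩
      exact Submodule.subset_span ⟨k + 1, by rw [pow_succ']; rfl⟩
    · intro x y _ _ hx hy; rw [map_add]; exact U.add_mem hx hy
    · intro c x _ hx
      rw [← Complex.coe_smul, map_smul, Complex.coe_smul]; exact U.smul_mem _ hx
  have hgU' : ∀ γ, γ ∈ U → g⁻¹ γ ∈ U := by
    intro γ hγ
    refine Submodule.span_induction (p := fun γ _ => g⁻¹ γ ∈ U) ?_ (by simp) ?_ ?_ hγ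
    · intro β hβ
      rw [← hΦ.image_orbit hgΦ hα] at hβ
      obtain ⟨δ, hδ, rfl⟩ := hβ
      rw [show g⁻¹ (g δ) = δ from g.symm_apply_apply δ]
      exact Submodule.subset_span hδ
    · intro x y _ _ hx hy; rw [map_add]; exact U.add_mem hx hy
    · intro c x _ hx
      rw [← Complex.coe_smul, map_smul, Complex.coe_smul]; exact U.smul_mem _ hx
  have hgΨ : ∀ γ, g γ ∈ Φ ∩ U ↔ γ ∈ Φ ∩ U := by
    intro γ
    refine ⟨fun h => ⟨(hgΦ γ).mp h.1, ?_⟩, fun h => ⟨(hgΦ γ).mpr h.1, hgU γ h.2⟩⟩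
    have := hgU' _ h.2
    rwa [show g⁻¹ (g γ) = γ from g.symm_apply_apply γ] at this
  obtain ⟨w, hw, hwx⟩ := hΨ.exists_map_chamber hxΨ' hxΨ
  have hwx' : ∀ γ ∈ Φ ∩ U, (b γ x).re * (b γ (w x)).re < 0 := fun γ hγ => by
    have := hwx γ hγ
    simp only [map_neg, Complex.neg_re] at this
    linarith
  have hcw := conj_mem_reflGroup hg hgΨ hw
  have hginv : g⁻¹ x = x := by
    conv_lhs => rw [← hgx]
    exact g.symm_apply_apply x
  have hcwx : (g * w * g⁻¹) x = g (w x) := by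
    change g (w (g⁻¹ x)) = _
    rw [hginv]
  have hcomm : g * w * g⁻¹ = w := by
    have h1 : w⁻¹ * (g * w * g⁻¹) = 1 := by
      refine hΨ.eq_one_of_pos hxΨ (mul_mem (inv_mem hw) hcw) fun γ hγ => ?_
      have hmem := hΨ.map_root (mul_mem (inv_mem hw) hcw) hγ.1
      refine ⟨hmem, ?_⟩
      have hγ1 : g⁻¹ γ ∈ Φ ∩ U := (hgΨ _).mp (by
        rw [show g (g⁻¹ γ) = γ from g.apply_symm_apply γ]; exact hγ.1)
      have hγ2 : 0 < (b (g⁻¹ γ) x).re := by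
        have := hg (g⁻¹ γ) x
        rw [show g (g⁻¹ γ) = γ from g.apply_symm_apply γ, hgx] at this
        rw [← this]; exact hγ.2
      have h3 : (b (w (g⁻¹ γ)) x).re < 0 := by
        have h4 := hwx' _ (hΨ.map_root hw hγ1)
        rw [hΨ.isom hw] at h4
        nlinarith
      have h5 : (b ((g * w * g⁻¹) γ) x).re < 0 := by
        have := hg (w (g⁻¹ γ)) x
        rw [hgx] at this
        change (b (g (w (g⁻¹ γ))) x).re < 0
        rw [this]; exact h3
      have h6 := hwx' _ (hΨ.map_root hcw hγ.1)
      have h7 : b ((w⁻¹ * (g * w * g⁻¹)) γ) x = b ((g * w * g⁻¹) γ) (w x) := by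
        rw [← hΨ.isom hw]
        change b (w (w.symm _)) _ = _
        rw [LinearEquiv.apply_symm_apply]
        rfl
      rw [h7]
      nlinarith
    rw [inv_mul_eq_one] at h1
    exact h1.symm
  have hcomm' : g * w = w * g := by
    nth_rewrite 2 [← hcomm]; group
  have hwΦ : w ∈ reflGroup b Φ := Subgroup.closure_mono (Set.image_mono Set.inter_subset_left) hw
  refine ⟨w, hwΦ, hcomm', ?_⟩
  have hspan : Submodule.span ℂ (Φ ∩ (U : Set E)) ≤ Submodule.span ℂ (orbitSet g α) := by
    rw [Submodule.span_le]
    intro γ hγ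
    exact Submodule.span_le_restrictScalars ℝ ℂ _ hγ.2
  have hdiff : ∀ y, g y = y → ∃ c : ℂ, w y = y + c • orbitSum g α := by
    intro y hy
    have h1 : g (w y - y) = w y - y := by
      rw [map_sub, hy]
      congr 1
      change (g * w) y = w y
      rw [hcomm']
      change w (g y) = w y
      rw [hy]
    obtain ⟨c, hc⟩ := hΦ.span_orbit_fixed hgΦ hα (hspan (hΨ.map_sub_mem hw y)) h1
    exact ⟨c, by rw [← hc]; abel⟩
  set S := orbitSum g α with hS
  have hgS : g S = S := hΦ.map_orbitSum hgΦ hα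
  have hSx : (b S x).re = (orbitSet g α).ncard * (b α x).re := by
    rw [hΦ.symm, hΦ.b_orbitSum hg hgΦ hα hgx, hΦ.symm x α, ← Complex.ofReal_natCast,
      Complex.re_ofReal_mul]
  have hN := hΦ.ncard_orbit_pos hgΦ hα
  have hSV : S ∈ V := finsum_mem_induction (· ∈ V) V.zero_mem (fun _ _ => V.add_mem)
    fun β hβ => hΦ.sub (hΦ.orbit_subset hgΦ hα hβ)
  have hS0 : S ≠ 0 := by
    intro h
    rw [h] at hSx
    simp only [map_zero, LinearMap.zero_apply, Complex.zero_re] at hSx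
    exact (mul_ne_zero (Nat.cast_ne_zero.mpr hN.ne') (hx.2 α hα)) hSx.symm
  have hSS : b S S ≠ 0 := fun h => by
    have := hΦ.pos S hSV hS0
    rw [h] at this; exact lt_irrefl _ this
  have hwS : w S = -S := by
    obtain ⟨c, hc⟩ := hdiff S hgS
    have h1 := hΨ.isom hw S S
    rw [hc] at h1
    have h2 : c * (c + 2) = 0 := by
      have h3 : (c * (c + 2)) * b S S = 0 := by
        simp only [map_add, LinearMap.add_apply, map_smul, LinearMap.smul_apply, smul_eq_mul] at h1
        linear_combination h1
      exact (mul_eq_zero.mp h3).resolve_right hSS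
    rcases mul_eq_zero.mp h2 with h3 | h3
    · exfalso
      rw [h3, zero_smul, add_zero] at hc
      have h4 : ∀ β ∈ orbitSet g α, 0 < (b α x).re * -(b (w β) x).re := by
        rintro _ ⟨k, rfl⟩
        have hβ : (g ^ k) α ∈ Φ ∩ U :=
          ⟨hΦ.orbit_subset hgΦ hα ⟨k, rfl⟩, Submodule.subset_span ⟨k, rfl⟩⟩
        have h5 := hwx' _ (hΨ.map_root hw hβ)
        rw [hΨ.isom hw] at h5
        have h6 : b ((g ^ k) α) x = b α x := by
          nth_rewrite 1 [← pow_fix hgx k]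
          exact IsIsom.pow hg k _ _
        rw [h6] at h5
        linarith
      have hfin : (orbitSet g α).Finite := hΦ.finite.subset (hΦ.orbit_subset hgΦ hα)
      have h7 : w S = ∑ β ∈ hfin.toFinset, w β := by
        rw [hS, orbitSum]
        change w (∑ᶠ β ∈ orbitSet g α, β) = _
        rw [finsum_mem_eq_finite_toFinset_sum _ hfin, map_sum]
      have h8 : 0 < (b α x).re * -(b (w S) x).re := by
        rw [h7, map_sum, LinearMap.sum_apply, Complex.re_sum, ← Finset.sum_neg_distrib,
          Finset.mul_sum]
        exact Finset.sum_pos (fun β hβ => h4 β (hfin.mem_toFinset.mp hβ))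
          ⟨α, hfin.mem_toFinset.mpr ⟨0, rfl⟩⟩
      rw [hc, hSx] at h8
      have h9 := mul_self_nonneg (b α x).re
      have h10 : (0 : ℝ) < (orbitSet g α).ncard := Nat.cast_pos.mpr hN
      nlinarith [mul_nonneg h10.le h9]
    · rw [hc, eq_neg_of_add_eq_zero_left h3]; module
  intro y hy
  obtain ⟨c, hc⟩ := hdiff y hy
  have h1 := hΨ.isom hw y S
  rw [hc, hwS] at h1
  have h2 : c = -(2 * b y S / b S S) := by
    field_simp
    simp only [map_add, map_neg, LinearMap.add_apply, map_smul, LinearMap.smul_apply,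
      smul_eq_mul] at h1
    linear_combination -h1
  rw [rootRefl_apply, hc, h2]
  module

end IsRootSys

end RootSystem

section Chambers

variable {L : Type*} [LieRing L] [LieAlgebra ℝ L] [FiniteDimensional ℝ L] {n : ℕ}
  {r : L →ₗ[ℝ] Matrix (Fin n) (Fin n) ℝ} {B : LinearMap.BilinForm ℝ L}
  {m h : LieSubalgebra ℝ L}

lemma CartanPair.isRootSys (hc : CartanPair r B m h) :
    IsRootSys (bForm hc) (realSub r h) {α | IsRoot m h α} where
  symm := bForm_symm hc
  im_eq := fun _ hx _ hy => bForm_im hc hx hy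
  pos := fun _ hx h0 => bForm_re_pos hc hx h0
  finite := hc.finite_roots
  sub := fun _ hα => hc.root_mem_realSub hα.2
  ne_zero := fun _ hα => hα.1
  refl := fun α hα β hβ => by
    refine ⟨fun h0 => ?_, hc.rootSpace_reflect hα hβ.2⟩
    rw [← rootRefl_apply] at h0
    exact hβ.1 ((LinearEquiv.map_eq_zero_iff _).mp h0)
  diff := fun α hα β hβ hpos hne =>
    ⟨sub_ne_zero.mpr hne, hc.rootSpace_sub hβ hα.2 (by rwa [bForm_symm])⟩
  two := fun _ hα h0 => h0.2 (hc.rootSpace_two_smul hα)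

variable (h) in
/-- The real space of imaginary forms. -/
def imagSub : Submodule ℝ (CForm h) where
  carrier := {α | IsImaginary h α}
  add_mem' := fun {α β} hα hβ X => by
    rw [LinearMap.add_apply, star_add, hα X, hβ X]; ring
  zero_mem' := fun X => by simp
  smul_mem' := fun c α hα X => by
    rw [LinearMap.smul_apply, star_smul, hα X]; simp

lemma CartanPair.isRootSys_imag (hc : CartanPair r B m h) :
    IsRootSys (bForm hc) (realSub r h) (imagRoots m h) :=
  hc.isRootSys.inter_real (imagSub h)

lemma CartanPair.weylGroup_eq (hc : CartanPair r B m h) :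
    weylGroup m h = reflGroup (bForm hc) {α | IsRoot m h α} := by
  rw [weylGroup, reflGroup]
  congr 1
  ext s
  constructor
  · rintro ⟨α, hα, hs⟩
    refine ⟨α, hα, ?_⟩
    ext1 β
    rw [hs, hc.pair_eq hα, rootRefl_apply]
  · rintro ⟨α, hα, rfl⟩
    exact ⟨α, hα, fun β => by rw [hc.pair_eq hα, rootRefl_apply]⟩

lemma CartanPair.pair_re (hc : CartanPair r B m h) {α β : CForm h} (hα : IsRoot m h α)
    (hβ : β ∈ realSub r h) :
    (pair m h β α).re = 2 * (bForm hc α β).re / (bForm hc α α).re := by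
  have hα' := hc.root_mem_realSub hα.2
  rw [hc.pair_eq hα, bForm_symm hc β α, hc.isRootSys.b_eq hα' hβ, hc.isRootSys.b_eq hα' hα']
  norm_cast

lemma CartanPair.pair_re_pos_iff (hc : CartanPair r B m h) {α β : CForm h} (hα : IsRoot m h α)
    (hβ : β ∈ realSub r h) : 0 < (pair m h β α).re ↔ 0 < (bForm hc α β).re := by
  rw [hc.pair_re hα hβ, div_pos_iff_of_pos_right (hc.isRootSys.re_pos hα)]
  constructor <;> intro h <;> linarith

lemma CartanPair.isRegularFor_iff (hc : CartanPair r B m h) {R : Set (CForm h)}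
    (hR : R ⊆ {α | IsRoot m h α}) {β : CForm h} (hβ : β ∈ realSub r h) :
    IsRegularFor m h R β ↔ IsRegularVec (bForm hc) (realSub r h) R β := by
  have key : ∀ α ∈ R, (pair m h β α).re ≠ 0 ↔ (bForm hc α β).re ≠ 0 := by
    intro α hα
    rw [hc.pair_re (hR hα) hβ]
    have := (hc.isRootSys.re_pos (hR hα)).ne'
    simp [this]
  exact ⟨fun H => ⟨hβ, fun α hα => (key α hα).mp (H α hα)⟩,
    fun H α hα => (key α hα).mpr (H.2 α hα)⟩

lemma CartanPair.mem_chamberOf_iff (hc : CartanPair r B m h) {S R : Set (CForm h)}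
    (hR : R ⊆ {α | IsRoot m h α}) (hS : S ⊆ realSub r h) {β γ : CForm h}
    (hβ : β ∈ realSub r h) : γ ∈ chamberOf m h S R β ↔
      γ ∈ S ∧ ∀ α ∈ R, 0 < (bForm hc α β).re * (bForm hc α γ).re := by
  refine and_congr_right fun hγ => forall₂_congr fun α hα => ?_
  rw [hc.pair_re (hR hα) hβ, hc.pair_re (hR hα) (hS hγ)]
  have h1 := hc.isRootSys.re_pos (hR hα)
  rw [div_mul_div_comm, div_pos_iff_of_pos_right (mul_pos h1 h1)]
  constructor <;> intro h <;> nlinarith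

/-- The description of a chamber and its positive roots by the half sum of the latter. -/
structure IsRhoOf (hc : CartanPair r B m h) (F : Set (CForm h)) : Prop where
  regular : IsRegularVec (bForm hc) (realSub r h) (imagRoots m h) (rho m h F)
  posRoots_eq : posRoots m h F = posSys (bForm hc) (imagRoots m h) (rho m h F)
  simpleRoots_eq : simpleRoots m h F = simpleSys (bForm hc) (imagRoots m h) (rho m h F)
  mem_iff : ∀ γ, γ ∈ F ↔ γ ∈ realSub r h ∧
    ∀ α ∈ imagRoots m h, 0 < (bForm hc α (rho m h F)).re * (bForm hc α γ).re
  eq_chamberOf : F = chamberOf m h (realDual r h) (imagRoots m h) (rho m h F)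

lemma CartanPair.posRoots_chamberOf (hc : CartanPair r B m h) {β : CForm h}
    (hβ : IsRegularVec (bForm hc) (realSub r h) (imagRoots m h) β) :
    posRoots m h (chamberOf m h (realDual r h) (imagRoots m h) β) =
      posSys (bForm hc) (imagRoots m h) β := by
  have hmem := fun γ => hc.mem_chamberOf_iff (S := realDual r h) (R := imagRoots m h) (γ := γ)
    (fun α hα => hα.1) (fun _ h => h) hβ.1
  ext α
  constructor
  · rintro ⟨h1, h2⟩
    refine ⟨h1, ?_⟩
    rw [← hc.pair_re_pos_iff h1.1 hβ.1]
    exact h2 β ((hmem β).mpr ⟨hβ.1, fun α hα => mul_self_pos.mpr (hβ.2 α hα)⟩)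
  · rintro ⟨h1, h2⟩
    refine ⟨h1, fun γ hγ => ?_⟩
    have h3 := (hmem γ).mp hγ
    rw [hc.pair_re_pos_iff h1.1 h3.1]
    exact pos_of_mul_pos_right (h3.2 α h1) h2.le

lemma CartanPair.isRhoOf (hc : CartanPair r B m h) {F : Set (CForm h)}
    (hF : IsImagChamber r m h F) : IsRhoOf hc F := by
  obtain ⟨β, hβ, hreg, rfl⟩ := hF
  have hreg' := (hc.isRegularFor_iff (fun α hα => hα.1) hβ).mp hreg
  have hpos := hc.posRoots_chamberOf hreg'
  have hΦ := hc.isRootSys_imag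
  set F := chamberOf m h (realDual r h) (imagRoots m h) β with hF
  have hmem := fun γ => hc.mem_chamberOf_iff (S := realDual r h) (R := imagRoots m h) (γ := γ)
    (fun α hα => hα.1) (fun _ h => h) hβ
  have hrho : rho m h F = (1 / 2 : ℂ) • ∑ᶠ α ∈ posSys (bForm hc) (imagRoots m h) β, α := by
    rw [rho, hpos]
  have hre : ∀ α, (bForm hc α (rho m h F)).re =
      1 / 2 * (bForm hc α (∑ᶠ α ∈ posSys (bForm hc) (imagRoots m h) β, α)).re := by
    intro α
    rw [hrho, map_smul, smul_eq_mul, show (1 / 2 : ℂ) = ((1 / 2 : ℝ) : ℂ) by norm_num,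
      Complex.re_ofReal_mul]
  have hdom : ∀ α ∈ imagRoots m h, 0 < (bForm hc α β).re * (bForm hc α (rho m h F)).re := by
    intro α hα
    rw [hre]
    have := hΦ.sum_pos_regular hreg' α hα
    linarith
  have hmemV : rho m h F ∈ realSub r h := by
    rw [hrho, show (1 / 2 : ℂ) = ((1 / 2 : ℝ) : ℂ) by norm_num, Complex.coe_smul]
    exact Submodule.smul_mem _ _ (hΦ.sum_pos_mem β)
  have hposeq : posSys (bForm hc) (imagRoots m h) β =
      posSys (bForm hc) (imagRoots m h) (rho m h F) := by
    ext α
    refine and_congr_right fun hα => ?_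
    have := hdom α hα
    exact ⟨fun h => pos_of_mul_pos_right this h.le, fun h => pos_of_mul_pos_left this h.le⟩
  have hmem' : ∀ γ, γ ∈ F ↔ γ ∈ realSub r h ∧
      ∀ α ∈ imagRoots m h, 0 < (bForm hc α (rho m h F)).re * (bForm hc α γ).re := by
    intro γ
    rw [hmem]
    refine and_congr_right fun hγ => forall₂_congr fun α hα => ?_
    have := hdom α hα
    constructor
    · intro h1; by_contra h2; nlinarith [mul_pos this h1, mul_self_nonneg (bForm hc α β).re]
    · intro h1; by_contra h2
      nlinarith [mul_pos this h1, mul_self_nonneg (bForm hc α (rho m h F)).re]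
  refine ⟨⟨hmemV, fun α hα => ?_⟩, hpos.trans hposeq, ?_, hmem', ?_⟩
  · exact right_ne_zero_of_mul (hdom α hα).ne'
  · ext α
    simp only [simpleRoots, simpleSys, hpos, hposeq]
  · ext γ
    rw [hmem', hc.mem_chamberOf_iff (S := realDual r h) (R := imagRoots m h)
      (fun α hα => hα.1) (fun _ h => h) hmemV]
    rfl

lemma IsRhoOf.rho_mem {hc : CartanPair r B m h} {F : Set (CForm h)} (hF : IsRhoOf hc F) :
    rho m h F ∈ F :=
  (hF.mem_iff _).mpr ⟨hF.regular.1, fun _ hα => mul_self_pos.mpr (hF.regular.2 _ hα)⟩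

lemma CartanPair.isImagChamber_chamberOf (hc : CartanPair r B m h) {β : CForm h}
    (hβ : IsRegularVec (bForm hc) (realSub r h) (imagRoots m h) β) :
    IsImagChamber r m h (chamberOf m h (realDual r h) (imagRoots m h) β) :=
  ⟨β, hβ.1, (hc.isRegularFor_iff (fun α hα => hα.1) hβ.1).mpr hβ, rfl⟩

lemma isImaginary_rho (F : Set (CForm h)) :
    IsImaginary h (rho m h F) := by
  have h1 : ∑ᶠ α ∈ posRoots m h F, α ∈ imagSub h :=
    finsum_mem_induction (· ∈ imagSub h) (Submodule.zero_mem _)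
      (fun _ _ => Submodule.add_mem _) fun _ h => h.1.2
  have h2 := Submodule.smul_mem (imagSub h) (1 / 2 : ℝ) h1
  rw [← Complex.coe_smul] at h2
  rw [rho, show (1 / 2 : ℂ) = ((1 / 2 : ℝ) : ℂ) by norm_num]
  exact h2

/-- Two vectors on the same side of all hyperplanes define the same chamber. -/
lemma chamberOf_congr {β γ : CForm h}
    (hγ : γ ∈ chamberOf m h (realDual r h) (imagRoots m h) β) :
    chamberOf m h (realDual r h) (imagRoots m h) γ =
      chamberOf m h (realDual r h) (imagRoots m h) β := by
  ext δ
  refine and_congr_right fun hδ => forall₂_congr fun α hα => ?_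
  have := hγ.2 α hα
  constructor
  · intro h1; by_contra h2; nlinarith [mul_pos this h1, mul_self_nonneg (pair m h γ α).re]
  · intro h1; by_contra h2; nlinarith [mul_pos this h1, mul_self_nonneg (pair m h β α).re]

/-- A root space decomposition compatible with operators acting by scalars on root spaces. -/
lemma CartanPair.exists_decomp (hc : CartanPair r B m h) {z : ℂ ⊗[ℝ] L}
    (hz : z ∈ m.toSubmodule.baseChange ℂ) :
    ∃ f : CForm h →₀ ℂ ⊗[ℝ] L, (∀ α, f α ∈ rootSpace m h α) ∧ (f.sum fun _ x => x) = z ∧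
      ∀ (T : Module.End ℂ (ℂ ⊗[ℝ] L)) (c : CForm h → ℂ),
        (∀ α, ∀ x ∈ rootSpace m h α, T x = c α • x) → ∀ μ : ℂ, T z = μ • z →
          ∀ α, f α ≠ 0 → c α = μ := by
  obtain ⟨f, hf, hsum⟩ := (Submodule.mem_iSup_iff_exists_finsupp _ _).mp (hc.baseChange_le_iSup hz)
  refine ⟨f, hf, hsum, fun T c hT μ hμ α hα => ?_⟩
  have h1 : ∑ β ∈ f.support, (c β - μ) • f β = 0 := by
    have h2 : T (f.sum fun _ x => x) = ∑ β ∈ f.support, c β • f β := by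
      rw [Finsupp.sum, map_sum]
      exact Finset.sum_congr rfl fun β _ => hT β _ (hf β)
    rw [hsum, hμ, ← hsum, Finsupp.sum, Finset.smul_sum] at h2
    simp_rw [sub_smul]
    rw [Finset.sum_sub_distrib, ← h2, sub_self]
  have h3 := (iSupIndep_iff_finsetSum_eq_zero_imp_eq_zero _).mp hc.iSupIndep_rootSpace f.support
    (fun β => (c β - μ) • f β) (fun β _ => Submodule.smul_mem _ _ (hf β)) h1 α
    (Finsupp.mem_support_iff.mpr hα)
  exact sub_eq_zero.mp ((smul_eq_zero.mp h3).resolve_right hα)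

lemma adC_apply (x y : ℂ ⊗[ℝ] L) : LieAlgebra.ad ℂ (ℂ ⊗[ℝ] L) x y = ⁅x, y⁆ := rfl

/-- The centralizer in `m` of a vector of `h` orthogonal to no root. -/
lemma CartanPair.mem_of_commute_regular (hc : CartanPair r B m h) {x : CForm h}
    (hx : IsRegularVec (bForm hc) (realSub r h) {α | IsRoot m h α} x) {X : L} (hX : X ∈ m)
    (h1 : ⁅reV (tC B x), X⁆ = 0) (h2 : ⁅imV (tC B x), X⁆ = 0) : X ∈ h := by
  obtain ⟨f, hf, hsum, hT⟩ := hc.exists_decomp (z := (1 : ℂ) ⊗ₜ[ℝ] X)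
    (mem_baseChange_iff.mpr ⟨by simpa using hX, by simp⟩)
  have h3 := hT (LieAlgebra.ad ℂ (ℂ ⊗[ℝ] L) (tC B x)) (fun α => bForm hc x α)
    (fun α y hy => hc.lie_tC x hy) 0 (by
      rw [zero_smul, adC_apply]
      apply ext_re_im <;> simp [h1, h2])
  have h4 : (1 : ℂ) ⊗ₜ[ℝ] X ∈ rootSpace m h 0 := by
    rw [← hsum]
    refine Submodule.sum_mem _ fun α hα => ?_
    have hα' := Finsupp.mem_support_iff.mp hα
    by_cases h0 : α = 0
    · rw [← h0]; exact hf α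
    · exfalso
      have hroot : IsRoot m h α := ⟨h0, fun hbot => hα' (by
        have := hf α; rw [hbot] at this; exact this)⟩
      apply hx.2 α hroot
      rw [bForm_symm, h3 α hα']; simp
  simpa using (hc.mem_rootSpace_zero_iff.mp h4).1

end Chambers

section Automorphisms

variable {L : Type*} [LieRing L] [LieAlgebra ℝ L] [FiniteDimensional ℝ L] {n : ℕ}
  {r : L →ₗ[ℝ] Matrix (Fin n) (Fin n) ℝ} {B : LinearMap.BilinForm ℝ L}
  {m h : LieSubalgebra ℝ L} {a : L →ₗ⁅ℝ⁆ L}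

lemma isSemisimpleMatrix_conj {M : Matrix (Fin n) (Fin n) ℝ} (hM : IsSemisimpleMatrix M)
    (g : GL (Fin n) ℝ) : IsSemisimpleMatrix ((g : Matrix (Fin n) (Fin n) ℝ) * M *
      ((g⁻¹ : GL (Fin n) ℝ) : Matrix (Fin n) (Fin n) ℝ)) := by
  refine isSemisimple_of_intertwine
    (Matrix.toLin' ((g⁻¹ : GL (Fin n) ℝ) : Matrix (Fin n) (Fin n) ℝ)) ?_ ?_ hM
  · intro v w hvw
    have := congrArg (Matrix.toLin' (g : Matrix (Fin n) (Fin n) ℝ)) hvw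
    rw [← LinearMap.comp_apply, ← LinearMap.comp_apply, ← Matrix.toLin'_mul] at this
    simpa using this
  · intro v
    rw [← LinearMap.comp_apply, ← LinearMap.comp_apply, ← Matrix.toLin'_mul, ← Matrix.toLin'_mul,
      ← mul_assoc, ← mul_assoc, Units.inv_mul, one_mul]

lemma isComplexEigenvalue_conj {M : Matrix (Fin n) (Fin n) ℝ} (g : GL (Fin n) ℝ) {z : ℂ} :
    IsComplexEigenvalue ((g : Matrix (Fin n) (Fin n) ℝ) * M *
        ((g⁻¹ : GL (Fin n) ℝ) : Matrix (Fin n) (Fin n) ℝ)) z ↔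
      IsComplexEigenvalue M z := by
  have h1 : ((g : Matrix (Fin n) (Fin n) ℝ) * M *
      ((g⁻¹ : GL (Fin n) ℝ) : Matrix (Fin n) (Fin n) ℝ)).charpoly = M.charpoly := by
    rw [Matrix.charpoly_mul_comm, ← mul_assoc, Units.inv_mul, one_mul]
  rw [IsComplexEigenvalue, IsComplexEigenvalue, Matrix.charpoly_map, Matrix.charpoly_map, h1]

/-- An automorphism of `L` induced by a semisimple conjugation and preserving `B`. -/
structure IsInvariantAut (r : L →ₗ[ℝ] Matrix (Fin n) (Fin n) ℝ) (B : LinearMap.BilinForm ℝ L)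
    (a : L →ₗ⁅ℝ⁆ L) : Prop where
  conj : ∃ g : GL (Fin n) ℝ, ∀ X, r (a X) = g * r X * (g⁻¹ : GL (Fin n) ℝ)
  form : ∀ X Y, B (a X) (a Y) = B X Y
  semisimple : Module.End.IsSemisimple (a : L →ₗ[ℝ] L)

/-- An automorphism preserving the members of a Cartan pair. -/
structure StableAut (r : L →ₗ[ℝ] Matrix (Fin n) (Fin n) ℝ) (B : LinearMap.BilinForm ℝ L)
    (m h : LieSubalgebra ℝ L) (a : L →ₗ⁅ℝ⁆ L) : Prop extends IsInvariantAut r B a where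
  cartan : CartanPair r B m h
  stable : ∀ X ∈ h, a X ∈ h
  stable_m : ∀ X ∈ m, a X ∈ m

lemma IsInvariantAut.elliptic (ia : IsInvariantAut r B a) {X : L} :
    IsInfElliptic r X → IsInfElliptic r (a X) := by
  obtain ⟨g, hg⟩ := ia.conj
  rw [IsInfElliptic, IsInfElliptic, hg]
  exact fun H => ⟨isSemisimpleMatrix_conj H.1 g, fun z hz =>
    H.2 z ((isComplexEigenvalue_conj g).mp hz)⟩

lemma IsInvariantAut.hyperbolic (ia : IsInvariantAut r B a) {X : L} :
    IsInfHyperbolic r X → IsInfHyperbolic r (a X) := by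
  obtain ⟨g, hg⟩ := ia.conj
  rw [IsInfHyperbolic, IsInfHyperbolic, hg]
  exact fun H => ⟨isSemisimpleMatrix_conj H.1 g, fun z hz =>
    H.2 z ((isComplexEigenvalue_conj g).mp hz)⟩

namespace StableAut

variable (ha : StableAut r B m h a)
include ha

lemma injective : Function.Injective a := by
  obtain ⟨g, hg⟩ := ha.conj
  intro X Y hXY
  apply ha.cartan.inj
  have h1 := congrArg r hXY
  rw [hg, hg] at h1
  have h2 := congrArg (fun M => ((g⁻¹ : GL (Fin n) ℝ) : Matrix (Fin n) (Fin n) ℝ) * M * g) h1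
  simpa [mul_assoc] using h2

/-- The restriction of the automorphism to `h`. -/
def resEquiv : h ≃ₗ[ℝ] h :=
  LinearEquiv.ofInjectiveEndo (resAut a h ha.stable) fun X Y hXY => by
    apply Subtype.ext
    exact ha.injective (congrArg Subtype.val hXY)

/-- The action of the automorphism on forms. -/
def pull : CForm h ≃ₗ[ℂ] CForm h where
  toFun β := β ∘ₗ resAut a h ha.stable
  map_add' _ _ := rfl
  map_smul' _ _ := rfl
  invFun β := β ∘ₗ (ha.resEquiv.symm : h →ₗ[ℝ] h)
  left_inv β := by
    ext X
    change β (ha.resEquiv (ha.resEquiv.symm X)) = β X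
    rw [LinearEquiv.apply_symm_apply]
  right_inv β := by
    ext X
    change β (ha.resEquiv.symm (ha.resEquiv X)) = β X
    rw [LinearEquiv.symm_apply_apply]

lemma pull_apply (β : CForm h) : ha.pull β = β ∘ₗ resAut a h ha.stable := rfl

lemma pull_apply_apply (β : CForm h) (X : h) : ha.pull β X = β ⟨a X, ha.stable X X.2⟩ := rfl

lemma exists_eq (Y : h) : ∃ X : h, Y = ⟨a X, ha.stable X X.2⟩ :=
  ⟨ha.resEquiv.symm Y, (ha.resEquiv.apply_symm_apply Y).symm⟩

lemma map_riesz (f : h →ₗ[ℝ] ℝ) :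
    a (riesz B h (f ∘ₗ resAut a h ha.stable) : L) = riesz B h f := by
  rw [← sub_eq_zero]
  refine ha.cartan.nondeg_cartan
    (h.sub_mem (ha.stable _ (Subtype.mem _)) (Subtype.mem _)) fun Y hY => ?_
  obtain ⟨X, hX⟩ := ha.exists_eq ⟨Y, hY⟩
  have hYX : Y = a X := congrArg Subtype.val hX
  rw [map_sub, LinearMap.sub_apply, ha.cartan.riesz_spec f ⟨Y, hY⟩, hX, hYX, ha.form,
    ha.cartan.riesz_spec]
  exact sub_self _

lemma map_reV_tC (β : CForm h) : a (reV (tC B (ha.pull β))) = reV (tC B β) := by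
  rw [tC, tC, reV_mkC, reV_mkC]
  exact ha.map_riesz (Complex.reLm ∘ₗ β)

lemma map_imV_tC (β : CForm h) : a (imV (tC B (ha.pull β))) = imV (tC B β) := by
  rw [tC, tC, imV_mkC, imV_mkC]
  exact ha.map_riesz (Complex.imLm ∘ₗ β)

lemma isIsom_pull : IsIsom (bForm ha.cartan) ha.pull := by
  intro β γ
  rw [bForm_apply, bForm_apply, bilC_apply, bilC_apply, ← ha.map_reV_tC β, ← ha.map_imV_tC β,
    ← ha.map_reV_tC γ, ← ha.map_imV_tC γ, ha.form, ha.form, ha.form, ha.form]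

/-- The automorphism of the complexification. -/
def mapC (a : L →ₗ⁅ℝ⁆ L) : ℂ ⊗[ℝ] L →ₗ[ℂ] ℂ ⊗[ℝ] L := (a : L →ₗ[ℝ] L).baseChange ℂ

omit ha in
@[simp] lemma reV_mapC (z : ℂ ⊗[ℝ] L) : reV (mapC a z) = a (reV z) := reV_baseChange _ _

omit ha in
@[simp] lemma imV_mapC (z : ℂ ⊗[ℝ] L) : imV (mapC a z) = a (imV z) := imV_baseChange _ _

omit ha in
lemma mapC_lie (z w : ℂ ⊗[ℝ] L) : mapC a ⁅z, w⁆ = ⁅mapC a z, mapC a w⁆ := by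
  apply ext_re_im <;> simp

omit ha in
lemma mapC_conjV (z : ℂ ⊗[ℝ] L) : mapC a (conjV z) = conjV (mapC a z) := by
  apply ext_re_im <;> simp

lemma bilC_mapC (z w : ℂ ⊗[ℝ] L) : bilC B (mapC a z) (mapC a w) = bilC B z w := by
  apply Complex.ext <;> simp [ha.form]

lemma mapC_injective : Function.Injective (mapC a) := by
  intro z w hzw
  apply ext_re_im
  · apply ha.injective; simpa using congrArg reV hzw
  · apply ha.injective; simpa using congrArg imV hzw

lemma mapC_mem {β : CForm h} {x : ℂ ⊗[ℝ] L} (hx : x ∈ rootSpace m h (ha.pull β)) :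
    mapC a x ∈ rootSpace m h β := by
  rw [mem_rootSpace_iff] at hx ⊢
  refine ⟨⟨by simpa using ha.stable_m _ hx.1.1, by simpa using ha.stable_m _ hx.1.2⟩, fun H => ?_⟩
  obtain ⟨X, rfl⟩ := ha.exists_eq H
  have h1 := congrArg (mapC a) (hx.2 X)
  rw [mapC_lie, map_smul, pull_apply_apply] at h1
  rw [← h1]
  congr 1

lemma isRoot_of_pull {β : CForm h} (hβ : IsRoot m h (ha.pull β)) : IsRoot m h β := by
  obtain ⟨x, hx, hx0⟩ := Submodule.exists_mem_ne_zero_of_ne_bot hβ.2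
  refine ⟨fun h0 => hβ.1 (by rw [h0, map_zero]), fun hbot => hx0 ?_⟩
  have := ha.mapC_mem hx
  rw [hbot] at this
  exact ha.mapC_injective (by rw [this, map_zero])

lemma pull_root_iff (β : CForm h) : ha.pull β ∈ {α | IsRoot m h α} ↔ β ∈ {α | IsRoot m h α} := by
  refine ⟨ha.isRoot_of_pull, fun hβ => ?_⟩
  set Φ := {α | IsRoot m h α} with hΦ
  have hsub : ha.pull.symm '' Φ ⊆ Φ := by
    rintro _ ⟨γ, hγ, rfl⟩
    exact ha.isRoot_of_pull (by rw [LinearEquiv.apply_symm_apply]; exact hγ)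
  have heq := Set.eq_of_subset_of_ncard_le hsub
    (Set.ncard_image_of_injective Φ ha.pull.symm.injective).ge ha.cartan.finite_roots
  rw [← heq] at hβ
  obtain ⟨γ, hγ, rfl⟩ := hβ
  rw [LinearEquiv.apply_symm_apply]; exact hγ

lemma pull_imaginary_iff (β : CForm h) : IsImaginary h (ha.pull β) ↔ IsImaginary h β := by
  refine ⟨fun hβ X => ?_, fun hβ X => hβ _⟩
  obtain ⟨Y, rfl⟩ := ha.exists_eq X
  exact hβ Y

lemma pull_imagRoots_iff (β : CForm h) : ha.pull β ∈ imagRoots m h ↔ β ∈ imagRoots m h :=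
  and_congr (ha.pull_root_iff β) (ha.pull_imaginary_iff β)

lemma pull_mem_realSub {β : CForm h} (hβ : β ∈ realSub r h) : ha.pull β ∈ realSub r h :=
  ⟨fun X hX => hβ.1 _ (ha.elliptic hX), fun X hX => hβ.2 _ (ha.hyperbolic hX)⟩

lemma map_tC_fixed {β : CForm h} (hβ : ha.pull β = β) :
    a (reV (tC B β)) = reV (tC B β) ∧ a (imV (tC B β)) = imV (tC B β) := by
  constructor
  · have := ha.map_reV_tC β; rwa [hβ] at this
  · have := ha.map_imV_tC β; rwa [hβ] at this

/-- Decomposition of `m` into the fixed points and the image of `a - 1`. -/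
lemma exists_fixed_add {p : LieSubalgebra ℝ L} (hp : ∀ X ∈ p, a X ∈ p) {Y : L} (hY : Y ∈ p) :
    ∃ k ∈ p, ∃ w ∈ p, a k = k ∧ Y = k + (a w - w) := by
  have h1 : Module.End.IsSemisimple ((a : L →ₗ[ℝ] L).restrict (p := p.toSubmodule)
      (q := p.toSubmodule) hp) :=
    isSemisimple_of_intertwine p.toSubmodule.subtype Subtype.val_injective (fun _ => rfl)
      ha.semisimple
  have h2 : Module.End.IsSemisimple ((a : L →ₗ[ℝ] L).restrict (p := p.toSubmodule)
      (q := p.toSubmodule) hp - 1) := by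
    have := (Module.End.isSemisimple_sub_algebraMap_iff (μ := (1 : ℝ))).mpr h1
    rwa [map_one] at this
  obtain ⟨k, w, hk, hkw⟩ := exists_ker_add_range h2 ⟨Y, hY⟩
  refine ⟨k, k.2, w, w.2, ?_, congrArg Subtype.val hkw⟩
  exact sub_eq_zero.mp (congrArg Subtype.val hk)

lemma form_fixed_range {X w : L} (hX : a X = X) : B X (a w - w) = 0 := by
  rw [map_sub]
  nth_rewrite 1 [← hX]
  rw [ha.form, sub_self]

lemma fixed_of_decomp {T A : L} (hT : T ∈ h) (hA : A ∈ h) (hT1 : IsInfElliptic r T)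
    (hA1 : IsInfHyperbolic r A) (hfix : a (T + A) = T + A) : a T = T ∧ a A = A := by
  have hc := ha.cartan
  have h1 : a T - T = A - a A := by
    rw [map_add] at hfix
    rw [sub_eq_sub_iff_add_eq_add, hfix, add_comm]
  have hTT := ha.stable T hT
  have hAA := ha.stable A hA
  have h2 : IsInfElliptic r (a T - T) := by
    have := hc.elliptic_add (ha.elliptic hT1) (hT1.smul (-1)) (by
      rw [lie_smul, hc.comm _ hTT _ hT, smul_zero])
    rwa [neg_one_smul, ← sub_eq_add_neg] at this
  have h3 : IsInfHyperbolic r (A - a A) := by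
    have := hc.hyperbolic_add hA1 ((ha.hyperbolic hA1).smul (-1)) (by
      rw [lie_smul, hc.comm _ hA _ hAA, smul_zero])
    rwa [neg_one_smul, ← sub_eq_add_neg] at this
  rw [← h1] at h3
  have h4 := h2.eq_zero_of_hyperbolic hc.toIsInvariantPair h3
  rw [h4] at h1
  exact ⟨sub_eq_zero.mp h4, (sub_eq_zero.mp h1.symm).symm⟩

/-- The fixed points of an automorphism fixing a regular vector form a Cartan pair. -/
lemma descend {m' : LieSubalgebra ℝ (fixedSub a)} (hm' : ∀ X : fixedSub a, X ∈ m' ↔ (X : L) ∈ m)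
    {x : CForm h} (hx : IsRegularVec (bForm ha.cartan) (realSub r h) {α | IsRoot m h α} x)
    (hfix : ha.pull x = x) : CartanPair (resRep r a) (resBilin B a) m' (resSub h a) where
  inj := fun _ _ hXY => Subtype.ext (ha.cartan.inj hXY)
  lie := fun X Y => ha.cartan.lie X Y
  symm := fun X Y => ha.cartan.symm X Y
  invariant := fun X Y Z => ha.cartan.invariant X Y Z
  nondeg := by
    intro X hX h0
    refine Subtype.ext (ha.cartan.nondeg X ((hm' X).mp hX) fun Y hY => ?_)
    obtain ⟨k, hk, w, hw, hkf, rfl⟩ := ha.exists_fixed_add ha.stable_m hY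
    rw [map_add, ha.form_fixed_range X.2, add_zero]
    exact h0 ⟨k, hkf⟩ ((hm' _).mpr hk)
  le := fun X hX => (hm' X).mpr (ha.cartan.le hX)
  comm := fun X hX Y hY => Subtype.ext (ha.cartan.comm X hX Y hY)
  self_centralizing := by
    intro X hX hcomm
    obtain ⟨h1, h2⟩ := ha.map_tC_fixed hfix
    exact ha.cartan.mem_of_commute_regular hx ((hm' X).mp hX)
      (congrArg Subtype.val (hcomm ⟨_, h1⟩ (reV_tC_mem x)))
      (congrArg Subtype.val (hcomm ⟨_, h2⟩ (imV_tC_mem x)))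
  decomp := by
    intro H hH
    obtain ⟨T, hT, A, hA, hTA, hT1, hA1⟩ := ha.cartan.decomp H hH
    obtain ⟨h1, h2⟩ := ha.fixed_of_decomp hT hA hT1 hA1 (by rw [← hTA]; exact H.2)
    exact ⟨⟨T, h1⟩, hT, ⟨A, h2⟩, hA, Subtype.ext hTA, hT1, hA1⟩
  neg := fun X hX hX1 h0 => ha.cartan.neg X hX hX1 fun h => h0 (Subtype.ext h)
  pos := fun X hX hX1 h0 => ha.cartan.pos X hX hX1 fun h => h0 (Subtype.ext h)
  orth := fun X hX hX1 Y hY hY1 => ha.cartan.orth X hX hX1 Y hY hY1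

end StableAut

lemma CartanPair.isCartanOf (hc : CartanPair r B m h) : IsCartanOf m h := by
  refine ⟨hc.le, ?_, ?_⟩
  · have : IsLieAbelian (h.comap m.incl) :=
      ⟨fun X Y => Subtype.ext (Subtype.ext (hc.comm X X.2 Y Y.2))⟩
    infer_instance
  · refine le_antisymm ?_ (LieSubalgebra.le_normalizer _)
    intro X hX
    rw [LieSubalgebra.mem_normalizer_iff] at hX
    refine hc.self_centralizing X X.2 fun H hH => ?_
    refine eq_zero_of_pow_apply_eq_zero (hc.isSemisimple_ad (hc.isSemisimpleElt hH)) (k := 2) ?_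
    have h1 : ⁅(X : L), H⁆ ∈ h := hX ⟨H, hc.le hH⟩ hH
    rw [pow_two, Module.End.mul_apply, LieAlgebra.ad_apply, LieAlgebra.ad_apply, ← lie_skew H X.1,
      lie_neg, hc.comm H hH _ h1, neg_zero]

end Automorphisms

section Descent

variable {L : Type*} [LieRing L] [LieAlgebra ℝ L] [FiniteDimensional ℝ L] {n : ℕ}
  {r : L →ₗ[ℝ] Matrix (Fin n) (Fin n) ℝ} {B : LinearMap.BilinForm ℝ L}
  {m h : LieSubalgebra ℝ L} {a : L →ₗ⁅ℝ⁆ L}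

/-- Restriction of forms to the fixed points, as a linear map. -/
def resFormLin (h : LieSubalgebra ℝ L) (a : L →ₗ⁅ℝ⁆ L) : CForm h →ₗ[ℂ] CForm (resSub h a) where
  toFun β := resForm β a
  map_add' _ _ := rfl
  map_smul' _ _ := rfl

lemma resForm_apply (β : CForm h) (X : resSub h a) :
    resForm β a X = β ⟨((X : fixedSub a) : L), X.2⟩ := rfl

lemma resForm_mem_realSub {β : CForm h} (hβ : β ∈ realSub r h) :
    resForm β a ∈ realSub (resRep r a) (resSub h a) :=
  ⟨fun X hX => hβ.1 ⟨((X : fixedSub a) : L), X.2⟩ hX,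
    fun X hX => hβ.2 ⟨((X : fixedSub a) : L), X.2⟩ hX⟩

/-- The inclusion of the complexification of the fixed points. -/
def inclC (a : L →ₗ⁅ℝ⁆ L) : ℂ ⊗[ℝ] fixedSub a →ₗ[ℂ] ℂ ⊗[ℝ] L :=
  ((fixedSub a).incl : fixedSub a →ₗ[ℝ] L).baseChange ℂ

@[simp] lemma reV_inclC (z : ℂ ⊗[ℝ] fixedSub a) : reV (inclC a z) = (reV z : fixedSub a) :=
  reV_baseChange _ _

@[simp] lemma imV_inclC (z : ℂ ⊗[ℝ] fixedSub a) : imV (inclC a z) = (imV z : fixedSub a) :=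
  imV_baseChange _ _

lemma inclC_injective : Function.Injective (inclC a) := by
  intro z w hzw
  apply ext_re_im <;> apply Subtype.ext
  · simpa using congrArg reV hzw
  · simpa using congrArg imV hzw

lemma inclC_lie (z w : ℂ ⊗[ℝ] fixedSub a) : inclC a ⁅z, w⁆ = ⁅inclC a z, inclC a w⁆ := by
  apply ext_re_im <;> simp

lemma bilC_inclC (z w : ℂ ⊗[ℝ] fixedSub a) :
    bilC (resBilin B a) z w = bilC B (inclC a z) (inclC a w) := by
  rw [bilC_apply, bilC_apply]
  simp only [reV_inclC, imV_inclC]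
  rfl

lemma exists_inclC {z : ℂ ⊗[ℝ] L} (h1 : a (reV z) = reV z) (h2 : a (imV z) = imV z) :
    ∃ w : ℂ ⊗[ℝ] fixedSub a, inclC a w = z :=
  ⟨mkC ⟨_, h1⟩ ⟨_, h2⟩, by apply ext_re_im <;> simp⟩

lemma coroot_congr {m m₀ : LieSubalgebra ℝ L} {α : CForm h}
    (h1 : rootSpace m₀ h α = rootSpace m h α) (h2 : rootSpace m₀ h (-α) = rootSpace m h (-α)) :
    coroot m₀ h α = coroot m h α := by
  unfold coroot IsCoroot
  rw [h1, h2]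

namespace StableAut

variable (ha : StableAut r B m h a)
include ha

lemma exists_fixed_vec (H : h) : ∃ k : resSub h a, ∀ β : CForm h, ha.pull β = β →
    β H = resForm β a k := by
  obtain ⟨k, hk, w, hw, hkf, hH⟩ := ha.exists_fixed_add ha.stable H.2
  refine ⟨⟨⟨k, hkf⟩, hk⟩, fun β hβ => ?_⟩
  have h1 : H = ⟨k, hk⟩ + (⟨a w, ha.stable w hw⟩ - ⟨w, hw⟩) := Subtype.ext hH
  have h2 : β ⟨a w, ha.stable w hw⟩ = β ⟨w, hw⟩ := by
    rw [← ha.pull_apply_apply β ⟨w, hw⟩, hβ]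
  rw [h1, map_add, map_sub, h2, sub_self, add_zero]
  rfl

lemma imaginary_of_resForm {β : CForm h} (hβ : ha.pull β = β)
    (him : IsImaginary (resSub h a) (resForm β a)) : IsImaginary h β := by
  intro H
  obtain ⟨k, hk⟩ := ha.exists_fixed_vec H
  rw [hk β hβ]
  exact him k

omit ha in
lemma imaginary_resForm {β : CForm h} (him : IsImaginary h β) :
    IsImaginary (resSub h a) (resForm β a) := fun X => him ⟨((X : fixedSub a) : L), X.2⟩

lemma resForm_pull (β : CForm h) : resForm (ha.pull β) a = resForm β a := by
  ext X
  rw [resForm_apply, pull_apply_apply, resForm_apply]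
  congr 1
  exact Subtype.ext X.1.2

lemma resForm_pow_pull (k : ℕ) (β : CForm h) : resForm ((ha.pull ^ k) β) a = resForm β a := by
  induction k with
  | zero => rfl
  | succ k ih => rw [pow_succ']; exact (ha.resForm_pull _).trans ih

lemma finite_orbit {α : CForm h} (hα : IsRoot m h α) : (orbitSet ha.pull α).Finite :=
  ha.cartan.finite_roots.subset (ha.cartan.isRootSys.orbit_subset ha.pull_root_iff hα)

lemma resForm_orbitSum {α : CForm h} (hα : IsRoot m h α) :
    resForm (orbitSum ha.pull α) a = ((orbitSet ha.pull α).ncard : ℂ) • resForm α a := by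
  have hfin := ha.finite_orbit hα
  have h3 := (resFormLin h a : CForm h →+ CForm (resSub h a)).map_finsum_mem
    (s := orbitSet ha.pull α) (fun α => α) hfin
  refine h3.trans ?_
  have h4 : ∑ᶠ β ∈ orbitSet ha.pull α, resForm β a = ∑ᶠ β ∈ orbitSet ha.pull α, resForm α a := by
    refine finsum_mem_congr rfl ?_
    rintro _ ⟨k, rfl⟩
    exact ha.resForm_pow_pull k α
  refine h4.trans ?_
  rw [finsum_mem_eq_finite_toFinset_sum _ hfin, Finset.sum_const,
    Set.ncard_eq_toFinset_card _ hfin, Nat.cast_smul_eq_nsmul]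

lemma rootSpace_inclC {m' : LieSubalgebra ℝ (fixedSub a)}
    (hm' : ∀ X : fixedSub a, X ∈ m' ↔ (X : L) ∈ m) {α' : CForm (resSub h a)}
    {z : ℂ ⊗[ℝ] fixedSub a} (hz : z ∈ rootSpace m' (resSub h a) α') :
    ∃ f : CForm h →₀ ℂ ⊗[ℝ] L, (∀ α, f α ∈ rootSpace m h α) ∧ (f.sum fun _ x => x) = inclC a z ∧
      ∀ α, f α ≠ 0 → resForm α a = α' := by
  rw [mem_rootSpace_iff] at hz
  obtain ⟨f, hf, hsum, hT⟩ := ha.cartan.exists_decomp (z := inclC a z)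
    (mem_baseChange_iff.mpr ⟨by simpa using (hm' _).mp hz.1.1, by simpa using (hm' _).mp hz.1.2⟩)
  refine ⟨f, hf, hsum, fun α hα => ?_⟩
  ext X
  refine hT (LieAlgebra.ad ℂ (ℂ ⊗[ℝ] L) ((1 : ℂ) ⊗ₜ[ℝ] ((X : fixedSub a) : L)))
    (fun α => resForm α a X) (fun α x hx => (mem_rootSpace_iff.mp hx).2 ⟨_, X.2⟩) _ ?_ α hα
  have h1 := congrArg (inclC a) (hz.2 X)
  rw [inclC_lie, map_smul] at h1
  rw [adC_apply, ← h1]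
  congr 1

lemma exists_root_of_descent {m' : LieSubalgebra ℝ (fixedSub a)}
    (hm' : ∀ X : fixedSub a, X ∈ m' ↔ (X : L) ∈ m) {α' : CForm (resSub h a)}
    (hα' : IsRoot m' (resSub h a) α') : ∃ α, IsRoot m h α ∧ resForm α a = α' := by
  obtain ⟨z, hz, hz0⟩ := Submodule.exists_mem_ne_zero_of_ne_bot hα'.2
  obtain ⟨f, hf, hsum, hres⟩ := ha.rootSpace_inclC hm' hz
  have : ∃ α, f α ≠ 0 := by
    by_contra! hcon
    have h0 : f = 0 := Finsupp.ext hcon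
    rw [h0, Finsupp.sum_zero_index] at hsum
    exact hz0 (inclC_injective (by rw [← hsum, map_zero]))
  obtain ⟨α, hα⟩ := this
  refine ⟨α, ⟨fun h0 => hα'.1 ?_, fun hbot => hα ?_⟩, hres α hα⟩
  · rw [← hres α hα, h0]; rfl
  · have := hf α
    rw [hbot] at this
    exact this

lemma inclC_tC {m' : LieSubalgebra ℝ (fixedSub a)}
    (hc' : CartanPair (resRep r a) (resBilin B a) m' (resSub h a)) {β : CForm h}
    (hβ : ha.pull β = β) : inclC a (tC (resBilin B a) (resForm β a)) = tC B β := by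
  obtain ⟨h1, h2⟩ := ha.map_tC_fixed hβ
  obtain ⟨w, hw⟩ := exists_inclC h1 h2
  rw [← hw]
  congr 1
  refine hc'.ext_bilC ⟨reV_tC_mem _, imV_tC_mem _⟩ ⟨?_, ?_⟩ fun H => ?_
  · have := reV_tC_mem (B := B) β
    rw [← hw, reV_inclC] at this; exact this
  · have := imV_tC_mem (B := B) β
    rw [← hw, imV_inclC] at this; exact this
  · rw [hc'.bilC_tC, bilC_inclC, hw, resForm_apply, ← ha.cartan.bilC_tC]
    congr 1

lemma bForm_resForm {m' : LieSubalgebra ℝ (fixedSub a)}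
    (hc' : CartanPair (resRep r a) (resBilin B a) m' (resSub h a)) {β : CForm h}
    (hβ : ha.pull β = β) (γ : CForm h) :
    bForm hc' (resForm β a) (resForm γ a) = bForm ha.cartan β γ := by
  have h1 := ha.inclC_tC hc' hβ
  obtain ⟨h2, h3⟩ := ha.map_tC_fixed hβ
  have h4 : ∀ (H : L) (hH : H ∈ h), bilC B (tC B γ) ((1 : ℂ) ⊗ₜ[ℝ] H) = γ ⟨H, hH⟩ :=
    fun H hH => ha.cartan.bilC_tC γ ⟨H, hH⟩
  have h5 : ∀ (H : L) (hH : H ∈ h) (hf : a H = H),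
      bilC (resBilin B a) (tC (resBilin B a) (resForm γ a))
        ((1 : ℂ) ⊗ₜ[ℝ] (⟨H, hf⟩ : fixedSub a)) = γ ⟨H, hH⟩ :=
    fun H hH hf => hc'.bilC_tC (resForm γ a) ⟨⟨H, hf⟩, hH⟩
  rw [bForm_symm, bForm_symm ha.cartan, bForm_apply, bForm_apply]
  have h6 : tC B β = (1 : ℂ) ⊗ₜ[ℝ] reV (tC B β) + Complex.I • ((1 : ℂ) ⊗ₜ[ℝ] imV (tC B β)) := by
    apply ext_re_im <;> simp
  have h7 : tC (resBilin B a) (resForm β a) = (1 : ℂ) ⊗ₜ[ℝ] (⟨reV (tC B β), h2⟩ : fixedSub a) +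
      Complex.I • ((1 : ℂ) ⊗ₜ[ℝ] (⟨imV (tC B β), h3⟩ : fixedSub a)) := by
    apply inclC_injective
    rw [h1]
    apply ext_re_im <;> simp
  rw [h6, h7, map_add, map_add, map_smul, map_smul, h4 _ (reV_tC_mem β), h4 _ (imV_tC_mem β),
    h5 _ (reV_tC_mem β) h2, h5 _ (imV_tC_mem β) h3]

end StableAut

/-- The centralizer in `m` of the vector dual to an imaginary form `ρ`. -/
lemma CartanPair.rootSpace_centralizer (hc : CartanPair r B m h) {ρ : CForm h}
    (hρ : IsImaginary h ρ) {m₀ : LieSubalgebra ℝ L}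
    (hm₀ : ∀ X, X ∈ m₀ ↔ X ∈ m ∧ ⁅imV (tC B ρ), X⁆ = 0) (α : CForm h) :
    (bForm hc ρ α = 0 → rootSpace m₀ h α = rootSpace m h α) ∧
      (bForm hc ρ α ≠ 0 → rootSpace m₀ h α = ⊥) := by
  have hre : reV (tC B ρ) = 0 := by
    refine hc.nondeg_cartan (reV_tC_mem _) fun Y hY => ?_
    have h1 := congrArg Complex.re (hc.bilC_tC ρ ⟨Y, hY⟩)
    have h2 := congrArg Complex.re (hρ ⟨Y, hY⟩)
    simp at h1 h2
    linarith
  have hmem : ∀ x : ℂ ⊗[ℝ] L, x ∈ rootSpace m₀ h α ↔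
      x ∈ rootSpace m h α ∧ bForm hc ρ α • x = 0 := by
    intro x
    constructor
    · intro hx
      rw [mem_rootSpace_iff] at hx
      have hx' : x ∈ rootSpace m h α := by
        rw [mem_rootSpace_iff]
        exact ⟨⟨((hm₀ _).mp hx.1.1).1, ((hm₀ _).mp hx.1.2).1⟩, hx.2⟩
      refine ⟨hx', ?_⟩
      rw [← hc.lie_tC ρ hx']
      apply ext_re_im <;> simp [hre, ((hm₀ _).mp hx.1.1).2, ((hm₀ _).mp hx.1.2).2]
    · rintro ⟨hx, h0⟩
      rw [← hc.lie_tC ρ hx] at h0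
      have h1 := congrArg reV h0
      have h2 := congrArg imV h0
      simp [hre] at h1 h2
      rw [mem_rootSpace_iff] at hx ⊢
      exact ⟨⟨(hm₀ _).mpr ⟨hx.1.1, h2⟩, (hm₀ _).mpr ⟨hx.1.2, by rw [← lie_skew, h1, neg_zero]⟩⟩, hx.2⟩
  constructor
  · intro h0
    ext x
    rw [hmem, h0, zero_smul]
    simp
  · intro h0
    rw [eq_bot_iff]
    intro x hx
    exact (smul_eq_zero.mp ((hmem x).mp hx).2).resolve_left h0

lemma CartanPair.bForm_imag_split (hc : CartanPair r B m h) {α β : CForm h}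
    (hα : IsImaginary h α) (hβ : β ∈ splitDual r h) : (bForm hc α β).re = 0 := by
  have hre : reV (tC B α) = 0 := by
    refine hc.nondeg_cartan (reV_tC_mem _) fun Y hY => ?_
    have h1 := congrArg Complex.re (hc.bilC_tC α ⟨Y, hY⟩)
    have h2 := congrArg Complex.re (hα ⟨Y, hY⟩)
    simp at h1 h2
    linarith
  have him : imV (tC B β) = 0 := by
    refine hc.nondeg_cartan (imV_tC_mem _) fun Y hY => ?_
    obtain ⟨T, hT, A, hA, rfl, hT1, hA1⟩ := hc.decomp Y hY
    have h1 := congrArg Complex.im (hc.bilC_tC β ⟨T + A, hY⟩)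
    have h2 : β ⟨T + A, hY⟩ = β ⟨T, hT⟩ + β ⟨A, hA⟩ := by rw [← map_add]; rfl
    rw [h2, hβ.1 ⟨T, hT⟩ hT1, zero_add, hβ.2 ⟨A, hA⟩ hA1] at h1
    simpa using h1
  rw [bForm_apply, bilC_re, hre, him]
  simp

lemma splitDual_le {β : CForm h} (hβ : β ∈ splitDual r h) : β ∈ realSub r h :=
  ⟨fun X hX => by rw [hβ.1 X hX]; rfl, hβ.2⟩

end Descent

section FixedParameters

variable {L : Type*} [LieRing L] [LieAlgebra ℝ L] [FiniteDimensional ℝ L] {n : ℕ}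
  {r : L →ₗ[ℝ] Matrix (Fin n) (Fin n) ℝ} {B : LinearMap.BilinForm ℝ L}
  {m h : LieSubalgebra ℝ L} {a : L →ₗ⁅ℝ⁆ L} {P : Param L}

/-- A parameter fixed by an automorphism. -/
structure FixedParam (r : L →ₗ[ℝ] Matrix (Fin n) (Fin n) ℝ) (B : LinearMap.BilinForm ℝ L)
    (a : L →ₗ⁅ℝ⁆ L) (P : Param L) : Prop where
  reductive : IsReductivePair r B
  aut : IsInvariantAut r B a
  param : IsParam r B P
  fixes : Fixes a P

lemma CartanPair.extendForm_eq (hc : CartanPair r B m h) (f : h →ₗ[ℝ] ℝ) (Y : L) :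
    extendForm B h f Y = B (riesz B h f) Y := by
  have hex : ∃ ψ : Module.Dual ℝ L,
      (∀ X : h, ψ X = f X) ∧ ∀ Y : L, (∀ X : h, B (X : L) Y = 0) → ψ Y = 0 :=
    ⟨B (riesz B h f), hc.riesz_spec f, fun Y hY => hY _⟩
  obtain ⟨h1, h2⟩ := Classical.epsilon_spec hex
  change (∀ X : h, extendForm B h f X = f X) at h1
  change (∀ Y : L, (∀ X : h, B (X : L) Y = 0) → extendForm B h f Y = 0) at h2
  set k := riesz B h ((B.flip Y) ∘ₗ h.toSubmodule.subtype) with hk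
  have h3 : ∀ X : h, B (k : L) X = B X Y := fun X => hc.riesz_spec _ X
  have h4 : Y = k + (Y - k) := by abel
  have h5 : extendForm B h f (Y - k) = 0 := h2 _ fun X => by
    rw [map_sub, ← h3, hc.symm, sub_self]
  calc extendForm B h f Y = extendForm B h f k + extendForm B h f (Y - k) := by
        rw [← map_add, ← h4]
    _ = B k (riesz B h f) := by rw [h5, add_zero, h1, ← hc.riesz_spec, hc.symm]
    _ = _ := h3 _

namespace FixedParam

variable (hp : FixedParam r B a P)
include hp

lemma cartan : CartanPair r B (stab P.lam) P.h :=
  hp.reductive.cartanPair hp.param.semisimple hp.param.cartan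

lemma injective : Function.Injective a := by
  obtain ⟨g, hg⟩ := hp.aut.conj
  intro X Y hXY
  apply hp.reductive.inj
  have h1 := congrArg r hXY
  rw [hg, hg] at h1
  have h2 := congrArg (fun M => ((g⁻¹ : GL (Fin n) ℝ) : Matrix (Fin n) (Fin n) ℝ) * M * g) h1
  simpa [mul_assoc] using h2

lemma surjective : Function.Surjective a :=
  (LinearMap.injective_iff_surjective (f := (a : L →ₗ[ℝ] L))).mp hp.injective

lemma stableAut : StableAut r B (stab P.lam) P.h a where
  toIsInvariantAut := hp.aut
  cartan := hp.cartan
  stable := hp.fixes.stable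
  stable_m := fun X hX Y => by
    obtain ⟨Z, rfl⟩ := hp.surjective Y
    rw [← LieHom.map_lie, hp.fixes.lam_eq]
    exact hX Z

lemma isRho : IsRhoOf hp.stableAut.cartan P.F := hp.cartan.isRhoOf hp.param.chamber

lemma pull_rho : hp.stableAut.pull P.rho = P.rho := by
  have ha := hp.stableAut
  have hΦ := ha.cartan.isRootSys_imag
  have hρ := hp.isRho
  have h1 : ha.pull P.rho ∈ P.F := (hp.fixes.mem_iff P.rho).mpr hρ.rho_mem
  have h2 : posSys (bForm ha.cartan) (imagRoots (stab P.lam) P.h) (ha.pull P.rho) =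
      posSys (bForm ha.cartan) (imagRoots (stab P.lam) P.h) P.rho := by
    ext α
    refine and_congr_right fun hα => ?_
    have := ((hρ.mem_iff _).mp h1).2 α hα
    exact ⟨fun h => pos_of_mul_pos_left this h.le, fun h => pos_of_mul_pos_right this h.le⟩
  have h3 : P.rho = (1 / 2 : ℂ) •
      ∑ᶠ α ∈ posSys (bForm ha.cartan) (imagRoots (stab P.lam) P.h) P.rho, α := by
    rw [Param.rho, ← hρ.posRoots_eq]; rfl
  have h4 := map_finsum_posSys hΦ.finite ha.isIsom_pull ha.pull_imagRoots_iff P.rho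
  rw [h2] at h4
  conv_lhs => rw [h3]
  rw [map_smul, h4, ← h3]

lemma mem_stabRho_iff (X : L) : X ∈ stabRho B P ↔
    X ∈ stab P.lam ∧ ⁅imV (tC B P.rho), X⁆ = 0 := by
  rw [stabRho, LieSubalgebra.mem_inf]
  refine and_congr_right fun _ => ?_
  rw [mem_stab_iff_lie_eq_zero hp.reductive (hp.cartan.extendForm_eq _)]
  have h1 : (riesz B P.h (Complex.reLm ∘ₗ (Complex.I • P.rho)) : L) = -imV (tC B P.rho) := by
    rw [← add_eq_zero_iff_eq_neg]
    refine hp.cartan.nondeg_cartan (P.h.add_mem (Subtype.mem _) (imV_tC_mem _)) fun Y hY => ?_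
    rw [map_add, LinearMap.add_apply, hp.cartan.riesz_spec _ ⟨Y, hY⟩]
    have h2 := congrArg Complex.im (hp.cartan.bilC_tC P.rho ⟨Y, hY⟩)
    simp at h2
    rw [h2]
    simp
  rw [h1, neg_lie, neg_eq_zero]

lemma isRoot_stabRho_iff (α : CForm P.h) : IsRoot (stabRho B P) P.h α ↔
    IsRoot (stab P.lam) P.h α ∧ bForm hp.cartan P.rho α = 0 := by
  obtain ⟨h1, h2⟩ := hp.cartan.rootSpace_centralizer (isImaginary_rho P.F) hp.mem_stabRho_iff α
  constructor
  · rintro ⟨h3, h4⟩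
    have h5 : bForm hp.cartan P.rho α = 0 := by
      by_contra hne; exact h4 (h2 hne)
    rw [h1 h5] at h4
    exact ⟨⟨h3, h4⟩, h5⟩
  · rintro ⟨⟨h3, h4⟩, h5⟩
    exact ⟨h3, by rw [h1 h5]; exact h4⟩

lemma pair_stabRho {α : CForm P.h} (hα : IsRoot (stabRho B P) P.h α) (β : CForm P.h) :
    pair (stabRho B P) P.h β α = pair (stab P.lam) P.h β α := by
  have h0 := (hp.isRoot_stabRho_iff α).mp hα
  have key := hp.cartan.rootSpace_centralizer (isImaginary_rho P.F) hp.mem_stabRho_iff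
  rw [pair, pair, coroot_congr ((key α).1 h0.2) ((key (-α)).1 (by rw [map_neg]; exact neg_eq_zero.mpr h0.2))]

/-- The roots orthogonal to `ρ`. -/
lemma isRootSys_stabRho :
    IsRootSys (bForm hp.cartan) (realSub r P.h) {α | IsRoot (stabRho B P) P.h α} := by
  have h1 := hp.cartan.isRootSys.inter_real
    ((LinearMap.ker (bForm hp.cartan P.rho)).restrictScalars ℝ)
  convert! h1 using 1
  ext α
  exact hp.isRoot_stabRho_iff α

lemma exists_stable_split (hst : HasStableChamber r B a P hp.fixes.stable) :
    ∃ β ∈ splitDual r P.h,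
      IsRegularVec (bForm hp.cartan) (realSub r P.h) {α | IsRoot (stabRho B P) P.h α} β ∧
      ∀ k : ℕ, ∀ α, IsRoot (stabRho B P) P.h α →
        0 < (bForm hp.cartan α β).re * (bForm hp.cartan α ((hp.stableAut.pull ^ k) β)).re := by
  obtain ⟨C, ⟨β, hβ, hreg, rfl⟩, hC⟩ := hst
  have hβV := splitDual_le hβ
  have hpr : ∀ {γ} (_ : γ ∈ realSub r P.h) {α} (_ : IsRoot (stabRho B P) P.h α),
      (pair (stabRho B P) P.h γ α).re =
        2 * (bForm hp.cartan α γ).re / (bForm hp.cartan α α).re := by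
    intro γ hγ α hα
    rw [hp.pair_stabRho hα, hp.cartan.pair_re ((hp.isRoot_stabRho_iff α).mp hα).1 hγ]
  have hpos : ∀ {α} (_ : IsRoot (stabRho B P) P.h α), 0 < (bForm hp.cartan α α).re :=
    fun hα => hp.isRootSys_stabRho.re_pos hα
  refine ⟨β, hβ, ⟨hβV, fun α hα h0 => hreg α hα ?_⟩, fun k α hα => ?_⟩
  · rw [hpr hβV hα, h0]; simp
  · have h1 : ∀ k : ℕ, (hp.stableAut.pull ^ k) β ∈ chamberOf (stabRho B P) P.h (splitDual r P.h)
        {α | IsRoot (stabRho B P) P.h α} β := by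
      intro k
      induction k with
      | zero => exact ⟨hβ, fun α hα => mul_self_pos.mpr (hreg α hα)⟩
      | succ k ih =>
        rw [pow_succ']
        exact (hC _).mpr ih
    have h2 := (h1 k).2 α hα
    rw [hpr hβV hα, hpr (splitDual_le (h1 k).1) hα, div_mul_div_comm,
      div_pos_iff_of_pos_right (mul_pos (hpos hα) (hpos hα))] at h2
    nlinarith

lemma pull_stabRho_iff (α : CForm P.h) : hp.stableAut.pull α ∈ {α | IsRoot (stabRho B P) P.h α} ↔
    α ∈ {α | IsRoot (stabRho B P) P.h α} := by
  simp only [Set.mem_ofPred_eq, hp.isRoot_stabRho_iff]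
  refine and_congr (hp.stableAut.pull_root_iff α) ?_
  have := hp.stableAut.isIsom_pull P.rho α
  rw [hp.pull_rho] at this
  rw [this]

/-- An automorphism stabilizing a chamber fixes a vector orthogonal to no root. -/
lemma exists_regular_fixed (hst : HasStableChamber r B a P hp.fixes.stable) :
    ∃ x, IsRegularVec (bForm hp.cartan) (realSub r P.h) {α | IsRoot (stab P.lam) P.h α} x ∧
      hp.stableAut.pull x = x := by
  obtain ⟨β, hβ, hreg, hk⟩ := hp.exists_stable_split hst
  have hΨ := hp.isRootSys_stabRho
  set ν := ∑ᶠ α ∈ posSys (bForm hp.cartan) {α | IsRoot (stabRho B P) P.h α} β, α with hν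
  have hνfix : hp.stableAut.pull ν = ν := by
    have h1 := map_finsum_posSys hΨ.finite hp.stableAut.isIsom_pull hp.pull_stabRho_iff β
    have h2 : posSys (bForm hp.cartan) {α | IsRoot (stabRho B P) P.h α} (hp.stableAut.pull β) =
        posSys (bForm hp.cartan) {α | IsRoot (stabRho B P) P.h α} β := by
      ext α
      refine and_congr_right fun hα => ?_
      have := hk 1 α hα
      rw [pow_one] at this
      exact ⟨fun h => pos_of_mul_pos_left this h.le, fun h => pos_of_mul_pos_right this h.le⟩
    rw [h2] at h1
    exact h1
  have hνV : ν ∈ realSub r P.h := hΨ.sum_pos_mem β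
  have hρ := hp.isRho
  have hfin := hp.cartan.finite_roots
  have hbad : (⋃ α ∈ {α | IsRoot (stab P.lam) P.h α},
      {ε : ℝ | (bForm hp.cartan α P.rho).re + ε * (bForm hp.cartan α ν).re = 0}).Finite := by
    refine hfin.biUnion fun α hα => ?_
    by_cases h0 : (bForm hp.cartan α ν).re = 0
    · have h1 : (bForm hp.cartan α P.rho).re ≠ 0 := by
        intro h1
        have h2 : IsRoot (stabRho B P) P.h α := (hp.isRoot_stabRho_iff α).mpr ⟨hα, by
          rw [bForm_symm, hp.cartan.isRootSys.b_eq (hp.cartan.root_mem_realSub hα.2)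
            (show P.rho ∈ _ from hρ.regular.1)]
          rw [h1, Complex.ofReal_zero]⟩
        have h3 := hΨ.sum_pos_regular hreg α h2
        rw [← hν, h0, mul_zero] at h3
        exact lt_irrefl _ h3
      convert Set.finite_empty
      ext ε
      simp [h0, h1]
    · refine (Set.finite_singleton (-(bForm hp.cartan α P.rho).re /
        (bForm hp.cartan α ν).re)).subset fun ε hε => ?_
      rw [Set.mem_singleton_iff, eq_div_iff h0]
      have : _ = _ := hε
      linarith
  obtain ⟨ε, hε⟩ := hbad.exists_notMem
  refine ⟨P.rho + ε • ν, ⟨Submodule.add_mem _ hρ.regular.1 (Submodule.smul_mem _ _ hνV),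
    fun α hα h0 => hε ?_⟩, ?_⟩
  · refine Set.mem_biUnion hα ?_
    rw [map_add, Complex.add_re, ← Complex.coe_smul, map_smul, smul_eq_mul,
      Complex.re_ofReal_mul] at h0
    exact h0
  · rw [map_add, hp.pull_rho, ← Complex.coe_smul, map_smul, hνfix]

/-- `ρ` is orthogonal to no root whose restriction to the fixed points is imaginary. -/
lemma rho_regular (hst : HasStableChamber r B a P hp.fixes.stable) {α : CForm P.h}
    (hα : IsRoot (stab P.lam) P.h α) (him : IsImaginary (resSub P.h a) (resForm α a)) :
    (bForm hp.cartan α P.rho).re ≠ 0 := by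
  intro h1
  have ha := hp.stableAut
  have h2 : IsRoot (stabRho B P) P.h α := (hp.isRoot_stabRho_iff α).mpr ⟨hα, by
    rw [bForm_symm, hp.cartan.isRootSys.b_eq (hp.cartan.root_mem_realSub hα.2)
      (show P.rho ∈ _ from hp.isRho.regular.1)]
    rw [h1, Complex.ofReal_zero]⟩
  obtain ⟨β, hβ, hreg, hk⟩ := hp.exists_stable_split hst
  have hfix := ha.cartan.isRootSys.map_orbitSum ha.pull_root_iff hα
  have h3 : IsImaginary P.h (orbitSum ha.pull α) := by
    refine ha.imaginary_of_resForm hfix ?_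
    rw [ha.resForm_orbitSum hα, ← Complex.ofReal_natCast, Complex.coe_smul]
    exact Submodule.smul_mem (imagSub (resSub P.h a)) _ him
  have h4 := hp.cartan.bForm_imag_split h3 hβ
  have hfin := ha.finite_orbit hα
  have h5 : orbitSum ha.pull α = ∑ β ∈ hfin.toFinset, β := by
    rw [orbitSum]
    change (∑ᶠ β ∈ orbitSet ha.pull α, β) = _
    rw [finsum_mem_eq_finite_toFinset_sum _ hfin]
  have hΨ := hp.isRootSys_stabRho
  have h6 : ∀ γ ∈ orbitSet ha.pull α,
      0 < (bForm hp.cartan α β).re * (bForm hp.cartan γ β).re := by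
    intro γ hγ
    rw [← hΨ.image_orbit hp.pull_stabRho_iff h2] at hγ
    have h7 : ∃ k : ℕ, (ha.pull ^ k) γ = α := by
      rw [hΨ.image_orbit hp.pull_stabRho_iff h2] at hγ
      obtain ⟨k, rfl⟩ := hγ
      obtain ⟨p, hp0, hpα⟩ := hΨ.exists_period hp.pull_stabRho_iff h2
      have h8 : ∀ q : ℕ, (ha.pull ^ (p * q)) α = α := by
        intro q
        rw [pow_mul]
        induction q with
        | zero => rfl
        | succ q ih =>
          rw [pow_succ]
          change ((ha.pull ^ p) ^ q) ((ha.pull ^ p) α) = α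
          rw [hpα, ih]
      refine ⟨p * k - k, ?_⟩
      change (ha.pull ^ (p * k - k) * ha.pull ^ k) α = α
      rw [← pow_add, Nat.sub_add_cancel (Nat.le_mul_of_pos_left k hp0), h8]
    obtain ⟨k, hk'⟩ := h7
    have h9 := hk k α h2
    have h10 := IsRootSys.IsIsom.pow ha.isIsom_pull k γ β
    rw [hk'] at h10
    rwa [h10] at h9
  have h7 : 0 < (bForm hp.cartan α β).re * (bForm hp.cartan (orbitSum ha.pull α) β).re := by
    rw [h5, map_sum, LinearMap.sum_apply, Complex.re_sum, Finset.mul_sum]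
    exact Finset.sum_pos (fun γ hγ => h6 γ (hfin.mem_toFinset.mp hγ))
      ⟨α, hfin.mem_toFinset.mpr ⟨0, rfl⟩⟩
  rw [h4, mul_zero] at h7
  exact lt_irrefl _ h7

lemma mem_stab_resLam (X : fixedSub a) : X ∈ stab (resLam P.lam a) ↔ (X : L) ∈ stab P.lam := by
  constructor
  · intro hX Y
    obtain ⟨k, -, w, -, hk, rfl⟩ := hp.stableAut.exists_fixed_add (p := ⊤)
      (fun _ _ => LieSubalgebra.mem_top _) (LieSubalgebra.mem_top Y)
    have h1 : P.lam ⁅(X : L), k⁆ = 0 := hX ⟨k, hk⟩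
    have h2 : ⁅(X : L), a w⁆ = a ⁅(X : L), w⁆ := by
      rw [LieHom.map_lie, show a (X : L) = X from X.2]
    rw [lie_add, map_add, h1, lie_sub, map_sub, h2, hp.fixes.lam_eq, sub_self, add_zero]
  · intro hX Y
    exact hX Y

lemma cartan_descent (hst : HasStableChamber r B a P hp.fixes.stable) :
    CartanPair (resRep r a) (resBilin B a) (stab (resLam P.lam a)) (resSub P.h a) := by
  obtain ⟨x, hx, hfix⟩ := hp.exists_regular_fixed hst
  exact hp.stableAut.descend hp.mem_stab_resLam hx hfix

lemma isSemisimpleForm_descent : IsSemisimpleForm (resRep r a) (resBilin B a) (resLam P.lam a) := by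
  obtain ⟨X, hX, hlam⟩ := hp.param.semisimple
  have h1 : a X = X := by
    rw [← sub_eq_zero]
    refine hp.reductive.nondeg _ fun Y => ?_
    obtain ⟨Z, rfl⟩ := hp.surjective Y
    rw [map_sub, LinearMap.sub_apply, hp.aut.form, ← hlam, ← hlam, hp.fixes.lam_eq, sub_self]
  exact ⟨⟨X, h1⟩, hX, fun Y => hlam Y⟩

lemma regular_descent (hst : HasStableChamber r B a P hp.fixes.stable) :
    IsRegularVec (bForm (hp.cartan_descent hst)) (realSub (resRep r a) (resSub P.h a))
      (imagRoots (stab (resLam P.lam a)) (resSub P.h a)) (resForm P.rho a) := by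
  refine ⟨resForm_mem_realSub hp.isRho.regular.1, fun α' hα' => ?_⟩
  obtain ⟨α, hα, rfl⟩ := hp.stableAut.exists_root_of_descent hp.mem_stab_resLam hα'.1
  rw [bForm_symm, hp.stableAut.bForm_resForm _ hp.pull_rho, bForm_symm]
  exact hp.rho_regular hst hα hα'.2

lemma isParam_descent (hst : HasStableChamber r B a P hp.fixes.stable) :
    IsParam (resRep r a) (resBilin B a) (descent r P a) where
  semisimple := hp.isSemisimpleForm_descent
  cartan := (hp.cartan_descent hst).isCartanOf
  chamber := (hp.cartan_descent hst).isImagChamber_chamberOf (hp.regular_descent hst)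

lemma chamber_unique (hst : HasStableChamber r B a P hp.fixes.stable)
    (C : Set (CForm (resSub P.h a))) :
    (IsImagChamber (resRep r a) (stab (resLam P.lam a)) (resSub P.h a) C ∧
      resForm P.rho a ∈ C) ↔ C = (descent r P a).F := by
  constructor
  · rintro ⟨⟨β, hβ, hreg, rfl⟩, hmem⟩
    exact (chamberOf_congr hmem).symm
  · rintro rfl
    refine ⟨(hp.isParam_descent hst).chamber, (hp.regular_descent hst).1, fun α hα => ?_⟩
    have := ((hp.cartan_descent hst).isRegularFor_iff (fun α hα => hα.1)
      (hp.regular_descent hst).1).mpr (hp.regular_descent hst) α hα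
    exact mul_self_pos.mpr this

end FixedParam

end FixedParameters

section RootSystem

variable {E : Type*} [AddCommGroup E] [Module ℂ E]
variable {b : LinearMap.BilinForm ℂ E} {V : Submodule ℝ E} {Φ : Set E}

lemma mem_simpleSys_map_iff {g : E ≃ₗ[ℂ] E} (hg : IsIsom b g) (hgΦ : ∀ α, g α ∈ Φ ↔ α ∈ Φ) {x : E}
    (hgx : g x = x) (α : E) : g α ∈ simpleSys b Φ x ↔ α ∈ simpleSys b Φ x := by
  have hpos : ∀ β, g β ∈ posSys b Φ x ↔ β ∈ posSys b Φ x := fun β => by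
    refine and_congr (hgΦ β) ?_
    conv_lhs => rw [← hgx, hg]
  refine and_congr (hpos α) (not_congr ?_)
  constructor
  · rintro ⟨β, hβ, γ, hγ, h⟩
    refine ⟨g.symm β, (hpos _).mp (by simpa using hβ), g.symm γ,
      (hpos _).mp (by simpa using hγ), g.injective ?_⟩
    simpa using h
  · rintro ⟨β, hβ, γ, hγ, rfl⟩
    exact ⟨g β, (hpos β).mpr hβ, g γ, (hpos γ).mpr hγ, map_add g β γ⟩

namespace IsRootSys

variable (hΦ : IsRootSys b V Φ)
include hΦ

lemma simple_b_nonpos {x α β : E} (hx : IsRegularVec b V Φ x) (hα : α ∈ simpleSys b Φ x)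
    (hβ : β ∈ simpleSys b Φ x) (hne : α ≠ β) : (b α β).re ≤ 0 := by
  by_contra! hpos
  have h1 := hΦ.diff α hα.1.1 β hβ.1.1 hpos hne
  rcases hΦ.neg_pos_or hx h1 with h2 | h2
  · exact hα.2 ⟨β, hβ.1, _, h2, by abel⟩
  · exact hβ.2 ⟨α, hα.1, _, h2, by abel⟩

lemma b_smul_right (c : ℝ) (x y : E) : (b x (c • y)).re = c * (b x y).re := by
  rw [← Complex.coe_smul, map_smul, smul_eq_mul, Complex.re_ofReal_mul]

lemma simple_indep_aux {x : E} (hx : IsRegularVec b V Φ x) (S : Finset E)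
    (hS : ∀ α ∈ S, α ∈ simpleSys b Φ x) (c : E → ℝ) (h0 : ∑ α ∈ S, c α • α = 0) :
    ∀ α ∈ S, c α ≤ 0 := by
  classical
  have hsplit := Finset.sum_filter_add_sum_filter_not S (fun α => 0 < c α) (fun α => c α • α)
  set T := S.filter fun α => 0 < c α with hT
  set T' := S.filter fun α => ¬ 0 < c α with hT'
  set v := ∑ α ∈ T, c α • α with hv
  have hv' : v = ∑ α ∈ T', (-c α) • α := by
    rw [h0] at hsplit
    rw [eq_neg_of_add_eq_zero_left hsplit, ← Finset.sum_neg_distrib]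
    exact Finset.sum_congr rfl fun α _ => by rw [neg_smul]
  have hvV : v ∈ V := Submodule.sum_mem _ fun α hα =>
    V.smul_mem _ (hΦ.sub (hS α (Finset.mem_filter.mp hα).1).1.1)
  have hvv : (b v v).re ≤ 0 := by
    have hvv' : b v v = ∑ β ∈ T', ∑ α ∈ T, b (c α • α) ((-c β) • β) := by
      conv_lhs => arg 2; rw [hv']
      rw [map_sum]
      exact Finset.sum_congr rfl fun β _ => by rw [hv, map_sum, LinearMap.sum_apply]
    rw [hvv', Complex.re_sum]
    refine Finset.sum_nonpos fun β hβ => ?_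
    rw [Complex.re_sum]
    refine Finset.sum_nonpos fun α hα => ?_
    rw [Finset.mem_filter] at hα hβ
    rw [hΦ.b_smul_left, hΦ.b_smul_right]
    have h1 := hΦ.simple_b_nonpos hx (hS α hα.1) (hS β hβ.1) (by
      rintro rfl; exact hβ.2 hα.2)
    have h2 : 0 ≤ -c β := by linarith [not_lt.mp hβ.2]
    nlinarith [mul_nonneg hα.2.le h2]
  have hv0 : v = 0 := by
    by_contra hne
    exact absurd (hΦ.pos v hvV hne) (not_lt.mpr hvv)
  intro α hα
  by_contra! hpos
  have h1 : 0 < (b v x).re := by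
    rw [hv, map_sum, LinearMap.sum_apply, Complex.re_sum]
    refine Finset.sum_pos (fun β hβ => ?_) ⟨α, Finset.mem_filter.mpr ⟨hα, hpos⟩⟩
    rw [hΦ.b_smul_left]
    exact mul_pos (Finset.mem_filter.mp hβ).2 (hS β (Finset.mem_filter.mp hβ).1).1.2
  rw [hv0, map_zero] at h1
  exact lt_irrefl _ h1

lemma simple_indep {x : E} (hx : IsRegularVec b V Φ x) (S : Finset E)
    (hS : ∀ α ∈ S, α ∈ simpleSys b Φ x) (c : E → ℝ) (h0 : ∑ α ∈ S, c α • α = 0) :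
    ∀ α ∈ S, c α = 0 := by
  intro α hα
  have h1 := hΦ.simple_indep_aux hx S hS c h0 α hα
  have h2 := hΦ.simple_indep_aux hx S hS (fun α => -c α) (by
    simp only [neg_smul, Finset.sum_neg_distrib, h0, neg_zero]) α hα
  linarith

/-- Simple roots take arbitrary values on a unique vector of their span; it is fixed by an
automorphism when the values are. -/
lemma exists_fixed_dual {x : E} (hx : IsRegularVec b V Φ x) {g : E ≃ₗ[ℂ] E} (hg : IsIsom b g)
    (hgΦ : ∀ α, g α ∈ Φ ↔ α ∈ Φ) (hgx : g x = x) (s : E → ℝ)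
    (hs : ∀ α ∈ simpleSys b Φ x, s (g α) = s α) :
    ∃ β ∈ Submodule.span ℝ (simpleSys b Φ x), g β = β ∧
      ∀ α ∈ simpleSys b Φ x, (b α β).re = s α := by
  have hfin : (simpleSys b Φ x).Finite := hΦ.finite.subset fun _ h => h.1.1
  have hspanV : Submodule.span ℝ (simpleSys b Φ x) ≤ V :=
    Submodule.span_le.mpr fun α hα => hΦ.sub hα.1.1
  have huniq : ∀ v ∈ Submodule.span ℝ (simpleSys b Φ x),
      (∀ α ∈ simpleSys b Φ x, (b α v).re = 0) → v = 0 := by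
    intro v hv h0
    by_contra hne
    have h1 : ∀ w ∈ Submodule.span ℝ (simpleSys b Φ x), (b w v).re = 0 := by
      intro w hw
      refine Submodule.span_induction (p := fun w _ => (b w v).re = 0) h0 (by simp) ?_ ?_ hw
      · intro x y _ _ hx hy; simp [hx, hy]
      · intro c x _ hx; rw [hΦ.b_smul_left, hx, mul_zero]
    exact absurd (hΦ.pos v (hspanV hv) hne) (by rw [h1 v hv]; exact lt_irrefl _)
  have := hfin.fintype
  let σ : (simpleSys b Φ x → ℝ) →ₗ[ℝ] E := Fintype.linearCombination ℝ (fun α => (α : E))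
  have hσ : ∀ c, σ c = ∑ α, c α • (α : E) := fun c => Fintype.linearCombination_apply ℝ _ c
  have hσmem : ∀ c, σ c ∈ Submodule.span ℝ (simpleSys b Φ x) := fun c => by
    rw [hσ]
    exact Submodule.sum_mem _ fun α _ => Submodule.smul_mem _ _ (Submodule.subset_span α.2)
  let Γ : (simpleSys b Φ x → ℝ) →ₗ[ℝ] (simpleSys b Φ x → ℝ) :=
    { toFun := fun c α => (b α (σ c)).re
      map_add' := fun c c' => by ext α; simp
      map_smul' := fun t c => by
        ext α
        rw [map_smul, hΦ.b_smul_right]; rfl }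
  have hinj : Function.Injective Γ := by
    rw [← LinearMap.ker_eq_bot, LinearMap.ker_eq_bot']
    intro c hc
    have h1 := huniq (σ c) (hσmem c) fun α hα => congrFun hc ⟨α, hα⟩
    classical
    have h2 : ∑ α ∈ hfin.toFinset, (if h : α ∈ simpleSys b Φ x then c ⟨α, h⟩ else 0) • α = 0 := by
      rw [← h1, hσ]
      rw [← Finset.sum_coe_sort]
      refine Fintype.sum_equiv (Equiv.subtypeEquivRight fun α => hfin.mem_toFinset) _ _ ?_
      rintro ⟨α, hα⟩
      have hα' := hfin.mem_toFinset.mp hα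
      simp only [dif_pos hα']
      rfl
    have h3 := hΦ.simple_indep hx hfin.toFinset (fun α hα => hfin.mem_toFinset.mp hα) _ h2
    ext α
    have := h3 α (hfin.mem_toFinset.mpr α.2)
    simpa [α.2] using this
  obtain ⟨c, hc⟩ := LinearMap.injective_iff_surjective.mp hinj fun α => s α
  have hval : ∀ α ∈ simpleSys b Φ x, (b α (σ c)).re = s α := fun α hα => congrFun hc ⟨α, hα⟩
  refine ⟨σ c, hσmem c, ?_, hval⟩
  have hmap := mem_simpleSys_map_iff hg hgΦ hgx
  have hgspan : g (σ c) ∈ Submodule.span ℝ (simpleSys b Φ x) := by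
    refine Submodule.span_induction
      (p := fun w _ => g w ∈ Submodule.span ℝ (simpleSys b Φ x)) ?_ (by simp) ?_ ?_ (hσmem c)
    · intro α hα; exact Submodule.subset_span ((hmap α).mpr hα)
    · intro x y _ _ hx hy; rw [map_add]; exact Submodule.add_mem _ hx hy
    · intro t x _ hx
      rw [← Complex.coe_smul, map_smul, Complex.coe_smul]; exact Submodule.smul_mem _ _ hx
  refine sub_eq_zero.mp (huniq _ (Submodule.sub_mem _ hgspan (hσmem c)) fun α hα => ?_)
  have hα' : g.symm α ∈ simpleSys b Φ x := (hmap _).mp (by rwa [LinearEquiv.apply_symm_apply])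
  have h1 : b α (g (σ c)) = b (g.symm α) (σ c) := by
    rw [← hg (g.symm α), LinearEquiv.apply_symm_apply]
  have h2 := hs _ hα'
  rw [LinearEquiv.apply_symm_apply] at h2
  rw [map_sub, Complex.sub_re, h1, hval α hα, hval _ hα', h2, sub_self]

end IsRootSys

end RootSystem

section Twist

variable {L : Type*} [LieRing L] [LieAlgebra ℝ L] [FiniteDimensional ℝ L] {n : ℕ}
  {r : L →ₗ[ℝ] Matrix (Fin n) (Fin n) ℝ} {B : LinearMap.BilinForm ℝ L}
  {m h : LieSubalgebra ℝ L} {a a₀ : L →ₗ⁅ℝ⁆ L} {P : Param L}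

lemma iterate_eq_pow (g : CForm h ≃ₗ[ℂ] CForm h) (k : ℕ) (α : CForm h) :
    g^[k] α = (g ^ k) α := by
  induction k with
  | zero => rfl
  | succ k ih => rw [Function.iterate_succ_apply', ih, pow_succ']; rfl

namespace StableAut

variable (ha : StableAut r B m h a)
include ha

lemma mapC_pow_mem (k : ℕ) : ∀ {β : CForm h} {x : ℂ ⊗[ℝ] L},
    x ∈ rootSpace m h ((ha.pull ^ k) β) → (mapC a ^ k) x ∈ rootSpace m h β := by
  induction k with
  | zero => intro β x hx; exact hx
  | succ k ih =>
    intro β x hx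
    rw [pow_succ] at hx
    rw [pow_succ']
    exact ha.mapC_mem (ih hx)

lemma bilC_mapC_pow (k : ℕ) (z w : ℂ ⊗[ℝ] L) :
    bilC B ((mapC a ^ k) z) ((mapC a ^ k) w) = bilC B z w := by
  induction k with
  | zero => rfl
  | succ k ih => rw [pow_succ', Module.End.mul_apply, Module.End.mul_apply, ha.bilC_mapC, ih]

omit ha in
lemma mapC_pow_conjV (k : ℕ) (z : ℂ ⊗[ℝ] L) : (mapC a ^ k) (conjV z) = conjV ((mapC a ^ k) z) := by
  induction k with
  | zero => rfl
  | succ k ih => rw [pow_succ', Module.End.mul_apply, ih, mapC_conjV]; rfl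

lemma minimalPeriod_pos {α : CForm h} (hα : IsRoot m h α) :
    0 < Function.minimalPeriod ha.pull α := by
  obtain ⟨k, hk, hkα⟩ := ha.cartan.isRootSys.exists_period ha.pull_root_iff hα
  exact Function.minimalPeriod_pos_of_mem_periodicPts ⟨k, hk, by
    rw [Function.IsPeriodicPt, Function.IsFixedPt, iterate_eq_pow, hkα]⟩

lemma pow_minimalPeriod (α : CForm h) :
    (ha.pull ^ Function.minimalPeriod ha.pull α) α = α := by
  rw [← iterate_eq_pow]
  exact Function.isPeriodicPt_minimalPeriod ha.pull α

/-- The automorphism acts on the root space of `α`, after one period, by the inverse of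
`exp (- i k s)`, where `k` is the period. -/
def HasPhase (α : CForm h) (s : ℝ) : Prop :=
  ∀ z ∈ rootSpace m h α,
    Complex.exp (-(Function.minimalPeriod ha.pull α : ℂ) * (s * Complex.I)) •
      (mapC a ^ Function.minimalPeriod ha.pull α) z = z

lemma exists_phase {α : CForm h} (hα : α ∈ imagRoots m h) : ∃ s, ha.HasPhase α s := by
  obtain ⟨z, hz, hz0⟩ := Submodule.exists_mem_ne_zero_of_ne_bot hα.1.2
  set k := Function.minimalPeriod ha.pull α with hk
  have hk0 : (k : ℂ) ≠ 0 := Nat.cast_ne_zero.mpr (ha.minimalPeriod_pos hα.1).ne'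
  have h1 : (mapC a ^ k) z ∈ rootSpace m h α :=
    ha.mapC_pow_mem k (by rw [ha.pow_minimalPeriod]; exact hz)
  obtain ⟨c, hc⟩ := ha.cartan.rootSpace_one_dim hα.1 hz hz0 h1
  obtain ⟨hN0, hN⟩ := ha.cartan.bilC_conj hα.1 hα.2 hz hz0
  have h2 := ha.bilC_mapC_pow k z (conjV z)
  rw [mapC_pow_conjV, hc, conjV_smul, map_smul, map_smul, LinearMap.smul_apply, smul_eq_mul,
    smul_eq_mul, ← mul_assoc, mul_comm (star c)] at h2
  have hNC : bilC B z (conjV z) ≠ 0 := fun h0 => hN0 (by rw [h0]; rfl)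
  have h3 : c * star c = 1 := mul_right_cancel₀ hNC (by rw [h2, one_mul])
  have h4 : ‖c‖ = 1 := by
    have h5 : (Complex.normSq c : ℂ) = 1 := by rw [Complex.normSq_eq_conj_mul_self, mul_comm]; exact h3
    have h6 : Complex.normSq c = 1 := by exact_mod_cast h5
    rw [Complex.normSq_eq_norm_sq] at h6
    nlinarith [norm_nonneg c]
  refine ⟨Complex.arg c / k, fun w hw => ?_⟩
  obtain ⟨d, rfl⟩ := ha.cartan.rootSpace_one_dim hα.1 hz hz0 hw
  rw [← hk, map_smul, hc, smul_smul, smul_smul]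
  have h5 : Complex.exp (Complex.arg c * Complex.I) = c := by
    have := Complex.norm_mul_exp_arg_mul_I c
    rwa [h4, Complex.ofReal_one, one_mul] at this
  have h6 : -(k : ℂ) * (((Complex.arg c / k : ℝ) : ℂ) * Complex.I) = -(Complex.arg c * Complex.I) := by
    push_cast
    field_simp
  rw [h6, Complex.exp_neg, h5]
  have hc0 : c ≠ 0 := by rintro rfl; simp at h4
  congr 1
  field_simp

lemma hasPhase_pull {α : CForm h} (hα : IsRoot m h α) : ha.HasPhase (ha.pull α) = ha.HasPhase α := by
  have hper : Function.minimalPeriod ha.pull (ha.pull α) = Function.minimalPeriod ha.pull α :=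
    Function.minimalPeriod_apply (Function.minimalPeriod_pos_iff_mem_periodicPts.mp
      (ha.minimalPeriod_pos hα))
  have hcomm : ∀ (k : ℕ) z, (mapC a ^ k) (mapC a z) = mapC a ((mapC a ^ k) z) := fun k z => by
    rw [← Module.End.mul_apply, ← pow_succ, pow_succ']; rfl
  ext s
  rw [HasPhase, HasPhase, hper]
  constructor
  · intro H z hz
    obtain ⟨w, hw, hw0⟩ := Submodule.exists_mem_ne_zero_of_ne_bot ((ha.pull_root_iff α).mpr hα).2
    have hw1 : mapC a w ≠ 0 := fun h0 => hw0 (ha.mapC_injective (by rw [h0, map_zero]))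
    obtain ⟨d, rfl⟩ := ha.cartan.rootSpace_one_dim hα (ha.mapC_mem hw) hw1 hz
    rw [map_smul, smul_comm, hcomm, ← map_smul (mapC a), H w hw]
  · intro H z hz
    apply ha.mapC_injective
    rw [map_smul, ← hcomm]
    exact H _ (ha.mapC_mem hz)

/-- A root vector for the fixed points, obtained by summing over an orbit. -/
lemma exists_root_vector {m' : LieSubalgebra ℝ (fixedSub a)}
    (hm' : ∀ X : fixedSub a, X ∈ m' ↔ (X : L) ∈ m) {α : CForm h} (hα : α ∈ imagRoots m h)
    {z : ℂ ⊗[ℝ] L} (hz : z ∈ rootSpace m h α)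
    (hper : (mapC a ^ Function.minimalPeriod ha.pull α) z = z) :
    ∃ w ∈ rootSpace m' (resSub h a) (resForm α a), bilC (resBilin B a) w (conjV w) =
      Function.minimalPeriod ha.pull α * bilC B z (conjV z) := by
  set k := Function.minimalPeriod ha.pull α with hk
  have hgα := ha.pow_minimalPeriod α
  rw [← hk] at hgα
  have hγ : ∀ j, j ≤ k → (mapC a ^ j) z ∈ rootSpace m h ((ha.pull ^ (k - j)) α) := by
    intro j hj
    refine ha.mapC_pow_mem j ?_
    change z ∈ rootSpace m h ((ha.pull ^ j * ha.pull ^ (k - j)) α)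
    rw [← pow_add, Nat.add_sub_cancel' hj, hgα]
    exact hz
  set y := ∑ j ∈ Finset.range k, (mapC a ^ j) z with hy
  have hfix : mapC a y = y := by
    rw [hy, map_sum]
    have h1 : ∀ j, mapC a ((mapC a ^ j) z) = (mapC a ^ (j + 1)) z := fun j => by
      rw [pow_succ']; rfl
    simp_rw [h1]
    have h2 := Finset.sum_range_succ (fun j => (mapC a ^ j) z) k
    rw [Finset.sum_range_succ', hper] at h2
    exact add_right_cancel h2
  obtain ⟨w, hw⟩ := exists_inclC (a := a) (z := y) (by rw [← reV_mapC, hfix])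
    (by rw [← imV_mapC, hfix])
  have hym : y ∈ m.toSubmodule.baseChange ℂ := Submodule.sum_mem _ fun j hj =>
    rootSpace_le_baseChange _ (hγ j (Finset.mem_range.mp hj).le)
  rw [mem_baseChange_iff] at hym
  refine ⟨w, ?_, ?_⟩
  · rw [mem_rootSpace_iff]
    refine ⟨⟨(hm' _).mpr (by rw [← reV_inclC, hw]; exact hym.1),
      (hm' _).mpr (by rw [← imV_inclC, hw]; exact hym.2)⟩, fun H => ?_⟩
    apply inclC_injective
    have h1 : inclC a ((1 : ℂ) ⊗ₜ[ℝ] (H : fixedSub a)) = (1 : ℂ) ⊗ₜ[ℝ] ((H : fixedSub a) : L) := by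
      apply ext_re_im <;> simp
    rw [inclC_lie, map_smul, hw, hy, Finset.smul_sum, h1, ← adC_apply, map_sum]
    refine Finset.sum_congr rfl fun j hj => ?_
    have h2 := (mem_rootSpace_iff.mp (hγ j (Finset.mem_range.mp hj).le)).2 ⟨_, H.2⟩
    rw [adC_apply, ← ha.resForm_pow_pull (k - j) α]
    exact h2
  · have hconj : inclC a (conjV w) = conjV y := by
      rw [← hw]; apply ext_re_im <;> simp
    rw [bilC_inclC, hconj, hw]
    have h1 : conjV y = ∑ j ∈ Finset.range k, conjV ((mapC a ^ j) z) := by rw [hy, map_sum]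
    rw [h1, map_sum]
    have h2 : ∀ j ∈ Finset.range k, bilC B y (conjV ((mapC a ^ j) z)) = bilC B z (conjV z) := by
      intro j hj
      rw [hy, map_sum, LinearMap.sum_apply, Finset.sum_eq_single_of_mem j hj]
      · rw [← mapC_pow_conjV, ha.bilC_mapC_pow]
      · intro i hi hij
        have hi' := Finset.mem_range.mp hi
        have hj' := Finset.mem_range.mp hj
        refine ha.cartan.bilC_rootSpace ?_ (hγ i hi'.le) (conjV_mem_rootSpace (hγ j hj'.le))
        have him : IsImaginary h ((ha.pull ^ (k - j)) α) := by
          have : ∀ q : ℕ, (ha.pull ^ q) α ∈ imagRoots m h := fun q =>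
            ha.cartan.isRootSys_imag.orbit_subset ha.pull_imagRoots_iff hα ⟨q, rfl⟩
          exact (this _).2
        rw [conjForm_eq_neg him, ← sub_eq_add_neg, sub_ne_zero]
        intro heq
        have h3 := congrArg (ha.pull ^ i) heq
        have h4 : ∀ p q : ℕ, (ha.pull ^ p) ((ha.pull ^ q) α) = (ha.pull ^ (p + q)) α := fun p q => by
          rw [pow_add]; rfl
        rw [h4, h4, Nat.add_sub_cancel' hi'.le, hgα, ← iterate_eq_pow] at h3
        have h5 : k ∣ i + (k - j) := Function.IsPeriodicPt.minimalPeriod_dvd h3.symm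
        rcases lt_trichotomy i j with hlt | heq' | hgt
        · have := Nat.le_of_dvd (by omega) h5
          omega
        · exact hij heq'
        · rw [show i + (k - j) = (i - j) + k by omega, Nat.dvd_add_left (dvd_refl k)] at h5
          have := Nat.le_of_dvd (by omega) h5
          omega
    rw [Finset.sum_congr rfl h2, Finset.sum_const, Finset.card_range, nsmul_eq_mul]

end StableAut

namespace FixedParam

open StableAut

variable (hp : FixedParam r B a P)
include hp

/-- The element of the elliptic part of `h` that twists the automorphism. -/
lemma exists_twist : ∃ X : P.h, IsInfElliptic r (X : L) ∧ a X = X ∧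
    ∀ α ∈ simpleSys (bForm hp.cartan) (imagRoots (stab P.lam) P.h) P.rho,
      ∀ z ∈ rootSpace (stab P.lam) P.h α,
        Complex.exp ((Function.minimalPeriod hp.stableAut.pull α : ℂ) * α X) •
          (mapC a ^ Function.minimalPeriod hp.stableAut.pull α) z = z := by
  have ha := hp.stableAut
  have hΦ := hp.cartan.isRootSys_imag
  have hreg : IsRegularVec (bForm hp.cartan) (realSub r P.h) (imagRoots (stab P.lam) P.h) P.rho :=
    hp.isRho.regular
  obtain ⟨β, hβ, hgβ, hval⟩ := hΦ.exists_fixed_dual hreg ha.isIsom_pull ha.pull_imagRoots_iff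
    hp.pull_rho (fun α => Classical.epsilon (ha.HasPhase α)) (fun α hα => by
      rw [ha.hasPhase_pull hα.1.1.1])
  have hβV : β ∈ realSub r P.h :=
    Submodule.span_le.mpr (fun α hα => hΦ.sub hα.1.1) hβ
  have hβI : IsImaginary P.h β :=
    Submodule.span_le (p := imagSub P.h).mpr (fun α hα => hα.1.1.2) hβ
  refine ⟨⟨imV (tC B β), imV_tC_mem β⟩, hp.cartan.elliptic_imV_tC hβV, (ha.map_tC_fixed hgβ).2,
    fun α hα z hz => ?_⟩
  have hphase := Classical.epsilon_spec (ha.exists_phase hα.1.1) z hz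
  have hre : reV (tC B β) = 0 := by
    refine hp.cartan.nondeg_cartan (reV_tC_mem _) fun Y hY => ?_
    have h1 := congrArg Complex.re (hp.cartan.bilC_tC β ⟨Y, hY⟩)
    have h2 := congrArg Complex.re (hβI ⟨Y, hY⟩)
    simp at h1 h2
    linarith
  have h1 : bForm hp.cartan α β = Complex.I * α ⟨imV (tC B β), imV_tC_mem β⟩ := by
    rw [← hp.cartan.bilC_tC, bForm_apply, ← smul_eq_mul, ← map_smul]
    congr 1
    apply ext_re_im <;> simp [hre]
  have h2 : α ⟨imV (tC B β), imV_tC_mem β⟩ =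
      -((Classical.epsilon (ha.HasPhase α) : ℝ) * Complex.I) := by
    have h3 := hΦ.b_eq (hΦ.sub hα.1.1) hβV
    rw [hval α hα, h1] at h3
    have h4 := congrArg (fun t => -Complex.I * t) h3
    have hI := Complex.I_mul_I
    linear_combination h4 + (α ⟨imV (tC B β), imV_tC_mem β⟩) * hI
  rw [h2]
  convert hphase using 3
  ring

end FixedParam

end Twist

section TwistedAutomorphism

open StableAut

variable {L : Type*} [LieRing L] [LieAlgebra ℝ L] [FiniteDimensional ℝ L] {n : ℕ}
  {r : L →ₗ[ℝ] Matrix (Fin n) (Fin n) ℝ} {B : LinearMap.BilinForm ℝ L}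
  {a a₀ : L →ₗ⁅ℝ⁆ L} {P : Param L}

/-- `a₀` is the product of `a` and of the exponential of `ad X`. -/
structure IsTwist (r : L →ₗ[ℝ] Matrix (Fin n) (Fin n) ℝ) (B : LinearMap.BilinForm ℝ L)
    (P : Param L) (a a₀ : L →ₗ⁅ℝ⁆ L) (X : P.h) : Prop where
  aut : IsInvariantAut r B a₀
  fixed : a X = X
  eq_on : ∀ Y ∈ P.h, a₀ Y = a Y
  exp_mul : ∀ α, ∀ z ∈ rootSpace (stab P.lam) P.h α, mapC a₀ z = Complex.exp (α X) • mapC a z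

namespace IsTwist

variable {X : P.h} (ht : IsTwist r B P a a₀ X) (hp : FixedParam r B a P)

lemma resAut_eq (hs : ∀ Y ∈ P.h, a Y ∈ P.h) (hs₀ : ∀ Y ∈ P.h, a₀ Y ∈ P.h)
    (h : ∀ Y ∈ P.h, a₀ Y = a Y) : resAut a₀ P.h hs₀ = resAut a P.h hs := by
  ext Y
  exact h Y Y.2

include ht hp

lemma stable : ∀ Y ∈ P.h, a₀ Y ∈ P.h := fun Y hY => by
  rw [ht.eq_on Y hY]; exact hp.fixes.stable Y hY

lemma fixedParam : FixedParam r B a₀ P where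
  reductive := hp.reductive
  aut := ht.aut
  param := hp.param
  fixes :=
    { lam_eq := fun Y => by
        obtain ⟨Z, hZ, hlam⟩ := hp.param.semisimple
        have h1 := (hp.reductive.isCartanSubalgebra hZ hlam hp.param.cartan).1
        have h2 : a Z = Z := by
          rw [← sub_eq_zero]
          refine hp.reductive.nondeg _ fun Y => ?_
          obtain ⟨W, rfl⟩ := hp.surjective Y
          rw [map_sub, LinearMap.sub_apply, hp.aut.form, ← hlam, ← hlam, hp.fixes.lam_eq, sub_self]
        rw [hlam, hlam]
        nth_rewrite 1 [← h2]
        rw [← ht.eq_on Z h1, ht.aut.form]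
      stable := ht.stable hp
      mem_iff := fun β => by
        rw [resAut_eq hp.fixes.stable (ht.stable hp) ht.eq_on]
        exact hp.fixes.mem_iff β }

lemma hasStableChamber (hst : HasStableChamber r B a P hp.fixes.stable) :
    HasStableChamber r B a₀ P (ht.stable hp) := by
  obtain ⟨C, hC, hst⟩ := hst
  refine ⟨C, hC, fun β => ?_⟩
  rw [resAut_eq hp.fixes.stable (ht.stable hp) ht.eq_on]
  exact hst β

lemma pull_eq : (ht.fixedParam hp).stableAut.pull = hp.stableAut.pull := by
  ext β Y
  rw [pull_apply, pull_apply, resAut_eq hp.fixes.stable _ ht.eq_on]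

lemma mapC_pow (j : ℕ) : ∀ {γ : CForm P.h} {z : ℂ ⊗[ℝ] L},
    z ∈ rootSpace (stab P.lam) P.h ((hp.stableAut.pull ^ j) γ) →
      (mapC a₀ ^ j) z = Complex.exp (j * γ X) • (mapC a ^ j) z := by
  induction j with
  | zero => intro γ z _; simp
  | succ j ih =>
    intro γ z hz
    have h1 : z ∈ rootSpace (stab P.lam) P.h ((hp.stableAut.pull ^ j) (hp.stableAut.pull γ)) := by
      rw [pow_succ] at hz; exact hz
    have h2 : hp.stableAut.pull γ X = γ X := by
      rw [pull_apply_apply]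
      congr 1
      exact Subtype.ext ht.fixed
    have h3 := ht.exp_mul _ _ (hp.stableAut.mapC_pow_mem j h1)
    rw [h2] at h3
    rw [pow_succ', Module.End.mul_apply, ih h1, map_smul, h3, smul_smul, h2, ← Complex.exp_add,
      pow_succ', Module.End.mul_apply]
    congr 2
    push_cast
    ring

lemma pow_period (hX : ∀ α ∈ simpleSys (bForm hp.cartan) (imagRoots (stab P.lam) P.h) P.rho,
      ∀ z ∈ rootSpace (stab P.lam) P.h α,
        Complex.exp ((Function.minimalPeriod hp.stableAut.pull α : ℂ) * α X) •
          (mapC a ^ Function.minimalPeriod hp.stableAut.pull α) z = z)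
    {α : CForm P.h}
    (hα : α ∈ simpleSys (bForm hp.cartan) (imagRoots (stab P.lam) P.h) P.rho)
    {z : ℂ ⊗[ℝ] L} (hz : z ∈ rootSpace (stab P.lam) P.h α) :
    (mapC a₀ ^ Function.minimalPeriod (ht.fixedParam hp).stableAut.pull α) z = z := by
  rw [ht.pull_eq hp, ht.mapC_pow hp (γ := α), hX α hα z hz]
  rw [hp.stableAut.pow_minimalPeriod]
  exact hz

end IsTwist

namespace FixedParam

variable (hp : FixedParam r B a P) (hst : HasStableChamber r B a P hp.fixes.stable)
  (hper : ∀ α ∈ simpleSys (bForm hp.cartan) (imagRoots (stab P.lam) P.h) P.rho,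
    ∀ z ∈ rootSpace (stab P.lam) P.h α,
      (mapC a ^ Function.minimalPeriod hp.stableAut.pull α) z = z)

include hst hper

/-- The restriction of a simple imaginary root is a root for the fixed points. -/
lemma exists_descent_vector {α : CForm P.h}
    (hα : α ∈ simpleSys (bForm hp.cartan) (imagRoots (stab P.lam) P.h) P.rho)
    {z : ℂ ⊗[ℝ] L} (hz : z ∈ rootSpace (stab P.lam) P.h α) (hz0 : z ≠ 0) :
    resForm α a ∈ posSys (bForm (hp.cartan_descent hst))
        (imagRoots (stab (resLam P.lam a)) (resSub P.h a)) (resForm P.rho a) ∧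
      ∃ w ∈ rootSpace (stab (resLam P.lam a)) (resSub P.h a) (resForm α a), w ≠ 0 ∧
        ∃ k : ℕ, 0 < k ∧ bilC (resBilin B a) w (conjV w) = k * bilC B z (conjV z) := by
  obtain ⟨w, hw, hwz⟩ := hp.stableAut.exists_root_vector hp.mem_stab_resLam hα.1.1 hz
    (hper α hα z hz)
  have hk := hp.stableAut.minimalPeriod_pos hα.1.1.1
  have hN := (hp.cartan.bilC_conj hα.1.1.1 hα.1.1.2 hz hz0).1
  have hw0 : w ≠ 0 := by
    rintro rfl
    rw [map_zero, LinearMap.zero_apply, eq_comm, mul_eq_zero] at hwz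
    rcases hwz with h0 | h0
    · exact hk.ne' (by exact_mod_cast h0)
    · exact hN (by rw [h0]; rfl)
  have hb : bForm (hp.cartan_descent hst) (resForm α a) (resForm P.rho a) =
      bForm hp.cartan α P.rho := by
    rw [bForm_symm, hp.stableAut.bForm_resForm _ hp.pull_rho, bForm_symm]
  refine ⟨⟨⟨⟨fun h0 => ?_, fun h0 => ?_⟩, imaginary_resForm hα.1.1.2⟩, ?_⟩, w, hw, hw0, _, hk, hwz⟩
  · have h1 := hα.1.2
    rw [← hb, h0, map_zero] at h1
    exact lt_irrefl _ h1
  · rw [h0] at hw; exact hw0 hw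
  · rw [hb]; exact hα.1.2

/-- The chamber `F` is determined by the chamber of the restriction of `ρ_F`. -/
lemma chamber_eq {F' : Set (CForm P.h)} (hF' : IsImagChamber r (stab P.lam) P.h F')
    (hfix : hp.stableAut.pull (rho (stab P.lam) P.h F') = rho (stab P.lam) P.h F')
    (hmem : resForm (rho (stab P.lam) P.h F') a ∈ (descent r P a).F) : F' = P.F := by
  have hρ' := hp.cartan.isRhoOf hF'
  have hρ := hp.isRho
  have hΦ := hp.cartan.isRootSys_imag
  set ρ' := rho (stab P.lam) P.h F' with hρ'def
  have hc' := hp.cartan_descent hst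
  have hmem' := (hc'.mem_chamberOf_iff (fun α hα => hα.1) (fun _ h => h)
    (hp.regular_descent hst).1).mp hmem
  have hsimple : ∀ α ∈ simpleSys (bForm hp.cartan) (imagRoots (stab P.lam) P.h) P.rho,
      0 < (bForm hp.cartan α ρ').re := by
    intro α hα
    obtain ⟨z, hz, hz0⟩ := Submodule.exists_mem_ne_zero_of_ne_bot hα.1.1.1.2
    obtain ⟨h1, -⟩ := hp.exists_descent_vector hst hper hα hz hz0
    have h2 := hmem'.2 _ h1.1
    have h3 := pos_of_mul_pos_right h2 h1.2.le
    rwa [bForm_symm, hp.stableAut.bForm_resForm _ hfix, bForm_symm] at h3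
  have hpos : ∀ α ∈ imagRoots (stab P.lam) P.h,
      0 < (bForm hp.cartan α P.rho).re * (bForm hp.cartan α ρ').re := by
    intro α hα
    rcases hΦ.neg_pos_or hρ.regular hα with h1 | h1
    · exact mul_pos h1.2 (hΦ.pos_of_simple hsimple h1)
    · have h2 := hΦ.pos_of_simple hsimple h1
      have h3 := h1.2
      simp only [map_neg, LinearMap.neg_apply, Complex.neg_re] at h2 h3
      change 0 < (bForm hp.cartan α (rho (stab P.lam) P.h P.F)).re * _
      nlinarith
  have h4 : ρ' ∈ P.F := (hρ.mem_iff _).mpr ⟨hρ'.regular.1, hpos⟩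
  rw [hρ.eq_chamberOf] at h4 ⊢
  rw [hρ'.eq_chamberOf]
  exact chamberOf_congr h4

end FixedParam

end TwistedAutomorphism

section Rank

open Module Topology

lemma finite_not_injective {K V : Type*} [AddCommGroup K] [Module ℝ K] [FiniteDimensional ℝ K]
    [AddCommGroup V] [Module ℝ V] {f : K →ₗ[ℝ] V} (g : K →ₗ[ℝ] V) (hf : Function.Injective f) :
    {s : ℝ | ¬ Function.Injective (f + s • g)}.Finite := by
  obtain ⟨q, hq⟩ := f.exists_leftInverse_of_injective (LinearMap.ker_eq_bot.mpr hf)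
  refine ((Module.End.finite_hasEigenvalue (q ∘ₗ g)).preimage
    (f := fun s : ℝ => -s⁻¹) (by intro x _ y _ h; simpa using h)).subset fun s hs => ?_
  have hs' : ¬ Function.Injective (f + s • g) := hs
  rw [← LinearMap.ker_eq_bot, Submodule.eq_bot_iff] at hs'
  push Not at hs'
  obtain ⟨v, hv, hv0⟩ := hs'
  have h1 : v + s • q (g v) = 0 := by
    have := congrArg q (LinearMap.mem_ker.mp hv)
    rwa [LinearMap.add_apply, map_add, LinearMap.smul_apply, map_smul, map_zero,
      show q (f v) = v from LinearMap.congr_fun hq v] at this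
  have hs0 : s ≠ 0 := by
    rintro rfl
    rw [zero_smul, add_zero] at h1
    exact hv0 h1
  refine Module.End.hasEigenvalue_of_hasEigenvector (x := v) ⟨?_, hv0⟩
  rw [Module.End.mem_eigenspace_iff, LinearMap.comp_apply, neg_smul, eq_neg_iff_add_eq_zero]
  have h2 := congrArg (s⁻¹ • ·) h1
  simpa [smul_smul, hs0, add_comm] using h2

variable {V : Type*} [AddCommGroup V] [Module ℝ V] [FiniteDimensional ℝ V]

lemma finite_finrank_ker_lt (f g : End ℝ V) :
    {s : ℝ | finrank ℝ (LinearMap.ker f) < finrank ℝ (LinearMap.ker (f + s • g))}.Finite := by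
  obtain ⟨K, hK⟩ := Submodule.exists_isCompl (LinearMap.ker f)
  refine (finite_not_injective (f := f ∘ₗ K.subtype) (g ∘ₗ K.subtype) ?_).subset fun s hs h => ?_
  · rw [← LinearMap.ker_eq_bot, Submodule.eq_bot_iff]
    intro x hx
    exact Subtype.ext (Submodule.disjoint_def.mp hK.disjoint x hx x.2)
  · rw [Set.mem_ofPred_eq] at hs
    refine absurd hs (not_lt.mpr ?_)
    have h1 : Disjoint (LinearMap.ker (f + s • g)) K := Submodule.disjoint_def.mpr fun x hx hxK =>
      congrArg Subtype.val (@h ⟨x, hxK⟩ 0 (by simpa using hx))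
    have h2 := Submodule.finrank_add_finrank_le_of_disjoint h1
    have h3 := Submodule.finrank_add_eq_of_isCompl hK
    omega

/-- A commuting family of semisimple operators has an element with the smallest kernel. -/
lemma exists_ker_le (W : Submodule ℝ (End ℝ V)) (hW : ∀ f ∈ W, f.IsSemisimple)
    (hc : ∀ f ∈ W, ∀ g ∈ W, Commute f g) :
    ∃ f ∈ W, ∀ g ∈ W, LinearMap.ker f ≤ LinearMap.ker g := by
  obtain ⟨f, hf, hmin⟩ := exists_minimalFor_of_wellFoundedLT (· ∈ W)
    (fun f => finrank ℝ (LinearMap.ker f)) ⟨0, W.zero_mem⟩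
  refine ⟨f, hf, fun g hg => ?_⟩
  have h0 : ∀ x, f (f x) = 0 → f x = 0 := fun x hx =>
    eq_zero_of_pow_apply_eq_zero (hW f hf) (k := 2) hx
  have hcm : ∀ x, f (g x) = g (f x) := fun x => LinearMap.congr_fun (hc f hf g hg) x
  obtain ⟨s, hs⟩ := ((finite_not_injective (f := f ∘ₗ (LinearMap.range f).subtype)
    (g ∘ₗ (LinearMap.range f).subtype) (by
      rw [← LinearMap.ker_eq_bot, Submodule.eq_bot_iff]
      rintro ⟨_, x, rfl⟩ hx
      exact Subtype.ext (h0 x hx))).union (Set.finite_singleton (0 : ℝ))).exists_notMem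
  simp only [Set.mem_union, Set.mem_ofPred_eq, not_or, not_not, Set.mem_singleton_iff] at hs
  obtain ⟨hs, hs0⟩ := hs
  have hle : LinearMap.ker (f + s • g) ≤ LinearMap.ker f ⊓ LinearMap.ker g := by
    intro v hv
    obtain ⟨k, w, hk, rfl⟩ := exists_ker_add_range (hW f hf) v
    have h1 : s • g k + (f (f w) + s • g (f w)) = 0 := by
      have := LinearMap.mem_ker.mp hv
      simp only [map_add, LinearMap.add_apply, LinearMap.smul_apply, hk, zero_add] at this
      rw [← this]
    have h2 : f (f w) + s • g (f w) = f (f w + s • g w) := by rw [map_add, map_smul, hcm]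
    have h3 : f (f w + s • g w) = 0 := by
      apply h0
      have := congrArg f h1
      rwa [h2, map_add, map_smul, hcm, hk, map_zero, smul_zero, zero_add, map_zero] at this
    have h4 : f w = 0 := congrArg Subtype.val
      (@hs ⟨f w, w, rfl⟩ 0 (by simpa [h2] using h3))
    rw [h2, h3, add_zero] at h1
    rw [h4, add_zero]
    exact ⟨hk, (smul_eq_zero.mp h1).resolve_left hs0⟩
  have h1 := Submodule.eq_of_le_of_finrank_le (hle.trans inf_le_left) (by
    rcases le_total (finrank ℝ (LinearMap.ker f)) (finrank ℝ (LinearMap.ker (f + s • g))) with h | h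
    · exact h
    · exact hmin (W.add_mem hf (W.smul_mem s hg)) h)
  rw [← h1]
  exact hle.trans inf_le_right

lemma exp_mul_exp_neg {E : Type*} [NormedAddCommGroup E] [NormedSpace ℝ E] [CompleteSpace E]
    (a : E →L[ℝ] E) : NormedSpace.exp a * NormedSpace.exp (-a) = 1 := by
  let _ : NormedAlgebra ℚ (E →L[ℝ] E) := NormedAlgebra.restrictScalars ℚ ℝ _
  rw [← NormedSpace.exp_add_of_commute (Commute.refl _).neg_right, add_neg_cancel,
    NormedSpace.exp_zero]

/-- The exponential of an operator that acts by derivations is an automorphism. -/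
lemma exp_derivation {E : Type*} [NormedAddCommGroup E] [NormedSpace ℝ E] [CompleteSpace E]
    (A : E →L[ℝ] E →L[ℝ] E) (hA : ∀ y z, A (A y z) = A y * A z - A z * A y) (y z : E) :
    A (NormedSpace.exp (A y) z) * NormedSpace.exp (A y) = NormedSpace.exp (A y) * A z := by
  have hd : ∀ t : ℝ, HasDerivAt (fun t : ℝ => NormedSpace.exp (t • (-A y)) *
      A (NormedSpace.exp (t • A y) z) * NormedSpace.exp (t • A y)) 0 t := by
    intro t
    have h1 := hasDerivAt_exp_smul_const' (𝕂 := ℝ) (A y) t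
    have h2 := hasDerivAt_exp_smul_const (𝕂 := ℝ) (-A y) t
    have h3 := A.hasFDerivAt.comp_hasDerivAt t (h1.clm_apply (hasDerivAt_const t z))
    convert! (h2.mul h3).mul h1 using 1
    simp [hA]
    noncomm_ring
  have h1 := is_const_of_deriv_eq_zero (fun t => (hd t).differentiableAt) (fun t => (hd t).deriv) 1 0
  simp only [one_smul, zero_smul, NormedSpace.exp_zero, one_mul, mul_one] at h1
  have h3 := congrArg (NormedSpace.exp (A y) * ·) h1
  simpa only [← mul_assoc, exp_mul_exp_neg, one_mul, one_apply_eq_self] using h3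

lemma finrank_le_of_normed {E : Type*} [NormedAddCommGroup E] [NormedSpace ℝ E]
    [FiniteDimensional ℝ E] [CompleteSpace E]
    (A : E →L[ℝ] E →L[ℝ] E) (hA : ∀ y z, A (A y z) = A y * A z - A z * A y)
    (hs : ∀ y z, A y z = -A z y) {τ Z : Submodule ℝ E} (hZ : ∀ z ∈ Z, ∀ t ∈ τ, A z t = 0)
    {H : E} (hH : H ∈ Z) (hsup : ∀ v, ∃ z ∈ Z, ∃ w, v = z + A H w) (X : E) :
    finrank ℝ τ ≤ finrank ℝ (LinearMap.ker (A X : E →ₗ[ℝ] E)) := by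
  have hF : HasStrictFDerivAt (fun p : E × Z => NormedSpace.exp (A p.1) (p.2 : E)) _
      ((0 : E), (⟨H, hH⟩ : Z)) :=
    HasStrictFDerivAt.clm_apply (HasStrictFDerivAt.comp _
      (by rw [map_zero]; exact hasStrictFDerivAt_exp_zero (𝕂 := ℝ))
      (A.hasStrictFDerivAt.comp _ hasStrictFDerivAt_fst))
      (Z.subtypeL.hasStrictFDerivAt.comp _ hasStrictFDerivAt_snd)
  have hmap := hF.map_nhds_eq_of_surj (LinearMap.range_eq_top.mpr fun v => by
    obtain ⟨z, hz, w, rfl⟩ := hsup v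
    refine ⟨(-w, ⟨z, hz⟩), ?_⟩
    simp [hs H w])
  have hnear : ∀ᶠ x in 𝓝 H, finrank ℝ τ ≤ finrank ℝ (LinearMap.ker (A x : E →ₗ[ℝ] E)) := by
    have h0 : NormedSpace.exp (A ((0 : E), (⟨H, hH⟩ : Z)).1) (((0 : E), (⟨H, hH⟩ : Z)).2 : E) = H := by
      simp
    rw [h0] at hmap
    rw [← hmap, Filter.eventually_map]
    refine Filter.Eventually.of_forall fun p => ?_
    have hu := exp_mul_exp_neg (-A p.1)
    rw [neg_neg] at hu
    have hinj : Function.Injective ((NormedSpace.exp (A p.1) : E →L[ℝ] E) : E →ₗ[ℝ] E) := fun v w h => by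
      have h1 : (NormedSpace.exp (A p.1) : E →L[ℝ] E) v = (NormedSpace.exp (A p.1) : E →L[ℝ] E) w := h
      have h2 := congrArg (NormedSpace.exp (-A p.1) : E →L[ℝ] E) h1
      rwa [← mul_apply_eq_comp, ← mul_apply_eq_comp, hu, one_apply_eq_self,
        one_apply_eq_self] at h2
    refine (Submodule.equivMapOfInjective _ hinj τ).finrank_eq.le.trans (Submodule.finrank_mono ?_)
    rintro _ ⟨t, ht, rfl⟩
    have h1 := DFunLike.congr_fun (exp_derivation A hA p.1 p.2) t
    simp only [mul_apply_eq_comp, hZ p.2 p.2.2 t ht, map_zero] at h1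
    exact h1
  have hc : ContinuousAt (fun s : ℝ => X + s • (H - X)) 1 := by fun_prop
  have h1 : ∀ᶠ s : ℝ in 𝓝 1, finrank ℝ τ ≤
      finrank ℝ (LinearMap.ker (A (X + s • (H - X)) : E →ₗ[ℝ] E)) := by
    have h2 : Filter.Tendsto (fun s : ℝ => X + s • (H - X)) (𝓝 1) (𝓝 H) := by
      have := hc.tendsto
      rwa [one_smul, add_sub_cancel] at this
    exact h2.eventually hnear
  obtain ⟨s, hs1, hs2⟩ := ((infinite_of_mem_nhds (1 : ℝ) h1).sdiff (finite_finrank_ker_lt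
    (A X : E →ₗ[ℝ] E) (A (H - X) : E →ₗ[ℝ] E))).nonempty
  rw [Set.mem_ofPred_eq, not_lt] at hs2
  have h2 : (A (X + s • (H - X)) : E →ₗ[ℝ] E) = (A X : E →ₗ[ℝ] E) + s • (A (H - X) : E →ₗ[ℝ] E) := by
    ext v
    simp
  rw [← h2] at hs2
  exact (show _ ≤ _ from hs1).trans hs2

/-- The dimension of a toral subspace is bounded by that of any centralizer. -/
lemma finrank_le_ker_ad {M : Type*} [LieRing M] [LieAlgebra ℝ M] [FiniteDimensional ℝ M]
    {τ Z : Submodule ℝ M} (hZ : ∀ z ∈ Z, ∀ t ∈ τ, ⁅z, t⁆ = 0)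
    {H : M} (hH : H ∈ Z) (hsup : ∀ v, ∃ z ∈ Z, ∃ w, v = z + ⁅H, w⁆) (X : M) :
    finrank ℝ τ ≤ finrank ℝ (LinearMap.ker (LieAlgebra.ad ℝ M X)) := by
  obtain ⟨E, _, _, ⟨u⟩⟩ : ∃ (E : Type) (_ : NormedAddCommGroup E) (_ : NormedSpace ℝ E),
      Nonempty (M ≃ₗ[ℝ] E) := ⟨Fin (finrank ℝ M) → ℝ, _, _, ⟨(finBasis ℝ M).equivFun⟩⟩
  have : FiniteDimensional ℝ E := u.finiteDimensional
  have : CompleteSpace E := FiniteDimensional.complete ℝ E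
  let A : E →L[ℝ] E →L[ℝ] E :=
    LinearMap.toContinuousLinearMap (LinearMap.toContinuousLinearMap.toLinearMap ∘ₗ
      (u.conj.toLinearMap ∘ₗ (LieAlgebra.ad ℝ M : M →ₗ[ℝ] End ℝ M) ∘ₗ u.symm.toLinearMap))
  have hA : ∀ y z, A y z = u ⁅u.symm y, u.symm z⁆ := fun y z => rfl
  have h1 := finrank_le_of_normed A (fun y z => by
      ext1 v
      simp [hA]) (fun y z => by
      rw [hA, hA, ← map_neg, lie_skew]) (τ := τ.map u.toLinearMap) (Z := Z.map u.toLinearMap) (by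
      rintro _ ⟨z, hz, rfl⟩ _ ⟨t, ht, rfl⟩
      simp [hA, hZ z hz t ht]) (H := u H) ⟨H, hH, rfl⟩ (by
      intro v
      obtain ⟨z, hz, w, hw⟩ := hsup (u.symm v)
      refine ⟨u z, ⟨z, hz, rfl⟩, u w, ?_⟩
      rw [hA, u.symm_apply_apply, u.symm_apply_apply, ← map_add, ← hw, u.apply_symm_apply]) (u X)
  rw [LinearEquiv.finrank_map_eq] at h1
  rw [← LinearEquiv.finrank_map_eq u (LinearMap.ker (LieAlgebra.ad ℝ M X))]
  refine h1.trans (Submodule.finrank_mono fun v hv => ?_)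
  have h2 : u ⁅u.symm (u X), u.symm v⁆ = 0 := hv
  rw [u.symm_apply_apply, LinearEquiv.map_eq_zero_iff] at h2
  exact ⟨u.symm v, h2, u.apply_symm_apply v⟩

variable {L : Type*} [LieRing L] [LieAlgebra ℝ L] [FiniteDimensional ℝ L] {n : ℕ}
  {r : L →ₗ[ℝ] Matrix (Fin n) (Fin n) ℝ} {B : LinearMap.BilinForm ℝ L} {m h : LieSubalgebra ℝ L}

lemma IsInvariantPair.exists_generic (hr : IsInvariantPair r B) (m : LieSubalgebra ℝ L)
    (τ : Submodule ℝ m) (hτ : ∀ X ∈ τ, IsSemisimpleElt r (X : L))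
    (hcomm : ∀ X ∈ τ, ∀ Y ∈ τ, ⁅X, Y⁆ = 0) :
    ∃ H ∈ τ, (∀ X ∈ τ, ∀ Y : m, ⁅H, Y⁆ = 0 → ⁅X, Y⁆ = 0) ∧
      ∀ v : m, ∃ z w : m, ⁅H, z⁆ = 0 ∧ v = z + ⁅H, w⁆ := by
  have hss : ∀ X ∈ τ, (LieAlgebra.ad ℝ m X).IsSemisimple := fun X hX =>
    Module.End.IsSemisimple.restrict (p := m.toSubmodule) (f := LieAlgebra.ad ℝ L (X : L))
      (fun Y hY => m.lie_mem X.2 hY) (hr.isSemisimple_ad (hτ X hX))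
  obtain ⟨_, ⟨H, hH, rfl⟩, hker⟩ := exists_ker_le
    (τ.map (LieAlgebra.ad ℝ m : m →ₗ[ℝ] End ℝ m)) (by rintro _ ⟨X, hX, rfl⟩; exact hss X hX) (by
      rintro _ ⟨X, hX, rfl⟩ _ ⟨Y, hY, rfl⟩
      refine LinearMap.ext fun v => ?_
      change ⁅X, ⁅Y, v⁆⁆ = ⁅Y, ⁅X, v⁆⁆
      rw [leibniz_lie, hcomm X hX Y hY, zero_lie, zero_add])
  refine ⟨H, hH, fun X hX Y hY => hker _ ⟨X, hX, rfl⟩ hY, fun v => ?_⟩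
  obtain ⟨k, w, hk, hv⟩ := exists_ker_add_range (hss H hH) v
  exact ⟨k, w, hk, hv⟩

/-- A toral subspace has at most the dimension of a Cartan subalgebra. -/
lemma CartanPair.finrank_le (hc : CartanPair r B m h) (τ : Submodule ℝ L) (hle : τ ≤ m.toSubmodule)
    (hτ : ∀ X ∈ τ, IsSemisimpleElt r X) (hcomm : ∀ X ∈ τ, ∀ Y ∈ τ, ⁅X, Y⁆ = 0) :
    finrank ℝ τ ≤ finrank ℝ h := by
  obtain ⟨T, hT, hTc, hTs⟩ := hc.exists_generic m (τ.comap m.toSubmodule.subtype)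
    (fun X hX => hτ X hX) (fun X hX Y hY => Subtype.ext (hcomm X hX Y hY))
  obtain ⟨H, hH, hHc, -⟩ := hc.exists_generic m (h.toSubmodule.comap m.toSubmodule.subtype)
    (fun X hX => hc.isSemisimpleElt hX) (fun X hX Y hY => Subtype.ext (hc.comm X hX Y hY))
  have h1 := finrank_le_ker_ad (τ := τ.comap m.toSubmodule.subtype)
    (Z := LinearMap.ker (LieAlgebra.ad ℝ m T)) (H := T) (fun z hz t ht => by
      rw [← lie_skew, hTc t ht z hz, neg_zero]) (lie_self T) (fun v => by
      obtain ⟨z, w, hz, hv⟩ := hTs v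
      exact ⟨z, hz, w, hv⟩) H
  refine (Submodule.comapSubtypeEquivOfLe hle).finrank_eq.symm.le.trans (h1.trans (le_trans ?_
    (Submodule.comapSubtypeEquivOfLe (show h.toSubmodule ≤ m.toSubmodule from hc.le)).finrank_eq.le))
  refine Submodule.finrank_mono fun Y hY => hc.self_centralizing Y Y.2 fun X hX => ?_
  exact congrArg Subtype.val (hHc ⟨X, hc.le hX⟩ hX Y hY)

end Rank

section TypeI

open Module StableAut

variable {L : Type*} [LieRing L] [LieAlgebra ℝ L] [FiniteDimensional ℝ L] {n : ℕ}
  {r : L →ₗ[ℝ] Matrix (Fin n) (Fin n) ℝ} {B : LinearMap.BilinForm ℝ L} {m h : LieSubalgebra ℝ L}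

/-- The span of the elliptic elements of `h`. -/
def ellSub (r : L →ₗ[ℝ] Matrix (Fin n) (Fin n) ℝ) (h : LieSubalgebra ℝ L) : Submodule ℝ L :=
  Submodule.span ℝ {X : L | X ∈ h ∧ IsInfElliptic r X}

/-- The span of the hyperbolic elements of `h`. -/
def hypSub (r : L →ₗ[ℝ] Matrix (Fin n) (Fin n) ℝ) (h : LieSubalgebra ℝ L) : Submodule ℝ L :=
  Submodule.span ℝ {X : L | X ∈ h ∧ IsInfHyperbolic r X}

lemma mem_of_mem_span {p : L → Prop} {h : LieSubalgebra ℝ L} (h0 : p 0)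
    (hsmul : ∀ (t : ℝ) X, p X → p (t • X)) (hadd : ∀ X Y, p X → p Y → ⁅X, Y⁆ = 0 → p (X + Y))
    (hcomm : ∀ X ∈ h, p X → ∀ Y ∈ h, p Y → ⁅X, Y⁆ = 0) {X : L}
    (hX : X ∈ Submodule.span ℝ {X : L | X ∈ h ∧ p X}) : X ∈ h ∧ p X := by
  induction hX using Submodule.span_induction with
  | mem X hX => exact hX
  | zero => exact ⟨h.zero_mem, h0⟩
  | add X Y _ _ hX hY => exact ⟨h.add_mem hX.1 hY.1, hadd X Y hX.2 hY.2 (hcomm X hX.1 hX.2 Y hY.1 hY.2)⟩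
  | smul t X _ hX => exact ⟨h.smul_mem t hX.1, hsmul t X hX.2⟩

lemma CartanPair.elliptic_zero (hc : CartanPair r B m h) : IsInfElliptic r (0 : L) := by
  obtain ⟨T, -, A, -, -, hT, -⟩ := hc.decomp 0 h.zero_mem
  simpa using hT.smul 0

lemma CartanPair.hyperbolic_zero (hc : CartanPair r B m h) : IsInfHyperbolic r (0 : L) := by
  obtain ⟨T, -, A, -, -, -, hA⟩ := hc.decomp 0 h.zero_mem
  simpa using hA.smul 0

lemma CartanPair.mem_ellSub (hc : CartanPair r B m h) {h' : LieSubalgebra ℝ L}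
    (hcomm : ∀ X ∈ h', IsInfElliptic r X → ∀ Y ∈ h', IsInfElliptic r Y → ⁅X, Y⁆ = 0) {X : L}
    (hX : X ∈ ellSub r h') : X ∈ h' ∧ IsInfElliptic r X :=
  mem_of_mem_span hc.elliptic_zero (fun t _ hX => hX.smul t) (fun _ _ => hc.elliptic_add) hcomm hX

lemma CartanPair.mem_hypSub (hc : CartanPair r B m h) {X : L} (hX : X ∈ hypSub r h) :
    X ∈ h ∧ IsInfHyperbolic r X :=
  mem_of_mem_span hc.hyperbolic_zero (fun t _ hX => hX.smul t) (fun _ _ => hc.hyperbolic_add)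
    (fun X hX _ Y hY _ => hc.comm X hX Y hY) hX

lemma CartanPair.finrank_sup (hc : CartanPair r B m h) {h' : LieSubalgebra ℝ L}
    (hcomm : ∀ X ∈ h', IsInfElliptic r X → ∀ Y ∈ h', IsInfElliptic r Y → ⁅X, Y⁆ = 0) :
    finrank ℝ (ellSub r h' ⊔ hypSub r h : Submodule ℝ L) =
      finrank ℝ (ellSub r h') + finrank ℝ (hypSub r h) := by
  have h1 := Submodule.finrank_sup_add_finrank_inf_eq (ellSub r h') (hypSub r h)
  have h2 : ellSub r h' ⊓ hypSub r h = ⊥ := (Submodule.eq_bot_iff _).mpr fun X hX =>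
    (hc.mem_ellSub hcomm hX.1).2.eq_zero_of_hyperbolic hc.toIsInvariantPair (hc.mem_hypSub hX.2).2
  rwa [h2, finrank_bot, add_zero] at h1

lemma CartanPair.finrank_eq (hc : CartanPair r B m h) :
    finrank ℝ (ellSub r h) + finrank ℝ (hypSub r h) = finrank ℝ h := by
  have hcomm : ∀ X ∈ h, IsInfElliptic r X → ∀ Y ∈ h, IsInfElliptic r Y → ⁅X, Y⁆ = 0 :=
    fun X hX _ Y hY _ => hc.comm X hX Y hY
  rw [← hc.finrank_sup hcomm]
  have : ellSub r h ⊔ hypSub r h = h.toSubmodule := by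
    refine le_antisymm (sup_le (fun X hX => (hc.mem_ellSub hcomm hX).1)
      fun X hX => (hc.mem_hypSub hX).1) fun X hX => ?_
    obtain ⟨T, hT, A, hA, rfl, hT1, hA1⟩ := hc.decomp X hX
    exact Submodule.add_mem_sup (Submodule.subset_span ⟨hT, hT1⟩) (Submodule.subset_span ⟨hA, hA1⟩)
  rw [this]; rfl

lemma CartanPair.hyperbolic_central (hc : CartanPair r B m h)
    (him : ∀ α, IsRoot m h α → IsImaginary h α) {X Y : L} (hX : X ∈ hypSub r h) (hY : Y ∈ m) :
    ⁅X, Y⁆ = 0 := by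
  obtain ⟨hXh, hX⟩ := hc.mem_hypSub hX
  obtain ⟨f, hf, hsum, -⟩ := hc.exists_decomp (z := (1 : ℂ) ⊗ₜ[ℝ] Y)
    (mem_baseChange_iff.mpr ⟨by simpa using hY, by simp⟩)
  have h1 : ⁅(1 : ℂ) ⊗ₜ[ℝ] X, (1 : ℂ) ⊗ₜ[ℝ] Y⁆ = 0 := by
    rw [← hsum, Finsupp.sum, ← adC_apply, map_sum]
    refine Finset.sum_eq_zero fun α hα => ?_
    rw [adC_apply, (mem_rootSpace_iff.mp (hf α)).2 ⟨X, hXh⟩]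
    by_cases h0 : α = 0
    · rw [h0, LinearMap.zero_apply, zero_smul]
    have hroot : IsRoot m h α := ⟨h0, fun hbot => Finsupp.mem_support_iff.mp hα (by
      have := hf α; rw [hbot] at this; exact this)⟩
    have h2 := congrArg Complex.re (him α hroot ⟨X, hXh⟩)
    have h3 := (hc.root_mem_realSub hroot.2).2 ⟨X, hXh⟩ hX
    have h4 : α ⟨X, hXh⟩ = 0 := by
      apply Complex.ext
      · simp at h2; simp; linarith
      · simpa using h3
    rw [h4, zero_smul]
  simpa using congrArg reV h1

/-- A Cartan subalgebra all of whose roots are imaginary is fundamental. -/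
lemma CartanPair.isFundamental (hc : CartanPair r B m h)
    (him : ∀ α, IsRoot m h α → IsImaginary h α) : IsFundamental r m h := by
  refine ⟨hc.isCartanOf, fun h' hc' => ?_⟩
  have hcomm : ∀ X ∈ h', IsInfElliptic r X → ∀ Y ∈ h', IsInfElliptic r Y → ⁅X, Y⁆ = 0 := by
    intro X hX hX1 Y hY _
    have := hc'.isNilpotent
    obtain ⟨k, hk⟩ := LieModule.exists_forall_pow_toEnd_eq_zero ℝ h' h'
    refine eq_zero_of_pow_apply_eq_zero (hc.isSemisimple_ad hX1.1) (k := k) ?_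
    have h3 : ∀ j : ℕ, (LieAlgebra.ad ℝ L X ^ j) Y =
        ((LieModule.toEnd ℝ h' h' ⟨X, hX⟩ ^ j) ⟨Y, hY⟩ : h') := by
      intro j
      induction j with
      | zero => simp
      | succ j ih =>
        rw [pow_succ', Module.End.mul_apply, ih, pow_succ', Module.End.mul_apply]
        rfl
    rw [h3, hk]; rfl
  have hmem := fun X (hX : X ∈ ellSub r h') => hc.mem_ellSub hcomm hX
  have hm := hc'.1
  have hcen : ∀ A ∈ hypSub r h, ∀ Y ∈ m, ⁅A, Y⁆ = 0 := fun A hA Y hY =>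
    hc.hyperbolic_central him hA hY
  have key := hc.finrank_le (ellSub r h' ⊔ hypSub r h)
    (sup_le (fun X hX => hm (hmem X hX).1) fun X hX => hc.le (hc.mem_hypSub hX).1) (by
      intro X hX
      obtain ⟨T, hT, A, hA, rfl⟩ := Submodule.mem_sup.mp hX
      rw [IsSemisimpleElt, map_add]
      refine (hmem T hT).2.1.add (hc.mem_hypSub hA).2.1 (hc.lie_eq_zero_iff.mp ?_)
      rw [← lie_skew, hcen A hA T (hm (hmem T hT).1), neg_zero]) (by
      intro X hX Y hY
      obtain ⟨T, hT, A, hA, rfl⟩ := Submodule.mem_sup.mp hX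
      obtain ⟨T', hT', A', hA', rfl⟩ := Submodule.mem_sup.mp hY
      rw [lie_add, add_lie, add_lie, hcen A hA T' (hm (hmem T' hT').1), ← lie_skew T A',
        hcen A' hA' T (hm (hmem T hT).1), hcen A hA A' (hc.le (hc.mem_hypSub hA').1),
        hcomm T (hmem T hT).1 (hmem T hT).2 T' (hmem T' hT').1 (hmem T' hT').2]
      simp)
  rw [hc.finrank_sup hcomm, ← hc.finrank_eq] at key
  exact Nat.add_le_add_iff_right.mp key

/-- If some Cartan subalgebra has imaginary roots only, so has a fundamental one. -/
lemma CartanPair.imaginary_of_fundamental {h₁ : LieSubalgebra ℝ L} (hc : CartanPair r B m h)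
    (hc₁ : CartanPair r B m h₁) (him : ∀ α, IsRoot m h₁ α → IsImaginary h₁ α)
    (hle : finrank ℝ (ellSub r h₁) ≤ finrank ℝ (ellSub r h)) {α : CForm h} (hα : IsRoot m h α) :
    IsImaginary h α := by
  have hsub : hypSub r h₁ ≤ hypSub r h := fun X hX =>
    Submodule.subset_span ⟨hc.self_centralizing X (hc₁.le (hc₁.mem_hypSub hX).1) fun H hH => by
      rw [← lie_skew, hc₁.hyperbolic_central him hX (hc.le hH), neg_zero], (hc₁.mem_hypSub hX).2⟩
  have h1 := hc₁.finrank_le h.toSubmodule hc.le (fun X hX => hc.isSemisimpleElt hX) hc.comm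
  have h2 : hypSub r h₁ = hypSub r h := Submodule.eq_of_le_of_finrank_le hsub (by
    have h3 := hc.finrank_eq
    have h4 := hc₁.finrank_eq
    have h5 : finrank ℝ h ≤ finrank ℝ h₁ := h1
    omega)
  obtain ⟨z, hz, hz0⟩ := Submodule.exists_mem_ne_zero_of_ne_bot hα.2
  have hz' := mem_rootSpace_iff.mp hz
  have hreal := hc.root_mem_realSub hα.2
  rintro ⟨X, hX⟩
  obtain ⟨T, hT, A, hA, rfl, hT1, hA1⟩ := hc.decomp X hX
  have hA2 : A ∈ hypSub r h₁ := h2 ▸ Submodule.subset_span ⟨hA, hA1⟩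
  have h0 : α ⟨A, hA⟩ = 0 := by
    have h3 := hz'.2 ⟨A, hA⟩
    refine (smul_eq_zero.mp (h3.symm.trans ?_)).resolve_right hz0
    apply ext_re_im <;> simp [hc₁.hyperbolic_central him hA2 hz'.1.1,
      hc₁.hyperbolic_central him hA2 hz'.1.2]
  have h3 : α ⟨T + A, hX⟩ = α ⟨T, hT⟩ := by
    rw [show (⟨T + A, hX⟩ : h) = ⟨T, hT⟩ + ⟨A, hA⟩ from rfl, map_add, h0, add_zero]
  have h4 : (α ⟨T, hT⟩).re = 0 := hreal.1 ⟨T, hT⟩ hT1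
  rw [h3]
  apply Complex.ext <;> simp [h4]

variable {a : L →ₗ⁅ℝ⁆ L} {P : Param L}

lemma IsTypeI.imaginary_root (hr : IsReductivePair r B) (hP : IsTypeI r B P) {α : CForm P.h}
    (hα : IsRoot (stab P.lam) P.h α) : IsImaginary P.h α := by
  obtain ⟨h₁, hc₁, him⟩ := hP.imaginary
  exact (hr.cartanPair hP.param.semisimple hP.param.cartan).imaginary_of_fundamental
    (hr.cartanPair hP.param.semisimple hc₁) him (hP.fundamental.2 h₁ hc₁) hα

/-- Type I parameters descend to type I parameters. -/
lemma FixedParam.isTypeI_descent (hp : FixedParam r B a P)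
    (hst : HasStableChamber r B a P hp.fixes.stable)
    (hper : ∀ α ∈ simpleSys (bForm hp.cartan) (imagRoots (stab P.lam) P.h) P.rho,
      ∀ z ∈ rootSpace (stab P.lam) P.h α,
        (mapC a ^ Function.minimalPeriod hp.stableAut.pull α) z = z) (hP : IsTypeI r B P) :
    IsTypeI (resRep r a) (resBilin B a) (descent r P a) := by
  have hc' := hp.cartan_descent hst
  have him : ∀ α, IsRoot (stab (resLam P.lam a)) (resSub P.h a) α → IsImaginary (resSub P.h a) α := by
    intro α' hα'
    obtain ⟨α, hα, rfl⟩ := hp.stableAut.exists_root_of_descent hp.mem_stab_resLam hα'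
    exact StableAut.imaginary_resForm (hP.imaginary_root hp.reductive hα)
  refine ⟨hp.isParam_descent hst, ⟨resSub P.h a, hc'.isCartanOf, him⟩, hc'.isFundamental him, ?_⟩
  intro α' hα' hcomp
  have hsimple : α' ∈ simpleSys (bForm hc') (imagRoots (stab (resLam P.lam a)) (resSub P.h a))
      (resForm P.rho a) := by
    have h1 := hc'.posRoots_chamberOf (hp.regular_descent hst)
    change α' ∈ simpleRoots (stab (resLam P.lam a)) (resSub P.h a) (chamberOf (stab (resLam P.lam a))
      (resSub P.h a) (realDual (resRep r a) (resSub P.h a))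
      (imagRoots (stab (resLam P.lam a)) (resSub P.h a)) (resForm P.rho a)) at hα'
    simpa only [simpleRoots, simpleSys, h1] using hα'
  have hcl : α' ∈ AddSubmonoid.closure ((fun α => resForm α a) ''
      simpleSys (bForm hp.cartan) (imagRoots (stab P.lam) P.h) P.rho) := by
    obtain ⟨α, hα, rfl⟩ := hp.stableAut.exists_root_of_descent hp.mem_stab_resLam hsimple.1.1.1
    have h1 : α ∈ posSys (bForm hp.cartan) (imagRoots (stab P.lam) P.h) P.rho := by
      refine ⟨⟨hα, hP.imaginary_root hp.reductive hα⟩, ?_⟩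
      have h2 := hsimple.1.2
      rwa [bForm_symm, hp.stableAut.bForm_resForm _ hp.pull_rho, bForm_symm] at h2
    have h2 := AddSubmonoid.mem_map_of_mem (resFormLin P.h a).toAddMonoidHom
      (hp.cartan.isRootSys_imag.posSys_le_closure P.rho α h1)
    rw [AddMonoidHom.map_mclosure] at h2
    exact h2
  obtain ⟨α, hα, rfl⟩ := hc'.isRootSys_imag.simple_mem_of_mem_closure hsimple (by
    rintro _ ⟨α, hα, rfl⟩
    obtain ⟨z, hz, hz0⟩ := Submodule.exists_mem_ne_zero_of_ne_bot hα.1.1.1.2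
    exact (hp.exists_descent_vector hst hper hα hz hz0).1) hcl
  obtain ⟨z, hz, hz0⟩ := Submodule.exists_mem_ne_zero_of_ne_bot hα.1.1.1.2
  obtain ⟨h1, w, hw, hw0, k, hk, hkw⟩ := hp.exists_descent_vector hst hper hα hz hz0
  have h2 := (hc'.isCompactRoot_iff h1.1.1 h1.1.2 hw hw0).mp hcomp
  rw [hkw, ← Complex.ofReal_natCast, Complex.re_ofReal_mul] at h2
  refine hP.noncompact α ?_ ((hp.cartan.isCompactRoot_iff hα.1.1.1 hα.1.1.2 hz hz0).mpr ?_)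
  · rw [hp.isRho.simpleRoots_eq]; exact hα
  · have : (0 : ℝ) < k := by exact_mod_cast hk
    by_contra hcon
    nlinarith [mul_nonneg this.le (not_lt.mp hcon)]

end TypeI

section Folding

variable {E E' : Type*} [AddCommGroup E] [Module ℂ E] [AddCommGroup E'] [Module ℂ E']
  {b : LinearMap.BilinForm ℂ E} {V : Submodule ℝ E} {Φ : Set E}
  {b' : LinearMap.BilinForm ℂ E'} {V' : Submodule ℝ E'} {Φ' : Set E'}

/-- The map `R` restricts forms to the fixed points of the automorphism `g`, which fixes the regular
element `x`. -/
structure IsFolding (b : LinearMap.BilinForm ℂ E) (V : Submodule ℝ E) (Φ : Set E)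
    (b' : LinearMap.BilinForm ℂ E') (V' : Submodule ℝ E') (Φ' : Set E') (g : E ≃ₗ[ℂ] E)
    (R : E →ₗ[ℂ] E') (x : E) : Prop where
  sys : IsRootSys b V Φ
  sys' : IsRootSys b' V' Φ'
  isom : IsIsom b g
  root_iff : ∀ α, g α ∈ Φ ↔ α ∈ Φ
  form : ∀ β, g β = β → ∀ γ, b' (R β) (R γ) = b β γ
  real : ∀ β ∈ V, R β ∈ V'
  lift_root : ∀ α' ∈ Φ', ∃ α ∈ Φ, R α = α'
  orbit : ∀ α ∈ Φ, R (orbitSum g α) = ((orbitSet g α).ncard : ℂ) • R α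
  regular : IsRegularVec b V Φ x
  fixed : g x = x

namespace IsFolding

variable {g : E ≃ₗ[ℂ] E} {R : E →ₗ[ℂ] E'} {x : E} (hf : IsFolding b V Φ b' V' Φ' g R x)
include hf

lemma exists_lift {w' : E' ≃ₗ[ℂ] E'} (hw' : w' ∈ reflGroup b' Φ') :
    ∃ w ∈ reflGroup b Φ, g * w = w * g ∧ ∀ y, g y = y → R (w y) = w' (R y) := by
  refine hf.sys'.group_induction hw' (p := fun w' => ∃ w ∈ reflGroup b Φ, g * w = w * g ∧
    ∀ y, g y = y → R (w y) = w' (R y)) ⟨1, one_mem _, by simp, fun y _ => rfl⟩ ?_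
  rintro α' hα' u' - ⟨u, hu, hgu, hRu⟩
  obtain ⟨α, hα, rfl⟩ := hf.lift_root α' hα'
  obtain ⟨w, hw, hgw, hwo⟩ := hf.sys.exists_lift hf.isom hf.root_iff hf.regular hf.fixed hα
  refine ⟨w * u, mul_mem hw hu, by rw [← mul_assoc, hgw, mul_assoc, hgu, mul_assoc], fun y hy => ?_⟩
  have huy : g (u y) = u y := by
    have := LinearEquiv.congr_fun hgu y
    rwa [LinearEquiv.mul_apply, LinearEquiv.mul_apply, hy] at this
  have hN : ((orbitSet g α).ncard : ℂ) ≠ 0 := by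
    exact_mod_cast (hf.sys.ncard_orbit_pos hf.root_iff hα).ne'
  have ho := hf.sys.map_orbitSum hf.root_iff hα
  have hb := hf.sys'.b_ne hα'
  rw [LinearEquiv.mul_apply, LinearEquiv.mul_apply, hwo _ huy, rootRefl_apply, rootRefl_apply,
    ← hRu y hy, map_sub, map_smul, ← hf.form _ huy, ← hf.form _ ho, hf.orbit α hα, smul_smul]
  simp only [map_smul, LinearMap.smul_apply, smul_eq_mul]
  congr 2
  field_simp

lemma commute_fixed {w : E ≃ₗ[ℂ] E} (hgw : g * w = w * g) : g (w x) = w x := by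
  have := LinearEquiv.congr_fun hgw x
  rwa [LinearEquiv.mul_apply, LinearEquiv.mul_apply, hf.fixed] at this

lemma regular_map {w : E ≃ₗ[ℂ] E} (hw : w ∈ reflGroup b Φ) (hgw : g * w = w * g) :
    IsRegularVec b' V' Φ' (R (w x)) := by
  have h1 := hf.sys.isRegularVec_map hw hf.regular
  refine ⟨hf.real _ h1.1, fun α' hα' => ?_⟩
  obtain ⟨α, hα, rfl⟩ := hf.lift_root α' hα'
  rw [hf.sys'.symm, hf.form _ (hf.commute_fixed hgw), hf.sys.symm]
  exact h1.2 α hα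

/-- The elements `w` of the Weyl group commuting with `g` such that `w x` and `x` restrict to the
same chamber. -/
def chamberSet (b : LinearMap.BilinForm ℂ E) (Φ : Set E) (b' : LinearMap.BilinForm ℂ E')
    (Φ' : Set E') (g : E ≃ₗ[ℂ] E) (R : E →ₗ[ℂ] E') (x : E) : Set (E ≃ₗ[ℂ] E) :=
  {w | w ∈ reflGroup b Φ ∧ g * w = w * g ∧
    ∀ α' ∈ Φ', 0 < (b' α' (R x)).re * (b' α' (R (w x))).re}

/-- The number of elements of the Weyl group commuting with `g`. -/
lemma card_commutant : Nat.card {w | w ∈ reflGroup b Φ ∧ g * w = w * g} =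
    Nat.card (reflGroup b' Φ') * Nat.card (chamberSet b Φ b' Φ' g R x) := by
  have hlift : ∀ w' : reflGroup b' Φ', ∃ w ∈ reflGroup b Φ, g * w = w * g ∧
      ∀ y, g y = y → R (w y) = w'.1 (R y) := fun w' => hf.exists_lift w'.2
  choose l hl hgl hRl using hlift
  rw [← Nat.card_prod]
  symm
  refine Nat.card_congr (Equiv.ofBijective (fun p => (⟨l p.1 * p.2.1, mul_mem (hl p.1) p.2.2.1, by
    rw [← mul_assoc, hgl, mul_assoc, p.2.2.2.1, mul_assoc]⟩ :
      {w | w ∈ reflGroup b Φ ∧ g * w = w * g})) ⟨?_, ?_⟩)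
  · rintro ⟨u, v⟩ ⟨u', v'⟩ h
    have h1 : l u * v.1 = l u' * v'.1 := congrArg Subtype.val h
    have h2 : u.1 (R (v.1 x)) = u'.1 (R (v'.1 x)) := by
      rw [← hRl u _ (hf.commute_fixed v.2.2.1), ← hRl u' _ (hf.commute_fixed v'.2.2.1)]
      exact congrArg R (LinearEquiv.congr_fun h1 x)
    have h3 : u'.1⁻¹ * u.1 = 1 := by
      refine hf.sys'.eq_one_of_chamber (y := R x) (hf.regular_map v.2.1 v.2.2.1)
        (mul_mem (inv_mem u'.2) u.2) (fun α hα => by rw [mul_comm]; exact v.2.2.2 α hα)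
        fun α hα => ?_
      have h4 : (u'.1⁻¹ * u.1) (R (v.1 x)) = R (v'.1 x) := by
        change u'.1.symm (u.1 (R (v.1 x))) = _
        rw [h2, LinearEquiv.symm_apply_apply]
      rw [h4, mul_comm]
      exact v'.2.2.2 α hα
    have h5 : u = u' := Subtype.ext (inv_mul_eq_one.mp h3).symm
    subst h5
    rw [mul_right_inj] at h1
    rw [Subtype.ext h1]
  · rintro ⟨v, hv, hgv⟩
    obtain ⟨u, hu, hpos⟩ := hf.sys'.exists_map_chamber
      (hf.regular_map (one_mem _) (by simp : g * 1 = 1 * g)) (hf.regular_map hv hgv)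
    set s := l ⟨u⁻¹, inv_mem hu⟩ with hs
    have hgs : g * (s⁻¹ * v) = (s⁻¹ * v) * g :=
      (show Commute g s from hgl _).inv_right.mul_right (show Commute g v from hgv)
    have h1 : R ((s⁻¹ * v) x) = u (R (v x)) := by
      have h2 := hRl ⟨u⁻¹, inv_mem hu⟩ _ (hf.commute_fixed hgs)
      have h3 : s ((s⁻¹ * v) x) = v x := by
        change s (s.symm (v x)) = _
        rw [LinearEquiv.apply_symm_apply]
      rw [← hs, h3] at h2
      rw [h2]
      exact (u.apply_symm_apply _).symm
    refine ⟨(⟨u⁻¹, inv_mem hu⟩, ⟨s⁻¹ * v, mul_mem (inv_mem (hl _)) hv, hgs, fun α hα => ?_⟩),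
      Subtype.ext (mul_inv_cancel_left s v)⟩
    rw [h1]
    exact hpos α hα

end IsFolding

end Folding

section Counting

open StableAut

variable {L : Type*} [LieRing L] [LieAlgebra ℝ L] [FiniteDimensional ℝ L] {n : ℕ}
  {r : L →ₗ[ℝ] Matrix (Fin n) (Fin n) ℝ} {B : LinearMap.BilinForm ℝ L} {m h : LieSubalgebra ℝ L}
  {a : L →ₗ⁅ℝ⁆ L} {P : Param L}

lemma IsInvariantAut.conj_symm (ia : IsInvariantAut r B a) :
    ∃ g : GL (Fin n) ℝ, ∀ X, r X = g * r (a X) * (g⁻¹ : GL (Fin n) ℝ) := by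
  obtain ⟨g, hg⟩ := ia.conj
  refine ⟨g⁻¹, fun X => ?_⟩
  rw [hg, inv_inv]
  simp [mul_assoc]

lemma IsInvariantAut.elliptic_iff (ia : IsInvariantAut r B a) {X : L} :
    IsInfElliptic r (a X) ↔ IsInfElliptic r X := by
  refine ⟨fun H => ?_, ia.elliptic⟩
  obtain ⟨g, hg⟩ := ia.conj_symm
  rw [IsInfElliptic, hg]
  exact ⟨isSemisimpleMatrix_conj H.1 g, fun z hz => H.2 z ((isComplexEigenvalue_conj g).mp hz)⟩

lemma IsInvariantAut.hyperbolic_iff (ia : IsInvariantAut r B a) {X : L} :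
    IsInfHyperbolic r (a X) ↔ IsInfHyperbolic r X := by
  refine ⟨fun H => ?_, ia.hyperbolic⟩
  obtain ⟨g, hg⟩ := ia.conj_symm
  rw [IsInfHyperbolic, hg]
  exact ⟨isSemisimpleMatrix_conj H.1 g, fun z hz => H.2 z ((isComplexEigenvalue_conj g).mp hz)⟩

namespace StableAut

variable (ha : StableAut r B m h a)
include ha

lemma pull_mem_realSub_iff {β : CForm h} : ha.pull β ∈ realSub r h ↔ β ∈ realSub r h := by
  refine ⟨fun H => ⟨fun X hX => ?_, fun X hX => ?_⟩, ha.pull_mem_realSub⟩ <;>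
    obtain ⟨Y, rfl⟩ := ha.exists_eq X
  · exact H.1 Y (ha.elliptic_iff.mp hX)
  · exact H.2 Y (ha.hyperbolic_iff.mp hX)

lemma pull_mem_splitDual_iff {β : CForm h} : ha.pull β ∈ splitDual r h ↔ β ∈ splitDual r h := by
  refine ⟨fun H => ⟨fun X hX => ?_, fun X hX => ?_⟩, fun H => ⟨fun X hX => ?_, fun X hX => ?_⟩⟩
  · obtain ⟨Y, rfl⟩ := ha.exists_eq X
    exact H.1 Y (ha.elliptic_iff.mp hX)
  · obtain ⟨Y, rfl⟩ := ha.exists_eq X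
    exact H.2 Y (ha.hyperbolic_iff.mp hX)
  · exact H.1 _ (ha.elliptic hX)
  · exact H.2 _ (ha.hyperbolic hX)

lemma pull_mem_chamberOf_iff {β : CForm h}
    (hβ : IsRegularVec (bForm ha.cartan) (realSub r h) (imagRoots m h) β) (hfix : ha.pull β = β)
    (γ : CForm h) : ha.pull γ ∈ chamberOf m h (realDual r h) (imagRoots m h) β ↔
      γ ∈ chamberOf m h (realDual r h) (imagRoots m h) β := by
  rw [ha.cartan.mem_chamberOf_iff (S := realDual r h) (fun α hα => hα.1) (fun _ h => h) hβ.1,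
    ha.cartan.mem_chamberOf_iff (S := realDual r h) (fun α hα => hα.1) (fun _ h => h) hβ.1]
  refine and_congr ha.pull_mem_realSub_iff ⟨fun H α hα => ?_, fun H α hα => ?_⟩
  · have := H _ ((ha.pull_imagRoots_iff α).mpr hα)
    nth_rewrite 1 [← hfix] at this
    rwa [ha.isIsom_pull, ha.isIsom_pull] at this
  · obtain ⟨δ, rfl⟩ := ha.pull.surjective α
    have := H _ ((ha.pull_imagRoots_iff δ).mp hα)
    nth_rewrite 1 [← hfix]
    rwa [ha.isIsom_pull, ha.isIsom_pull]

end StableAut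

/-- The pair `(λ, w F)`. -/
def Param.translate (r : L →ₗ[ℝ] Matrix (Fin n) (Fin n) ℝ) (P : Param L)
    (w : CForm P.h ≃ₗ[ℂ] CForm P.h) : Param L where
  lam := P.lam
  h := P.h
  F := chamberOf (stab P.lam) P.h (realDual r P.h) (imagRoots (stab P.lam) P.h) (w P.rho)

namespace FixedParam

variable (hp : FixedParam r B a P) (hP : IsTypeI r B P)
include hp

lemma rho_translate {w : CForm P.h ≃ₗ[ℂ] CForm P.h}
    (hw : w ∈ reflGroup (bForm hp.cartan) (imagRoots (stab P.lam) P.h)) :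
    (P.translate r w).rho = w P.rho := by
  have hΦ := hp.cartan.isRootSys_imag
  have hρ := hp.isRho
  have h1 := hp.cartan.posRoots_chamberOf (β := w P.rho) (hΦ.isRegularVec_map hw hρ.regular)
  have h2 := map_finsum_posSys hΦ.finite (hΦ.isom hw) (hΦ.map_root_iff hw) P.rho
  have h3 : P.rho = (1 / 2 : ℂ) •
      ∑ᶠ α ∈ posSys (bForm hp.cartan) (imagRoots (stab P.lam) P.h) P.rho, α := by
    rw [Param.rho, ← hρ.posRoots_eq]; rfl
  conv_rhs => rw [h3]
  rw [map_smul, h2]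
  change rho (stab P.lam) P.h (chamberOf (stab P.lam) P.h (realDual r P.h)
    (imagRoots (stab P.lam) P.h) (w P.rho)) = _
  rw [rho, h1]

lemma translate {w : CForm P.h ≃ₗ[ℂ] CForm P.h}
    (hw : w ∈ reflGroup (bForm hp.cartan) (imagRoots (stab P.lam) P.h))
    (hgw : hp.stableAut.pull * w = w * hp.stableAut.pull) :
    FixedParam r B a (P.translate r w) := by
  have hreg := hp.cartan.isRootSys_imag.isRegularVec_map hw hp.isRho.regular
  refine ⟨hp.reductive, hp.aut, ⟨hp.param.semisimple, hp.param.cartan,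
    hp.cartan.isImagChamber_chamberOf hreg⟩, ⟨hp.fixes.lam_eq, hp.fixes.stable, fun β =>
      hp.stableAut.pull_mem_chamberOf_iff hreg ?_ β⟩⟩
  have := LinearEquiv.congr_fun hgw P.rho
  rw [LinearEquiv.mul_apply, LinearEquiv.mul_apply, hp.pull_rho] at this
  exact this

lemma hasStableChamber_of_imaginary
    (him : ∀ α, IsRoot (stab P.lam) P.h α → IsImaginary P.h α) :
    HasStableChamber r B a P hp.fixes.stable := by
  have h0 : ∀ α, ¬ IsRoot (stabRho B P) P.h α := fun α hα => by
    obtain ⟨h1, h2⟩ := (hp.isRoot_stabRho_iff α).mp hα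
    refine hp.isRho.regular.2 α ⟨h1, him α h1⟩ ?_
    have h3 : bForm hp.cartan α P.rho = 0 := by rw [bForm_symm]; exact h2
    exact congrArg Complex.re h3
  refine ⟨splitDual r P.h, ⟨0, ⟨fun _ _ => rfl, fun _ _ => rfl⟩, fun α hα => (h0 α hα).elim, ?_⟩,
    fun β => hp.stableAut.pull_mem_splitDual_iff⟩
  ext β
  exact ⟨fun hβ => ⟨hβ, fun α hα => (h0 α hα).elim⟩, fun hβ => hβ.1⟩

/-- `h` is determined by its fixed points. -/
lemma mem_h_iff (hst : HasStableChamber r B a P hp.fixes.stable) (X : L) :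
    X ∈ P.h ↔ X ∈ stab P.lam ∧ ∀ Y ∈ P.h, a Y = Y → ⁅Y, X⁆ = 0 := by
  refine ⟨fun hX => ⟨hp.cartan.le hX, fun Y hY _ => hp.cartan.comm Y hY X hX⟩, fun ⟨h1, h2⟩ => ?_⟩
  obtain ⟨x, hx, hfix⟩ := hp.exists_regular_fixed hst
  obtain ⟨h3, h4⟩ := hp.stableAut.map_tC_fixed hfix
  exact hp.cartan.mem_of_commute_regular hx h1 (h2 _ (reV_tC_mem x) h3) (h2 _ (imV_tC_mem x) h4)

lemma lam_eq_of_resLam {P' : Param L} (hp' : FixedParam r B a P')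
    (h : resLam P'.lam a = resLam P.lam a) : P'.lam = P.lam := by
  ext Y
  obtain ⟨k, -, w, -, hk, rfl⟩ := hp.stableAut.exists_fixed_add (p := ⊤) (fun _ _ => trivial)
    (LieSubalgebra.mem_top Y)
  have h1 : P'.lam k = P.lam k := LinearMap.congr_fun h ⟨k, hk⟩
  simp only [map_add, map_sub]
  rw [hp'.fixes.lam_eq, hp.fixes.lam_eq, h1, sub_self, sub_self]

lemma isFolding (hst : HasStableChamber r B a P hp.fixes.stable)
    (him : ∀ α, IsRoot (stab P.lam) P.h α → IsImaginary P.h α) :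
    IsFolding (bForm hp.cartan) (realSub r P.h) (imagRoots (stab P.lam) P.h)
      (bForm (hp.cartan_descent hst)) (realSub (resRep r a) (resSub P.h a))
      (imagRoots (stab (resLam P.lam a)) (resSub P.h a)) hp.stableAut.pull (resFormLin P.h a)
      P.rho where
  sys := hp.cartan.isRootSys_imag
  sys' := (hp.cartan_descent hst).isRootSys_imag
  isom := hp.stableAut.isIsom_pull
  root_iff := hp.stableAut.pull_imagRoots_iff
  form := fun _ hβ γ => hp.stableAut.bForm_resForm _ hβ γ
  real := fun _ hβ => resForm_mem_realSub hβ
  lift_root := fun α' hα' => by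
    obtain ⟨α, hα, rfl⟩ := hp.stableAut.exists_root_of_descent hp.mem_stab_resLam hα'.1
    exact ⟨α, ⟨hα, him α hα⟩, rfl⟩
  orbit := fun _ hα => hp.stableAut.resForm_orbitSum hα.1
  regular := hp.isRho.regular
  fixed := hp.pull_rho

/-- The elements of the Weyl group that give the parameters with the same descent. -/
def sameChamber (r : L →ₗ[ℝ] Matrix (Fin n) (Fin n) ℝ) (hp : FixedParam r B a P)
    (hst : HasStableChamber r B a P hp.fixes.stable) : Set (CForm P.h ≃ₗ[ℂ] CForm P.h) :=
  IsFolding.chamberSet (bForm hp.cartan) (imagRoots (stab P.lam) P.h)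
    (bForm (hp.cartan_descent hst)) (imagRoots (stab (resLam P.lam a)) (resSub P.h a))
    hp.stableAut.pull (resFormLin P.h a) P.rho

variable (hst : HasStableChamber r B a P hp.fixes.stable)
include hst

lemma descent_translate {w : CForm P.h ≃ₗ[ℂ] CForm P.h} (hw : w ∈ sameChamber r hp hst) :
    descent r (P.translate r w) a = descent r P a := by
  have h1 := hp.isRho.regular
  have h2 := hp.cartan.isRootSys_imag.map_real hw.1 h1.1
  have h3 : resForm (w P.rho) a ∈ (descent r P a).F :=
    ((hp.cartan_descent hst).mem_chamberOf_iff (fun α hα => hα.1) (fun _ h => h)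
      (resForm_mem_realSub h1.1)).mpr ⟨resForm_mem_realSub h2, hw.2.2⟩
  have h4 := chamberOf_congr h3
  have h5 := hp.rho_translate hw.1
  change (⟨resLam P.lam a, resSub P.h a, chamberOf _ _ _ _ (resForm (P.translate r w).rho a)⟩ :
    Param (fixedSub a)) = ⟨resLam P.lam a, resSub P.h a, _⟩
  rw [h5]
  exact congrArg (fun F => (⟨resLam P.lam a, resSub P.h a, F⟩ : Param (fixedSub a))) h4

lemma exists_translate {P' : Param L} (hp' : FixedParam r B a P')
    (hst' : HasStableChamber r B a P' hp'.fixes.stable) (hd : descent r P' a = descent r P a) :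
    ∃ w ∈ sameChamber r hp hst, P' = P.translate r w := by
  have h1 : P'.lam = P.lam := hp.lam_eq_of_resLam hp' (congrArg Param.lam hd)
  have h2 : resSub P'.h a = resSub P.h a := congrArg Param.h hd
  have h3 : P'.h = P.h := by
    ext X
    rw [hp.mem_h_iff hst, hp'.mem_h_iff hst', h1]
    refine and_congr_right fun _ => forall_congr' fun Y => ?_
    have h4 : ∀ hY : a Y = Y, Y ∈ P'.h ↔ Y ∈ P.h := fun hY =>
      (SetLike.ext_iff.mp h2 ⟨Y, hY⟩ : (⟨Y, hY⟩ : fixedSub a) ∈ resSub P'.h a ↔ _)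
    constructor
    · intro H hY hf; exact H ((h4 hf).mpr hY) hf
    · intro H hY hf; exact H ((h4 hf).mp hY) hf
  obtain ⟨lam', h', F'⟩ := P'
  obtain rfl : lam' = P.lam := h1
  obtain rfl : h' = P.h := h3
  have hΦ := hp.cartan.isRootSys_imag
  have hρ := hp.isRho
  have hρ' : IsRhoOf hp.cartan F' := hp.cartan.isRhoOf hp'.param.chamber
  obtain ⟨w, hw, hpos⟩ := hΦ.exists_map_chamber hρ'.regular hρ.regular
  have hF : F' = chamberOf (stab P.lam) P.h (realDual r P.h) (imagRoots (stab P.lam) P.h)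
      (w P.rho) := by
    refine hρ'.eq_chamberOf.trans (chamberOf_congr ?_).symm
    exact (hp.cartan.mem_chamberOf_iff (fun α hα => hα.1) (fun _ h => h) hρ'.regular.1).mpr
      ⟨hΦ.map_real hw hρ.regular.1, hpos⟩
  have hrho : rho (stab P.lam) P.h F' = w P.rho :=
    (congrArg (rho (stab P.lam) P.h) hF).trans (hp.rho_translate hw)
  have hgw : hp.stableAut.pull * w = w * hp.stableAut.pull := by
    have h4 : hp.stableAut.pull (w P.rho) = w P.rho := hrho ▸ hp'.pull_rho
    refine mul_inv_eq_iff_eq_mul.mp (hΦ.eq_of_map_eq hρ.regular (conj_mem_reflGroup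
      hp.stableAut.isIsom_pull hp.stableAut.pull_imagRoots_iff hw) hw ?_)
    have h5 : (hp.stableAut.pull)⁻¹ P.rho = P.rho := by
      nth_rewrite 1 [← hp.pull_rho]
      exact hp.stableAut.pull.symm_apply_apply _
    rw [LinearEquiv.mul_apply, LinearEquiv.mul_apply]
    exact (congrArg (fun x => hp.stableAut.pull (w x)) h5).trans h4
  refine ⟨w, ⟨hw, hgw, ?_⟩, congrArg (fun F => (⟨P.lam, P.h, F⟩ : Param L)) hF⟩
  have h4 := ((hp'.chamber_unique hst' _).mpr rfl).2
  have hFd : (descent r ⟨P.lam, P.h, F'⟩ a).F = (descent r P a).F :=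
    eq_of_heq (Param.mk.inj hd).2.2
  replace h4 := hFd ▸ h4
  have h5 : resForm (w P.rho) a ∈ (descent r P a).F := hrho ▸ h4
  exact (((hp.cartan_descent hst).mem_chamberOf_iff (fun α hα => hα.1) (fun _ h => h)
    (resForm_mem_realSub hρ.regular.1)).mp h5).2

/-- The number of parameters with a given descent. -/
theorem card_descent (hP : IsTypeI r B P) :
    Finite (weylCommutant (stab P.lam) P.h a hp.fixes.stable) ∧
      Finite (weylGroup (stab (resLam P.lam a)) (resSub P.h a)) ∧
      {P' : Param L | IsParam r B P' ∧
        (∃ hfix' : Fixes a P', HasStableChamber r B a P' hfix'.stable) ∧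
        descent r P' a = descent r P a}.Finite ∧
      ({P' : Param L | IsParam r B P' ∧
        (∃ hfix' : Fixes a P', HasStableChamber r B a P' hfix'.stable) ∧
        descent r P' a = descent r P a}.ncard : ℚ) =
        (Nat.card (weylCommutant (stab P.lam) P.h a hp.fixes.stable) : ℚ) /
          Nat.card (weylGroup (stab (resLam P.lam a)) (resSub P.h a)) := by
  have him : ∀ α, IsRoot (stab P.lam) P.h α → IsImaginary P.h α := fun α hα =>
    hP.imaginary_root hp.reductive hα
  have hf := hp.isFolding hst him
  have hΦ : {α | IsRoot (stab P.lam) P.h α} = imagRoots (stab P.lam) P.h :=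
    Set.ext fun α => ⟨fun hα => ⟨hα, him α hα⟩, fun hα => hα.1⟩
  have hΦ' : {α | IsRoot (stab (resLam P.lam a)) (resSub P.h a) α} =
      imagRoots (stab (resLam P.lam a)) (resSub P.h a) := by
    refine Set.ext fun α' => ⟨fun hα' => ⟨hα', ?_⟩, fun hα => hα.1⟩
    obtain ⟨α, hα, rfl⟩ := hp.stableAut.exists_root_of_descent hp.mem_stab_resLam hα'
    exact imaginary_resForm (him α hα)
  have hW : weylCommutant (stab P.lam) P.h a hp.fixes.stable =
      {w | w ∈ reflGroup (bForm hp.cartan) (imagRoots (stab P.lam) P.h) ∧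
        hp.stableAut.pull * w = w * hp.stableAut.pull} := by
    ext w
    rw [weylCommutant, hp.cartan.weylGroup_eq, hΦ]
    refine and_congr_right fun _ => ⟨fun H => LinearEquiv.ext fun β => (H β).symm, fun H β => ?_⟩
    exact (LinearEquiv.congr_fun H β).symm
  have hW' := (hp.cartan_descent hst).weylGroup_eq
  rw [hΦ'] at hW'
  have hfin := hf.sys.finite_reflGroup
  have hfin' := hf.sys'.finite_reflGroup
  have hS : {P' : Param L | IsParam r B P' ∧
      (∃ hfix' : Fixes a P', HasStableChamber r B a P' hfix'.stable) ∧
      descent r P' a = descent r P a} = P.translate r '' sameChamber r hp hst := by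
    ext P'
    constructor
    · rintro ⟨h1, ⟨h2, h3⟩, h4⟩
      obtain ⟨w, hw, rfl⟩ := hp.exists_translate hst ⟨hp.reductive, hp.aut, h1, h2⟩ h3 h4
      exact ⟨w, hw, rfl⟩
    · rintro ⟨w, hw, rfl⟩
      have hp' := hp.translate hw.1 hw.2.1
      exact ⟨hp'.param, ⟨hp'.fixes, hp'.hasStableChamber_of_imaginary him⟩,
        hp.descent_translate hst hw⟩
  have hinj : Set.InjOn (P.translate r) (sameChamber r hp hst) := by
    intro w hw w' hw' heq
    have h1 : (P.translate r w).F = (P.translate r w').F := eq_of_heq (Param.mk.inj heq).2.2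
    refine hf.sys.eq_of_map_eq hf.regular hw.1 hw'.1 ?_
    rw [← hp.rho_translate hw.1, ← hp.rho_translate hw'.1]
    exact congrArg (rho (stab P.lam) P.h) h1
  have hle : sameChamber r hp hst ⊆
      (reflGroup (bForm hp.cartan) (imagRoots (stab P.lam) P.h) : Set (CForm P.h ≃ₗ[ℂ] CForm P.h)) :=
    fun w hw => hw.1
  have hfS : (reflGroup (bForm hp.cartan) (imagRoots (stab P.lam) P.h) :
      Set (CForm P.h ≃ₗ[ℂ] CForm P.h)).Finite := Set.toFinite _
  rw [hW, hW', hS]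
  refine ⟨(hfS.subset fun w hw => hw.1).to_subtype, hfin', (hfS.subset hle).image _, ?_⟩
  rw [hinj.ncard_image, hf.card_commutant, Nat.cast_mul, mul_div_cancel_left₀]
  · rfl
  · exact_mod_cast Nat.card_pos.ne'

end FixedParam

end Counting

section MatrixExp

attribute [local instance] Matrix.linftyOpNormedRing Matrix.linftyOpNormedAlgebra

lemma exp_mul_of_commutator {n : ℕ} {A R : Matrix (Fin n) (Fin n) ℂ} {c : ℂ}
    (h : A * R - R * A = c • R) :
    NormedSpace.exp A * R = Complex.exp c • (R * NormedSpace.exp A) := by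
  have h1 : SemiconjBy R (A + algebraMap ℂ _ c) A := by
    rw [SemiconjBy, mul_add, ← Algebra.commutes c R, ← Algebra.smul_def, ← h]
    abel
  have h2 : R * NormedSpace.exp (A + algebraMap ℂ _ c) = NormedSpace.exp A * R := h1.exp_right
  have h3 : NormedSpace.exp (algebraMap ℂ (Matrix (Fin n) (Fin n) ℂ) c) =
      algebraMap ℂ _ (Complex.exp c) := by
    rw [Complex.exp_eq_exp_ℂ]
    exact (NormedSpace.algebraMap_exp_comm c).symm
  rw [Matrix.exp_add_of_commute _ _ (Algebra.commutes c A).symm, h3, ← Algebra.commutes, ← Algebra.smul_def, mul_smul_comm] at h2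
  exact h2.symm

end MatrixExp

section ReductiveGroup

open StableAut

variable {d n : ℕ} {G : Type*} [TopologicalSpace G] [T2Space G]
  [SecondCountableTopology G] [ChartedSpace (EuclideanSpace ℝ (Fin d)) G] [Group G]
  [LieGroup (𝓡 d) ∞ G] {𝔾 : Subgroup (GL (Fin n) ℂ)} {φ : G →* GL (Fin n) ℝ}
  (hG : IsReductiveRealGroup d 𝔾 φ)
  {B : LinearMap.BilinForm ℝ (GroupLieAlgebra (𝓡 d) G)} (hB : IsAdmissibleForm d φ B)
include hG

lemma IsReductiveRealGroup.injective : Function.Injective (differential d φ) :=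
  differential_injective hG.smooth hG.finite_ker

lemma IsReductiveRealGroup.isReductivePair (hB : IsAdmissibleForm d φ B) :
    IsReductivePair (differential d φ) B where
  inj := hG.injective
  lie := differential_lie hG.smooth
  symm := fun X Y => hB.symm.eq X Y
  invariant := fun X Y Z => by
    have h := lie_invariant_of_Ad_invariant hG.smooth hG.injective hB.invariant Y X Z
    rw [← lie_skew X Y, map_neg, LinearMap.neg_apply]
    linarith
  nondeg := fun X hX => hB.nondegenerate.1 X hX
  splitting := by
    obtain ⟨S, hS⟩ := exists_polynomials hG
    exact isSplitting_of_polynomials hS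
  reductive := hG.reductive
  semisimple_center := hG.semisimple_center
  neg := hB.neg_elliptic
  pos := hB.pos_hyperbolic
  orth := hB.orthogonal

lemma IsReductiveRealGroup.isInvariantAut (hB : IsAdmissibleForm d φ B) {e : G}
    (he : IsElliptic φ e) : IsInvariantAut (differential d φ) B (Ad d e) where
  conj := ⟨φ e, differential_Ad hG.smooth e⟩
  form := hB.invariant e
  semisimple := isSemisimple_of_conj (differential d φ) hG.injective he.1
    (differential_Ad hG.smooth e)

lemma IsReductiveRealGroup.Ad_mul (e x : G) (X : GroupLieAlgebra (𝓡 d) G) :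
    Ad d (e * x) X = Ad d e (Ad d x X) := by
  apply hG.injective
  rw [differential_Ad hG.smooth, differential_Ad hG.smooth, differential_Ad hG.smooth, map_mul,
    mul_inv_rev]
  simp only [Units.val_mul, mul_assoc]

lemma IsReductiveRealGroup.isElliptic_mul {e x : G} {X : GroupLieAlgebra (𝓡 d) G}
    (he : IsElliptic φ e) (hX : IsInfElliptic (differential d φ) X) (hfix : Ad d e X = X)
    (hx : (φ x : Matrix (Fin n) (Fin n) ℝ) = NormedSpace.exp (differential d φ X)) :
    IsElliptic φ (e * x) := by
  have hc : Commute (φ e : Matrix (Fin n) (Fin n) ℝ) (differential d φ X) := by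
    have h1 := differential_Ad hG.smooth e X
    rw [hfix] at h1
    have h2 := congrArg (· * (φ e : Matrix (Fin n) (Fin n) ℝ)) h1
    simp only [mul_assoc, Units.inv_mul, mul_one] at h2
    exact h2.symm
  rw [IsElliptic, map_mul, Units.val_mul, hx]
  exact isElliptic_mul_exp hc he.1 he.2 hX.1 hX.2

/-- The adjoint action of the exponential of `X` on root vectors. -/
lemma IsReductiveRealGroup.mapC_Ad_exp {m h : LieSubalgebra ℝ (GroupLieAlgebra (𝓡 d) G)}
    (hr : IsInvariantPair (differential d φ) B) {x : G} {X : h}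
    (hx : (φ x : Matrix (Fin n) (Fin n) ℝ) = NormedSpace.exp (differential d φ X))
    {α : CForm h} {z : ℂ ⊗[ℝ] GroupLieAlgebra (𝓡 d) G} (hz : z ∈ rootSpace m h α) :
    mapC (Ad d x) z = Complex.exp (α X) • z := by
  have h1 : ∀ w, repC (differential d φ) (mapC (Ad d x) w) =
      toC (φ x : Matrix (Fin n) (Fin n) ℝ) * repC (differential d φ) w *
        toC ((φ x)⁻¹ : GL (Fin n) ℝ) := fun w => by
    rw [repC, repC, reV_mapC, imV_mapC, differential_Ad hG.smooth, differential_Ad hG.smooth,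
      toC_mul, toC_mul, toC_mul, toC_mul, mul_add, add_mul, mul_smul_comm, smul_mul_assoc]
  have h2 : repC (differential d φ) (Complex.exp (α X) • z) =
      Complex.exp (α X) • repC (differential d φ) z := by
    ext i j
    simp only [repC, reV_smul, imV_smul, map_sub, map_add, map_smul]
    apply Complex.ext <;> simp [toC]
  have h3 : toC (φ x : Matrix (Fin n) (Fin n) ℝ) * toC ((φ x)⁻¹ : GL (Fin n) ℝ) = 1 := by
    rw [← toC_mul, Units.mul_inv]; simp [toC]
  apply hr.repC_injective
  rw [h1, h2]
  have h4 := exp_mul_of_commutator (hr.repC_rootSpace hz X)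
  rw [← toC_exp, ← hx] at h4
  rw [h4, smul_mul_assoc, mul_assoc, h3, mul_one]

/-- The product of `e` by the exponential of an elliptic element of `h` fixed by `e`. -/
lemma IsReductiveRealGroup.isTwist (hB : IsAdmissibleForm d φ B) {e x : G} (he : IsElliptic φ e)
    {P : Param (GroupLieAlgebra (𝓡 d) G)} (hp : FixedParam (differential d φ) B (Ad d e) P) {X : P.h}
    (hX : IsInfElliptic (differential d φ) X)
    (hfix : Ad d e X = X)
    (hx : (φ x : Matrix (Fin n) (Fin n) ℝ) = NormedSpace.exp (differential d φ X)) :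
    IsTwist (differential d φ) B P (Ad d e) (Ad d (e * x)) X where
  aut := hG.isInvariantAut hB (hG.isElliptic_mul he hX hfix hx)
  fixed := hfix
  eq_on := fun Y hY => by
    have h1 : (1 : ℂ) ⊗ₜ[ℝ] Y ∈ rootSpace (stab P.lam) P.h 0 :=
      hp.cartan.mem_rootSpace_zero_iff.mpr (by simpa using hY)
    have h2 := hG.mapC_Ad_exp hp.cartan.toIsInvariantPair hx h1
    rw [hG.Ad_mul]
    congr 1
    simpa using congrArg reV h2
  exp_mul := fun α z hz => by
    rw [← map_smul, ← hG.mapC_Ad_exp hp.cartan.toIsInvariantPair hx hz]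
    apply ext_re_im <;> simp [hG.Ad_mul]

end ReductiveGroup

end
end EllipticDescent

open EllipticDescent in
theorem mainTheorem9 {d n : ℕ} {G : Type*} [TopologicalSpace G] [T2Space G]
    [SecondCountableTopology G] [ChartedSpace (EuclideanSpace ℝ (Fin d)) G] [Group G]
    [LieGroup (𝓡 d) ∞ G] (𝔾 : Subgroup (GL (Fin n) ℂ)) (φ : G →* GL (Fin n) ℝ)
    (hG : IsReductiveRealGroup d 𝔾 φ)
    (B : LinearMap.BilinForm ℝ (GroupLieAlgebra (𝓡 d) G)) (hB : IsAdmissibleForm d φ B)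
    (e : G) (he : IsElliptic φ e)
    (P : Param (GroupLieAlgebra (𝓡 d) G)) (hP : IsParam (differential d φ) B P)
    (hfix : Fixes (Ad d e) P)
    (hst : HasStableChamber (differential d φ) B (Ad d e) P hfix.stable) :
    -- (a)
    (IsSemisimpleForm (resRep (differential d φ) (Ad d e)) (resBilin B (Ad d e))
        (resLam P.lam (Ad d e)) ∧
      IsCartanOf (stab (resLam P.lam (Ad d e))) (resSub P.h (Ad d e)) ∧
      resForm P.rho (Ad d e) ∈
        realDual (resRep (differential d φ) (Ad d e)) (resSub P.h (Ad d e)) ∧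
      IsRegularFor (stab (resLam P.lam (Ad d e))) (resSub P.h (Ad d e))
        (imagRoots (stab (resLam P.lam (Ad d e))) (resSub P.h (Ad d e)))
        (resForm P.rho (Ad d e)) ∧
      ∀ C : Set (CForm (resSub P.h (Ad d e))),
        (IsImagChamber (resRep (differential d φ) (Ad d e)) (stab (resLam P.lam (Ad d e)))
            (resSub P.h (Ad d e)) C ∧ resForm P.rho (Ad d e) ∈ C) ↔
          C = (descent (differential d φ) P (Ad d e)).F) ∧
    -- (b)
    (∃ X ∈ P.h, IsInfElliptic (differential d φ) X ∧ Ad d e X = X ∧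
      ∃ x : G, IsExp X x ∧ IsElliptic φ (e * x) ∧
        ∃ hfix₀ : Fixes (Ad d (e * x)) P,
          HasStableChamber (differential d φ) B (Ad d (e * x)) P hfix₀.stable ∧
          (∀ F' : Set (CForm P.h), IsImagChamber (differential d φ) (stab P.lam) P.h F' →
            rho (stab P.lam) P.h F' ∘ₗ resAut (Ad d (e * x)) P.h hfix₀.stable =
              rho (stab P.lam) P.h F' →
            resForm (rho (stab P.lam) P.h F') (Ad d (e * x)) ∈
              (descent (differential d φ) P (Ad d (e * x))).F →
            F' = P.F) ∧
          (IsTypeI (differential d φ) B P →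
            IsTypeI (resRep (differential d φ) (Ad d (e * x))) (resBilin B (Ad d (e * x)))
              (descent (differential d φ) P (Ad d (e * x))))) ∧
    -- (c)
    (IsTypeI (differential d φ) B P →
      Finite (weylCommutant (stab P.lam) P.h (Ad d e) hfix.stable) ∧
      Finite (weylGroup (stab (resLam P.lam (Ad d e))) (resSub P.h (Ad d e))) ∧
      {P' : Param (GroupLieAlgebra (𝓡 d) G) | IsParam (differential d φ) B P' ∧
        (∃ hfix' : Fixes (Ad d e) P',
          HasStableChamber (differential d φ) B (Ad d e) P' hfix'.stable) ∧
        descent (differential d φ) P' (Ad d e) =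
          descent (differential d φ) P (Ad d e)}.Finite ∧
      ({P' : Param (GroupLieAlgebra (𝓡 d) G) | IsParam (differential d φ) B P' ∧
        (∃ hfix' : Fixes (Ad d e) P',
          HasStableChamber (differential d φ) B (Ad d e) P' hfix'.stable) ∧
        descent (differential d φ) P' (Ad d e) =
          descent (differential d φ) P (Ad d e)}.ncard : ℚ) =
        (Nat.card (weylCommutant (stab P.lam) P.h (Ad d e) hfix.stable) : ℚ) /
          Nat.card (weylGroup (stab (resLam P.lam (Ad d e))) (resSub P.h (Ad d e)))) := by
  have hp : FixedParam (differential d φ) B (Ad d e) P :=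
    ⟨hG.isReductivePair hB, hG.isInvariantAut hB he, hP, hfix⟩
  refine ⟨⟨hp.isSemisimpleForm_descent, (hp.cartan_descent hst).isCartanOf,
    (hp.regular_descent hst).1, ?_, hp.chamber_unique hst⟩, ?_, hp.card_descent hst⟩
  · exact ((hp.cartan_descent hst).isRegularFor_iff (fun α hα => hα.1)
      (hp.regular_descent hst).1).mpr (hp.regular_descent hst)
  · obtain ⟨X, hX, hXfix, hper⟩ := hp.exists_twist
    obtain ⟨x, hx, hφx⟩ := exists_isExp hG.smooth hG.injective (X : GroupLieAlgebra (𝓡 d) G)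
    have ht := hG.isTwist hB he hp hX hXfix hφx
    have hp₀ := ht.fixedParam hp
    have hst₀ : HasStableChamber (differential d φ) B (Ad d (e * x)) P hp₀.fixes.stable :=
      ht.hasStableChamber hp hst
    have hper₀ := fun α hα z hz => ht.pow_period hp hper (α := α) hα (z := z) hz
    exact ⟨X, X.2, hX, hXfix, x, hx, hG.isElliptic_mul he hX hXfix hφx, hp₀.fixes, hst₀,
      fun F' hF' hρ hmem => hp₀.chamber_eq hst₀ hper₀ hF' hρ hmem,
      fun hI => hp₀.isTypeI_descent hst₀ hper₀ hI⟩
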